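/- For $n\ge 1$ let $\mathrm{Tam}_n$ be the $n$-th Tamari lattice, realised as the set of permutations $\sigma$ of $[n]$ that avoid the pattern $312$ (there are no $i_1<i_2<i_3$ with $\sigma(i_1)>\sigma(i_3)>\sigma(i_2)$), ordered by the right weak order. For a finite lattice $L$ with least element $\hat 0$ and greatest element $\hat 1$, and for $p\in(0,1)$, the Ungarian Markov chain on $L$ with parameter $p$ moves from $x$ to $\bigwedge(\{x\}\cup T)$, where $T$ is a random subset of the set of elements covered by $x$ that contains each of these elements independently with probability $p$. Let $\mathcal E_p(L)$ be the expected number of steps until this chain, started at $\hat 1$, reaches $\hat 0$. Let $\zeta_p(n)$ be the probability that the maximum of $n$ independent geometric random variables on $\{1,2,\dots\}$, each with expected value $1/p$, is attained by exactly one of them, and let $\zeta_p^-=\liminf_{n\to\infty}\zeta_p(n)$. There is an absolute constant $C>0$ such that for all $p\in(0,1)$ and all integers $n\ge 16$, $$\mathcal E_p(\mathrm{Tam}_n)\ \ge\ \zeta_p^-\, n\,\exp\!\Big(-p^8\, e^{C/p^2}\,(\log\log n)^4\Big).$$ In particular, for every fixed $p\in(0,1)$ we have $\mathcal E_p(\mathrm{Tam}_n)\ge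 n^{1-o(1)}$ as $n\to\infty$, that is, there are real numbers $\varepsilon_n\to 0$ with $\mathcal E_p(\mathrm{Tam}_n)\ge n^{1-\varepsilon_n}$ for all $n\ge 16$. -/

import Mathlib

/-! ## The right weak order and the Tamari lattice -/

namespace Tamari

/-- `σ` arises from `τ` by swapping the two entries (in one-line notation `τ 0, …, τ (n-1)`) at a
descent `i` of `τ`, that is `σ = τ ∘ (i i+1)` where `τ i > τ (i+1)`. -/
def DescentSwap {n : ℕ} (σ τ : Equiv.Perm (Fin n)) : Prop :=
  ∃ i j : Fin n, (i : ℕ) + 1 = j ∧ τ j < τ i ∧ σ = τ * Equiv.swap i j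

/-- The right weak order on permutations, generated by the descent swaps. -/
def WeakLE {n : ℕ} (σ τ : Equiv.Perm (Fin n)) : Prop :=
  Relation.ReflTransGen DescentSwap σ τ

/-- `σ` contains no indices `i₁ < i₂ < i₃` such that `σ i₁ > σ i₃ > σ i₂`. -/
def Avoids312 {n : ℕ} (σ : Equiv.Perm (Fin n)) : Prop :=
  ¬ ∃ i₁ i₂ i₃ : Fin n, i₁ < i₂ ∧ i₂ < i₃ ∧ σ i₃ < σ i₁ ∧ σ i₂ < σ i₃

theorem symm_mul_swap {n : ℕ} (τ : Equiv.Perm (Fin n)) (i j x : Fin n) :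
    (τ * Equiv.swap i j).symm x = Equiv.swap i j (τ.symm x) := by
  rw [Equiv.symm_apply_eq]; simp

/-- If every inversion of `σ` is an inversion of `τ`, and every descent of `τ` is an inversion of
`σ`, then `σ = τ`. -/
theorem eq_of_descents {n : ℕ} {σ τ : Equiv.Perm (Fin n)}
    (h : ∀ a b, a < b → σ.symm b < σ.symm a → τ.symm b < τ.symm a)
    (hd : ∀ i j : Fin n, (i : ℕ) + 1 = j → τ j < τ i → σ.symm (τ i) < σ.symm (τ j)) : σ = τ := by
  have key : ∀ i j : Fin n, (i : ℕ) + 1 = j → (τ.trans σ.symm) i < (τ.trans σ.symm) j := by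
    intro i j hij
    have hlt : i < j := by rw [Fin.lt_def]; omega
    rcases lt_trichotomy (τ i) (τ j) with h1 | h1 | h1
    · rcases lt_trichotomy (σ.symm (τ i)) (σ.symm (τ j)) with h2 | h2 | h2
      · exact h2
      · exact absurd (σ.symm.injective h2) h1.ne
      · have := h _ _ h1 h2
        simp only [Equiv.symm_apply_apply] at this
        exact absurd this hlt.not_gt
    · exact absurd (τ.injective h1) hlt.ne
    · exact hd i j hij h1
  have hmono : StrictMono (τ.trans σ.symm) := by
    cases n with
    | zero => exact fun a => a.elim0
    | succ m => exact Fin.strictMono_iff_lt_succ.2 fun i => key _ _ (by simp)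
  have hid : ∀ x, (τ.trans σ.symm) x = x := fun x => by
    have := Subsingleton.elim
      (hmono.orderIsoOfSurjective _ (τ.trans σ.symm).surjective) (OrderIso.refl (Fin n))
    simpa using congrArg (fun f => f x) this
  refine Equiv.ext fun x => ?_
  have := congrArg σ (hid x)
  simpa using this.symm

/-- The right weak order is containment of inversion sets. -/
theorem weakLE_iff {n : ℕ} {σ τ : Equiv.Perm (Fin n)} :
    WeakLE σ τ ↔ ∀ a b, a < b → σ.symm b < σ.symm a → τ.symm b < τ.symm a := by
  classical
  -- how a swap of adjacent positions acts on pairs of positions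
  have swap_lt : ∀ {i j x y : Fin n}, (i : ℕ) + 1 = j →
      x < y → (x = i ∧ y = j) ∨ Equiv.swap i j x < Equiv.swap i j y := by
    intro i j x y hij hxy
    simp only [Equiv.swap_apply_def, Fin.lt_def, Fin.ext_iff] at *
    split_ifs <;> simp_all <;> omega
  have step : ∀ {ρ ω : Equiv.Perm (Fin n)}, DescentSwap ρ ω →
      ∀ a b, a < b → ρ.symm b < ρ.symm a → ω.symm b < ω.symm a := by
    rintro ρ ω ⟨i, j, hij, hd, rfl⟩ a b hab h
    rw [symm_mul_swap, symm_mul_swap] at h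
    rcases lt_trichotomy (ω.symm b) (ω.symm a) with h1 | h1 | h1
    · exact h1
    · exact absurd (ω.symm.injective h1) hab.ne'
    · rcases swap_lt hij h1 with ⟨h2, h3⟩ | h2
      · rw [← h2, ← h3] at hd
        simp only [Equiv.apply_symm_apply] at hd
        exact absurd hd hab.not_gt
      · exact absurd h h2.not_gt
  constructor
  · intro h
    induction h with
    | refl => exact fun _ _ _ h => h
    | tail _ h2 ih => exact fun a b hab h => step h2 a b hab (ih a b hab h)
  · let inv : Equiv.Perm (Fin n) → Finset (Fin n × Fin n) := fun ω =>
      Finset.univ.filter fun q => q.1 < q.2 ∧ ω.symm q.2 < ω.symm q.1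
    induction hN : (inv τ).card using Nat.strong_induction_on generalizing τ with
    | _ N ih =>
      intro h
      by_cases hd : ∀ i j : Fin n, (i : ℕ) + 1 = j → τ j < τ i → σ.symm (τ i) < σ.symm (τ j)
      · rw [eq_of_descents h hd]
        exact Relation.ReflTransGen.refl
      · push Not at hd
        obtain ⟨i, j, hij, hlt, hn⟩ := hd
        have hij' : i < j := by rw [Fin.lt_def]; omega
        have hs : DescentSwap (τ * Equiv.swap i j) τ := ⟨i, j, hij, hlt, rfl⟩
        refine Relation.ReflTransGen.tail (ih _ ?_ rfl ?_) hs
        · rw [← hN]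
          apply Finset.card_lt_card
          rw [Finset.ssubset_iff_of_subset]
          · refine ⟨(τ j, τ i), ?_, ?_⟩
            · simp [inv, hlt, hij']
            · simp [inv, symm_mul_swap, hij'.le]
          · intro q hq
            simp only [inv, Finset.mem_filter, Finset.mem_univ, true_and] at hq ⊢
            exact ⟨hq.1, step hs _ _ hq.1 hq.2⟩
        · intro a b hab hσ
          have h1 := h a b hab hσ
          rw [symm_mul_swap, symm_mul_swap]
          rcases swap_lt hij h1 with ⟨h2, h3⟩ | h2
          · rw [← h2, ← h3] at hn
            simp only [Equiv.apply_symm_apply] at hn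
            exact absurd hσ hn.not_gt
          · exact h2

/-- In terms of values, `σ` avoids 312 iff whenever `c` precedes the smaller value `a` in the
one-line notation, so do all the values between `a` and `c`. -/
theorem avoids312_iff {n : ℕ} {σ : Equiv.Perm (Fin n)} :
    Avoids312 σ ↔ ∀ a b c, a < b → b < c → σ.symm c < σ.symm a → σ.symm b < σ.symm a := by
  constructor
  · intro h a b c hab hbc hca
    by_contra hn
    rcases (not_lt.1 hn).lt_or_eq with h1 | h1
    · exact h ⟨σ.symm c, σ.symm a, σ.symm b, hca, h1, by simpa using hbc, by simpa using hab⟩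
    · exact hab.ne (σ.symm.injective h1)
  · rintro h ⟨i₁, i₂, i₃, h12, h23, h1, h2⟩
    have := h (σ i₂) (σ i₃) (σ i₁) h2 h1 (by simpa using h12)
    simp only [Equiv.symm_apply_apply] at this
    exact absurd this h23.not_gt

/-- A transitive relation `I a b` (to be read: `a < b`, and `b` precedes `a`) with the interval
property of `avoids312_iff` is the inversion set of a 312-avoiding permutation. -/
theorem exists_perm {n : ℕ} (I : Fin n → Fin n → Prop)
    (hT : ∀ a b c, a < b → b < c → I a b → I b c → I a c)
    (hV : ∀ a b c, a < b → b < c → I a c → I a b) :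
    ∃ σ : Equiv.Perm (Fin n), Avoids312 σ ∧ ∀ a b, a < b → (σ.symm b < σ.symm a ↔ I a b) := by
  classical
  let R : Fin n → Fin n → Prop := fun x y => (x < y ∧ ¬ I x y) ∨ (y < x ∧ I y x)
  have irr : ∀ x, ¬ R x x := fun x h => by
    rcases h with h | h <;> exact lt_irrefl _ h.1
  have total : ∀ x y, x ≠ y → R x y ∨ R y x := by
    intro x y hxy
    rcases lt_or_gt_of_ne hxy with h | h
    · by_cases hI : I x y
      · exact Or.inr (Or.inr ⟨h, hI⟩)
      · exact Or.inl (Or.inl ⟨h, hI⟩)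
    · by_cases hI : I y x
      · exact Or.inl (Or.inr ⟨h, hI⟩)
      · exact Or.inr (Or.inl ⟨h, hI⟩)
  have trans : ∀ x y z, R x y → R y z → R x z := by
    rintro x y z (⟨h1, h2⟩ | ⟨h1, h2⟩) (⟨h3, h4⟩ | ⟨h3, h4⟩)
    · exact Or.inl ⟨h1.trans h3, fun h => h2 (hV _ _ _ h1 h3 h)⟩
    · rcases lt_trichotomy x z with h | rfl | h
      · exact Or.inl ⟨h, fun h5 => h2 (hT _ _ _ h h3 h5 h4)⟩
      · exact absurd h4 h2
      · exact Or.inr ⟨h, hV _ _ _ h h1 h4⟩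
    · rcases lt_trichotomy x z with h | rfl | h
      · exact Or.inl ⟨h, fun h5 => h4 (hT _ _ _ h1 h h2 h5)⟩
      · exact absurd h2 h4
      · exact absurd (hV _ _ _ h3 h h2) h4
    · exact Or.inr ⟨h3.trans h1, hT _ _ _ h3 h1 h4 h2⟩
  let pos : Fin n → Fin n := fun x => ⟨(Finset.univ.filter fun y => R y x).card, by
    have : (Finset.univ.filter fun y => R y x) ⊂ Finset.univ := by
      rw [Finset.ssubset_iff_of_subset (Finset.subset_univ _)]
      exact ⟨x, Finset.mem_univ _, by simp [irr x]⟩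
    simpa using Finset.card_lt_card this⟩
  have pos_lt : ∀ x y, R x y → pos x < pos y := by
    intro x y h
    rw [Fin.lt_def]
    refine Finset.card_lt_card (?_ : (Finset.univ.filter fun z => R z x) ⊂
      (Finset.univ.filter fun z => R z y))
    rw [Finset.ssubset_iff_of_subset]
    · exact ⟨x, by simpa using h, by simp [irr x]⟩
    · intro z hz
      simp only [Finset.mem_filter, Finset.mem_univ, true_and] at hz ⊢
      exact trans _ _ _ hz h
  have pos_iff : ∀ x y, x ≠ y → (pos x < pos y ↔ R x y) := by
    intro x y hxy
    refine ⟨fun h => ?_, pos_lt x y⟩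
    rcases total x y hxy with h1 | h1
    · exact h1
    · exact absurd h (pos_lt _ _ h1).not_gt
  have inj : Function.Injective pos := by
    intro x y h
    by_contra hxy
    rcases total x y hxy with h1 | h1
    · exact (pos_lt _ _ h1).ne h
    · exact (pos_lt _ _ h1).ne' h
  let e : Equiv.Perm (Fin n) := Equiv.ofBijective pos (Finite.injective_iff_bijective.1 inj)
  have main : ∀ a b, a < b → (e b < e a ↔ I a b) := by
    intro a b hab
    have : e b < e a ↔ R b a := pos_iff b a hab.ne'
    rw [this]
    constructor
    · rintro (h | h)
      · exact absurd h.1 hab.not_gt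
      · exact h.2
    · exact fun h => Or.inr ⟨hab, h⟩
  refine ⟨e.symm, avoids312_iff.2 ?_, ?_⟩
  · intro a b c hab hbc
    rw [Equiv.symm_symm, main a b hab, main a c (hab.trans hbc)]
    exact hV a b c hab hbc
  · intro a b hab
    rw [Equiv.symm_symm]
    exact main a b hab

end Tamari

/-- The `n`-th Tamari lattice: the 312-avoiding permutations of `n` letters, ordered by the right
weak order. -/
def Tam (n : ℕ) : Type :=
  {σ : Equiv.Perm (Fin n) // Tamari.Avoids312 σ}

namespace Tam

noncomputable instance (n : ℕ) : Fintype (Tam n) :=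
  @Subtype.fintype _ _ (Classical.decPred _) _

instance (n : ℕ) : MeasurableSpace (Tam n) := ⊤

instance (n : ℕ) : DiscreteMeasurableSpace (Tam n) := ⟨fun _ => trivial⟩

instance (n : ℕ) : PartialOrder (Tam n) where
  le x y := Tamari.WeakLE x.1 y.1
  le_refl _ := Relation.ReflTransGen.refl
  le_trans _ _ _ h1 h2 := Relation.ReflTransGen.trans h1 h2
  le_antisymm x y h1 h2 := by
    have h1' := Tamari.weakLE_iff.1 h1
    have h2' := Tamari.weakLE_iff.1 h2
    refine Subtype.ext (Tamari.eq_of_descents h1' fun i j hij hlt => ?_)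
    exact h2' _ _ hlt (by
      simp only [Equiv.symm_apply_apply, Fin.lt_def]
      omega)

theorem le_def {n : ℕ} {x y : Tam n} : x ≤ y ↔ Tamari.WeakLE x.1 y.1 := Iff.rfl

theorem le_iff {n : ℕ} {x y : Tam n} :
    x ≤ y ↔ ∀ a b, a < b → x.1.symm b < x.1.symm a → y.1.symm b < y.1.symm a :=
  Tamari.weakLE_iff

/-- Meets exist: the inversions of the meet are the common inversions. -/
theorem exists_inf {n : ℕ} (x y : Tam n) :
    ∃ z : Tam n, ∀ a b, a < b →
      (z.1.symm b < z.1.symm a ↔ x.1.symm b < x.1.symm a ∧ y.1.symm b < y.1.symm a) := by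
  obtain ⟨σ, hσ, h⟩ := Tamari.exists_perm
    (fun a b => x.1.symm b < x.1.symm a ∧ y.1.symm b < y.1.symm a)
    (fun a b c _ _ h1 h2 => ⟨h2.1.trans h1.1, h2.2.trans h1.2⟩)
    (fun a b c hab hbc h =>
      ⟨Tamari.avoids312_iff.1 x.2 a b c hab hbc h.1,
        Tamari.avoids312_iff.1 y.2 a b c hab hbc h.2⟩)
  exact ⟨⟨σ, hσ⟩, h⟩

noncomputable instance (n : ℕ) : SemilatticeInf (Tam n) where
  inf x y := (exists_inf x y).choose
  inf_le_left x y :=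
    le_iff.2 fun a b hab h => (((exists_inf x y).choose_spec a b hab).1 h).1
  inf_le_right x y :=
    le_iff.2 fun a b hab h => (((exists_inf x y).choose_spec a b hab).1 h).2
  le_inf _ y z h1 h2 :=
    le_iff.2 fun a b hab h => ((exists_inf y z).choose_spec a b hab).2
      ⟨le_iff.1 h1 a b hab h, le_iff.1 h2 a b hab h⟩

/-- The greatest element is the decreasing permutation, the least one is the identity. -/
instance (n : ℕ) : BoundedOrder (Tam n) where
  top := ⟨Fin.revPerm, Tamari.avoids312_iff.2 fun a b _ hab _ _ => by
    simpa using hab⟩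
  le_top _ := le_iff.2 fun a b hab _ => by
    change (Fin.revPerm : Equiv.Perm (Fin n)).symm b < (Fin.revPerm : Equiv.Perm (Fin n)).symm a
    simpa using hab
  bot := ⟨1, Tamari.avoids312_iff.2 fun a b c hab hbc h =>
    absurd h (hab.trans hbc).not_gt⟩
  bot_le x := le_iff.2 fun a b hab h => absurd h hab.not_gt

open Classical in
noncomputable instance (n : ℕ) : Lattice (Tam n) where
  sup x y := (Finset.univ.filter fun z => x ≤ z ∧ y ≤ z).inf id
  le_sup_left _ _ := Finset.le_inf fun z hz => (Finset.mem_filter.1 hz).2.1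
  le_sup_right _ _ := Finset.le_inf fun z hz => (Finset.mem_filter.1 hz).2.2
  sup_le _ _ z h1 h2 :=
    Finset.inf_le (f := id) (Finset.mem_filter.2 ⟨Finset.mem_univ z, h1, h2⟩)

end Tam

/-! ## Ungarian Markov chains -/

namespace Ungarian

/-- The set of elements covered by `x`. -/
noncomputable def lowerCovers {L : Type*} [Preorder L] [Fintype L] (x : L) : Finset L :=
  open Classical in Finset.univ.filter fun y => y ⋖ x

/-- The Ungar move associated with `T`: the element `⋀ ({x} ∪ T)`. -/
noncomputable def ungarMove {L : Type*} [Lattice L] [BoundedOrder L] (x : L) (T : Finset L) : L :=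
  open Classical in (insert x T).inf id

/-- The probability that a random Ungar move with parameter `p` sends `x` to `y`. -/
noncomputable def transProb {L : Type*} [Lattice L] [BoundedOrder L] [Fintype L]
    (p : unitInterval) (x y : L) : ℝ :=
  open Classical in
  ∑ T ∈ (lowerCovers x).powerset.filter (fun T => ungarMove x T = y),
    (p : ℝ) ^ T.card * (1 - (p : ℝ)) ^ ((lowerCovers x).card - T.card)

theorem transProb_nonneg {L : Type*} [Lattice L] [BoundedOrder L] [Fintype L]
    (p : unitInterval) (x y : L) : 0 ≤ transProb p x y :=
  Finset.sum_nonneg fun _ _ =>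
    mul_nonneg (pow_nonneg p.2.1 _) (pow_nonneg (sub_nonneg.2 p.2.2) _)

theorem sum_transProb {L : Type*} [Lattice L] [BoundedOrder L] [Fintype L]
    (p : unitInterval) (x : L) : ∑ y, transProb p x y = 1 := by
  classical
  have h := Finset.sum_fiberwise (lowerCovers x).powerset (ungarMove x)
    (fun T => (p : ℝ) ^ T.card * (1 - (p : ℝ)) ^ ((lowerCovers x).card - T.card))
  rw [Finset.sum_pow_mul_eq_add_pow] at h
  simp only [add_sub_cancel, one_pow] at h
  rw [← h]
  refine Finset.sum_congr rfl fun y _ => ?_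
  unfold transProb
  congr!

/-- The distribution of the state after one random Ungar move from `x`. -/
noncomputable def step {L : Type*} [Lattice L] [BoundedOrder L] [Fintype L]
    (p : unitInterval) (x : L) : PMF L :=
  PMF.ofFintype (fun y => ENNReal.ofReal (transProb p x y)) (by
    rw [← ENNReal.ofReal_sum_of_nonneg fun y _ => transProb_nonneg p x y, sum_transProb,
      ENNReal.ofReal_one])

/-- The transition kernel of the Ungarian Markov chain. -/
noncomputable def kernel {L : Type*} [Lattice L] [BoundedOrder L] [Fintype L]
    [MeasurableSpace L] [DiscreteMeasurableSpace L] (p : unitInterval) :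
    ProbabilityTheory.Kernel L L where
  toFun x := (step p x).toMeasure
  measurable' := Measurable.of_discrete

instance {L : Type*} [Lattice L] [BoundedOrder L] [Fintype L]
    [MeasurableSpace L] [DiscreteMeasurableSpace L] (p : unitInterval) :
    ProbabilityTheory.IsMarkovKernel (kernel (L := L) p) :=
  ⟨fun x => PMF.toMeasure.isProbabilityMeasure (step p x)⟩

/-- The law, on the space of trajectories `ℕ → L`, of the Ungarian Markov chain started at the
greatest element: given the states up to time `t`, the state at time `t + 1` is distributed
according to the transition kernel at the state at time `t`. -/
noncomputable def chainLaw (L : Type*) [Lattice L] [BoundedOrder L] [Fintype L]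
    [MeasurableSpace L] [DiscreteMeasurableSpace L] (p : unitInterval) :
    MeasureTheory.Measure (ℕ → L) :=
  ProbabilityTheory.Kernel.trajMeasure (X := fun _ => L) (MeasureTheory.Measure.dirac ⊤)
    fun t => (kernel p).comap (fun h : (Finset.Iic t → L) => h ⟨t, Finset.mem_Iic.2 le_rfl⟩)
      (measurable_pi_apply _)

/-- The first time at which a trajectory is at the least element (`∞` if there is none). -/
noncomputable def absorptionTime {L : Type*} [Lattice L] [BoundedOrder L] (ω : ℕ → L) : ENNReal :=
  ⨅ (t : ℕ) (_ : ω t = ⊥), (t : ENNReal)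

/-- The expected number of steps until the Ungarian Markov chain with parameter `p`, started at
the greatest element of `L`, reaches the least element. -/
noncomputable def expectedTime (p : unitInterval) (L : Type*) [Lattice L] [BoundedOrder L]
    [Fintype L] [MeasurableSpace L] [DiscreteMeasurableSpace L] : ENNReal :=
  ∫⁻ ω, absorptionTime ω ∂(chainLaw L p)

end Ungarian

/-! ## Uniquely attained maxima of geometric random variables -/

/-- The geometric distribution on `{1, 2, …}` with parameter `p`, and so with mean `1 / p`
(Mathlib's `geometricMeasure` counts failures and starts at `0`). -/
noncomputable def geometricLaw (p : unitInterval) : MeasureTheory.Measure ℕ :=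
  (ProbabilityTheory.geometricMeasure p).map (fun k => k + 1)

/-- The probability that the maximum of `n` independent geometric random variables with
parameter `p` is attained by exactly one of them. -/
noncomputable def uniqueMaxProb (p : unitInterval) (n : ℕ) : ℝ :=
  (MeasureTheory.Measure.pi fun _ : Fin n => geometricLaw p).real
    {g | ∃! i, ∀ j, g j ≤ g i}

/-- The limit inferior of `uniqueMaxProb p n` as `n → ∞`. -/
noncomputable def zetaMinus (p : unitInterval) : ℝ :=
  Filter.liminf (fun n => uniqueMaxProb p n) Filter.atTop

/-!
An element of the Tamari lattice `Tam n` is encoded by a laminar level function `l` on the positions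
`0, …, n - 1`: the position `x` is on a level `l x ≤ x`, and the intervals `[l x, x]` are nested or
disjoint. All levels are `0` at the top element, and `l x = x` for all `x` at the bottom element. An
Ungar move sends every chosen position just above the nearest smaller position on its level
(`stepLev`), so the Ungarian chain is driven by independent coins, one for each time and position
(`coinLaw_ofLev`), and `lev w t y` denotes the level of `y` at time `t`. The expected time is at
least `T` times the probability that some position has not reached its final level after `T` steps
(`mul_coinLaw_le_expectedTime`). So it suffices that this probability is at least
`exp (-O((log log n) ^ 4))` for some `T` of order at least `(1 - p) * n`.

Every success lifts a position that is not yet settled by at least one level, and by exactly one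
level if it meets nobody, that is, if no other position above that level shares it. A position `x`
that meets nobody thus needs a time of the order of `x`. It meets nobody as long as it has had fewer
successes than all smaller unsettled positions. This event is too rare to be asked for all of the
time, but it can be asked for during a short initial period and for a chain of *anchors*
`a 0 < a 1 < … < a r` with `r = O(log log n)`, of sizes that grow at most like a power `3 / 2` from
one to the next. Each anchor has its first success later than all smaller positions, then falls
behind by some further failures, and afterwards keeps a lag that grows like the square root of the
time, up to a time that is at most polylogarithmic in `n`, for fixed `p`. Then the lags are given up
one after another. By laminarity, a position above `a i` that gets to a higher level than `a i` lies
above `a i` itself from then on (`AnchorSystem.lt_lev_of_drop`), hence far ahead of the last anchor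
on the scale of `a i`. As the next scale is at most the power `3 / 2` of this one, fluctuations do
not let the last anchor catch up with the positions between `a i` and `a (i + 1)` before these are
settled. Finally the last anchor is lifted just above `a 0`, where it meets nobody any more, and it
needs about its own size in time to settle (`AnchorSystem.lev_last_lt`, `Scales.Config.lev_lt`).

Put `Q = 1 / (1 - p)`. An anchor of size about `Q ^ u` has its first success at time `u`, an event
whose small probability is compensated by the number of candidates, so that the probability to find
anchors with the required coins does not depend on their sizes. With `l` of the order of
`log log n`, for fixed `p`, the lag of an anchor is enforced in `O(l)` time windows of geometrically
growing lengths, in each of which it is `O(l)` standard deviations, at a cost of `exp (-O(l ^ 2))`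
per window. This gives `exp (-O(l ^ 3))` for an anchor, and the fourth power for `O(l)` anchors. The
other positions may then be assumed typical by a union bound. It is affordable because a position
`y` that is preceded by a position in `[y / 2, y)` without earlier successes (`Blocked`) gets to a
level above `y / 2` at its first success, and thus is out of the way, while only few positions are
not blocked (`RowEvents.Bounds.le_coinP_exists_anchored`, `Setup.exp_le_coinP`, `exp_le_coinP`).

If `n ≤ Q ^ 3`, then the event of one or two late positions is simple enough to be estimated
directly (`le_coinP_single`, `le_coinP_pair`), and if `n ≤ Q` or `n` is at most a fixed power of
`2 ^ l`, the trivial bound `1` is enough (`one_le_expectedTime`). So the expected time is at least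
`(1 - p) * n * exp (-O((log log n) ^ 4))` for fixed `p` (`ofReal_mul_exp_le_expectedTime`), which
implies the bound `n ^ (1 - o(1))`. For the other bound, `zetaMinus p` is compared with `1 - p` by
`zetaMinus_le`; the additional factor, logarithmic in `Q`, is at most of the order of `log n` if
`Q ≤ n`, and `exp (O(log log n))` is negligible (`zetaMinus_mul_exp_le`).
-/


namespace TamariLevels

open Finset

/-! ### Laminar level functions and their dynamics -/

/-- A level function `l` is laminar if `l x ≤ x` and the intervals `[l x, x]` are nested or
disjoint.  The elements of `Tam n` correspond to the laminar functions on `{0, …, n - 1}`: if `x` is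
the `x`-th position from the right, then `x - l x` is the number of inversions starting there. -/
def Laminar (l : ℕ → ℕ) : Prop :=
  (∀ x, l x ≤ x) ∧ ∀ x y, l x ≤ y → y ≤ x → l x ≤ l y

/-- The largest `y < x` on the same level as `x` (if `l x < x` and `l` is laminar). -/
def pred (l : ℕ → ℕ) (x : ℕ) : ℕ :=
  Nat.findGreatest (fun y => l y = l x) (x - 1)

/-- One Ungar move in terms of level functions: every position `x` in `S` that is not yet on its
final level `x` moves just above the nearest smaller position on the same level. -/
def stepLev (l : ℕ → ℕ) (S : ℕ → Bool) (x : ℕ) : ℕ :=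
  if S x = true ∧ l x < x then pred l x + 1 else l x

theorem Laminar.map_self {l : ℕ → ℕ} (h : Laminar l) (x : ℕ) : l (l x) = l x :=
  le_antisymm (h.1 _) (h.2 x (l x) le_rfl (h.1 x))

theorem Laminar.pred_spec {l : ℕ → ℕ} (h : Laminar l) {x : ℕ} (hx : l x < x) :
    l (pred l x) = l x ∧ pred l x < x ∧ l x ≤ pred l x ∧
      ∀ y, pred l x < y → y < x → pred l x < l y := by
  have h1 : l (pred l x) = l x :=
    Nat.findGreatest_spec (P := fun y => l y = l x) (by omega : l x ≤ x - 1) (h.map_self x)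
  have h2 : l x ≤ pred l x :=
    Nat.le_findGreatest (P := fun y => l y = l x) (by omega : l x ≤ x - 1) (h.map_self x)
  have h3 : pred l x ≤ x - 1 := Nat.findGreatest_le _
  refine ⟨h1, by omega, h2, fun y hy1 hy2 => ?_⟩
  have h4 : l y ≠ l x :=
    Nat.findGreatest_is_greatest (P := fun y => l y = l x) hy1 (by omega)
  have h5 : l x ≤ l y := h.2 x y (by omega) hy2.le
  by_contra hc
  have := h.2 y (pred l x) (by omega) hy1.le
  omega

theorem le_stepLev {l : ℕ → ℕ} (h : Laminar l) (S : ℕ → Bool) (x : ℕ) : l x ≤ stepLev l S x := by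
  unfold stepLev
  split_ifs with hc
  · have := (h.pred_spec hc.2).2.2.1
    omega
  · exact le_rfl

theorem Laminar.stepLev {l : ℕ → ℕ} (h : Laminar l) (S : ℕ → Bool) : Laminar (stepLev l S) := by
  constructor
  · intro x
    unfold TamariLevels.stepLev
    split_ifs with hc
    · have := (h.pred_spec hc.2).2.1
      omega
    · exact h.1 x
  · intro x y h1 h2
    rcases h2.lt_or_eq with h2 | rfl
    swap
    · exact le_rfl
    refine le_trans ?_ (le_stepLev h S y)
    unfold TamariLevels.stepLev at h1 ⊢
    split_ifs at h1 ⊢ with hc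
    · exact (h.pred_spec hc.2).2.2.2 y (by omega) h2
    · exact h.2 x y h1 h2.le

/-- The level functions visited by the dynamics driven by the coins `w`, where `w x t` decides
whether the position `x` is to be moved in the step from time `t` to time `t + 1`. -/
def lev (w : ℕ → ℕ → Bool) : ℕ → ℕ → ℕ
  | 0 => fun _ => 0
  | t + 1 => stepLev (lev w t) (fun x => w x t)

theorem lev_succ (w : ℕ → ℕ → Bool) (t x : ℕ) :
    lev w (t + 1) x = stepLev (lev w t) (fun x => w x t) x := rfl

theorem laminar_lev (w : ℕ → ℕ → Bool) (t : ℕ) : Laminar (lev w t) := by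
  induction t with
  | zero => exact ⟨fun x => Nat.zero_le _, fun _ _ _ _ => le_rfl⟩
  | succ t ih => exact ih.stepLev _

theorem lev_mono (w : ℕ → ℕ → Bool) (x : ℕ) : Monotone fun t => lev w t x :=
  monotone_nat_of_le_succ fun t => le_stepLev (laminar_lev w t) _ x

/-- The number of successes among the coins with index in `[s, t)`. -/
def succs (w : ℕ → Bool) (s t : ℕ) : ℕ := #{i ∈ Ico s t | w i = true}

/-- The number of failures among the coins with index in `[s, t)`. -/
def fails (w : ℕ → Bool) (s t : ℕ) : ℕ := #{i ∈ Ico s t | w i = false}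

theorem succs_add_fails (w : ℕ → Bool) (s t : ℕ) : succs w s t + fails w s t = t - s := by
  unfold succs fails
  have := card_filter_add_card_filter_not (s := Ico s t) (fun i => w i = true)
  simpa using this

theorem succs_split (w : ℕ → Bool) {s t u : ℕ} (h1 : s ≤ t) (h2 : t ≤ u) :
    succs w s u = succs w s t + succs w t u := by
  unfold succs
  rw [← Ico_union_Ico_eq_Ico h1 h2, filter_union, card_union_of_disjoint]
  exact disjoint_filter_filter (Ico_disjoint_Ico_consecutive s t u)

theorem fails_split (w : ℕ → Bool) {s t u : ℕ} (h1 : s ≤ t) (h2 : t ≤ u) :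
    fails w s u = fails w s t + fails w t u := by
  unfold fails
  rw [← Ico_union_Ico_eq_Ico h1 h2, filter_union, card_union_of_disjoint]
  exact disjoint_filter_filter (Ico_disjoint_Ico_consecutive s t u)

theorem succs_self (w : ℕ → Bool) (s : ℕ) : succs w s s = 0 := by simp [succs]

theorem fails_self (w : ℕ → Bool) (s : ℕ) : fails w s s = 0 := by simp [fails]

theorem succs_succ (w : ℕ → Bool) {s t : ℕ} (h : s ≤ t) :
    succs w s (t + 1) = succs w s t + if w t = true then 1 else 0 := by
  rw [succs_split w h (Nat.le_succ t)]
  congr 1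
  unfold succs
  rw [Nat.Ico_succ_singleton, filter_singleton]
  split_ifs <;> simp

theorem succs_le (w : ℕ → Bool) (s t : ℕ) : succs w s t ≤ t - s := by
  have := succs_add_fails w s t
  omega

theorem succs_mono (w : ℕ → Bool) (s : ℕ) {t u : ℕ} (h : t ≤ u) : succs w s t ≤ succs w s u :=
  card_le_card (filter_subset_filter _ (Ico_subset_Ico_right h))

theorem fails_mono (w : ℕ → Bool) (s : ℕ) {t u : ℕ} (h : t ≤ u) : fails w s t ≤ fails w s u :=
  card_le_card (filter_subset_filter _ (Ico_subset_Ico_right h))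

theorem succs_anti (w : ℕ → Bool) {s s' : ℕ} (h : s ≤ s') (t : ℕ) : succs w s' t ≤ succs w s t :=
  card_le_card (filter_subset_filter _ (Ico_subset_Ico_left h))

/-- Every success raises the level by at least one, until the final level is reached. -/
theorem min_le_lev (w : ℕ → ℕ → Bool) (x : ℕ) {s t m : ℕ} (h : s ≤ t) (hm : m ≤ lev w s x) :
    min x (m + succs (w x) s t) ≤ lev w t x := by
  induction t, h using Nat.le_induction with
  | base => rw [succs_self]; omega
  | succ t h ih =>
    rw [succs_succ _ h, lev_succ]
    have h1 := le_stepLev (laminar_lev w t) (fun x => w x t) x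
    split_ifs with hc
    · by_cases hx : lev w t x < x
      · have h2 := ((laminar_lev w t).pred_spec hx).2.2.1
        have h3 : stepLev (lev w t) (fun x => w x t) x = pred (lev w t) x + 1 := if_pos ⟨hc, hx⟩
        omega
      · omega
    · omega

/-- If the position `y < x` has had no success before the first success of `x`, then `x` moves above
`y` at once. -/
theorem lt_lev_of_blocked (w : ℕ → ℕ → Bool) {x y g : ℕ} (hyx : y < x)
    (hx : ∀ i < g, w x i = false) (hg : w x g = true) (hy : ∀ i < g, w y i = false) :
    y < lev w (g + 1) x := by
  have zero : ∀ z, (∀ i < g, w z i = false) → ∀ t ≤ g, lev w t z = 0 := by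
    intro z hz t
    induction t with
    | zero => intro _; rfl
    | succ t ih =>
      intro ht
      rw [lev_succ]
      unfold stepLev
      rw [if_neg (by simp [hz t (by omega)])]
      exact ih (by omega)
  have h1 : lev w g x = 0 := zero x hx g le_rfl
  have h2 : lev w g y = 0 := zero y hy g le_rfl
  have h3 : stepLev (lev w g) (fun x => w x g) x = pred (lev w g) x + 1 :=
    if_pos ⟨hg, by omega⟩
  rw [lev_succ, h3]
  have : y ≤ pred (lev w g) x :=
    Nat.le_findGreatest (P := fun y => lev w g y = lev w g x) (by omega) (by rw [h1, h2])
  omega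

theorem lt_lev_of_lev_lt (w : ℕ → ℕ → Bool) {x y t : ℕ} (hyx : y < x)
    (h : lev w t y < lev w t x) : y < lev w t x := by
  by_contra hc
  have := (laminar_lev w t).2 x y (by omega) hyx.le
  omega

/-- The position `a` meets nobody at time `s` if all positions strictly between its current level
`k` and `a` itself are on higher levels. -/
theorem lev_succ_of_clear (w : ℕ → ℕ → Bool) {a s k : ℕ} (hk : lev w s a = k) (hka : k < a)
    (h : w a s = true → ∀ y < a, k < y → k < lev w s y) :
    lev w (s + 1) a = k + if w a s = true then 1 else 0 := by
  rw [lev_succ]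
  unfold stepLev
  by_cases hc : w a s = true
  · have h1 : lev w s a < a := by omega
    rw [if_pos ⟨hc, h1⟩, if_pos hc]
    obtain ⟨h2, h3, h4, -⟩ := (laminar_lev w s).pred_spec h1
    by_contra hne
    have := h hc (pred (lev w s) a) h3 (by omega)
    omega
  · rw [if_neg (fun h => hc h.1), if_neg hc, hk]
    rfl

/-- A position that meets nobody is on the level given by its number of successes. -/
theorem lev_eq_of_clear (w : ℕ → ℕ → Bool) {a s t m : ℕ} (hst : s ≤ t) (hm : lev w s a = m)
    (hlt : m + (t - s) ≤ a)
    (h : ∀ u, s ≤ u → u < t → w a u = true → ∀ y < a, m + succs (w a) s u < y →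
      m + succs (w a) s u < lev w u y) :
    lev w t a = m + succs (w a) s t := by
  induction t, hst using Nat.le_induction with
  | base => rw [succs_self, hm]; rfl
  | succ t hst ih =>
    have h1 := ih (by omega) fun u hu1 hu2 => h u hu1 (by omega)
    have h2 := succs_le (w a) s t
    rw [lev_succ_of_clear w h1 (by omega) (h t hst (by omega)), succs_succ _ hst]
    omega

end TamariLevels

namespace TamariLevels

open Finset

/-! ### Survival of the last anchor -/

/-- The position `y` is blocked if the position `c`, with `y / 2 ≤ c < y`, does not succeed before
`y` does; then the first move of `y` takes it above `c`. -/
def Blocked (w : ℕ → ℕ → Bool) (y : ℕ) : Prop :=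
  ∃ c g, c < y ∧ y / 2 ≤ c ∧ (∀ i < g, w y i = false) ∧ w y g = true ∧ ∀ i < g, w c i = false

theorem Blocked.min_le_lev {w : ℕ → ℕ → Bool} {y : ℕ} (h : Blocked w y) {s g : ℕ} (hg : g < s)
    (hyg : w y g = true) : min y (y / 2 + succs (w y) 0 s) ≤ lev w s y := by
  obtain ⟨c, g', hc, hc2, h1, h2, h3⟩ := h
  have hgg : g' ≤ g := by
    by_contra hlt
    have := h1 g (by omega)
    simp [hyg] at this
  have h4 := lt_lev_of_blocked w hc h1 h2 h3
  have h5 := TamariLevels.min_le_lev w y (s := g' + 1) (t := s) (by omega) (Nat.succ_le_of_lt h4)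
  have h6 := succs_split (w y) (Nat.zero_le (g' + 1)) (show g' + 1 ≤ s by omega)
  have h7 : succs (w y) 0 (g' + 1) = 1 := by
    rw [succs_succ _ (Nat.zero_le _), if_pos h2]
    have : succs (w y) 0 g' = 0 := by
      unfold succs
      rw [card_eq_zero, filter_eq_empty_iff]
      intro i hi
      simp [h1 i (mem_Ico.1 hi).2]
    omega
  omega

/-- A system of anchors `a 0 < ⋯ < a r`.  The anchor `a j` has its first success at time `h j`,
later than all smaller positions.  It meets nobody until the time `e j` because it has had fewer
successes than the positions below it.  For `1 ≤ j < r`, the anchor `a j` overtakes `a (j - 1)` by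
the time `d j`, while `a r` overtakes `a 0` between the times `e r` and `Tf`. The positions between
two anchors `a j` and `a (j + 1)` have reached the level `B j` by the time `T1`, and from then
on are too far ahead of `a r` for it to catch up.

The disjunction `o j ≤ s ∨ w (a j) s = true` restricts the comparison of `a j` with the positions
below it, before a time `o j`, to the times at which `a j` actually moves. -/
structure AnchorSystem (w : ℕ → ℕ → Bool) (r : ℕ) (a h o e d B : ℕ → ℕ)
    (t1 T1 Tf Tend : ℕ) : Prop where
  r_pos : 0 < r
  a_lt : ∀ i j, i < j → j ≤ r → a i < a j
  fail : ∀ j ≤ r, ∀ i < h j, w (a j) i = false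
  succ : ∀ j ≤ r, w (a j) (h j) = true
  moved : ∀ j ≤ r, ∀ y < a j, 0 < y → ∃ g < h j, w y g = true
  /-- The ordinary positions below `a j` stay ahead of it. -/
  gen : ∀ j ≤ r, ∀ y < a j, 0 < y → (∀ i ≤ r, y ≠ a i) → ∀ s, h j < s → s ≤ e j →
    (o j ≤ s ∨ w (a j) s = true) →
    succs (w (a j)) 0 s < succs (w y) 0 s ∨
      (Blocked w y ∧ succs (w (a j)) 0 s < y / 2 + succs (w y) 0 s)
  /-- The lower anchors stay ahead of the higher ones until they are dropped. -/
  ord : ∀ i j, i < j → j ≤ r → ∀ s, h j < s → s ≤ d i → s ≤ e j →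
    (o j ≤ s ∨ w (a j) s = true) → succs (w (a j)) 0 s < succs (w (a i)) 0 s
  /-- The anchor `a j` overtakes the preceding one while that one still meets nobody. -/
  drop_anchor : ∀ j, 1 ≤ j → j < r → d j ≤ e (j - 1) ∧
    succs (w (a (j - 1))) 0 (d j) < succs (w (a j)) 0 (d j)
  /-- The ordinary positions between two anchors overtake the lower one. -/
  drop_gen : ∀ j < r, ∀ y, a j < y → y < a (j + 1) →
    succs (w (a j)) 0 t1 < succs (w y) 0 t1 ∨ Blocked w y
  drop_last : succs (w (a 0)) 0 Tf < succs (w (a r)) 0 Tf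
  e_zero : e 0 = Tf
  d_zero : d 0 = Tf
  e_le_d : ∀ i j, i < j → j < r → e j ≤ d i
  h_lt_t1 : ∀ j ≤ r, h j < t1
  t1_le : ∀ j < r, t1 ≤ e j
  t1_le_T1 : t1 ≤ T1
  d_le : ∀ j, 1 ≤ j → j < r → d j ≤ T1
  T1_le : T1 ≤ e r
  e_le : ∀ j ≤ r, e j ≤ Tf
  o_le : o 0 ≤ e r
  Tf_le : Tf < a 0
  B_zero : B 0 = a 0 + 1
  B_le : ∀ i, 1 ≤ i → i < r → B i ≤ a i / 2
  Tf_lt : ∀ i < r, Tf < B i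
  /-- Positions above `a i` stay ahead of the last anchor, or settle before it passes them. -/
  final : ∀ i < r, ∀ y, a i < y → y ≤ a (i + 1) → y ≠ a r → ∀ t, e r ≤ t → t ≤ Tend →
    y ≤ succs (w (a r)) Tf t ∨
      a 0 + 1 + succs (w (a r)) (e r) t < B i + succs (w y) T1 t
  Tend_lt : a 0 + 1 + Tend < a r

namespace AnchorSystem

variable {w : ℕ → ℕ → Bool} {r : ℕ} {a h o e d B : ℕ → ℕ} {t1 T1 Tf Tend : ℕ}

theorem a_le (H : AnchorSystem w r a h o e d B t1 T1 Tf Tend) {i j : ℕ} (hij : i ≤ j)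
    (hj : j ≤ r) : a i ≤ a j := by
  rcases hij.lt_or_eq with h1 | rfl
  · exact (H.a_lt i j h1 hj).le
  · exact le_rfl

/-- The first success of `a j` comes after those of all smaller positions. -/
theorem clear_first (H : AnchorSystem w r a h o e d B t1 T1 Tf Tend) {j : ℕ} (hj : j ≤ r)
    {s : ℕ} (hs : s = h j) {y : ℕ} (hy : y < a j) (hy0 : 0 < y) : 0 < lev w s y := by
  obtain ⟨g, hg, hyg⟩ := H.moved j hj y hy hy0
  have h1 := min_le_lev w y (Nat.zero_le s) (Nat.zero_le (lev w 0 y))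
  have h2 : 1 ≤ succs (w y) 0 s := by
    unfold succs
    rw [Nat.one_le_iff_ne_zero, card_ne_zero]
    exact ⟨g, mem_filter.2 ⟨mem_Ico.2 ⟨Nat.zero_le _, by omega⟩, hyg⟩⟩
  omega

theorem succs_zero_of_le (H : AnchorSystem w r a h o e d B t1 T1 Tf Tend) {j : ℕ} (hj : j ≤ r)
    {s : ℕ} (hs : s ≤ h j) : succs (w (a j)) 0 s = 0 := by
  unfold succs
  rw [card_eq_zero, filter_eq_empty_iff]
  intro i hi
  simp [H.fail j hj i (by have := (mem_Ico.1 hi).2; omega)]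

/-- As far as the first `k` levels are concerned, ordinary positions do not stop `a j`. -/
theorem gen_lev (H : AnchorSystem w r a h o e d B t1 T1 Tf Tend) {j : ℕ} (hj : j ≤ r) {y : ℕ}
    (hy : y < a j) (hy0 : 0 < y) (hya : ∀ i ≤ r, y ≠ a i) {s : ℕ} (hs : h j < s) (hse : s ≤ e j)
    (hso : o j ≤ s ∨ w (a j) s = true) {k : ℕ} (hk : k ≤ succs (w (a j)) 0 s) (hky : k < y) :
    k < lev w s y := by
  rcases H.gen j hj y hy hy0 hya s hs hse hso with h1 | ⟨h1, h2⟩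
  · have := min_le_lev w y (Nat.zero_le s) (Nat.zero_le (lev w 0 y))
    omega
  · obtain ⟨g, hg, hyg⟩ := H.moved j hj y hy hy0
    have := h1.min_le_lev (hg.trans hs) hyg
    omega

/-- The anchors other than the last one climb one level per success until the time `e j`. -/
theorem lev_eq_of_lt (H : AnchorSystem w r a h o e d B t1 T1 Tf Tend) {j : ℕ} (hj : j < r)
    {s : ℕ} (hs : s ≤ e j) : lev w s (a j) = succs (w (a j)) 0 s := by
  have hT := H.e_le j hj.le
  have h0 : a 0 ≤ a j := H.a_le (Nat.zero_le j) hj.le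
  have := H.Tf_le
  rw [lev_eq_of_clear w (Nat.zero_le s) (m := 0) rfl (by omega), zero_add]
  intro u _ hu hc y hy hk
  rw [zero_add] at hk ⊢
  have hu1 : h j ≤ u := by
    by_contra hlt
    simp [H.fail j hj.le u (by omega)] at hc
  rcases hu1.eq_or_lt with hu1 | hu1
  · rw [H.succs_zero_of_le hj.le hu1.ge]
    exact H.clear_first hj.le hu1.symm hy (by omega)
  by_cases hya : ∀ i ≤ r, y ≠ a i
  · exact H.gen_lev hj.le hy (by omega) hya hu1 (by omega) (Or.inr hc) le_rfl hk
  · push Not at hya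
    obtain ⟨i, hi, rfl⟩ := hya
    have hij : i < j := by
      by_contra hlt
      have := H.a_le (not_lt.1 hlt) hi
      omega
    have := H.ord i j hij hj.le u hu1 (by have := H.e_le_d i j hij hj; omega) (by omega) (Or.inr hc)
    have := min_le_lev w (a i) (Nat.zero_le u) (Nat.zero_le (lev w 0 (a i)))
    omega

/-- A position on a higher level than `a j` is above `a j`, by laminarity; this is how a position
gets out of the way of the last anchor once it overtakes `a j`. -/
theorem lt_lev_of_drop (H : AnchorSystem w r a h o e d B t1 T1 Tf Tend) {j : ℕ} (hj : j < r)
    {s y : ℕ} (hs : s ≤ e j) (hy : a j < y) (hlt : succs (w (a j)) 0 s < succs (w y) 0 s) :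
    a j < lev w s y := by
  have h1 := H.lev_eq_of_lt hj hs
  have h2 := min_le_lev w y (Nat.zero_le s) (Nat.zero_le (lev w 0 y))
  have h3 := (laminar_lev w s).1 (a j)
  exact lt_lev_of_lev_lt w hy (by omega)

theorem B_le_lev (H : AnchorSystem w r a h o e d B t1 T1 Tf Tend) {i : ℕ} (hi : i < r) {y : ℕ}
    (h1 : a i < y) (h2 : y ≤ a (i + 1)) (h3 : y ≠ a r) : B i ≤ lev w T1 y := by
  have hB : B i ≤ a i + 1 := by
    rcases Nat.eq_zero_or_pos i with rfl | h0
    · exact H.B_zero.le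
    · have := H.B_le i h0 hi
      omega
  rcases h2.lt_or_eq with h2 | rfl
  · rcases H.drop_gen i hi y h1 h2 with h4 | h4
    · have := H.lt_lev_of_drop hi (H.t1_le i hi) h1 h4
      have := lev_mono w y H.t1_le_T1
      simp only at this
      omega
    · obtain ⟨g, hg, hyg⟩ := H.moved (i + 1) hi y h2 (by omega)
      have hT : g + 1 ≤ T1 := by
        have := H.h_lt_t1 (i + 1) hi
        have := H.t1_le_T1
        omega
      -- a blocked position gets to level `y / 2 ≥ B i` if `i > 0`, while for `i = 0` the blocking
      -- position is seen to be `a 0` or a higher one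
      rcases Nat.eq_zero_or_pos i with rfl | h0
      · obtain ⟨c, g', hc, hc2, hy1, hy2, hc3⟩ := h4
        have hg' : g' ≤ g := by
          by_contra hlt
          have := hy1 g (by omega)
          simp [hyg] at this
        have hT' := lev_mono w y (show g' + 1 ≤ T1 by omega)
        simp only at hT'
        rw [H.B_zero]
        have ha0 : 0 < a 0 := by have := H.Tf_le; omega
        rcases le_or_gt g' (h 0) with h5 | h5
        · have := lt_lev_of_blocked w h1 hy1 hy2
            (fun i hi => H.fail 0 (Nat.zero_le r) i (by omega))
          omega
        · have hca : a 0 < c := by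
            by_contra hlt
            rcases (not_lt.1 hlt).lt_or_eq with h6 | h6
            · obtain ⟨g2, h7, h8⟩ := H.moved 0 (Nat.zero_le r) c h6 (by omega)
              have := hc3 g2 (by omega)
              simp [h8] at this
            · have h7 := H.succ 0 (Nat.zero_le r)
              have := hc3 (h 0) h5
              rw [h6] at this
              simp [h7] at this
          have := lt_lev_of_blocked w hc hy1 hy2 hc3
          omega
      · have h5 := h4.min_le_lev (s := T1) (by omega) hyg
        have := H.B_le i h0 hi
        omega
  · have hir : i + 1 < r := by
      by_contra hlt
      exact h3 (by rw [show i + 1 = r by omega])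
    obtain ⟨h4, h5⟩ := H.drop_anchor (i + 1) (by omega) hir
    rw [Nat.add_sub_cancel] at h4 h5
    have := H.lt_lev_of_drop hi h4 h1 h5
    have := lev_mono w (a (i + 1)) (H.d_le (i + 1) (by omega) hir)
    simp only at this
    omega

theorem exists_between {y : ℕ} (h0 : a 0 < y) (hy : y < a r) :
    ∃ i < r, a i < y ∧ y ≤ a (i + 1) := by
  by_contra hc
  push Not at hc
  have : ∀ i ≤ r, a i < y := by
    intro i
    induction i with
    | zero => exact fun _ => h0
    | succ i ih => exact fun hi => hc i hi (ih (by omega))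
  have := this r le_rfl
  omega

theorem lev_last_eq (H : AnchorSystem w r a h o e d B t1 T1 Tf Tend) {s : ℕ} (hs : s ≤ e r) :
    lev w s (a r) = succs (w (a r)) 0 s := by
  have hT := H.e_le r le_rfl
  have h0 : a 0 ≤ a r := H.a_le (Nat.zero_le r) le_rfl
  have hTf := H.Tf_le
  rw [lev_eq_of_clear w (Nat.zero_le s) (m := 0) rfl (by omega), zero_add]
  intro u _ hu hc y hy hk
  rw [zero_add] at hk ⊢
  have hu1 : h r ≤ u := by
    by_contra hlt
    simp [H.fail r le_rfl u (by omega)] at hc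
  rcases hu1.eq_or_lt with hu1 | hu1
  · rw [H.succs_zero_of_le le_rfl hu1.ge]
    exact H.clear_first le_rfl hu1.symm hy (by omega)
  by_cases hya : ∀ i ≤ r, y ≠ a i
  · exact H.gen_lev le_rfl hy (by omega) hya hu1 (by omega) (Or.inr hc) le_rfl hk
  · push Not at hya
    obtain ⟨i, hi, rfl⟩ := hya
    have hij : i < r := by
      by_contra hlt
      rw [show i = r by omega] at hy
      omega
    rcases le_or_gt u (d i) with hd | hd
    · have := H.ord i r hij le_rfl u hu1 hd (by omega) (Or.inr hc)
      have := min_le_lev w (a i) (Nat.zero_le u) (Nat.zero_le (lev w 0 (a i)))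
      omega
    · have hi1 : 1 ≤ i := by
        by_contra hlt
        rw [show i = 0 by omega, H.d_zero] at hd
        omega
      obtain ⟨h4, h5⟩ := H.drop_anchor i hi1 hij
      have := H.lt_lev_of_drop (show i - 1 < r by omega) h4 (H.a_lt _ _ (by omega) hi) h5
      have h6 := lev_mono w (a i) hd.le
      simp only at h6
      have := H.a_le (Nat.zero_le (i - 1)) (show i - 1 ≤ r by omega)
      have := succs_le (w (a r)) 0 u
      omega

/-- From the time `e r` on, the last anchor either still meets nobody, or it has been moved
to the level `a 0 + 1` at a time `s ≤ Tf` and has met nobody since. -/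
theorem lev_last (H : AnchorSystem w r a h o e d B t1 T1 Tf Tend) {t : ℕ} (ht : e r ≤ t)
    (htT : t ≤ Tend) : (t < Tf ∧ lev w t (a r) = succs (w (a r)) 0 t) ∨
      ∃ s, e r ≤ s ∧ s ≤ Tf ∧ s ≤ t ∧ lev w t (a r) = a 0 + 1 + succs (w (a r)) s t := by
  have hTf := H.Tf_le
  have h0 : a 0 < a r := H.a_lt 0 r H.r_pos le_rfl
  have her := H.e_le r le_rfl
  -- while it meets nobody, the last anchor is not above `a 0`
  have key : ∀ s ≤ Tf, lev w s (a r) = succs (w (a r)) 0 s →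
      succs (w (a r)) 0 s ≤ succs (w (a 0)) 0 s := by
    intro s hs hl
    have h1 := (laminar_lev w s).2 (a r) (a 0)
      (by have := succs_le (w (a r)) 0 s; omega) h0.le
    rw [H.lev_eq_of_lt H.r_pos (by rw [H.e_zero]; exact hs)] at h1
    omega
  have high : ∀ y, a 0 < y → y < a r → ∀ s, T1 ≤ s → s ≤ Tf → s < lev w s y := by
    intro y hy1 hy2 s hs1 hs2
    obtain ⟨i, hi, h1, h2⟩ := exists_between hy1 hy2
    have h3 := H.B_le_lev hi h1 h2 (by omega)
    have h4 := lev_mono w y hs1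
    simp only at h4
    have := H.Tf_lt i hi
    omega
  induction t, ht using Nat.le_induction with
  | base =>
    left
    refine ⟨?_, H.lev_last_eq le_rfl⟩
    rcases her.lt_or_eq with h1 | h1
    · exact h1
    · have := key (e r) her (H.lev_last_eq le_rfl)
      have := H.drop_last
      rw [h1] at *
      omega
  | succ t ht ih =>
    rcases ih (by omega) with ⟨h1, h2⟩ | ⟨s, h1, h2, h3, h4⟩
    · set k := succs (w (a r)) 0 t with hk
      have hkt : k ≤ t := by have := succs_le (w (a r)) 0 t; omega
      have hk0 := key t h1.le h2
      have hT1 := H.T1_le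
      -- everybody except possibly `a 0` is on a higher level
      have clear : ∀ y < a r, k < y → y ≠ a 0 → k < lev w t y := by
        intro y hy hky hne
        rcases lt_or_gt_of_ne hne with hlt | hgt
        · refine H.gen_lev (Nat.zero_le r) hlt (by omega) ?_ (s := t) ?_ ?_ ?_ hk0 hky
          · intro i hi he
            have := H.a_le (Nat.zero_le i) hi
            omega
          · have := H.h_lt_t1 0 (Nat.zero_le r)
            have := H.t1_le_T1
            omega
          · rw [H.e_zero]; omega
          · exact Or.inl (by have := H.o_le; omega)
        · have := high y hgt hy t (by omega) h1.le
          omega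
      have same := H.lev_eq_of_lt H.r_pos (s := t) (by rw [H.e_zero]; omega)
      by_cases hc : w (a r) t = true ∧ succs (w (a 0)) 0 t = k
      · right
        refine ⟨t + 1, by omega, by omega, le_rfl, ?_⟩
        rw [succs_self, lev_succ]
        have h5 : lev w t (a r) < a r := by omega
        have h6 : stepLev (lev w t) (fun x => w x t) (a r) = pred (lev w t) (a r) + 1 :=
          if_pos ⟨hc.1, h5⟩
        obtain ⟨h7, h8, h9, h10⟩ := (laminar_lev w t).pred_spec h5
        have h11 : a 0 ≤ pred (lev w t) (a r) :=
          Nat.le_findGreatest (P := fun y => lev w t y = lev w t (a r)) (by omega)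
            (by rw [same, h2]; exact hc.2)
        have h12 : pred (lev w t) (a r) = a 0 := by
          by_contra hne
          have := clear _ h8 (by omega) hne
          omega
        omega
      · have h5 := lev_succ_of_clear w h2 (show k < a r by omega) (by
          intro hc2 y hy hky
          by_cases hne : y = a 0
          · subst hne
            rw [same]
            have : succs (w (a 0)) 0 t ≠ k := fun h => hc ⟨hc2, h⟩
            omega
          · exact clear y hy hky hne)
        have h6 : lev w (t + 1) (a r) = succs (w (a r)) 0 (t + 1) := by
          rw [h5, succs_succ _ (Nat.zero_le t)]
        left
        refine ⟨?_, h6⟩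
        by_contra hlt
        have h7 : t + 1 = Tf := by omega
        have := key (t + 1) h7.le h6
        have := H.drop_last
        rw [h7] at *
        omega
    · right
      refine ⟨s, h1, h2, by omega, ?_⟩
      have h5 := succs_le (w (a r)) s t
      have hTe := H.Tend_lt
      rw [lev_succ_of_clear w h4 (by omega), succs_succ _ h3]
      · omega
      intro hc y hy hky
      obtain ⟨i, hi, hy1, hy2⟩ := exists_between (show a 0 < y by omega) hy
      have h6 := H.B_le_lev hi hy1 hy2 (by omega)
      have h7 := min_le_lev w y (show T1 ≤ t by have := H.T1_le; omega) h6
      have h9 := succs_anti (w (a r)) h2 t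
      have h10 := succs_anti (w (a r)) h1 t
      rcases H.final i hi y hy1 hy2 (by omega) t ht (by omega) with h8 | h8
      · omega
      · omega

/-- The last anchor is not on its final level at time `Tend`. -/
theorem lev_last_lt (H : AnchorSystem w r a h o e d B t1 T1 Tf Tend) :
    lev w Tend (a r) < a r := by
  have hTe := H.Tend_lt
  rcases le_total Tend (e r) with h1 | h1
  · rw [H.lev_last_eq h1]
    have := succs_le (w (a r)) 0 Tend
    omega
  · rcases H.lev_last h1 le_rfl with ⟨-, h2⟩ | ⟨s, -, -, h3, h2⟩
    · rw [h2]
      have := succs_le (w (a r)) 0 Tend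
      omega
    · rw [h2]
      have := succs_le (w (a r)) s Tend
      omega

end AnchorSystem

end TamariLevels

namespace TamariLevels

open Finset MeasureTheory

/-! ### Products of coin tosses -/

section Independence

variable {ι : Type*} (μ : ι → Measure Bool) [∀ i, IsProbabilityMeasure (μ i)]

theorem exists_preimage_restrict {A : Set (ι → Bool)} {S : Finset ι}
    (hA : DependsOn (fun w => w ∈ A) (S : Set ι)) :
    ∃ A' : Set (S → Bool), A = (fun (w : ι → Bool) (i : S) => w i) ⁻¹' A' := by
  classical
  refine ⟨{v | (fun i => if h : i ∈ S then v ⟨i, h⟩ else false) ∈ A}, ?_⟩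
  ext w
  have := @hA w (fun i => if h : i ∈ S then w i else false) (by
    intro i hi
    simp [Finset.mem_coe.1 hi])
  simp only [Set.mem_preimage, Set.mem_ofPred_eq]
  simpa using this

theorem measurableSet_of_dependsOn {A : Set (ι → Bool)} {S : Finset ι}
    (hA : DependsOn (fun w => w ∈ A) (S : Set ι)) : MeasurableSet A := by
  obtain ⟨A', rfl⟩ := exists_preimage_restrict hA
  exact measurableSet_preimage (by fun_prop) (Set.toFinite A').measurableSet

/-- Events that depend on disjoint sets of coins are independent. -/
theorem infinitePi_inter_eq_mul {A B : Set (ι → Bool)} {S T : Finset ι} (hST : Disjoint S T)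
    (hA : DependsOn (fun w => w ∈ A) (S : Set ι)) (hB : DependsOn (fun w => w ∈ B) (T : Set ι)) :
    Measure.infinitePi μ (A ∩ B) = Measure.infinitePi μ A * Measure.infinitePi μ B := by
  obtain ⟨A', rfl⟩ := exists_preimage_restrict hA
  obtain ⟨B', rfl⟩ := exists_preimage_restrict hB
  have h := ProbabilityTheory.iIndepFun_infinitePi (P := μ) (X := fun _ (x : Bool) => x)
    (fun _ => measurable_id)
  have h2 := h.indepFun_finset S T hST (fun i => measurable_pi_apply i)
  exact h2.measure_inter_preimage_eq_mul _ _ (Set.toFinite A').measurableSet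
    (Set.toFinite B').measurableSet

end Independence

/-- The law of a coin that shows `true` with probability `p`. -/
noncomputable def coin (p : unitInterval) : Measure Bool :=
  ENNReal.ofReal p • Measure.dirac true + ENNReal.ofReal (1 - p) • Measure.dirac false

instance (p : unitInterval) : IsProbabilityMeasure (coin p) := ⟨by
  simp only [coin, Measure.coe_add, Measure.coe_smul, Pi.add_apply, Pi.smul_apply, measure_univ,
    smul_eq_mul, mul_one]
  rw [← ENNReal.ofReal_add p.2.1 (sub_nonneg.2 p.2.2)]
  simp⟩

/-- The weight of an outcome of a coin. -/
noncomputable def wt (q : ℝ) (b : Bool) : ℝ := if b = true then 1 - q else q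

theorem coin_singleton (p : unitInterval) (b : Bool) :
    coin p {b} = ENNReal.ofReal (wt (1 - p) b) := by
  cases b <;> simp [coin, wt]

/-- The law of the coins of one position. -/
noncomputable def rowLaw (p : unitInterval) : Measure (ℕ → Bool) :=
  Measure.infinitePi fun _ => coin p

/-- The law of the coins of all positions. -/
noncomputable def coinLaw (p : unitInterval) : Measure (ℕ → ℕ → Bool) :=
  Measure.infinitePi fun _ => rowLaw p

instance (p : unitInterval) : IsProbabilityMeasure (rowLaw p) := by
  unfold rowLaw; infer_instance

instance (p : unitInterval) : IsProbabilityMeasure (coinLaw p) := by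
  unfold coinLaw; infer_instance

theorem coinLaw_eq_map (p : unitInterval) :
    coinLaw p = (Measure.infinitePi fun _ : ℕ × ℕ => coin p).map
      (MeasurableEquiv.curry ℕ ℕ Bool) :=
  (Measure.infinitePi_map_curry fun _ _ => coin p).symm

/-- The coins up to time `t` are independent of the coins at time `t`. -/
theorem coinLaw_inter_time {p : unitInterval} {A : Set (ℕ → ℕ → Bool)} {n t : ℕ}
    (hA : ∀ w w' : ℕ → ℕ → Bool, (∀ y < n, ∀ s < t, w y s = w' y s) → (w ∈ A ↔ w' ∈ A))
    (e : Fin n → Bool) :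
    coinLaw p (A ∩ {w | ∀ y : Fin n, w y t = e y}) =
      coinLaw p A * ENNReal.ofReal (∏ y, wt (1 - p) (e y)) := by
  set f := MeasurableEquiv.curry ℕ ℕ Bool
  set B : Set (ℕ → ℕ → Bool) := {w | ∀ y : Fin n, w y t = e y}
  have hA' : DependsOn (fun w => w ∈ f ⁻¹' A) ((range n ×ˢ range t : Finset (ℕ × ℕ)) : Set _) := by
    intro w w' h
    refine propext (hA _ _ fun y hy s hs => h (y, s) ?_)
    simp [hy, hs]
  have hB' : DependsOn (fun w => w ∈ f ⁻¹' B) ((range n ×ˢ {t} : Finset (ℕ × ℕ)) : Set _) := by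
    intro w w' h
    refine propext (forall_congr' fun y => ?_)
    have := h (y, t) (by simp)
    change w (y, t) = e y ↔ w' (y, t) = e y
    rw [this]
  have hd : Disjoint (range n ×ˢ range t : Finset (ℕ × ℕ)) (range n ×ˢ {t}) := by
    rw [disjoint_left]
    rintro ⟨y, s⟩ h1 h2
    simp at h1 h2
    omega
  have hBm : coinLaw p B = ENNReal.ofReal (∏ y, wt (1 - p) (e y)) := by
    let emb : Fin n ↪ ℕ × ℕ :=
      ⟨fun y => ((y : ℕ), t), fun a b h => Fin.ext (Prod.ext_iff.1 h).1⟩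
    have hB2 : f ⁻¹' B = Set.pi ((Finset.map emb univ : Finset (ℕ × ℕ)) : Set (ℕ × ℕ))
        (fun i => if h : i.1 < n then {e ⟨i.1, h⟩} else Set.univ) := by
      ext w
      simp only [Set.mem_preimage, Set.mem_pi, coe_map, Set.mem_image, SetLike.mem_coe, mem_univ,
        true_and, forall_exists_index, forall_apply_eq_imp_iff, B, emb, Set.mem_ofPred_eq]
      refine forall_congr' fun y => ?_
      change _ ↔ w ((y : ℕ), t) ∈
        (if h : (y : ℕ) < n then ({e ⟨y, h⟩} : Set Bool) else Set.univ)
      rw [dif_pos y.2]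
      rfl
    rw [coinLaw_eq_map, MeasurableEquiv.map_apply, hB2, Measure.infinitePi_pi, prod_map,
      ENNReal.ofReal_prod_of_nonneg]
    · refine prod_congr rfl fun y _ => ?_
      change coin p (if h : (y : ℕ) < n then {e ⟨y, h⟩} else Set.univ) = _
      rw [dif_pos y.2]
      exact coin_singleton p _
    · intro y _
      unfold wt
      have h1 := p.2.1
      have h2 := p.2.2
      split_ifs <;> linarith
    · intro i _
      exact (Set.toFinite _).measurableSet
  rw [← hBm, coinLaw_eq_map, MeasurableEquiv.map_apply, MeasurableEquiv.map_apply,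
    MeasurableEquiv.map_apply, Set.preimage_inter]
  exact infinitePi_inter_eq_mul _ hd hA' hB'

end TamariLevels

namespace TamariLevels

open Finset

/-! ### The Tamari lattice in terms of level functions -/

/-- The laminar function `l` represents the element `x` of the Tamari lattice: `y - l y` is the
number of inversions of `x` whose smaller entry is the `y`-th one from above. -/
def Rep {n : ℕ} (x : Tam n) (l : ℕ → ℕ) : Prop :=
  Laminar l ∧ ∀ y z : Fin n, z < y →
    (x.1.symm (Fin.rev z) < x.1.symm (Fin.rev y) ↔ l y ≤ (z : ℕ))

variable {n : ℕ}

theorem exists_rep_of_laminar {l : ℕ → ℕ} (h : Laminar l) : ∃ x : Tam n, Rep x l := by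
  obtain ⟨σ, h1, h2⟩ := Tamari.exists_perm (fun a b : Fin n => l (Fin.rev a) ≤ (Fin.rev b : ℕ))
    (fun a b c hab hbc h1 h2 => by
      refine (h.2 _ _ h1 ?_).trans h2
      exact_mod_cast (Fin.rev_lt_rev.2 hab).le)
    (fun a b c hab hbc h1 => by
      refine h1.trans ?_
      exact_mod_cast (Fin.rev_lt_rev.2 hbc).le)
  refine ⟨⟨σ, h1⟩, h, fun y z hzy => ?_⟩
  have := h2 (Fin.rev y) (Fin.rev z) (Fin.rev_lt_rev.2 hzy)
  simpa using this

theorem exists_rep (x : Tam n) : ∃ l, Rep x l := by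
  classical
  set I : Fin n → Fin n → Prop := fun y z => x.1.symm (Fin.rev z) < x.1.symm (Fin.rev y) with hI
  have hex : ∀ y : Fin n, ∃ k : ℕ, ∀ z : Fin n, z < y → k ≤ z → I y z :=
    fun y => ⟨y, fun z h1 h2 => absurd h2 (by rw [not_le]; exact h1)⟩
  set l : ℕ → ℕ := fun y => if h : y < n then Nat.find (hex ⟨y, h⟩) else y with hl
  have lf : ∀ y : Fin n, l y = Nat.find (hex y) := fun y => by simp [hl]
  have spec : ∀ y z : Fin n, z < y → l y ≤ z → I y z := fun y z h1 h2 =>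
    Nat.find_spec (hex y) z h1 (by rw [← lf]; exact h2)
  have lmin : ∀ (y : Fin n) (k : ℕ), (∀ z : Fin n, z < y → k ≤ z → I y z) → l y ≤ k := by
    intro y k hk
    rw [lf]
    exact Nat.find_le hk
  have lle : ∀ y, l y ≤ y := by
    intro y
    by_cases hy : y < n
    · exact lmin ⟨y, hy⟩ y fun z h1 h2 => absurd h2 (by rw [not_le]; exact h1)
    · simp [hl, hy]
  refine ⟨l, ⟨lle, fun a b h1 h2 => ?_⟩, fun y z hzy => ⟨fun h => ?_, spec y z hzy⟩⟩
  · rcases h2.eq_or_lt with rfl | h2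
    · exact le_rfl
    by_cases ha : a < n
    · have hb : b < n := by omega
      by_contra hc
      refine hc (lmin ⟨a, ha⟩ (l b) fun z hz1 hz2 => ?_)
      by_cases hzb : b ≤ (z : ℕ)
      · exact spec _ _ hz1 (by simp only; omega)
      · have h3 : I ⟨a, ha⟩ ⟨b, hb⟩ := spec ⟨a, ha⟩ ⟨b, hb⟩ h2 h1
        have h4 : I ⟨b, hb⟩ z := spec ⟨b, hb⟩ z (by rw [Fin.lt_def]; simp only; omega) hz2
        exact h4.trans h3
    · have : l a = a := by simp [hl, ha]
      omega
  · refine lmin y z fun z' h1 h2 => ?_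
    rcases h2.eq_or_lt with h2 | h2
    · rwa [← Fin.ext h2]
    · exact Tamari.avoids312_iff.1 x.2 (Fin.rev y) (Fin.rev z') (Fin.rev z) (Fin.rev_lt_rev.2 h1)
        (Fin.rev_lt_rev.2 h2) h

/-- The order of the Tamari lattice is the reverse pointwise order of the level functions. -/
theorem Rep.le_iff {x x' : Tam n} {l l' : ℕ → ℕ} (h : Rep x l) (h' : Rep x' l') :
    x ≤ x' ↔ ∀ y < n, l' y ≤ l y := by
  rw [Tam.le_iff]
  constructor
  · intro hle y hy
    rcases (h.1.1 y).eq_or_lt with h1 | h1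
    · rw [h1]
      exact h'.1.1 y
    · have h2 := (h.2 ⟨y, hy⟩ ⟨l y, by omega⟩ h1).2 le_rfl
      exact (h'.2 ⟨y, hy⟩ ⟨l y, by omega⟩ h1).1 (hle _ _ (Fin.rev_lt_rev.2 h1) h2)
  · intro hle a b hab hinv
    have h1 := h.2 (Fin.rev a) (Fin.rev b) (Fin.rev_lt_rev.2 hab)
    have h2 := h'.2 (Fin.rev a) (Fin.rev b) (Fin.rev_lt_rev.2 hab)
    rw [Fin.rev_rev, Fin.rev_rev] at h1 h2
    exact h2.2 ((hle _ (Fin.rev a).2).trans (h1.1 hinv))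

theorem Rep.ext {x x' : Tam n} {l l' : ℕ → ℕ} (h : Rep x l) (h' : Rep x' l')
    (hl : ∀ y < n, l y = l' y) : x = x' :=
  le_antisymm ((h.le_iff h').2 fun y hy => (hl y hy).ge) ((h'.le_iff h).2 fun y hy => (hl y hy).le)

theorem Rep.eq_of_lt {x : Tam n} {l l' : ℕ → ℕ} (h : Rep x l) (h' : Rep x l') {y : ℕ}
    (hy : y < n) : l y = l' y :=
  le_antisymm ((h'.le_iff h).1 le_rfl y hy) ((h.le_iff h').1 le_rfl y hy)

theorem rep_top : Rep (⊤ : Tam n) fun _ => 0 := by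
  obtain ⟨x, hx⟩ := exists_rep_of_laminar (n := n) (l := fun _ => 0)
    ⟨fun x => Nat.zero_le _, fun _ _ _ _ => le_rfl⟩
  obtain ⟨l, hl⟩ := exists_rep (⊤ : Tam n)
  have : x = ⊤ := le_antisymm le_top ((hl.le_iff hx).2 fun _ _ => Nat.zero_le _)
  rwa [← this]

theorem Rep.eq_bot {l : ℕ → ℕ} (h : Rep (⊥ : Tam n) l) {y : ℕ} (hy : y < n) : l y = y := by
  obtain ⟨x, hx⟩ := exists_rep_of_laminar (n := n) (l := fun y => y)
    ⟨fun x => le_rfl, fun _ _ h _ => h⟩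
  exact le_antisymm (h.1.1 y) ((h.le_iff hx).1 bot_le y hy)

theorem findGreatest_congr {P Q : ℕ → Prop} [DecidablePred P] [DecidablePred Q] {k : ℕ}
    (h : ∀ y ≤ k, P y ↔ Q y) : Nat.findGreatest P k = Nat.findGreatest Q k := by
  induction k with
  | zero => rfl
  | succ k ih =>
    rw [Nat.findGreatest_succ, Nat.findGreatest_succ, ih fun y hy => h y (by omega)]
    simp only [h (k + 1) le_rfl]

theorem stepLev_congr {l l' : ℕ → ℕ} {S S' : ℕ → Bool} {x : ℕ} (h : ∀ y ≤ x, l y = l' y)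
    (hS : S x = S' x) : stepLev l S x = stepLev l' S' x := by
  have h1 : pred l x = pred l' x := by
    unfold pred
    rw [h x le_rfl]
    exact findGreatest_congr fun k hk => by rw [h k (by omega)]
  unfold stepLev
  rw [h1, h x le_rfl, hS]

/-- The extension of a choice of positions below `n`. -/
def extCoins (e : Fin n → Bool) (y : ℕ) : Bool := if h : y < n then e ⟨y, h⟩ else false

/-- Moving the position `y` alone. -/
def single (y : ℕ) (z : ℕ) : Bool := decide (z = y)

/-- A move of a single position is as small as laminarity permits. -/
theorem lt_of_laminar_of_eq {l m : ℕ → ℕ} (hl : Laminar l) (hm : Laminar m) {y : ℕ}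
    (hy : l y < y) (h : m (pred l y) = l (pred l y)) (hlt : l y < m y) : pred l y + 1 ≤ m y := by
  obtain ⟨h1, h2, h3, -⟩ := hl.pred_spec hy
  by_contra hc
  have := hm.2 y (pred l y) (by omega) h2.le
  omega

theorem stepLev_single {l : ℕ → ℕ} {y : ℕ} (hy : l y < y) :
    stepLev l (single y) y = pred l y + 1 :=
  if_pos ⟨by simp [single], hy⟩

theorem stepLev_single_of_ne {l : ℕ → ℕ} {y z : ℕ} (h : z ≠ y) :
    stepLev l (single y) z = l z :=
  if_neg fun hc => h (by simpa [single] using hc.1)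

/-- Elements are covered by moving one single position. -/
theorem Rep.covBy_iff {x z : Tam n} {l : ℕ → ℕ} (h : Rep x l) :
    z ⋖ x ↔ ∃ y < n, l y < y ∧ Rep z (stepLev l (single y)) := by
  constructor
  · intro hz
    obtain ⟨m, hm⟩ := exists_rep z
    have hle := (hm.le_iff h).1 hz.le
    have hne : ∃ y, y < n ∧ l y < m y := by
      by_contra hc
      push Not at hc
      exact hz.lt.not_ge ((h.le_iff hm).2 hc)
    classical
    set y := Nat.find hne
    obtain ⟨hy1, hy2⟩ := Nat.find_spec hne
    have hmin : ∀ z < y, m z = l z := by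
      intro z hzy
      have := Nat.find_min hne hzy
      have := hle z (by omega)
      omega
    have hy3 : l y < y := hy2.trans_le (hm.1.1 y)
    obtain ⟨u, hu⟩ := exists_rep_of_laminar (n := n) (h.1.stepLev (single y))
    have h1 := lt_of_laminar_of_eq h.1 hm.1 hy3 (hmin _ (h.1.pred_spec hy3).2.1) hy2
    have h2 : z ≤ u := by
      refine (hm.le_iff hu).2 fun k hk => ?_
      by_cases hky : k = y
      · rw [hky, stepLev_single hy3]
        exact h1
      · rw [stepLev_single_of_ne hky]
        exact hle k hk
    have h3 : u < x := by
      refine lt_of_le_not_ge ((hu.le_iff h).2 fun k hk => le_stepLev h.1 _ _) fun hc => ?_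
      have := (h.le_iff hu).1 hc y hy1
      rw [stepLev_single hy3] at this
      have := (h.1.pred_spec hy3).2.2.1
      omega
    rcases h2.eq_or_lt with h4 | h4
    · exact ⟨y, hy1, hy3, by rwa [h4]⟩
    · exact absurd h3 (hz.2 h4)
  · rintro ⟨y, hy, hly, hz⟩
    refine ⟨lt_of_le_not_ge ((hz.le_iff h).2 fun k hk => le_stepLev h.1 _ _) fun hc => ?_, ?_⟩
    · have := (h.le_iff hz).1 hc y hy
      rw [stepLev_single hly] at this
      have := (h.1.pred_spec hly).2.2.1
      omega
    · intro u hu1 hu2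
      obtain ⟨m, hm⟩ := exists_rep u
      have h1 := (hz.le_iff hm).1 hu1.le
      have h2 := (hm.le_iff h).1 hu2.le
      have h3 : ∀ k < n, k ≠ y → m k = l k := by
        intro k hk hky
        have := h1 k hk
        rw [stepLev_single_of_ne hky] at this
        exact le_antisymm this (h2 k hk)
      obtain ⟨-, hp, -, -⟩ := h.1.pred_spec hly
      rcases (h2 y hy).eq_or_lt with h4 | h4
      · refine hu2.not_ge ((h.le_iff hm).2 fun k hk => ?_)
        by_cases hky : k = y
        · rw [hky, h4]
        · exact (h3 k hk hky).le
      · have h5 := lt_of_laminar_of_eq h.1 hm.1 hly (h3 _ (by omega) (by omega)) h4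
        refine hu1.not_ge ((hm.le_iff hz).2 fun k hk => ?_)
        by_cases hky : k = y
        · rw [hky, stepLev_single hly]
          exact h5
        · rw [stepLev_single_of_ne hky]
          exact h2 k hk

/-- The element represented by a laminar function (and `⊤` for other functions). -/
noncomputable def ofLev (n : ℕ) (l : ℕ → ℕ) : Tam n :=
  open Classical in if h : Laminar l then (exists_rep_of_laminar h).choose else ⊤

theorem rep_ofLev {l : ℕ → ℕ} (h : Laminar l) : Rep (ofLev n l) l := by
  rw [ofLev, dif_pos h]
  exact (exists_rep_of_laminar h).choose_spec

theorem Rep.eq_ofLev {x : Tam n} {l : ℕ → ℕ} (h : Rep x l) : x = ofLev n l :=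
  h.ext (rep_ofLev h.1) fun _ _ => rfl

/-- The meet of `x` and the elements obtained by moving the positions in `V`. -/
theorem Rep.ungarMove {x : Tam n} {l : ℕ → ℕ} (h : Rep x l) {V : Finset (Fin n)}
    (hV : ∀ y ∈ V, l y < y) {T : Finset (Tam n)}
    (hT : ∀ z, z ∈ T ↔ ∃ y ∈ V, z = ofLev n (stepLev l (single y))) {S : ℕ → Bool}
    (hS : ∀ y : Fin n, S y = true ∧ l y < y ↔ y ∈ V) :
    Ungarian.ungarMove x T = ofLev n (stepLev l S) := by
  classical
  have hr := rep_ofLev (n := n) (h.1.stepLev S)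
  refine eq_of_forall_le_iff fun u => ?_
  obtain ⟨m, hm⟩ := exists_rep u
  unfold Ungarian.ungarMove
  rw [Finset.le_inf_iff, hm.le_iff hr]
  simp only [mem_insert, forall_eq_or_imp, id_eq]
  rw [hm.le_iff h]
  constructor
  · rintro ⟨h1, h2⟩ y hy
    unfold TamariLevels.stepLev
    split_ifs with hc
    · have h3 := h2 _ ((hT _).2 ⟨⟨y, hy⟩, (hS ⟨y, hy⟩).1 hc, rfl⟩)
      have h4 := (hm.le_iff (rep_ofLev (h.1.stepLev _))).1 h3 y hy
      rwa [stepLev_single hc.2] at h4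
    · exact h1 y hy
  · intro h1
    refine ⟨fun y hy => (le_stepLev h.1 S y).trans (h1 y hy), fun z hz => ?_⟩
    obtain ⟨y, hy, rfl⟩ := (hT z).1 hz
    refine (hm.le_iff (rep_ofLev (h.1.stepLev _))).2 fun k hk => ?_
    by_cases hky : k = y
    · have := h1 y y.2
      unfold TamariLevels.stepLev at this
      rw [if_pos ((hS y).2 hy)] at this
      rw [hky, stepLev_single (hV y hy)]
      exact this
    · rw [stepLev_single_of_ne hky]
      exact (le_stepLev h.1 S k).trans (h1 k hk)

/-- The coins of the positions in `E` do not matter if only those in `D` are looked at. -/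
theorem sum_powerset_inter {α : Type*} [DecidableEq α] {p : ℝ} (D : Finset α) (f : Finset α → ℝ)
    (E : Finset α) (hDE : Disjoint D E) :
    ∑ V ∈ (D ∪ E).powerset, p ^ #V * (1 - p) ^ (#(D ∪ E) - #V) * f (V ∩ D) =
      ∑ V ∈ D.powerset, p ^ #V * (1 - p) ^ (#D - #V) * f V := by
  induction E using Finset.induction_on with
  | empty =>
    rw [union_empty]
    refine sum_congr rfl fun V hV => ?_
    rw [inter_eq_left.2 (mem_powerset.1 hV)]
  | insert a E ha ih =>
    rw [disjoint_insert_right] at hDE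
    have ha2 : a ∉ D ∪ E := by simp [hDE.1, ha]
    rw [← ih hDE.2, union_insert, sum_powerset_insert ha2, ← sum_add_distrib]
    refine sum_congr rfl fun V hV => ?_
    have hV := mem_powerset.1 hV
    have haV : a ∉ V := fun h => ha2 (hV h)
    have hc := card_le_card hV
    rw [insert_inter_of_notMem hDE.1, card_insert_of_notMem haV, card_insert_of_notMem ha2,
      show #(D ∪ E) + 1 - (#V + 1) = #(D ∪ E) - #V by omega,
      show #(D ∪ E) + 1 - #V = (#(D ∪ E) - #V) + 1 by omega]
    ring

theorem prod_wt (q : ℝ) (e : Fin n → Bool) :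
    ∏ y, wt q (e y) = (1 - q) ^ #{y | e y = true} * q ^ (n - #{y | e y = true}) := by
  unfold wt
  rw [prod_ite, prod_const, prod_const]
  congr 2
  have := card_filter_add_card_filter_not (s := (univ : Finset (Fin n))) (fun y => e y = true)
  simp only [card_univ, Fintype.card_fin] at this
  omega

open Classical in
/-- The transition probabilities of the Ungarian Markov chain in terms of coins. -/
theorem Rep.transProb {x : Tam n} {l : ℕ → ℕ} (h : Rep x l) (p : unitInterval) (z : Tam n) :
    Ungarian.transProb p x z = ∑ e : Fin n → Bool,
      if ofLev n (stepLev l (extCoins e)) = z then ∏ y, wt (1 - p) (e y) else 0 := by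
  set D : Finset (Fin n) := {y | l y < y} with hD
  set c : Fin n → Tam n := fun y => ofLev n (stepLev l (single y)) with hc
  have hinj : Set.InjOn c D := by
    intro y hy y' hy' heq
    by_contra hne
    have h1 := (mem_filter.1 (mem_coe.1 hy)).2
    have h2 : stepLev l (single y) y = stepLev l (single y') y :=
      Rep.eq_of_lt (x := c y) (rep_ofLev (h.1.stepLev _))
        (by rw [heq]; exact rep_ofLev (h.1.stepLev _)) y.2
    rw [stepLev_single h1, stepLev_single_of_ne (fun he => hne (Fin.ext he))] at h2
    have := (h.1.pred_spec h1).2.2.1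
    omega
  have hcov : Ungarian.lowerCovers x = D.image c := by
    ext u
    unfold Ungarian.lowerCovers
    rw [mem_filter, h.covBy_iff]
    simp only [mem_univ, true_and, mem_image, hD, mem_filter]
    constructor
    · rintro ⟨y, hy, h1, h2⟩
      exact ⟨⟨y, hy⟩, h1, h2.eq_ofLev.symm⟩
    · rintro ⟨y, h1, rfl⟩
      exact ⟨y, y.2, h1, rep_ofLev (h.1.stepLev _)⟩
  set g : Finset (Fin n) → ℝ := fun V =>
    if ofLev n (stepLev l (extCoins fun y => decide (y ∈ V))) = z then 1 else 0 with hg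
  have hmove : ∀ V ⊆ D, Ungarian.ungarMove x (V.image c) =
      ofLev n (stepLev l (extCoins fun y => decide (y ∈ V))) := by
    intro V hV
    refine h.ungarMove (V := V) (fun y hy => (mem_filter.1 (hV hy)).2) (fun u => ?_) fun y => ?_
    · simp only [mem_image, hc, eq_comm]
    · simp only [extCoins, Fin.is_lt, dite_true, decide_eq_true_eq, Fin.eta, and_iff_left_iff_imp]
      exact fun hy => (mem_filter.1 (hV hy)).2
  have key := sum_powerset_inter (p := (p : ℝ)) D g (univ \ D) disjoint_sdiff
  rw [union_sdiff_of_subset (subset_univ D), powerset_univ, card_univ, Fintype.card_fin] at key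
  have hinter : ∀ V : Finset (Fin n), g (V ∩ D) = g V := by
    intro V
    have : ofLev n (stepLev l (extCoins fun y => decide (y ∈ V ∩ D))) =
        ofLev n (stepLev l (extCoins fun y => decide (y ∈ V))) := by
      refine (rep_ofLev (h.1.stepLev _)).ext (rep_ofLev (h.1.stepLev _)) fun y hy => ?_
      unfold TamariLevels.stepLev
      simp only [extCoins, hy, dite_true, decide_eq_true_eq, mem_inter, hD, mem_filter, mem_univ,
        true_and]
      congr 1
      simp only [and_assoc, and_self]
    simp only [hg, this]
  have h1 : Ungarian.transProb p x z =
      ∑ V ∈ D.powerset, (p : ℝ) ^ #V * (1 - (p : ℝ)) ^ (#D - #V) * g V := by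
    unfold Ungarian.transProb
    rw [sum_filter, hcov, powerset_image, sum_image, card_image_of_injOn hinj]
    · refine sum_congr rfl fun V hV => ?_
      have hV := mem_powerset.1 hV
      rw [hmove V hV, card_image_of_injOn (hinj.mono (coe_subset.2 hV))]
      simp only [hg, mul_ite, mul_one, mul_zero]
    · intro V hV V' hV' heq
      exact image_injOn_powerset_of_injOn hinj hV hV' heq
  rw [h1, ← key]
  refine sum_nbij' (fun V y => decide (y ∈ V)) (fun e => ({y | e y = true} : Finset (Fin n)))
    (fun _ _ => mem_univ _) (fun _ _ => mem_univ _) (fun V _ => by ext; simp)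
    (fun e _ => by funext y; simp) fun V _ => ?_
  rw [hinter, prod_wt]
  simp only [decide_eq_true_eq, filter_mem_eq_inter, univ_inter, sub_sub_cancel, hg, mul_ite,
    mul_one, mul_zero]

end TamariLevels

namespace TamariLevels

open Finset MeasureTheory

/-! ### Coupling the Ungarian Markov chain with the coins -/

theorem transProb_bot {L : Type*} [Lattice L] [BoundedOrder L] [Fintype L] (p : unitInterval)
    {z : L} (hz : z ≠ ⊥) : Ungarian.transProb p ⊥ z = 0 := by
  classical
  unfold Ungarian.transProb
  refine sum_eq_zero fun T hT => absurd ?_ hz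
  have h := (mem_filter.1 hT).2
  unfold Ungarian.ungarMove at h
  rw [← h]
  exact bot_unique (Finset.inf_le (f := id) (mem_insert_self _ _))

section Chain

variable {L : Type*} [Lattice L] [BoundedOrder L] [Fintype L] [MeasurableSpace L]
  [DiscreteMeasurableSpace L] (p : unitInterval)

instance : IsProbabilityMeasure (Ungarian.chainLaw L p) := by
  unfold Ungarian.chainLaw
  infer_instance

theorem chainLaw_step (t : ℕ) (x z : L) :
    Ungarian.chainLaw L p {ω | ω t = x ∧ ω (t + 1) = z} =
      Ungarian.chainLaw L p {ω | ω t = x} * ENNReal.ofReal (Ungarian.transProb p x z) := by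
  set κ : (t : ℕ) → ProbabilityTheory.Kernel (Finset.Iic t → L) L := fun t =>
    (Ungarian.kernel p).comap (fun h : (Finset.Iic t → L) => h ⟨t, Finset.mem_Iic.2 le_rfl⟩)
      (measurable_pi_apply _) with hκ
  have h := ProbabilityTheory.Kernel.map_frestrictLe_trajMeasure_compProd_eq_map_trajMeasure
    (X := fun _ => L) (μ₀ := Measure.dirac ⊤) (κ := κ) (a := t)
  set A : Set (Finset.Iic t → L) := {h | h ⟨t, Finset.mem_Iic.2 le_rfl⟩ = x} with hA
  have hAm : MeasurableSet A := measurableSet_eq_fun (measurable_pi_apply _) measurable_const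
  have h2 := congrArg (fun m => m (A ×ˢ {z})) h
  rw [Measure.compProd_apply_prod hAm (measurableSet_singleton z),
    Measure.map_apply (by fun_prop) (hAm.prod (measurableSet_singleton z)),
    setLIntegral_congr_fun (g := fun _ => ENNReal.ofReal (Ungarian.transProb p x z)) hAm,
    setLIntegral_const, Measure.map_apply (by fun_prop) hAm, mul_comm] at h2
  · exact h2.symm
  · intro g hg
    simp only [hκ]
    rw [ProbabilityTheory.Kernel.comap_apply, show g ⟨t, Finset.mem_Iic.2 le_rfl⟩ = x from hg]
    change (Ungarian.step p x).toMeasure {z} = _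
    rw [PMF.toMeasure_apply_singleton _ _ (measurableSet_singleton z)]
    rfl

theorem chainLaw_zero : Ungarian.chainLaw L p {ω | ω 0 = ⊤} = 1 := by
  have hm : MeasurableSet {ω : ℕ → L | ω 0 = ⊤} :=
    measurableSet_eq_fun (measurable_pi_apply _) measurable_const
  set κ : (t : ℕ) → ProbabilityTheory.Kernel (Finset.Iic t → L) L := fun t =>
    (Ungarian.kernel p).comap (fun h : (Finset.Iic t → L) => h ⟨t, Finset.mem_Iic.2 le_rfl⟩)
      (measurable_pi_apply _) with hκ
  change ProbabilityTheory.Kernel.trajMeasure (X := fun _ => L) (Measure.dirac ⊤) κ _ = 1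
  unfold ProbabilityTheory.Kernel.trajMeasure
  set x₀ : Finset.Iic 0 → L := (MeasurableEquiv.piUnique (fun _ : Finset.Iic 0 => L)).symm ⊤
  have h0 : Measure.map (MeasurableEquiv.piUnique (fun _ : Finset.Iic 0 => L)).symm
      (Measure.dirac ⊤) = Measure.dirac x₀ :=
    Measure.map_dirac _
  change ((Measure.map (MeasurableEquiv.piUnique (fun _ : Finset.Iic 0 => L)).symm
      (Measure.dirac ⊤)).bind (ProbabilityTheory.Kernel.traj (X := fun _ => L) κ 0)) _ = 1
  rw [h0, Measure.dirac_bind (ProbabilityTheory.Kernel.measurable _)]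
  have h1 := ProbabilityTheory.Kernel.traj_map_frestrictLe_apply (X := fun _ => L) (κ := κ) 0 0 x₀
  rw [ProbabilityTheory.Kernel.partialTraj_self, ProbabilityTheory.Kernel.id_apply] at h1
  set A : Set (Finset.Iic 0 → L) := {h | h ⟨0, Finset.mem_Iic.2 le_rfl⟩ = ⊤} with hA
  have hAm : MeasurableSet A := measurableSet_eq_fun (measurable_pi_apply _) measurable_const
  have h2 := congrArg (fun m => m A) h1
  rw [Measure.map_apply (by fun_prop) hAm, Measure.dirac_apply' _ hAm,
    Set.indicator_of_mem (by rfl)] at h2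
  exact h2

open Classical in
theorem chainLaw_succ (t : ℕ) (z : L) :
    Ungarian.chainLaw L p {ω | ω (t + 1) = z} = ∑ x,
      Ungarian.chainLaw L p {ω | ω t = x} * ENNReal.ofReal (Ungarian.transProb p x z) := by
  simp_rw [← chainLaw_step]
  rw [← measure_biUnion_finset]
  · congr 1
    ext ω
    simp
  · intro x _ y _ hxy
    refine Set.disjoint_left.2 fun ω h1 h2 => hxy ?_
    exact h1.1.symm.trans h2.1
  · intro x _
    exact (measurableSet_eq_fun (measurable_pi_apply _) measurable_const).inter
      (measurableSet_eq_fun (measurable_pi_apply _) measurable_const)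

/-- The chain needs more than `T` steps if it has not reached `⊥` at time `T`. -/
theorem mul_chainLaw_le_expectedTime (T : ℕ) :
    T * Ungarian.chainLaw L p {ω | ω T ≠ ⊥} ≤ Ungarian.expectedTime p L := by
  have habs : ∀ᵐ ω ∂Ungarian.chainLaw L p, ∀ t, ω t = ⊥ → ω (t + 1) = ⊥ := by
    rw [ae_all_iff]
    intro t
    have : ∀ᵐ ω ∂Ungarian.chainLaw L p, ∀ z : L, z ≠ ⊥ → ¬ (ω t = ⊥ ∧ ω (t + 1) = z) := by
      rw [ae_all_iff]
      intro z
      by_cases hz : z = ⊥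
      · exact Filter.Eventually.of_forall fun _ h => absurd hz h
      · have h1 := chainLaw_step p t ⊥ z
        rw [transProb_bot p hz, ENNReal.ofReal_zero, mul_zero] at h1
        have h2 := measure_eq_zero_iff_ae_notMem.1 h1
        filter_upwards [h2] with ω h3 _ h4
        exact h3 h4
    filter_upwards [this] with ω h1 h2
    by_contra hc
    exact h1 _ hc ⟨h2, rfl⟩
  have hm : MeasurableSet {ω : ℕ → L | ω T ≠ ⊥} :=
    (measurableSet_eq_fun (measurable_pi_apply _) measurable_const).compl
  rw [← lintegral_indicator_const hm]
  refine lintegral_mono_ae ?_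
  filter_upwards [habs] with ω h1
  by_cases h2 : ω T = ⊥
  · rw [Set.indicator_of_notMem (by simpa using h2)]
    exact bot_le
  · rw [Set.indicator_of_mem (by simpa using h2)]
    unfold Ungarian.absorptionTime
    refine le_iInf₂ fun t ht => ?_
    have : T ≤ t := by
      by_contra hlt
      refine h2 ?_
      obtain ⟨k, rfl⟩ := Nat.exists_eq_add_of_le (not_le.1 hlt).le
      clear hlt h2 hm
      induction k with
      | zero => exact ht
      | succ k ih => exact h1 _ ih
    exact_mod_cast this

end Chain

theorem lev_congr {w w' : ℕ → ℕ → Bool} {n t : ℕ} (h : ∀ y < n, ∀ s < t, w y s = w' y s) :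
    ∀ y < n, lev w t y = lev w' t y := by
  induction t with
  | zero => exact fun _ _ => rfl
  | succ t ih =>
    intro y hy
    rw [lev_succ, lev_succ]
    exact stepLev_congr (fun z hz => ih (fun y hy s hs => h y hy s (by omega)) z (by omega))
      (h y hy t (by omega))

theorem ofLev_congr {n : ℕ} {l l' : ℕ → ℕ} (hl : Laminar l) (hl' : Laminar l')
    (h : ∀ y < n, l y = l' y) : ofLev n l = ofLev n l' :=
  (rep_ofLev hl).ext (rep_ofLev hl') h

/-- At every time the level functions driven by independent coins represent a random element of the
Tamari lattice with the same law as the Ungarian Markov chain. -/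
theorem coinLaw_ofLev (p : unitInterval) {n : ℕ} (t : ℕ) (x : Tam n) :
    coinLaw p {w | ofLev n (lev w t) = x} = Ungarian.chainLaw (Tam n) p {ω | ω t = x} := by
  classical
  induction t generalizing x with
  | zero =>
    have h0 : ofLev n (fun _ => 0) = ⊤ := (rep_top (n := n)).eq_ofLev.symm
    change coinLaw p {w | ofLev n (fun _ => 0) = x} = _
    rw [h0]
    by_cases hx : ⊤ = x
    · subst hx
      rw [chainLaw_zero]
      simp
    · have h2 : Ungarian.chainLaw (Tam n) p {ω | ω 0 = x} = 0 := by
        have hm : MeasurableSet {ω : ℕ → Tam n | ω 0 = ⊤} :=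
          measurableSet_eq_fun (measurable_pi_apply _) measurable_const
        refine measure_mono_null ?_ ((prob_compl_eq_zero_iff hm).2 (chainLaw_zero p))
        intro ω h3 h4
        exact hx (h4.symm.trans h3)
      rw [h2]
      simp [hx]
  | succ t ih =>
    rw [chainLaw_succ]
    simp_rw [← ih]
    set A : Tam n → Set (ℕ → ℕ → Bool) := fun z => {w | ofLev n (lev w t) = z} with hA
    choose l hl using fun z : Tam n => exists_rep z
    have hdep : ∀ z, ∀ w w' : ℕ → ℕ → Bool, (∀ y < n, ∀ s < t, w y s = w' y s) →
        (w ∈ A z ↔ w' ∈ A z) := by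
      intro z w w' h
      simp only [hA, Set.mem_ofPred_eq]
      rw [ofLev_congr (laminar_lev w t) (laminar_lev w' t) (lev_congr h)]
    set F : Tam n → (Fin n → Bool) → Tam n := fun z e => ofLev n (stepLev (l z) (extCoins e))
      with hF
    set C : Tam n → (Fin n → Bool) → Set (ℕ → ℕ → Bool) := fun z e =>
      A z ∩ {w | ∀ y : Fin n, w y t = e y} with hC
    have hset : {w | ofLev n (lev w (t + 1)) = x} =
        ⋃ i ∈ (univ : Finset (Tam n × (Fin n → Bool))).filter (fun i => F i.1 i.2 = x),
          C i.1 i.2 := by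
      ext w
      simp only [mem_filter, mem_univ, true_and, Set.mem_iUnion, exists_prop, Prod.exists,
        Set.mem_ofPred_eq]
      have key : ∀ z e, w ∈ C z e → ofLev n (lev w (t + 1)) = F z e := by
        rintro z e ⟨h1, h2⟩
        refine ofLev_congr (laminar_lev w (t + 1)) ((hl z).1.stepLev _) fun y hy => ?_
        rw [lev_succ]
        refine stepLev_congr (fun y' hy' => ?_) ?_
        · have h3 : Rep z (lev w t) := by
            rw [← show ofLev n (lev w t) = z from h1]
            exact rep_ofLev (laminar_lev w t)
          exact h3.eq_of_lt (hl z) (by omega)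
        · simp only [extCoins, hy, dite_true]
          exact h2 ⟨y, hy⟩
      constructor
      · intro h
        have hw : w ∈ C (ofLev n (lev w t)) (fun y => w y t) := ⟨rfl, fun y => rfl⟩
        exact ⟨_, _, by rw [← key _ _ hw, h], hw⟩
      · rintro ⟨z, e, h1, h2⟩
        rw [key z e h2, h1]
    have hmeas : ∀ z e, MeasurableSet (C z e) := by
      intro z e
      have h1 : MeasurableSet ((MeasurableEquiv.curry ℕ ℕ Bool) ⁻¹' C z e) := by
        refine measurableSet_of_dependsOn (S := range n ×ˢ range (t + 1)) ?_
        intro w w' h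
        have h2 : ∀ y < n, ∀ s < t + 1, w (y, s) = w' (y, s) := fun y hy s hs =>
          h (y, s) (by simp [hy]; omega)
        refine propext (and_congr (hdep z _ _ fun y hy s hs => h2 y hy s (by omega)) ?_)
        refine forall_congr' fun y => ?_
        change w (y, t) = e y ↔ w' (y, t) = e y
        rw [h2 y y.2 t (by omega)]
      exact (MeasurableEquiv.measurableSet_preimage _).1 h1
    rw [hset, measure_biUnion_finset, sum_filter, Fintype.sum_prod_type]
    · refine sum_congr rfl fun z _ => ?_
      rw [(hl z).transProb p x, ENNReal.ofReal_sum_of_nonneg, mul_sum]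
      · refine sum_congr rfl fun e _ => ?_
        simp only [hF]
        split_ifs with h1
        · exact coinLaw_inter_time (hdep z) e
        · simp
      · intro e _
        split_ifs
        · refine prod_nonneg fun y _ => ?_
          unfold wt
          have h1 := p.2.1
          have h2 := p.2.2
          split_ifs <;> linarith
        · exact le_rfl
    · rintro ⟨z, e⟩ - ⟨z', e'⟩ - hne
      refine Set.disjoint_left.2 fun w h1 h2 => hne ?_
      have h3 : z = z' := h1.1.symm.trans h2.1
      have h4 : e = e' := funext fun y => (h1.2 y).symm.trans (h2.2 y)
      rw [h3, h4]
    · intro i _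
      exact hmeas _ _

/-- If the coins keep some position from reaching its final level by time `T` with
probability `P`, then the expected absorption time is at least `T * P`. -/
theorem mul_coinLaw_le_expectedTime (p : unitInterval) {n T : ℕ} {E : Set (ℕ → ℕ → Bool)}
    (hE : ∀ w ∈ E, ∃ y < n, lev w T y < y) :
    T * coinLaw p E ≤ Ungarian.expectedTime p (Tam n) := by
  classical
  refine le_trans ?_ (mul_chainLaw_le_expectedTime p T)
  gcongr
  have h1 : ∀ S : Finset (Tam n), Ungarian.chainLaw (Tam n) p {ω | ω T ∈ S} =
      ∑ x ∈ S, Ungarian.chainLaw (Tam n) p {ω | ω T = x} := by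
    intro S
    rw [← measure_biUnion_finset]
    · congr 1
      ext ω
      simp
    · intro x _ y _ hxy
      exact Set.disjoint_left.2 fun ω h1 h2 => hxy (h1.symm.trans h2)
    · intro x _
      exact measurableSet_eq_fun (measurable_pi_apply _) measurable_const
  have h2 := h1 (univ.filter fun x => x ≠ ⊥)
  simp only [mem_filter, mem_univ, true_and] at h2
  rw [h2]
  simp_rw [← coinLaw_ofLev]
  refine le_trans (measure_mono ?_) (measure_biUnion_finset_le _ _)
  intro w hw
  simp only [Set.mem_iUnion, exists_prop, mem_filter, mem_univ, true_and, Set.mem_ofPred_eq]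
  refine ⟨_, ?_, rfl⟩
  intro hbot
  obtain ⟨y, hy, hlt⟩ := hE w hw
  have h3 := rep_ofLev (n := n) (laminar_lev w T)
  rw [hbot] at h3
  have := h3.eq_bot hy
  omega

end TamariLevels

namespace TamariLevels

open Finset MeasureTheory

/-! ### Coin sequences of one position -/

/-- The event `A` is determined by the coins with index in `[s, t)`. -/
def DepOn (A : Set (ℕ → Bool)) (s t : ℕ) : Prop :=
  ∀ w w' : ℕ → Bool, (∀ i, s ≤ i → i < t → w i = w' i) → (w ∈ A ↔ w' ∈ A)

namespace DepOn

variable {A B : Set (ℕ → Bool)} {s t s' t' : ℕ}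

theorem dependsOn (h : DepOn A s t) : DependsOn (fun w => w ∈ A) ((Ico s t : Finset ℕ) : Set ℕ) :=
  fun w w' h' => propext (h w w' fun i h1 h2 => h' i (by simp [h1, h2]))

theorem measurableSet (h : DepOn A s t) : MeasurableSet A :=
  measurableSet_of_dependsOn h.dependsOn

theorem mono (h : DepOn A s t) (h1 : s' ≤ s) (h2 : t ≤ t') : DepOn A s' t' :=
  fun w w' h' => h w w' fun i h3 h4 => h' i (by omega) (by omega)

theorem inter (hA : DepOn A s t) (hB : DepOn B s t) : DepOn (A ∩ B) s t :=
  fun w w' h => and_congr (hA w w' h) (hB w w' h)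

theorem compl (hA : DepOn A s t) : DepOn Aᶜ s t :=
  fun w w' h => not_congr (hA w w' h)

end DepOn

theorem depOn_forall {ι : Sort*} {A : ι → Set (ℕ → Bool)} {s t : ℕ} (h : ∀ i, DepOn (A i) s t) :
    DepOn {w | ∀ i, w ∈ A i} s t :=
  fun w w' h' => forall_congr' fun i => h i w w' h'

theorem depOn_imp {P : Prop} {A : Set (ℕ → Bool)} {s t : ℕ} (h : P → DepOn A s t) :
    DepOn {w | P → w ∈ A} s t :=
  fun w w' h' => forall_congr' fun i => h i w w' h'

theorem fails_congr {w w' : ℕ → Bool} {s t : ℕ} (h : ∀ i, s ≤ i → i < t → w i = w' i) :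
    fails w s t = fails w' s t := by
  unfold fails
  congr 1
  exact filter_congr fun i hi => by rw [h i (mem_Ico.1 hi).1 (mem_Ico.1 hi).2]

theorem depOn_fails {s t : ℕ} (Q : ℕ → Prop) : DepOn {w | Q (fails w s t)} s t :=
  fun w w' h => by simp only [Set.mem_ofPred_eq, fails_congr h]

theorem depOn_coin {s : ℕ} (b : Bool) : DepOn {w | w s = b} s (s + 1) :=
  fun w w' h => by simp only [Set.mem_ofPred_eq, h s le_rfl (Nat.lt_succ_self s)]

variable (p : unitInterval)

/-- The probability of an event concerning the coins of one position. -/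
noncomputable def rowP (A : Set (ℕ → Bool)) : ℝ := (rowLaw p).real A

theorem rowP_nonneg (A : Set (ℕ → Bool)) : 0 ≤ rowP p A := measureReal_nonneg

theorem rowP_le_one (A : Set (ℕ → Bool)) : rowP p A ≤ 1 := measureReal_le_one

theorem rowP_mono {A B : Set (ℕ → Bool)} (h : A ⊆ B) : rowP p A ≤ rowP p B := measureReal_mono h

theorem rowP_univ : rowP p Set.univ = 1 := probReal_univ

theorem rowP_eq_zero {A : Set (ℕ → Bool)} (h : ∀ w, w ∉ A) : rowP p A = 0 := by
  rw [Set.eq_empty_iff_forall_notMem.2 h]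
  exact measureReal_empty

theorem rowP_compl {A : Set (ℕ → Bool)} {s t : ℕ} (h : DepOn A s t) :
    rowP p Aᶜ = 1 - rowP p A := probReal_compl_eq_one_sub h.measurableSet

theorem rowP_union_le (A B : Set (ℕ → Bool)) : rowP p (A ∪ B) ≤ rowP p A + rowP p B :=
  measureReal_union_le A B

theorem rowP_biUnion_le {ι : Type*} (S : Finset ι) (A : ι → Set (ℕ → Bool)) :
    rowP p (⋃ i ∈ S, A i) ≤ ∑ i ∈ S, rowP p (A i) :=
  measureReal_biUnion_finset_le S A

/-- Disjoint stretches of coins are independent. -/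
theorem rowP_inter {A B : Set (ℕ → Bool)} {s t s' t' : ℕ} (hA : DepOn A s t)
    (hB : DepOn B s' t') (h : t ≤ s') : rowP p (A ∩ B) = rowP p A * rowP p B := by
  unfold rowP
  rw [measureReal_def, measureReal_def, measureReal_def, ← ENNReal.toReal_mul]
  congr 1
  refine infinitePi_inter_eq_mul (fun _ => coin p) ?_ hA.dependsOn hB.dependsOn
  rw [Finset.disjoint_left]
  intro i h1 h2
  have := (mem_Ico.1 h1).2
  have := (mem_Ico.1 h2).1
  omega

theorem rowP_coin (s : ℕ) (b : Bool) : rowP p {w | w s = b} = wt (1 - p) b := by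
  unfold rowP rowLaw
  have h := (measurePreserving_eval_infinitePi (fun _ : ℕ => coin p) s).measure_preimage
    (measurableSet_singleton b).nullMeasurableSet
  have e : {w : ℕ → Bool | w s = b} = Function.eval s ⁻¹' ({b} : Set Bool) := rfl
  rw [measureReal_def, e, h, coin_singleton, ENNReal.toReal_ofReal]
  unfold wt
  have h1 := p.2.1
  have h2 := p.2.2
  split_ifs <;> linarith

/-- Conditioning on one coin. -/
theorem rowP_split {A A0 A1 : Set (ℕ → Bool)} {τ t : ℕ} (h0 : DepOn A0 (τ + 1) t)
    (h1 : DepOn A1 (τ + 1) t) (hA0 : ∀ w, w τ = false → (w ∈ A ↔ w ∈ A0))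
    (hA1 : ∀ w, w τ = true → (w ∈ A ↔ w ∈ A1)) :
    rowP p A = (1 - p) * rowP p A0 + p * rowP p A1 := by
  have e : A = ({w | w τ = false} ∩ A0) ∪ ({w | w τ = true} ∩ A1) := by
    ext w
    cases hw : w τ
    · simp [hw, hA0 w hw]
    · simp [hw, hA1 w hw]
  have e1 := rowP_inter p (depOn_coin (s := τ) false) h0 le_rfl
  have e2 := rowP_inter p (depOn_coin (s := τ) true) h1 le_rfl
  rw [rowP_coin] at e1 e2
  have e3 : rowP p A = rowP p ({w | w τ = false} ∩ A0) + rowP p ({w | w τ = true} ∩ A1) := by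
    rw [e]
    refine measureReal_union ?_ ((depOn_coin (s := τ) true).measurableSet.inter h1.measurableSet)
    rw [Set.disjoint_left]
    rintro w ⟨hw1, -⟩ ⟨hw2, -⟩
    simp only [Set.mem_ofPred_eq] at hw1 hw2
    simp [hw1] at hw2
  rw [e3, e1, e2]
  simp [wt]

theorem fails_succ_left {w : ℕ → Bool} {τ t : ℕ} (h : τ < t) :
    fails w τ t = (if w τ = false then 1 else 0) + fails w (τ + 1) t := by
  rw [fails_split w (Nat.le_succ τ) h]
  congr 1
  unfold fails
  rw [Nat.Ico_succ_singleton, filter_singleton]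
  split_ifs <;> simp

/-- The exponential Chebyshev inequality, with `0 ≤ θ` for the upper tail and `θ ≤ 0` for the lower
tail. -/
theorem rowP_exp_le (θ y : ℝ) (τ ℓ : ℕ) :
    rowP p {w | θ * y ≤ θ * fails w τ (τ + ℓ)} ≤
      Real.exp (-(θ * y)) * (p + (1 - p) * Real.exp θ) ^ ℓ := by
  have hp0 : (0 : ℝ) ≤ p := p.2.1
  have hp1 : (p : ℝ) ≤ 1 := p.2.2
  induction ℓ generalizing y τ with
  | zero =>
    rw [pow_zero, mul_one]
    by_cases h : θ * y ≤ 0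
    · exact (rowP_le_one p _).trans (Real.one_le_exp (by linarith))
    · have : {w : ℕ → Bool | θ * y ≤ θ * fails w τ (τ + 0)} = ∅ := by
        ext w
        simp [fails_self, h]
      rw [this]
      unfold rowP
      rw [measureReal_empty]
      positivity
  | succ ℓ ih =>
    rw [rowP_split p (τ := τ) (t := τ + 1 + ℓ)
      (A0 := {w | θ * (y - 1) ≤ θ * fails w (τ + 1) (τ + 1 + ℓ)})
      (A1 := {w | θ * y ≤ θ * fails w (τ + 1) (τ + 1 + ℓ)})
      (depOn_fails fun k => θ * (y - 1) ≤ θ * k) (depOn_fails fun k => θ * y ≤ θ * k)]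
    · have h1 := ih (y - 1) (τ + 1)
      have h2 := ih y (τ + 1)
      have h3 : Real.exp (-(θ * (y - 1))) = Real.exp (-(θ * y)) * Real.exp θ := by
        rw [← Real.exp_add]
        congr 1
        ring
      rw [h3] at h1
      calc _ ≤ (1 - (p : ℝ)) * (Real.exp (-(θ * y)) * Real.exp θ *
              (p + (1 - p) * Real.exp θ) ^ ℓ) +
            p * (Real.exp (-(θ * y)) * (p + (1 - p) * Real.exp θ) ^ ℓ) := by gcongr
        _ = _ := by ring
    · intro w hw
      simp only [Set.mem_ofPred_eq]
      rw [fails_succ_left (by omega), if_pos hw, show τ + (ℓ + 1) = τ + 1 + ℓ by ring]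
      push_cast
      constructor <;> intro h <;> linarith
    · intro w hw
      simp only [Set.mem_ofPred_eq]
      rw [fails_succ_left (by omega), if_neg (by simp [hw]), zero_add,
        show τ + (ℓ + 1) = τ + 1 + ℓ by ring]

theorem mgf_le {θ : ℝ} (h0 : -1 ≤ θ) (h1 : θ ≤ 1) (ℓ : ℕ) :
    (p + (1 - (p : ℝ)) * Real.exp θ) ^ ℓ ≤
      Real.exp ((1 - p) * ℓ * θ + (1 - p) * ℓ * θ ^ 2) := by
  have hp0 : (0 : ℝ) ≤ p := p.2.1
  have hp1 : (p : ℝ) ≤ 1 := p.2.2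
  have h2 : Real.exp θ ≤ 1 + θ + θ ^ 2 := by
    have := Real.abs_exp_sub_one_sub_id_le (x := θ) (abs_le.2 ⟨h0, h1⟩)
    linarith [(abs_le.1 this).2]
  have h3 : (p : ℝ) + (1 - p) * Real.exp θ ≤ Real.exp ((1 - p) * (θ + θ ^ 2)) := by
    have h4 := Real.add_one_le_exp ((1 - (p : ℝ)) * (θ + θ ^ 2))
    nlinarith
  calc _ ≤ Real.exp ((1 - p) * (θ + θ ^ 2)) ^ ℓ := by gcongr
    _ = _ := by
      rw [← Real.exp_nat_mul]
      congr 1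
      ring

/-- Upper tail of the number of failures. -/
theorem rowP_upper {x V : ℝ} (hx : 0 ≤ x) (hV : 0 < V) (τ ℓ : ℕ)
    (hℓ : (1 - (p : ℝ)) * ℓ ≤ V) :
    rowP p {w | (1 - (p : ℝ)) * ℓ + x ≤ fails w τ (τ + ℓ)} ≤
      Real.exp (-min (x / 2) (x ^ 2 / (4 * V))) := by
  set θ : ℝ := min 1 (x / (2 * V)) with hθ
  have h0 : 0 ≤ θ := le_min zero_le_one (by positivity)
  have h1 : θ ≤ 1 := min_le_left _ _
  refine (rowP_mono p ?_).trans ((rowP_exp_le p θ ((1 - p) * ℓ + x) τ ℓ).trans ?_)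
  · intro w hw
    exact mul_le_mul_of_nonneg_left hw h0
  · refine (mul_le_mul_of_nonneg_left (mgf_le p (by linarith) h1 ℓ) (Real.exp_pos _).le).trans ?_
    rw [← Real.exp_add]
    refine Real.exp_le_exp.2 ?_
    have h2 : (1 - (p : ℝ)) * ℓ * θ ^ 2 ≤ θ * (x / 2) := by
      have : θ * V ≤ x / 2 := by
        calc θ * V ≤ x / (2 * V) * V := by gcongr; exact min_le_right _ _
          _ = x / 2 := by field_simp
      nlinarith [mul_le_mul_of_nonneg_right hℓ (sq_nonneg θ)]
    have h3 : θ * (x / 2) = min (x / 2) (x ^ 2 / (4 * V)) := by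
      rw [hθ, min_mul_of_nonneg _ _ (by positivity)]
      congr 1
      · ring
      · field_simp; ring
    linarith

/-- Lower tail of the number of failures. -/
theorem rowP_lower {x V : ℝ} (hx : 0 ≤ x) (hV : 0 < V) (τ ℓ : ℕ)
    (hℓ : (1 - (p : ℝ)) * ℓ ≤ V) :
    rowP p {w | (fails w τ (τ + ℓ) : ℝ) ≤ (1 - (p : ℝ)) * ℓ - x} ≤
      Real.exp (-min (x / 2) (x ^ 2 / (4 * V))) := by
  set θ : ℝ := min 1 (x / (2 * V)) with hθ
  have h0 : 0 ≤ θ := le_min zero_le_one (by positivity)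
  have h1 : θ ≤ 1 := min_le_left _ _
  refine (rowP_mono p ?_).trans ((rowP_exp_le p (-θ) ((1 - p) * ℓ - x) τ ℓ).trans ?_)
  · intro w hw
    have := mul_le_mul_of_nonneg_left hw h0
    simp only [Set.mem_ofPred_eq]
    linarith
  · refine (mul_le_mul_of_nonneg_left (mgf_le p (by linarith) (by linarith) ℓ)
      (Real.exp_pos _).le).trans ?_
    rw [← Real.exp_add]
    refine Real.exp_le_exp.2 ?_
    have h2 : (1 - (p : ℝ)) * ℓ * θ ^ 2 ≤ θ * (x / 2) := by
      have : θ * V ≤ x / 2 := by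
        calc θ * V ≤ x / (2 * V) * V := by gcongr; exact min_le_right _ _
          _ = x / 2 := by field_simp
      nlinarith [mul_le_mul_of_nonneg_right hℓ (sq_nonneg θ)]
    have h3 : θ * (x / 2) = min (x / 2) (x ^ 2 / (4 * V)) := by
      rw [hθ, min_mul_of_nonneg _ _ (by positivity)]
      congr 1
      · ring
      · field_simp; ring
    nlinarith

/-- The probability that a random walk started at `y`, with steps `1 - x` (with probability `θ`) and
`-x`, stays in `[-X, X]` for `ℓ` steps. -/
noncomputable def stay (θ x X : ℝ) : ℕ → ℝ → ℝ
  | 0, y => if |y| ≤ X then 1 else 0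
  | ℓ + 1, y => if |y| ≤ X then
      θ * stay θ x X ℓ (y + 1 - x) + (1 - θ) * stay θ x X ℓ (y - x) else 0

/-- Kolmogorov's maximal inequality for a centred walk. -/
theorem one_sub_stay_le {x X : ℝ} (h0 : 0 ≤ x) (h1 : x ≤ 1) (hX : 0 < X) (ℓ : ℕ) (y : ℝ) :
    1 - stay x x X ℓ y ≤ (y ^ 2 + ℓ * (x * (1 - x))) / X ^ 2 := by
  have out : ∀ y : ℝ, ∀ ℓ : ℕ, ¬ |y| ≤ X → 1 - 0 ≤ (y ^ 2 + ℓ * (x * (1 - x))) / X ^ 2 := by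
    intro y ℓ h
    rw [le_div_iff₀ (by positivity)]
    have h2 : X ^ 2 ≤ y ^ 2 := by
      rw [← sq_abs y]
      gcongr
      exact (not_le.1 h).le
    have : 0 ≤ (ℓ : ℝ) * (x * (1 - x)) := by
      have : 0 ≤ 1 - x := by linarith
      positivity
    linarith
  induction ℓ generalizing y with
  | zero =>
    unfold stay
    split_ifs with h
    · rw [sub_self]
      positivity
    · exact out y 0 h
  | succ ℓ ih =>
    unfold stay
    split_ifs with h
    · have h2 := mul_le_mul_of_nonneg_left (ih (y + 1 - x)) h0
      have h3 := mul_le_mul_of_nonneg_left (ih (y - x)) (sub_nonneg.2 h1)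
      have h4 : x * (((y + 1 - x) ^ 2 + ℓ * (x * (1 - x))) / X ^ 2) +
          (1 - x) * (((y - x) ^ 2 + ℓ * (x * (1 - x))) / X ^ 2) =
          (y ^ 2 + ((ℓ + 1 : ℕ) : ℝ) * (x * (1 - x))) / X ^ 2 := by
        push_cast
        field_simp
        ring
      linarith
    · exact out y _ h

/-- Changing the parameter of the walk (Cauchy–Schwarz). -/
theorem stay_sq_le {θ θ' x X : ℝ} (h0 : 0 < θ) (h1 : θ < 1)
    (ℓ : ℕ) (y : ℝ) :
    stay θ' x X ℓ y ^ 2 ≤ (1 + (θ' - θ) ^ 2 / (θ * (1 - θ))) ^ ℓ * stay θ x X ℓ y := by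
  have hθ : 0 < 1 - θ := by linarith
  set ρ : ℝ := 1 + (θ' - θ) ^ 2 / (θ * (1 - θ)) with hρ
  have hρ1 : 0 ≤ ρ := by positivity
  have hρ2 : ρ = θ' ^ 2 / θ + (1 - θ') ^ 2 / (1 - θ) := by
    rw [hρ]
    field_simp
    ring
  induction ℓ generalizing y with
  | zero => unfold stay; split_ifs <;> simp
  | succ ℓ ih =>
    unfold stay
    split_ifs with h
    · set a := stay θ' x X ℓ (y + 1 - x)
      set b := stay θ' x X ℓ (y - x)
      have ha := ih (y + 1 - x)
      have hb := ih (y - x)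
      set c := stay θ x X ℓ (y + 1 - x)
      set d := stay θ x X ℓ (y - x)
      have cs : (θ' * a + (1 - θ') * b) ^ 2 ≤ ρ * (θ * a ^ 2 + (1 - θ) * b ^ 2) := by
        rw [hρ2]
        have key : (θ' ^ 2 / θ + (1 - θ') ^ 2 / (1 - θ)) * (θ * a ^ 2 + (1 - θ) * b ^ 2) -
            (θ' * a + (1 - θ') * b) ^ 2 =
            (θ' * (1 - θ) * b - (1 - θ') * θ * a) ^ 2 / (θ * (1 - θ)) := by
          field_simp
          ring
        have : 0 ≤ (θ' * (1 - θ) * b - (1 - θ') * θ * a) ^ 2 / (θ * (1 - θ)) := by positivity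
        linarith
      refine cs.trans ?_
      calc ρ * (θ * a ^ 2 + (1 - θ) * b ^ 2)
          ≤ ρ * (θ * (ρ ^ ℓ * c) + (1 - θ) * (ρ ^ ℓ * d)) := by gcongr
        _ = _ := by ring
    · simp

/-- The deviation of the number of failures after time `τ` from `x` per step stays within `X` for
`ℓ` steps. -/
def Near (x X : ℝ) (τ ℓ : ℕ) : Set (ℕ → Bool) :=
  {w | ∀ k ≤ ℓ, |(fails w τ (τ + k) : ℝ) - x * k| ≤ X}

theorem depOn_near (x X : ℝ) (τ ℓ : ℕ) : DepOn (Near x X τ ℓ) τ (τ + ℓ) :=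
  depOn_forall fun k => depOn_imp fun hk =>
    (depOn_fails fun m => |(m : ℝ) - x * k| ≤ X).mono le_rfl (by omega)

theorem rowP_near (x X : ℝ) (τ ℓ : ℕ) : rowP p (Near x X τ ℓ) = stay (1 - p) x X ℓ 0 := by
  have key : ∀ (ℓ τ : ℕ) (y : ℝ),
      rowP p {w | ∀ k ≤ ℓ, |y + fails w τ (τ + k) - x * k| ≤ X} = stay (1 - p) x X ℓ y := by
    intro ℓ
    induction ℓ with
    | zero =>
      intro τ y
      unfold stay
      split_ifs with h
      · convert rowP_univ p
        rw [Set.eq_univ_iff_forall]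
        intro w k hk
        rw [Nat.le_zero.1 hk, add_zero, fails_self]
        simpa using h
      · refine rowP_eq_zero p fun w hw => ?_
        have := hw 0 le_rfl
        rw [add_zero, fails_self] at this
        exact h (by simpa using this)
    | succ ℓ ih =>
      intro τ y
      unfold stay
      split_ifs with h
      · have dep : ∀ y : ℝ, DepOn {w | ∀ k ≤ ℓ, |y + fails w (τ + 1) (τ + 1 + k) - x * k| ≤ X}
            (τ + 1) (τ + 1 + ℓ) := fun y =>
          depOn_forall fun k => depOn_imp fun hk =>
            (depOn_fails fun m => |y + (m : ℝ) - x * k| ≤ X).mono le_rfl (by omega)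
        have aux : ∀ (w : ℕ → Bool) (c : ℝ),
            (∀ k, fails w τ (τ + (k + 1)) = c + fails w (τ + 1) (τ + 1 + k)) →
            (w ∈ {w | ∀ k ≤ ℓ + 1, |y + fails w τ (τ + k) - x * k| ≤ X} ↔
              w ∈ {w | ∀ k ≤ ℓ, |(y + c - x) + fails w (τ + 1) (τ + 1 + k) - x * k| ≤ X}) := by
          intro w c hc
          constructor
          · intro h1 k hk
            have := h1 (k + 1) (by omega)
            rw [hc k] at this
            convert this using 2
            push_cast
            ring
          · intro h1 k hk
            cases k with
            | zero =>
              rw [add_zero, fails_self]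
              simpa using h
            | succ k =>
              have := h1 k (by omega)
              rw [hc k]
              convert this using 2
              push_cast
              ring
        rw [rowP_split p (τ := τ) (t := τ + 1 + ℓ) (dep (y + 1 - x)) (dep (y + 0 - x)), ih, ih]
        · rw [add_zero]
          ring
        · intro w hw
          refine aux w 1 fun k => ?_
          rw [fails_succ_left (by omega), if_pos hw, show τ + (k + 1) = τ + 1 + k by ring]
          push_cast
          ring
        · intro w hw
          refine aux w 0 fun k => ?_
          rw [fails_succ_left (by omega), if_neg (by simp [hw]),
            show τ + (k + 1) = τ + 1 + k by ring]
          push_cast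
          ring
      · refine rowP_eq_zero p fun w hw => ?_
        have := hw 0 (Nat.zero_le _)
        rw [add_zero, fails_self] at this
        exact h (by simpa using this)
  rw [← key ℓ τ 0]
  simp only [zero_add]
  rfl

/-- A lower bound for the probability that the failures follow a drift `x` differing from the
typical one, `1 - p`. -/
theorem le_rowP_near {x X : ℝ} (hp0 : 0 < p) (hp1 : p < 1) (h0 : 0 ≤ x) (h1 : x ≤ 1) (hX : 0 < X)
    (τ ℓ : ℕ) (hv : 2 * (ℓ * (x * (1 - x))) ≤ X ^ 2) :
    1 / 4 * Real.exp (-(ℓ * ((x - (1 - p)) ^ 2 / ((1 - p) * p)))) ≤ rowP p (Near x X τ ℓ) := by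
  have hp0' : (0 : ℝ) < p := hp0
  have hp1' : (p : ℝ) < 1 := hp1
  have e1 := one_sub_stay_le h0 h1 hX ℓ 0
  have e2 : ((0 : ℝ) ^ 2 + ℓ * (x * (1 - x))) / X ^ 2 ≤ 1 / 2 := by
    rw [div_le_iff₀ (by positivity)]
    linarith
  have e3 : 1 / 2 ≤ stay x x X ℓ 0 := by linarith
  have e4 := stay_sq_le (θ := 1 - (p : ℝ)) (θ' := x) (x := x) (X := X) (by linarith) (by linarith) ℓ 0
  rw [← rowP_near p x X τ ℓ, sub_sub_cancel] at e4
  set z : ℝ := (x - (1 - p)) ^ 2 / ((1 - p) * p) with hz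
  have e5 : (1 + z) ^ ℓ ≤ Real.exp (ℓ * z) := by
    rw [Real.exp_nat_mul]
    have : 0 ≤ z := by
      have : 0 < 1 - (p : ℝ) := by linarith
      positivity
    gcongr
    linarith [Real.add_one_le_exp z]
  have e6 : 1 / 4 ≤ Real.exp (ℓ * z) * rowP p (Near x X τ ℓ) := by
    have := mul_le_mul_of_nonneg_right e5 (rowP_nonneg p (Near x X τ ℓ))
    nlinarith
  rw [Real.exp_neg, ← div_eq_mul_inv, div_le_iff₀ (Real.exp_pos _)]
  linarith

end TamariLevels

namespace TamariLevels

open Finset MeasureTheory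

/-! ### Drifts and tubes -/

/-- The end points of the windows into which the time axis is divided: the window `s ≥ σ₀` is
`[win U σ₀ s, win U σ₀ (s + 1))`. -/
def win (U σ₀ s : ℕ) : ℕ := U * (4 ^ s - 4 ^ σ₀)

/-- The slope of the drift at time `i`, which is `1 / (3 * U * 2 ^ s)` in the window `s`. -/
noncomputable def slope (U σ₀ i : ℕ) : ℝ := 1 / (3 * U * 2 ^ Nat.log 4 (i / U + 4 ^ σ₀))

/-- The drift, a concave function that grows like the square root of `v / U`. -/
noncomputable def drift (U σ₀ v : ℕ) : ℝ := ∑ i ∈ range v, slope U σ₀ i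

section Drift

variable {U σ₀ : ℕ}

theorem win_mono : Monotone (win U σ₀) := fun s t h => by
  unfold win
  gcongr
  norm_num

theorem win_self : win U σ₀ σ₀ = 0 := by simp [win]

theorem win_succ {s : ℕ} (hs : σ₀ ≤ s) : win U σ₀ (s + 1) = win U σ₀ s + 3 * 4 ^ s * U := by
  unfold win
  have h1 : 4 ^ σ₀ ≤ 4 ^ s := Nat.pow_le_pow_right (by norm_num) hs
  obtain ⟨d, hd⟩ := Nat.exists_eq_add_of_le h1
  rw [pow_succ, hd, Nat.add_sub_cancel_left,
    show (4 ^ σ₀ + d) * 4 - 4 ^ σ₀ = d + 3 * (4 ^ σ₀ + d) by omega]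
  ring

theorem win_add_le {s t δ : ℕ} (hs : σ₀ ≤ s) (hst : s < t) (hδ : δ ≤ 3 * 4 ^ s * U) :
    win U σ₀ s + δ ≤ win U σ₀ t := by
  have h1 := win_succ (U := U) hs
  have h2 := win_mono (U := U) (σ₀ := σ₀) (show s + 1 ≤ t from hst)
  omega

theorem win_le_iff (hU : 0 < U) {s v : ℕ} (hs : σ₀ ≤ s) :
    win U σ₀ s ≤ v ↔ s ≤ Nat.log 4 (v / U + 4 ^ σ₀) := by
  have h1 : 4 ^ σ₀ ≤ 4 ^ s := Nat.pow_le_pow_right (by norm_num) hs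
  have h2 : 0 < 4 ^ σ₀ := by positivity
  rw [win, mul_comm, ← Nat.le_div_iff_mul_le hU]
  generalize v / U = x
  rw [Nat.le_log_iff_pow_le (by norm_num) (by omega)]
  omega

theorem slope_nonneg (i : ℕ) : 0 ≤ slope U σ₀ i := by
  unfold slope
  positivity

theorem slope_le (hU : 0 < U) (i : ℕ) : slope U σ₀ i ≤ 1 / (3 * U * 2 ^ σ₀) := by
  unfold slope
  have h1 : σ₀ ≤ Nat.log 4 (i / U + 4 ^ σ₀) := by
    rw [← win_le_iff hU le_rfl, win_self]
    exact Nat.zero_le _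
  have : (0 : ℝ) < U := by exact_mod_cast hU
  gcongr
  norm_num

theorem slope_eq (hU : 0 < U) {s i : ℕ} (hs : σ₀ ≤ s) (h1 : win U σ₀ s ≤ i)
    (h2 : i < win U σ₀ (s + 1)) : slope U σ₀ i = 1 / (3 * U * 2 ^ s) := by
  unfold slope
  have h3 := (win_le_iff hU hs).1 h1
  have h4 : ¬ s + 1 ≤ Nat.log 4 (i / U + 4 ^ σ₀) := by
    rw [← win_le_iff hU (by omega)]
    omega
  rw [show Nat.log 4 (i / U + 4 ^ σ₀) = s by omega]

theorem drift_mono : Monotone (drift U σ₀) := fun _ _ h =>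
  sum_le_sum_of_subset_of_nonneg (range_mono h) fun _ _ _ => slope_nonneg _

theorem drift_nonneg (v : ℕ) : 0 ≤ drift U σ₀ v := sum_nonneg fun _ _ => slope_nonneg _

theorem drift_add_le (hU : 0 < U) (v δ : ℕ) :
    drift U σ₀ (v + δ) ≤ drift U σ₀ v + δ / (3 * U * 2 ^ σ₀) := by
  unfold drift
  rw [sum_range_add]
  gcongr
  calc _ ≤ ∑ _i ∈ range δ, 1 / (3 * (U : ℝ) * 2 ^ σ₀) := sum_le_sum fun i _ => slope_le hU _
    _ = _ := by rw [sum_const, card_range, nsmul_eq_mul]; ring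

theorem drift_add_eq (hU : 0 < U) {s δ : ℕ} (hs : σ₀ ≤ s) (hδ : δ ≤ 3 * 4 ^ s * U) :
    drift U σ₀ (win U σ₀ s + δ) = drift U σ₀ (win U σ₀ s) + δ / (3 * U * 2 ^ s) := by
  unfold drift
  rw [sum_range_add]
  congr 1
  have h1 := win_succ (U := U) hs
  rw [sum_congr rfl fun i hi => slope_eq hU hs (Nat.le_add_right _ i)
    (by have := mem_range.1 hi; omega), sum_const, card_range, nsmul_eq_mul]
  ring

theorem drift_win (hU : 0 < U) {s : ℕ} (hs : σ₀ ≤ s) :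
    drift U σ₀ (win U σ₀ s) = 2 ^ s - 2 ^ σ₀ := by
  have hU' : (0 : ℝ) < U := by exact_mod_cast hU
  induction s, hs using Nat.le_induction with
  | base => rw [win_self, sub_self]; simp [drift]
  | succ s hs ih =>
    rw [win_succ hs, drift_add_eq hU hs le_rfl, ih]
    push_cast
    rw [show (4 : ℝ) ^ s = 2 ^ s * 2 ^ s by rw [← mul_pow]; norm_num, pow_succ]
    field_simp
    ring

/-- Every time lies in some window. -/
theorem exists_win (hU : 0 < U) (v : ℕ) :
    ∃ s δ, σ₀ ≤ s ∧ δ < 3 * 4 ^ s * U ∧ v = win U σ₀ s + δ := by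
  set s := Nat.log 4 (v / U + 4 ^ σ₀) with hs
  have h0 : σ₀ ≤ s := by
    rw [hs, ← win_le_iff hU le_rfl, win_self]
    exact Nat.zero_le _
  have h1 : win U σ₀ s ≤ v := (win_le_iff hU h0).2 le_rfl
  have h2 : ¬ win U σ₀ (s + 1) ≤ v := by
    rw [win_le_iff hU (by omega)]
    omega
  have h3 := win_succ (U := U) h0
  exact ⟨s, v - win U σ₀ s, h0, by omega, by omega⟩

theorem two_pow_le_drift (hU : 0 < U) {s v : ℕ} (hs : σ₀ ≤ s) (hv : win U σ₀ s ≤ v) :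
    (2 : ℝ) ^ s ≤ drift U σ₀ v + 2 ^ σ₀ := by
  have := drift_mono (U := U) (σ₀ := σ₀) hv
  rw [drift_win hU hs] at this
  linarith

theorem le_drift_sq (hU : 0 < U) (v : ℕ) : (v : ℝ) ≤ 4 * U * (drift U σ₀ v + 2 ^ σ₀) ^ 2 := by
  obtain ⟨s, δ, hs, hδ, rfl⟩ := exists_win (σ₀ := σ₀) hU v
  have h1 := two_pow_le_drift hU hs (Nat.le_add_right (win U σ₀ s) δ)
  have h2 : win U σ₀ s + δ ≤ 4 * U * 4 ^ s := by
    have : win U σ₀ s ≤ U * 4 ^ s := Nat.mul_le_mul_left U (Nat.sub_le _ _)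
    nlinarith
  have h3 : ((win U σ₀ s + δ : ℕ) : ℝ) ≤ 4 * U * (2 ^ s) ^ 2 := by
    rw [← pow_mul, mul_comm s 2, pow_mul]
    norm_num
    exact_mod_cast h2
  refine h3.trans ?_
  gcongr

end Drift

/-- From the time `o` on, the failures of `w` exceed the typical number by `c` times the drift, up
to an error that is small compared with the drift; this holds until the window `σ`, in which there
is no further drift. -/
structure TubeRow (w : ℕ → Bool) (q c : ℝ) (U σ₀ o σ : ℕ) : Prop where
  tube : ∀ v ≤ win U σ₀ σ, |(fails w o (o + v) : ℝ) - q * v - c * drift U σ₀ v| ≤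
    12 * (drift U σ₀ v + 2 ^ σ₀)
  last : ∀ v, win U σ₀ σ ≤ v → v ≤ win U σ₀ (σ + 1) →
    |(fails w o (o + v) : ℝ) - q * v - c * (2 ^ σ - 2 ^ σ₀)| ≤ 12 * 2 ^ σ

theorem TubeRow.of_near {w : ℕ → Bool} {q c : ℝ} {U σ₀ o σ : ℕ} (hU : 0 < U) (hσ : σ₀ ≤ σ)
    (h : ∀ s, σ₀ ≤ s → s < σ → w ∈ Near (q + c / (3 * U * 2 ^ s)) (6 * 2 ^ s) (o + win U σ₀ s)
      (3 * 4 ^ s * U))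
    (hlast : w ∈ Near q (6 * 2 ^ σ) (o + win U σ₀ σ) (3 * 4 ^ σ * U)) :
    TubeRow w q c U σ₀ o σ := by
  have hU' : (0 : ℝ) < U := by exact_mod_cast hU
  have base : ∀ s, σ₀ ≤ s → s ≤ σ → |(fails w o (o + win U σ₀ s) : ℝ) - q * win U σ₀ s -
      c * (2 ^ s - 2 ^ σ₀)| ≤ 6 * (2 ^ s - 2 ^ σ₀) := by
    intro s hs
    induction s, hs using Nat.le_induction with
    | base => intro _; simp [win_self, fails_self]
    | succ s hs ih =>
      intro hsσ
      have h1 := abs_le.1 (ih (by omega))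
      have h2 := abs_le.1 (h s hs (by omega) _ le_rfl)
      rw [win_succ hs, ← add_assoc, fails_split w (Nat.le_add_right o (win U σ₀ s))
        (Nat.le_add_right _ _)]
      have h3 : (c / (3 * U * 2 ^ s)) * (3 * 4 ^ s * U) = c * 2 ^ s := by
        rw [show (4 : ℝ) ^ s = 2 ^ s * 2 ^ s by rw [← mul_pow]; norm_num]
        field_simp
      push_cast at h1 h2 ⊢
      rw [abs_le, pow_succ]
      constructor <;> linarith
  constructor
  · intro v hv
    obtain ⟨s, δ, hs, hδ, rfl⟩ := exists_win (σ₀ := σ₀) hU v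
    have hpow := two_pow_le_drift hU hs (Nat.le_add_right (win U σ₀ s) δ)
    rcases lt_or_ge s σ with h1 | h1
    · have h2 := abs_le.1 (base s hs h1.le)
      have h3 := abs_le.1 (h s hs h1 δ hδ.le)
      rw [← add_assoc, fails_split w (Nat.le_add_right o (win U σ₀ s)) (Nat.le_add_right _ _)]
      have h5 : (0 : ℝ) < 2 ^ σ₀ := by positivity
      have h6 : c * (2 ^ s - 2 ^ σ₀ + δ / (3 * U * 2 ^ s)) =
        c * (2 ^ s - 2 ^ σ₀) + c / (3 * U * 2 ^ s) * δ := by ring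
      have h7 : |(fails w o (o + win U σ₀ s) : ℝ) + fails w (o + win U σ₀ s)
          (o + win U σ₀ s + δ) - q * (win U σ₀ s + δ) -
          c * (2 ^ s - 2 ^ σ₀ + δ / (3 * U * 2 ^ s))| ≤ 12 * 2 ^ s := by
        rw [h6, abs_le]
        constructor <;> linarith
      have h8 := drift_add_eq hU hs hδ.le
      rw [drift_win hU hs] at h8
      push_cast
      rw [h8] at hpow ⊢
      linarith
    · have h2 := win_mono (U := U) (σ₀ := σ₀) h1
      have h3 : win U σ₀ s + δ = win U σ₀ σ := by omega
      rw [h3] at hpow ⊢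
      have h4 := base σ hσ le_rfl
      rw [drift_win hU hσ] at hpow ⊢
      have h5 : (0 : ℝ) < 2 ^ σ := by positivity
      have h6 : (0 : ℝ) < 2 ^ σ₀ := by positivity
      linarith
  · intro v h1 h2
    obtain ⟨δ, rfl⟩ := Nat.exists_eq_add_of_le h1
    rw [win_succ hσ] at h2
    have h3 := abs_le.1 (base σ hσ le_rfl)
    have h4 := abs_le.1 (hlast δ (by omega))
    rw [← add_assoc, fails_split w (Nat.le_add_right o (win U σ₀ σ)) (Nat.le_add_right _ _)]
    have h5 : (0 : ℝ) < 2 ^ σ₀ := by positivity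
    push_cast
    rw [abs_le]
    constructor <;> linarith

theorem TubeRow.upper {w : ℕ → Bool} {q c : ℝ} {U σ₀ o σ : ℕ} (H : TubeRow w q c U σ₀ o σ)
    (hU : 0 < U) (hσ : σ₀ ≤ σ) (hc : 0 ≤ c) {v : ℕ} (hv : v ≤ win U σ₀ (σ + 1)) :
    (fails w o (o + v) : ℝ) ≤ q * v + c * drift U σ₀ v + 12 * (drift U σ₀ v + 2 ^ σ₀) := by
  rcases le_total v (win U σ₀ σ) with h1 | h1
  · linarith [(abs_le.1 (H.tube v h1)).2]
  · have h2 := (abs_le.1 (H.last v h1 hv)).2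
    have h3 := two_pow_le_drift hU hσ h1
    have h4 : c * (2 ^ σ - 2 ^ σ₀) ≤ c * drift U σ₀ v :=
      mul_le_mul_of_nonneg_left (by linarith) hc
    linarith

theorem TubeRow.lower {w : ℕ → Bool} {q c : ℝ} {U σ₀ o σ : ℕ} (H : TubeRow w q c U σ₀ o σ)
    {v : ℕ} (hv : v ≤ win U σ₀ σ) :
    q * v + c * drift U σ₀ v - 12 * (drift U σ₀ v + 2 ^ σ₀) ≤ fails w o (o + v) := by
  linarith [(abs_le.1 (H.tube v hv)).1]

end TamariLevels

namespace TamariLevels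

open Finset MeasureTheory

/-! ### Configurations with a surviving anchor -/

/-- The parameters of a configuration of anchors `a 0 < ⋯ < a r`. -/
structure Scales where
  /-- The number of anchors, minus one. -/
  r : ℕ
  /-- The unit of time, about `1 / q`. -/
  U : ℕ
  /-- The first window. -/
  σ₀ : ℕ
  /-- The window in which the anchors begin to be dropped. -/
  s₁ : ℕ
  /-- The window in which the drift of the last anchor stops. -/
  sr : ℕ
  /-- Positions beyond `Y₀` have no influence as long as they are blocked. -/
  Y₀ : ℕ
  /-- The time of the first success of `a j`. -/
  h : ℕ → ℕ
  /-- The scale of `a j`, which lies in `(n j / 2, n j]`. -/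
  n : ℕ → ℕ
  /-- The number of failures of `a j` between its first success and the time `o j`. -/
  k : ℕ → ℕ
  /-- The number of failures that other positions may have in the meantime. -/
  m : ℕ → ℕ
  /-- The onset of the drift of `a j`. -/
  o : ℕ → ℕ
  /-- The duration of the control of the failures with precision `ε i`. -/
  V : ℕ → ℕ
  /-- The probability of a failure. -/
  q : ℝ
  /-- The strength of the drift that other positions stay below. -/
  Λ : ℝ
  /-- The precision of the control of the failures up to the duration `V i`. -/
  ε : ℕ → ℝ

namespace Scales

variable (S : Scales)

/-- The strength of the drift of the anchor `a j`. Higher anchors drift more strongly, and thus stay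
behind the lower ones. -/
noncomputable def c (j : ℕ) : ℝ := 2 * S.Λ + 24 * j

/-- The window in which the drift of the anchor `a j` stops. This happens in the order
`a (r - 1), …, a 1, a r, a 0`, and in this window `a j` overtakes the anchor preceding it (or `a 0`,
if `j = r`), which still drifts. -/
def sig (j : ℕ) : ℕ :=
  if j = 0 then S.sr + 2 else if j = S.r then S.sr else S.s₁ + 1 + 2 * (S.r - 1 - j)

/-- The windows of the parameters `S`. -/
def W (s : ℕ) : ℕ := win S.U S.σ₀ s

/-- The drift of the parameters `S`. -/
noncomputable def φ (v : ℕ) : ℝ := drift S.U S.σ₀ v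

/-- The time by which the ordinary positions have overtaken the anchors below them. -/
def t1 : ℕ := S.o S.r + S.W S.s₁

/-- The time by which all anchors but the first and the last have overtaken the preceding one. -/
def T1 : ℕ := S.o S.r + S.W (S.s₁ + 2 * S.r)

/-- The time by which the last anchor has overtaken the first one. -/
def Tf : ℕ := S.o S.r + S.W (S.sr + 1)

/-- The time until which the anchor `a j` meets nobody. -/
def e (j : ℕ) : ℕ := if j = 0 then S.Tf else S.o j + S.W (S.sig j)

/-- The time by which the anchor `a j`, for `1 ≤ j < r`, has overtaken `a (j - 1)`. -/
def d (j : ℕ) : ℕ := if j = 0 then S.Tf else S.o j + S.W (S.sig j + 1)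

/-- The time until which the last anchor survives. -/
def Tend : ℕ := S.n S.r / 4

/-- The inequalities between the parameters that make the last anchor survive. -/
structure Valid : Prop where
  r_pos : 0 < S.r
  U_pos : 0 < S.U
  q_nonneg : 0 ≤ S.q
  q_lt : S.q < 1
  qU : S.q * S.U ≤ 2
  σ₀_lt : S.σ₀ < S.s₁
  s₁_lt : S.s₁ + 2 * S.r < S.sr
  h_lt : ∀ i j, i < j → j ≤ S.r → S.h i < S.h j
  o_le : ∀ i j, i ≤ j → j ≤ S.r → S.o i ≤ S.o j
  h_lt_o : ∀ j ≤ S.r, S.h j < S.o j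
  /-- The lead of `a i` over `a j` at the onset is at least the difference of the onsets. -/
  lead : ∀ i j, i ≤ j → j ≤ S.r → S.o j + S.h i + S.k i ≤ S.o i + S.h j + S.k j
  gap : ∀ i j, i < j → j ≤ S.r →
    48 * 2 ^ S.σ₀ < (1 - S.q) * ((S.h j + S.k j : ℝ) - (S.h i + S.k i))
  c_small : 2 * (S.c S.r + 12) ≤ 3 * 2 ^ S.σ₀ * (1 - S.q)
  Λ_big : 24 * S.r + 40 ≤ S.Λ
  /-- At the onset, `a j` is behind ordinary positions by more than the errors of the tubes. -/
  sleep : ∀ j ≤ S.r, S.m j + 1 + S.Λ * (1 + 2 ^ S.σ₀) + 12 * 2 ^ S.σ₀ < S.k j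
  s₁_big : S.h S.r + S.k S.r < 2 ^ S.s₁
  n_mul_le : ∀ i j, i < j → j ≤ S.r → 100 * S.n i ≤ S.n j
  Tf_le : 4 * S.Tf + 8 ≤ S.n 0
  ε_le : ∀ i, 1 ≤ i → i < S.r → S.ε i ≤ S.n i / 32
  ε_zero_le : S.ε 0 ≤ (1 - S.q) * ((S.W S.sr : ℝ) - S.W (S.s₁ + 2 * S.r)) / 4
  V_ge : ∀ i < S.r, 2 * (S.n (i + 1) : ℝ) ≤ (1 - S.q) * S.V i
  last : 24 * 2 ^ S.sr < (1 - S.q) * ((S.W S.sr : ℝ) - S.W (S.s₁ + 2 * S.r)) / 2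

/-- The failures after time `τ` stay close to their typical number. -/
def PostRow (τ : ℕ) (w : ℕ → Bool) : Prop :=
  ∀ i < S.r, ∀ t ≤ S.V i, |(fails w τ (τ + t) : ℝ) - S.q * t| ≤ S.ε i

/-- The coins of the anchor `a j`. -/
structure AnchorRow (j : ℕ) (w : ℕ → Bool) : Prop where
  fail : ∀ i < S.h j, w i = false
  succ : w (S.h j) = true
  sleep : fails w (S.h j + 1) (S.o j) = S.k j
  tube : TubeRow w S.q (S.c j) S.U S.σ₀ (S.o j) (S.sig j)
  post : j ≠ 0 → S.PostRow (if j = S.r then S.Tf else S.T1) w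

/-- The coins of a position that is required not to delay the anchor `a j`. -/
def RelRow (j : ℕ) (w : ℕ → Bool) : Prop :=
  fails w (S.h j) (S.o j) ≤ S.m j ∧ ∀ k ≤ 4 ^ (S.sr + 2),
    (fails w (S.o j) (S.o j + k * S.U) : ℝ) ≤ S.q * (k * S.U) +
      S.Λ * (S.φ (k * S.U) + 2 ^ S.σ₀)

/-- A configuration with anchors `a 0 < ⋯ < a r`. Before the onset, either the anchors always fail,
or ordinary positions never do and the anchors fail in such an order that higher ones stay behind
(`early`). Only those positions are controlled closely that are small or not blocked (`rel`), since
a blocked position `y` has a lead of `y / 2`, which it keeps under the crude bound `far`. -/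
structure Config (a : ℕ → ℕ) (w : ℕ → ℕ → Bool) : Prop where
  lt_a : ∀ j ≤ S.r, S.n j < 2 * a j
  a_le : ∀ j ≤ S.r, a j ≤ S.n j
  row : ∀ j ≤ S.r, S.AnchorRow j (w (a j))
  early : (∀ j ≤ S.r, ∀ s, S.h j < s → s < S.o j → w (a j) s = false) ∨
    (∀ j ≤ S.r, S.m j = 0) ∧ ∀ i j, i < j → j ≤ S.r → ∀ s, S.h j < s → s < S.o j →
      fails (w (a i)) (S.h i + 1) s ≤ fails (w (a j)) (S.h j + 1) s
  moved : ∀ y, 0 < y → (∀ i ≤ S.r, y ≠ a i) → ∀ j ≤ S.r, y ≤ S.n j → ∃ g < S.h j, w y g = true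
  rel : ∀ y, 0 < y → (∀ i ≤ S.r, y ≠ a i) → ∀ j ≤ S.r, y ≤ S.n j →
    (y ≤ S.Y₀ ∨ ¬ Blocked w y) → S.RelRow j (w y)
  far : ∀ y, S.Y₀ < y → (∀ i ≤ S.r, y ≠ a i) → y ≤ S.n S.r → fails (w y) 0 S.Tf ≤ y / 2
  post : ∀ y, 0 < y → (∀ i ≤ S.r, y ≠ a i) → y ≤ S.n S.r → S.PostRow S.T1 (w y)

theorem W_mono : Monotone S.W := win_mono

theorem φ_nonneg (v : ℕ) : 0 ≤ S.φ v := drift_nonneg v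

theorem sig_lt {i j : ℕ} (hi : 1 ≤ i) (hij : i < j) (hj : j < S.r) : S.sig j + 1 < S.sig i := by
  unfold sig
  rw [if_neg (by omega), if_neg (by omega), if_neg (by omega), if_neg (by omega)]
  omega

variable {S}

namespace Valid

variable (N : S.Valid)
include N

theorem o_le_add {i j : ℕ} (hi : i ≤ S.r) (hj : j ≤ S.r) {s t : ℕ} (hs : S.s₁ ≤ s) (hst : s < t) :
    S.o j + S.W s ≤ S.o i + S.W t := by
  have h1 := N.lead i S.r hi le_rfl
  have h2 := N.o_le j S.r hj le_rfl
  have h3 := N.s₁_big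
  have h4 : 2 ^ S.s₁ ≤ 3 * 4 ^ s * S.U := by
    have h5 : 2 ^ S.s₁ ≤ 4 ^ S.s₁ := Nat.pow_le_pow_left (by norm_num) _
    have h6 : 4 ^ S.s₁ ≤ 4 ^ s := Nat.pow_le_pow_right (by norm_num) hs
    have := N.U_pos
    nlinarith
  have h7 := win_add_le (U := S.U) (σ₀ := S.σ₀) (δ := S.o S.r - S.o i)
    (N.σ₀_lt.le.trans hs) hst (by omega)
  unfold W
  omega

theorem sig_ge {j : ℕ} (hj : j ≤ S.r) : S.s₁ < S.sig j := by
  have := N.s₁_lt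
  unfold sig
  split_ifs <;> omega

theorem σ₀_le_sig {j : ℕ} (hj : j ≤ S.r) : S.σ₀ ≤ S.sig j :=
  N.σ₀_lt.le.trans (N.sig_ge hj).le

theorem e_le {j : ℕ} (hj : j ≤ S.r) : S.e j ≤ S.Tf := by
  have := N.s₁_lt
  unfold e Tf
  split_ifs with h
  · rfl
  · have h1 := N.o_le j S.r hj le_rfl
    have h2 : S.W (S.sig j) ≤ S.W (S.sr + 1) := by
      refine S.W_mono ?_
      unfold sig
      split_ifs <;> omega
    omega

/-- The failures of anchors and other positions are compared at times up to `win (sr + 2)`. -/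
theorem le_W_of_le_Tf {j s : ℕ} (hj : j ≤ S.r) (hs : s ≤ S.Tf) : s ≤ S.o j + S.W (S.sr + 2) := by
  have h1 := N.s₁_lt
  have h2 := N.o_le_add hj le_rfl (s := S.sr + 1) (t := S.sr + 2) (by omega) (by omega)
  unfold Tf at hs
  omega

end Valid

theorem fails_of_first {w : ℕ → Bool} {h s : ℕ} (h1 : ∀ i < h, w i = false) (h2 : w h = true)
    (hs : h < s) : fails w 0 s = h + fails w (h + 1) s := by
  rw [fails_split w (Nat.zero_le h) hs.le, fails_succ_left hs, if_neg (by simp [h2]), zero_add]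
  congr 1
  unfold fails
  rw [filter_true_of_mem fun i hi => h1 i (mem_Ico.1 hi).2]
  simp

theorem AnchorRow.succs_eq {j : ℕ} {w : ℕ → Bool} (H : S.AnchorRow j w)
    (ho : S.h j < S.o j) {s : ℕ} (hs : S.o j ≤ s) :
    succs w 0 s + S.h j + S.k j + fails w (S.o j) s = s := by
  have h1 := succs_add_fails w 0 s
  have h2 := fails_of_first H.fail H.succ (ho.trans_le hs)
  have h3 := fails_split w (show S.h j + 1 ≤ S.o j from ho) hs
  have h4 := H.sleep
  omega

theorem AnchorRow.succs_le {j : ℕ} {w : ℕ → Bool} (H : S.AnchorRow j w) {s : ℕ}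
    (hs : S.h j < s) : succs w 0 s + S.h j + fails w (S.h j + 1) s = s := by
  have h1 := succs_add_fails w 0 s
  have h2 := fails_of_first H.fail H.succ hs
  omega

theorem le_succs_of_moved {w : ℕ → Bool} {h g s : ℕ} (hg : g < h) (hw : w g = true) (hs : h ≤ s) :
    s + 1 ≤ succs w 0 s + h + fails w h s := by
  have h1 := succs_add_fails w h s
  have h2 := succs_split w (Nat.zero_le h) hs
  have h3 : 1 ≤ succs w 0 h := by
    unfold succs
    rw [Nat.one_le_iff_ne_zero, card_ne_zero]
    exact ⟨g, mem_filter.2 ⟨mem_Ico.2 ⟨Nat.zero_le _, hg⟩, hw⟩⟩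
  omega

namespace Valid

variable (N : S.Valid)
include N

theorem c_nonneg (j : ℕ) : 0 ≤ S.c j := by
  have := N.Λ_big
  unfold c
  linarith [show (0 : ℝ) ≤ 24 * S.r by positivity, show (0 : ℝ) ≤ 24 * j by positivity]

theorem φ_add_le {v δ : ℕ} : S.φ (v + δ) ≤ S.φ v + δ / (3 * S.U * 2 ^ S.σ₀) :=
  drift_add_le N.U_pos v δ

theorem rel_le {j : ℕ} {w : ℕ → Bool} (H : S.RelRow j w) {v : ℕ} (hv : v ≤ S.W (S.sr + 2)) :
    (fails w (S.o j) (S.o j + v) : ℝ) ≤ S.q * v + 2 + S.Λ * (S.φ v + 1 + 2 ^ S.σ₀) := by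
  have hU := N.U_pos
  have hU' : (1 : ℝ) ≤ S.U := by exact_mod_cast hU
  set k := v / S.U + 1 with hk
  have h1 : v ≤ k * S.U := by
    rw [hk, add_mul, one_mul]
    have := Nat.div_add_mod v S.U
    have := Nat.mod_lt v hU
    linarith [mul_comm S.U (v / S.U)]
  have h2 : k * S.U ≤ v + S.U := by
    rw [hk, add_mul, one_mul]
    have := Nat.div_mul_le_self v S.U
    omega
  have h3 : k ≤ 4 ^ (S.sr + 2) := by
    have h4 : v / S.U ≤ 4 ^ (S.sr + 2) - 4 ^ S.σ₀ := by
      unfold W win at hv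
      exact Nat.div_le_of_le_mul hv
    have h5 : 4 ^ S.σ₀ ≤ 4 ^ (S.sr + 2) := by
      have := N.σ₀_lt
      have := N.s₁_lt
      exact Nat.pow_le_pow_right (by norm_num) (by omega)
    have h6 : 0 < 4 ^ S.σ₀ := by positivity
    omega
  have h4 := H.2 k h3
  have h5 : (fails w (S.o j) (S.o j + v) : ℝ) ≤ fails w (S.o j) (S.o j + k * S.U) := by
    exact_mod_cast fails_mono w _ (by omega)
  have h6 : S.φ (k * S.U) ≤ S.φ v + 1 := by
    refine (drift_mono h2).trans ((drift_add_le hU v S.U).trans ?_)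
    have : (S.U : ℝ) / (3 * S.U * 2 ^ S.σ₀) ≤ 1 := by
      rw [div_le_one (by positivity)]
      have : (1 : ℝ) ≤ 2 ^ S.σ₀ := one_le_pow₀ (by norm_num)
      nlinarith
    unfold φ
    linarith
  have h7 : ((k * S.U : ℕ) : ℝ) ≤ v + S.U := by exact_mod_cast h2
  push_cast at h7
  have h8 := mul_le_mul_of_nonneg_left h7 N.q_nonneg
  have h9 : S.Λ * (S.φ (k * S.U) + 2 ^ S.σ₀) ≤ S.Λ * (S.φ v + 1 + 2 ^ S.σ₀) := by
    have := N.Λ_big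
    have : 0 ≤ S.Λ := by linarith [show (0 : ℝ) ≤ 24 * S.r by positivity]
    gcongr
  have := N.qU
  linarith

/-- Positions that are not delayed stay ahead of the anchor `a j`. -/
theorem gen_lt {j : ℕ} (hj : j ≤ S.r) {w w' : ℕ → Bool} (H : S.AnchorRow j w)
    (H' : S.RelRow j w') {g : ℕ} (hg : g < S.h j) (hw : w' g = true) {s : ℕ} (hs : S.o j ≤ s)
    (hse : s ≤ S.o j + S.W (S.sig j)) (hsT : s ≤ S.Tf) : succs w 0 s < succs w' 0 s := by
  have ho := N.h_lt_o j hj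
  have h1 := H.succs_eq ho hs
  have h2 := le_succs_of_moved hg hw (ho.le.trans hs)
  obtain ⟨v, rfl⟩ := Nat.exists_eq_add_of_le hs
  have h3 := N.rel_le H' (v := v) (by have := N.le_W_of_le_Tf hj hsT; omega)
  have h4 := H.tube.lower (v := v) (by unfold W at hse; omega)
  have h5 := fails_split w' ho.le hs
  have h6 := H'.1
  have h7 := N.sleep j hj
  have h8 := S.φ_nonneg v
  have h9 : 0 ≤ (S.c j - 12 - S.Λ) * S.φ v := by
    refine mul_nonneg ?_ h8
    have := N.Λ_big
    unfold c
    linarith [show (0 : ℝ) ≤ 24 * S.r by positivity, show (0 : ℝ) ≤ 24 * j by positivity]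
  have h10 : (S.m j : ℝ) + 1 + fails w' (S.o j) (S.o j + v) <
      S.k j + fails w (S.o j) (S.o j + v) + 2 := by
    unfold φ at *
    linarith
  have h11 : S.m j + 1 + fails w' (S.o j) (S.o j + v) <
      S.k j + fails w (S.o j) (S.o j + v) + 2 := by exact_mod_cast h10
  omega

/-- The anchors stay in order. -/
theorem ord_lt {i j : ℕ} (hij : i < j) (hj : j ≤ S.r) {w w' : ℕ → Bool} (H : S.AnchorRow i w)
    (H' : S.AnchorRow j w') {s : ℕ} (hs : S.o j ≤ s) (hsj : s ≤ S.o j + S.W (S.sig j))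
    (hsi : s ≤ S.o i + S.W (S.sig i + 1)) : succs w' 0 s < succs w 0 s := by
  have hoi := N.h_lt_o i (hij.le.trans hj)
  have hoj := N.h_lt_o j hj
  have hoo := N.o_le i j hij.le hj
  have h1 := H.succs_eq hoi (hoo.trans hs)
  have h2 := H'.succs_eq hoj hs
  obtain ⟨v, rfl⟩ := Nat.exists_eq_add_of_le hs
  obtain ⟨δ, hδ⟩ := Nat.exists_eq_add_of_le hoo
  have e1 : S.o j + v = S.o i + (v + δ) := by omega
  have h3 := H.tube.upper N.U_pos (N.σ₀_le_sig (hij.le.trans hj)) (N.c_nonneg i) (v := v + δ)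
    (by unfold W at hsi; omega)
  have h4 := H'.tube.lower (v := v) (by unfold W at hsj; omega)
  have h5 := N.φ_add_le (v := v) (δ := δ)
  have h6 := N.gap i j hij hj
  have h7 := N.lead i j hij.le hj
  have h8 : ((δ : ℕ) : ℝ) ≤ (S.h j + S.k j) - (S.h i + S.k i) := by
    have : δ + S.h i + S.k i ≤ S.h j + S.k j := by omega
    have : ((δ + S.h i + S.k i : ℕ) : ℝ) ≤ (S.h j + S.k j : ℕ) := by exact_mod_cast this
    push_cast at this
    linarith
  have hU : (1 : ℝ) ≤ S.U := by exact_mod_cast N.U_pos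
  have hA : (0 : ℝ) < 2 ^ S.σ₀ := by positivity
  have hq := N.q_lt
  have h9 : (S.c i + 12) * (δ / (3 * S.U * 2 ^ S.σ₀)) ≤ (1 - S.q) / 2 * δ := by
    have hc : S.c i ≤ S.c S.r := by
      unfold c
      have : (i : ℝ) ≤ S.r := by exact_mod_cast hij.le.trans hj
      linarith
    have h10 : S.c i + 12 ≤ (1 - S.q) / 2 * (3 * S.U * 2 ^ S.σ₀) := by
      have h11 := N.c_small
      have : 0 ≤ (S.U - 1) * ((1 - S.q) * (3 * 2 ^ S.σ₀)) :=
        mul_nonneg (by linarith) (mul_nonneg (by linarith) (by positivity))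
      nlinarith
    rw [← mul_div_assoc, div_le_iff₀ (by positivity)]
    nlinarith [show (0 : ℝ) ≤ δ by positivity]
  have h10 : (S.c i + 12) * S.φ (v + δ) ≤ (S.c i + 12) * S.φ v + (1 - S.q) / 2 * δ := by
    have := mul_le_mul_of_nonneg_left h5 (show 0 ≤ S.c i + 12 by linarith [N.c_nonneg i])
    linarith
  have h11 : 0 ≤ (S.c j - S.c i - 24) * S.φ v := by
    refine mul_nonneg ?_ (S.φ_nonneg v)
    unfold c
    have : ((i + 1 : ℕ) : ℝ) ≤ j := by exact_mod_cast hij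
    push_cast at this
    linarith
  have h12 : (S.h i + S.k i : ℝ) + fails w (S.o i) (S.o i + (v + δ)) <
      S.h j + S.k j + fails w' (S.o j) (S.o j + v) := by
    have h12 := mul_le_mul_of_nonneg_left h8 (show 0 ≤ S.q + (1 - S.q) / 2 by
      linarith [N.q_nonneg])
    unfold φ at *
    push_cast at h3
    linarith
  have h13 : S.h i + S.k i + fails w (S.o i) (S.o i + (v + δ)) <
      S.h j + S.k j + fails w' (S.o j) (S.o j + v) := by exact_mod_cast h12
  rw [← e1] at h13
  omega

/-- In its last window the anchor `a j` overtakes the anchor `a i`. -/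
theorem drop_lt {i j : ℕ} (hij : i < j) (hj : j ≤ S.r) {w w' : ℕ → Bool} (H : S.AnchorRow i w)
    (H' : S.AnchorRow j w')
    (hsi : S.o j + S.W (S.sig j + 1) ≤ S.o i + S.W (S.sig i)) :
    succs w 0 (S.o j + S.W (S.sig j + 1)) < succs w' 0 (S.o j + S.W (S.sig j + 1)) := by
  have hoi := N.h_lt_o i (hij.le.trans hj)
  have hoj := N.h_lt_o j hj
  have hoo := N.o_le i j hij.le hj
  have hσ := N.σ₀_le_sig hj
  set v := S.W (S.sig j + 1) with hv
  have h1 := H.succs_eq hoi (hoo.trans (Nat.le_add_right (S.o j) v))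
  have h2 := H'.succs_eq hoj (Nat.le_add_right (S.o j) v)
  obtain ⟨δ, hδ⟩ := Nat.exists_eq_add_of_le hoo
  have e1 : S.o j + v = S.o i + (v + δ) := by omega
  have h3 := H.tube.lower (v := v + δ) (by unfold W at hsi; omega)
  have h4 := (abs_le.1 (H'.tube.last v (S.W_mono (Nat.le_succ _)) le_rfl)).2
  have h5 : drift S.U S.σ₀ v ≤ drift S.U S.σ₀ (v + δ) := drift_mono (by omega)
  have h6 : drift S.U S.σ₀ v = 2 ^ (S.sig j + 1) - 2 ^ S.σ₀ := drift_win N.U_pos (by omega)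
  rw [pow_succ] at h6
  have h7 : (2 : ℝ) ^ S.s₁ ≤ 2 ^ S.sig j := pow_le_pow_right₀ (by norm_num) (N.sig_ge hj).le
  have h8 : (S.h j + S.k j : ℝ) < 2 ^ S.s₁ := by
    have := N.s₁_big
    have := N.lead j S.r hj le_rfl
    have := N.o_le j S.r hj le_rfl
    exact_mod_cast (show S.h j + S.k j < 2 ^ S.s₁ by omega)
  have hΛ := N.Λ_big
  have hcij : 0 ≤ S.c j - S.c i := by
    unfold c
    have : (i : ℝ) ≤ j := by exact_mod_cast hij.le
    linarith
  have hci : S.c i ≥ 40 := by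
    unfold c
    linarith [show (0 : ℝ) ≤ 24 * S.r by positivity, show (0 : ℝ) ≤ 24 * i by positivity]
  have hcc : 1 ≤ 2 * S.c i - S.c j - 36 := by
    unfold c
    have : (j : ℝ) ≤ S.r := by exact_mod_cast hj
    linarith [show (0 : ℝ) ≤ 24 * S.r by positivity, show (0 : ℝ) ≤ 24 * i by positivity]
  have h9 : (0 : ℝ) < 2 ^ S.σ₀ := by positivity
  have h10 := mul_le_mul_of_nonneg_left h5 (show 0 ≤ S.c i - 12 by linarith)
  have h11 := mul_le_mul_of_nonneg_right hcc (show (0 : ℝ) ≤ 2 ^ S.sig j by positivity)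
  have h12 := mul_nonneg hcij h9.le
  have h13 : S.q * v ≤ S.q * ((v + δ : ℕ) : ℝ) :=
    mul_le_mul_of_nonneg_left (by push_cast; linarith [show (0 : ℝ) ≤ δ by positivity]) N.q_nonneg
  have h14 : (S.h j + S.k j : ℝ) + fails w' (S.o j) (S.o j + v) <
      fails w (S.o i) (S.o i + (v + δ)) := by
    rw [h6] at h10
    linarith
  have h15 : S.h j + S.k j + fails w' (S.o j) (S.o j + v) <
      fails w (S.o i) (S.o i + (v + δ)) := by exact_mod_cast h14
  rw [← e1] at h15
  omega

/-- Positions between `a j` and `a (j + 1)` that are not delayed overtake `a j`. -/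
theorem drop_gen_lt {j : ℕ} (hj : j < S.r) {w w' : ℕ → Bool} (H : S.AnchorRow j w)
    (H' : S.RelRow (j + 1) w') : succs w 0 S.t1 < succs w' 0 S.t1 := by
  have hoj := N.h_lt_o j hj.le
  have hoj' := N.h_lt_o (j + 1) hj
  have h0 := N.o_le (j + 1) S.r hj le_rfl
  have h0' := N.o_le j (j + 1) (Nat.le_succ j) hj
  have ht : S.o S.r ≤ S.t1 := Nat.le_add_right _ _
  have h1 := H.succs_eq hoj (show S.o j ≤ S.t1 by omega)
  have h2 := succs_add_fails w' (S.h (j + 1)) S.t1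
  have h3 := succs_anti w' (Nat.zero_le (S.h (j + 1))) S.t1
  have h4 := fails_split w' hoj'.le (show S.o (j + 1) ≤ S.t1 by omega)
  obtain ⟨v, hv⟩ := Nat.exists_eq_add_of_le (show S.o j ≤ S.t1 by omega)
  obtain ⟨v', hv'⟩ := Nat.exists_eq_add_of_le (show S.o (j + 1) ≤ S.t1 by omega)
  have hs₁ := N.s₁_lt
  have hvv : v ≤ S.W (S.sig j) := by
    have := N.o_le_add hj.le le_rfl (s := S.s₁) le_rfl (N.sig_ge hj.le)
    unfold t1 at hv
    omega
  have h5 := H.tube.lower (v := v) hvv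
  have h6 := N.rel_le H' (v := v') (by
    have : S.W (S.sig j) ≤ S.W (S.sr + 2) := by
      refine S.W_mono ?_
      unfold sig
      split_ifs <;> omega
    omega)
  have h7 : S.φ v' ≤ S.φ v := drift_mono (by omega)
  have h8 : S.q * v' ≤ S.q * v := by
    have : (v' : ℝ) ≤ v := by exact_mod_cast (show v' ≤ v by omega)
    exact mul_le_mul_of_nonneg_left this N.q_nonneg
  have h9 : (2 : ℝ) ^ S.s₁ ≤ drift S.U S.σ₀ v + 2 ^ S.σ₀ :=
    two_pow_le_drift N.U_pos N.σ₀_lt.le (by unfold t1 W at hv; omega)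
  have h10 := N.sleep (j + 1) hj
  have h11 := N.s₁_big
  have hΛ := N.Λ_big
  have hr : (0 : ℝ) ≤ 24 * S.r := by positivity
  have h12 : (2 : ℝ) * 2 ^ S.σ₀ ≤ 2 ^ S.s₁ := by
    rw [← pow_succ']
    exact pow_le_pow_right₀ (by norm_num) N.σ₀_lt
  have h13 : (S.h (j + 1) + S.k (j + 1) + 1 : ℝ) ≤ 2 ^ S.s₁ := by
    have := N.lead (j + 1) S.r hj le_rfl
    exact_mod_cast (show S.h (j + 1) + S.k (j + 1) + 1 ≤ 2 ^ S.s₁ by omega)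
  have h14 : S.Λ * S.φ v' ≤ S.Λ * S.φ v := mul_le_mul_of_nonneg_left h7 (by linarith)
  have h15 : 2 * S.φ v ≤ (S.c j - 12 - S.Λ) * S.φ v := by
    refine mul_le_mul_of_nonneg_right ?_ (S.φ_nonneg v)
    unfold c
    linarith [show (0 : ℝ) ≤ 24 * j by positivity]
  have h16 := H'.1
  rw [hv] at h1
  rw [hv'] at h4
  have h17 : (S.h (j + 1) : ℝ) + S.m (j + 1) + fails w' (S.o (j + 1)) (S.o (j + 1) + v') <
      S.h j + S.k j + fails w (S.o j) (S.o j + v) := by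
    unfold φ at *
    have : (0 : ℝ) ≤ S.h j + S.k j := by positivity
    linarith
  have h18 : S.h (j + 1) + S.m (j + 1) + fails w' (S.o (j + 1)) (S.o (j + 1) + v') <
      S.h j + S.k j + fails w (S.o j) (S.o j + v) := by exact_mod_cast h17
  rw [← hv] at h1
  rw [← hv'] at h4
  rw [← hv] at h18
  rw [← hv'] at h18
  omega

end Valid

end Scales

end TamariLevels

namespace TamariLevels

open Finset MeasureTheory

namespace Scales

variable {S : Scales}

namespace Valid

variable (N : S.Valid)
include N

theorem W_gap {s t : ℕ} (hs : S.s₁ ≤ s) (hst : s < t) : S.W s < S.W t := by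
  have h1 := N.o_le_add (i := 0) (j := 0) (Nat.zero_le _) (Nat.zero_le _) hs hst
  have h2 := win_succ (U := S.U) (N.σ₀_lt.le.trans hs)
  have h3 := S.W_mono (show s + 1 ≤ t from hst)
  have h4 : 0 < 3 * 4 ^ s * S.U := by
    have := N.U_pos
    positivity
  unfold W at *
  omega

/-- The last anchor has climbed past `y ≤ n (i + 1)` when the control of the failures expires. -/
theorem le_succs_of_late {w : ℕ → Bool} (H : S.PostRow S.Tf w) {i t : ℕ} (hi : i < S.r)
    (hε : S.ε i ≤ S.n (i + 1) / 4) (hn : 4 * S.Tf ≤ S.n (i + 1)) (ht : S.V i ≤ t) :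
    S.n (i + 1) ≤ succs w S.Tf t := by
  have hV := N.V_ge i hi
  have hq := N.q_lt
  have hq0 := N.q_nonneg
  have hT : S.Tf ≤ S.V i := by
    have : (4 : ℝ) * S.Tf ≤ S.n (i + 1) := by exact_mod_cast hn
    have h2 : (1 - S.q) * S.V i ≤ S.V i := by
      nlinarith [show (0 : ℝ) ≤ S.V i by positivity]
    have : (S.Tf : ℝ) ≤ S.V i := by
      have : (0 : ℝ) ≤ S.Tf := by positivity
      linarith
    exact_mod_cast this
  obtain ⟨x, hx⟩ := Nat.exists_eq_add_of_le hT
  have h1 := (abs_le.1 (H i hi x (by omega))).2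
  have h2 := succs_add_fails w S.Tf (S.Tf + x)
  have h3 : (succs w S.Tf (S.Tf + x) : ℝ) + fails w S.Tf (S.Tf + x) = x := by
    exact_mod_cast (show succs w S.Tf (S.Tf + x) + fails w S.Tf (S.Tf + x) = x by omega)
  have h4 : (S.n (i + 1) : ℝ) ≤ succs w S.Tf (S.Tf + x) := by
    have h5 : (S.V i : ℝ) = S.Tf + x := by exact_mod_cast hx
    rw [h5] at hV
    have h6 : (4 : ℝ) * S.Tf ≤ S.n (i + 1) := by exact_mod_cast hn
    have h7 : (1 - S.q) * S.Tf ≤ S.Tf := by nlinarith [show (0 : ℝ) ≤ S.Tf by positivity]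
    have : (0 : ℝ) ≤ S.n (i + 1) := by positivity
    linarith
  have h5 : S.n (i + 1) ≤ succs w S.Tf (S.Tf + x) := by exact_mod_cast h4
  exact h5.trans (succs_mono w _ (by omega))

end Valid

namespace Config

variable {a : ℕ → ℕ} {w : ℕ → ℕ → Bool}

theorem a_lt (C : S.Config a w) (N : S.Valid) {i j : ℕ} (hij : i < j) (hj : j ≤ S.r) :
    a i < a j := by
  have h1 := C.lt_a j hj
  have h2 := C.a_le i (hij.le.trans hj)
  have h3 := N.n_mul_le i j hij hj
  omega

theorem anchorSystem (C : S.Config a w) (N : S.Valid) :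
    AnchorSystem w S.r a S.h S.o S.e S.d (fun i => if i = 0 then a 0 + 1 else a i / 2)
      S.t1 S.T1 S.Tf S.Tend := by
  have hs := N.s₁_lt
  have hr := N.r_pos
  have ho := fun j (hj : j ≤ S.r) => N.o_le j S.r hj le_rfl
  have hn : ∀ i ≤ S.r, S.n 0 ≤ S.n i := by
    intro i hi
    rcases Nat.eq_zero_or_pos i with rfl | h
    · exact le_rfl
    · have := N.n_mul_le 0 i h hi
      omega
  have hW1 : S.W (S.s₁ + 2 * S.r) < S.W S.sr := N.W_gap (by omega) (by omega)
  have hW2 : S.W S.sr < S.W (S.sr + 1) := N.W_gap (by omega) (by omega)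
  have he0 : S.e 0 = S.Tf := if_pos rfl
  have hd0 : S.d 0 = S.Tf := if_pos rfl
  have he : ∀ j, j ≠ 0 → S.e j = S.o j + S.W (S.sig j) := fun j hj => if_neg hj
  have hd : ∀ j, j ≠ 0 → S.d j = S.o j + S.W (S.sig j + 1) := fun j hj => if_neg hj
  have her : S.e S.r = S.o S.r + S.W S.sr := by
    rw [he _ (by omega)]
    unfold sig
    rw [if_neg (by omega), if_pos rfl]
  have hT0 : S.Tf ≤ S.o 0 + S.W (S.sig 0) := by
    have := N.le_W_of_le_Tf (Nat.zero_le S.r) le_rfl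
    unfold sig
    rwa [if_pos rfl]
  have hsT : ∀ j ≤ S.r, ∀ s ≤ S.e j, s ≤ S.o j + S.W (S.sig j) := by
    intro j hj s hse
    rcases Nat.eq_zero_or_pos j with rfl | h
    · omega
    · rwa [he j (by omega)] at hse
  have hnr : 0 < S.n 0 := by have := N.Tf_le; omega
  have hTf : S.Tf < a 0 := by
    have := N.Tf_le
    have := C.lt_a 0 (Nat.zero_le _)
    omega
  -- the failures of all positions above an anchor, except for the last anchor, are controlled
  have hpost : ∀ j ≤ S.r, ∀ y, a j < y → y ≤ a S.r → y ≠ a S.r → S.PostRow S.T1 (w y) := by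
    intro j hj y h1 h2 h3
    by_cases hya : ∀ i ≤ S.r, y ≠ a i
    · exact C.post y (by omega) hya (by have := C.a_le S.r le_rfl; omega)
    · push Not at hya
      obtain ⟨i, hi, rfl⟩ := hya
      have hir : i ≠ S.r := fun h => h3 (by rw [h])
      have hi0 : i ≠ 0 := by
        rintro rfl
        rcases Nat.eq_zero_or_pos j with rfl | h
        · omega
        · have := C.a_lt N h hj
          omega
      have := (C.row i hi).post hi0
      rwa [if_neg hir] at this
  -- positions that are small or not blocked stay ahead of `a j`
  have gen1 : ∀ j ≤ S.r, ∀ y < a j, 0 < y → (∀ i ≤ S.r, y ≠ a i) → ∀ s, S.h j < s → s ≤ S.e j →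
      (S.o j ≤ s ∨ w (a j) s = true) → S.RelRow j (w y) →
      succs (w (a j)) 0 s < succs (w y) 0 s := by
    intro j hj y hy hy0 hya s hs1 hse hso hrel
    obtain ⟨g, hg, hyg⟩ := C.moved y hy0 hya j hj (hy.le.trans (C.a_le j hj))
    rcases le_or_gt (S.o j) s with h1 | h1
    · exact N.gen_lt hj (C.row j hj) hrel hg hyg h1 (hsT j hj s hse) (hse.trans (N.e_le hj))
    · have h2 : w (a j) s = true := hso.resolve_left (by omega)
      rcases C.early with h3 | ⟨h3, -⟩
      · have := h3 j hj s hs1 h1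
        simp [h2] at this
      · have h4 := hrel.1
        rw [h3 j hj] at h4
        have h5 := fails_mono (w y) (S.h j) h1.le
        have h6 := le_succs_of_moved hg hyg hs1.le
        have h7 := (C.row j hj).succs_le hs1
        omega
  constructor
  · exact hr
  · exact fun i j hij hj => C.a_lt N hij hj
  · exact fun j hj => (C.row j hj).fail
  · exact fun j hj => (C.row j hj).succ
  · -- moved
    intro j hj y hy hy0
    by_cases hya : ∀ i ≤ S.r, y ≠ a i
    · exact C.moved y hy0 hya j hj (hy.le.trans (C.a_le j hj))
    · push Not at hya
      obtain ⟨i, hi, rfl⟩ := hya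
      have hij : i < j := by
        by_contra h
        rcases (not_lt.1 h).eq_or_lt with h1 | h1
        · rw [h1] at hy
          omega
        · have := C.a_lt N h1 hi
          omega
      exact ⟨S.h i, N.h_lt i j hij hj, (C.row i hi).succ⟩
  · -- gen
    intro j hj y hy hy0 hya s hs1 hse hso
    have hyn := hy.le.trans (C.a_le j hj)
    by_cases hrel : y ≤ S.Y₀ ∨ ¬ Blocked w y
    · exact Or.inl (gen1 j hj y hy hy0 hya s hs1 hse hso (C.rel y hy0 hya j hj hyn hrel))
    · push Not at hrel
      right
      refine ⟨hrel.2, ?_⟩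
      obtain ⟨g, hg, hyg⟩ := C.moved y hy0 hya j hj hyn
      have hjr : S.n j ≤ S.n S.r := by
        rcases hj.eq_or_lt with rfl | h
        · exact le_rfl
        · have := N.n_mul_le j S.r h le_rfl
          omega
      have h1 := C.far y hrel.1 hya (hyn.trans hjr)
      have h2 := le_succs_of_moved hg hyg hs1.le
      have h3 := (C.row j hj).succs_le hs1
      have h4 := fails_split (w y) (Nat.zero_le (S.h j)) hs1.le
      have h5 := fails_mono (w y) 0 (hse.trans (N.e_le hj))
      omega
  · -- ord
    intro i j hij hj s hs1 hsd hse hso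
    have hi := hij.le.trans hj
    rcases le_or_gt (S.o j) s with h1 | h1
    · refine N.ord_lt hij hj (C.row i hi) (C.row j hj) h1 (hsT j hj s hse) ?_
      rcases Nat.eq_zero_or_pos i with rfl | h
      · rw [hd0] at hsd
        exact (hsd.trans hT0).trans (Nat.add_le_add_left (S.W_mono (Nat.le_succ _)) _)
      · rwa [hd i (by omega)] at hsd
    · have h2 : w (a j) s = true := hso.resolve_left (by omega)
      rcases C.early with h3 | ⟨-, h3⟩
      · have := h3 j hj s hs1 h1
        simp [h2] at this
      · have h4 := h3 i j hij hj s hs1 h1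
        have h5 := N.h_lt i j hij hj
        have h6 := (C.row j hj).succs_le hs1
        have h7 := (C.row i hi).succs_le (h5.trans hs1)
        omega
  · -- drop_anchor
    intro j hj1 hjr
    have h1 : S.d j ≤ S.o (j - 1) + S.W (S.sig (j - 1)) := by
      rw [hd j (by omega)]
      refine N.o_le_add (by omega) hjr.le (by have := N.sig_ge hjr.le; omega) ?_
      unfold sig
      rw [if_neg (show j ≠ 0 by omega), if_neg (show j ≠ S.r by omega)]
      split_ifs <;> omega
    constructor
    · rcases Nat.eq_or_lt_of_le hj1 with rfl | h
      · rw [Nat.sub_self, he0, hd 1 (by omega)]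
        have h2 := ho 1 hjr.le
        have h3 : S.W (S.sig 1 + 1) ≤ S.W (S.sr + 1) := by
          refine S.W_mono ?_
          unfold sig
          rw [if_neg (by omega), if_neg (by omega)]
          omega
        unfold Tf
        omega
      · rwa [he _ (by omega)]
    · rw [hd j (by omega)] at h1 ⊢
      exact N.drop_lt (by omega) hjr.le (C.row _ (by omega)) (C.row j hjr.le) h1
  · -- drop_gen
    intro j hj y hy1 hy2
    by_cases hrel : Blocked w y
    · exact Or.inr hrel
    · left
      have hya : ∀ i ≤ S.r, y ≠ a i := by
        rintro i hi rfl
        rcases lt_trichotomy i j with h | rfl | h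
        · have := C.a_lt N h hj.le
          omega
        · omega
        · rcases (show j + 1 ≤ i from h).eq_or_lt with h2 | h2
          · rw [← h2] at hy2
            omega
          · have := C.a_lt N h2 hi
            omega
      exact N.drop_gen_lt hj (C.row j hj.le) (C.rel y (by omega) hya (j + 1) hj
        (hy2.le.trans (C.a_le _ hj)) (Or.inr hrel))
  · -- drop_last
    have h1 := N.drop_lt hr le_rfl (C.row 0 (Nat.zero_le _)) (C.row S.r le_rfl)
    have h2 : S.sig S.r = S.sr := by
      unfold sig
      rw [if_neg (by omega), if_pos rfl]
    rw [h2] at h1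
    exact h1 hT0
  · exact he0
  · exact hd0
  · -- e_le_d
    intro i j hij hj
    rcases Nat.eq_zero_or_pos i with rfl | h
    · rw [hd0]
      exact N.e_le hj.le
    · rw [he j (by omega), hd i (by omega)]
      refine N.o_le_add (by omega) hj.le (N.sig_ge hj.le).le ?_
      have := S.sig_lt h hij hj
      omega
  · -- h_lt_t1
    intro j hj
    have h1 := N.h_lt_o j hj
    have h2 := ho j hj
    unfold t1
    omega
  · -- t1_le
    intro j hj
    rcases Nat.eq_zero_or_pos j with rfl | h
    · rw [he0]
      have : S.W S.s₁ ≤ S.W (S.sr + 1) := S.W_mono (by omega)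
      unfold t1 Tf
      omega
    · rw [he j (by omega)]
      exact N.o_le_add hj.le le_rfl le_rfl (N.sig_ge hj.le)
  · exact Nat.add_le_add_left (S.W_mono (by omega)) _
  · -- d_le
    intro j hj1 hjr
    rw [hd j (by omega)]
    have h1 := ho j hjr.le
    have h2 : S.W (S.sig j + 1) ≤ S.W (S.s₁ + 2 * S.r) := by
      refine S.W_mono ?_
      unfold sig
      rw [if_neg (by omega), if_neg (by omega)]
      omega
    unfold T1
    omega
  · rw [her]
    unfold T1
    omega
  · exact fun j hj => N.e_le hj
  · rw [her]
    have := ho 0 (Nat.zero_le _)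
    omega
  · exact hTf
  · simp
  · intro i hi1 hir
    rw [if_neg (by omega)]
  · -- Tf_lt
    intro i hi
    split_ifs with h
    · omega
    · have h1 := C.lt_a i hi.le
      have h2 := N.n_mul_le 0 i (by omega) hi.le
      have h3 := N.Tf_le
      omega
  · -- final
    intro i hi y hy1 hy2 hyr t ht1 ht2
    have hq0 := N.q_nonneg
    have hq1 := N.q_lt
    have hyar : y ≤ a S.r := by
      refine hy2.trans ?_
      rcases (show i + 1 ≤ S.r from hi).eq_or_lt with h | h
      · rw [← h]
      · exact (C.a_lt N h le_rfl).le
    have hPr : S.PostRow S.Tf (w (a S.r)) := by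
      have := (C.row S.r le_rfl).post (by omega)
      rwa [if_pos rfl] at this
    have hPy := hpost i hi.le y hy1 hyar hyr
    have hTn := N.Tf_le
    have hn0 := hn (i + 1) hi
    have hTfe : S.e S.r ≤ S.Tf := N.e_le le_rfl
    have hTe : S.T1 < S.e S.r := by
      rw [her]
      unfold T1
      omega
    have hεn : S.ε i ≤ S.n (i + 1) / 4 := by
      rcases Nat.eq_zero_or_pos i with rfl | h
      · have h1 := N.ε_zero_le
        have h2 : (S.W S.sr : ℝ) ≤ S.n 1 := by
          have : S.W S.sr ≤ S.n 1 := by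
            unfold Tf at hTn
            rw [zero_add] at hn0
            omega
          exact_mod_cast this
        have h3 : (0 : ℝ) ≤ S.W (S.s₁ + 2 * S.r) := by positivity
        have h4 : (S.W (S.s₁ + 2 * S.r) : ℝ) ≤ S.W S.sr := by exact_mod_cast hW1.le
        rw [zero_add]
        nlinarith
      · have h1 := N.ε_le i h hi
        have h2 := N.n_mul_le i (i + 1) (Nat.lt_succ_self i) hi
        have h3 : (100 : ℝ) * S.n i ≤ S.n (i + 1) := by exact_mod_cast h2
        have : (0 : ℝ) ≤ S.n i := by positivity
        linarith
    rcases le_or_gt (S.V i) (t - S.T1) with h1 | h1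
    · left
      have h2 := N.le_succs_of_late hPr hi hεn (by omega) (show S.V i ≤ t by omega)
      have h3 := C.a_le (i + 1) hi
      omega
    right
    obtain ⟨x, rfl⟩ := Nat.exists_eq_add_of_le (hTe.le.trans ht1)
    rw [Nat.add_sub_cancel_left] at h1
    have h2 := (abs_le.1 (hPy i hi x h1.le)).2
    have h3 := succs_add_fails (w y) S.T1 (S.T1 + x)
    have h4 := succs_add_fails (w (a S.r)) (S.e S.r) (S.T1 + x)
    have h5 := fails_mono (w (a S.r)) (S.e S.r) (t := min S.Tf (S.T1 + x)) (min_le_right _ _)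
    -- the failures of the last anchor after the time `Tf`
    have h6 : fails (w (a S.r)) (S.e S.r) (min S.Tf (S.T1 + x)) + (S.q * ((S.T1 + x : ℕ) -
        (min S.Tf (S.T1 + x) : ℕ)) - S.ε i) ≤ fails (w (a S.r)) (S.e S.r) (S.T1 + x) := by
      have hε0 : 0 ≤ S.ε i := by
        have := hPy i hi 0 (Nat.zero_le _)
        exact (abs_nonneg _).trans this
      rcases le_total (S.T1 + x) S.Tf with h7 | h7
      · rw [min_eq_right h7]
        simp [hε0]
      · rw [min_eq_left h7]
        obtain ⟨z, hz⟩ := Nat.exists_eq_add_of_le h7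
        have h8 := (abs_le.1 (hPr i hi z (by omega))).1
        rw [fails_split (w (a S.r)) hTfe h7, hz]
        push_cast
        linarith
    rcases Nat.eq_zero_or_pos i with rfl | hi0
    · -- the rows are compared through the tube of the last anchor up to `Tf`
      rw [if_pos rfl, add_assoc, add_assoc, add_lt_add_iff_left, add_lt_add_iff_left]
      obtain ⟨z, hz⟩ := Nat.exists_eq_add_of_le (show S.e S.r ≤ min S.Tf (S.T1 + x) from
        le_min hTfe ht1)
      have hsr : S.sig S.r = S.sr := by
        unfold sig
        rw [if_neg (by omega), if_pos rfl]
      have tube := (C.row S.r le_rfl).tube.last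
      rw [hsr] at tube
      have hWsr : win S.U S.σ₀ S.sr = S.W S.sr := rfl
      have hWsr' : win S.U S.σ₀ (S.sr + 1) = S.W (S.sr + 1) := rfl
      rw [hWsr, hWsr'] at tube
      have hzle : S.e S.r + z ≤ S.Tf := by rw [← hz]; exact min_le_left _ _
      have t1 := (abs_le.1 (tube (S.W S.sr) le_rfl hW2.le)).2
      have t2 := (abs_le.1 (tube (S.W S.sr + z) (Nat.le_add_right _ _) (by
        rw [her] at hzle
        unfold Tf at hzle
        omega))).1
      rw [← add_assoc, ← her] at t2
      rw [← her] at t1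
      rw [fails_split (w (a S.r)) (show S.o S.r ≤ S.e S.r by rw [her]; omega)
        (Nat.le_add_right (S.e S.r) z)] at t2
      push_cast at t2
      have hlast := N.last
      have hε := N.ε_zero_le
      obtain ⟨D, hD⟩ := Nat.exists_eq_add_of_le hTe.le
      have hDW : (D : ℝ) = S.W S.sr - S.W (S.s₁ + 2 * S.r) := by
        rw [her] at hD
        unfold T1 at hD
        have : S.W S.sr = S.W (S.s₁ + 2 * S.r) + D := by omega
        rw [this]
        push_cast
        ring
      rw [hz] at h6
      have h7 : (fails (w y) S.T1 (S.T1 + x) : ℝ) <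
          D + fails (w (a S.r)) (S.e S.r) (S.T1 + x) := by
        have hT1x : ((S.T1 + x : ℕ) : ℝ) = S.T1 + x := by push_cast; ring
        have hez : ((S.e S.r + z : ℕ) : ℝ) = S.T1 + D + z := by rw [hD]; push_cast; ring
        rw [hT1x, hez] at h6
        rw [← hDW] at hlast hε
        have : 0 < (1 - S.q) * D := by
          have : (0 : ℝ) < 2 ^ S.sr := by positivity
          linarith
        linarith
      have h8 : fails (w y) S.T1 (S.T1 + x) < D + fails (w (a S.r)) (S.e S.r) (S.T1 + x) := by
        exact_mod_cast h7
      omega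
    · rw [if_neg (by omega)]
      have h7 := N.ε_le i hi0 hi
      have h8 := C.lt_a i hi.le
      have h9 := N.n_mul_le 0 i hi0 hi.le
      have h10 := C.a_le 0 (Nat.zero_le _)
      have h11 : ((min S.Tf (S.T1 + x) : ℕ) : ℝ) ≤ S.Tf := by exact_mod_cast min_le_left _ _
      have h12 := mul_le_mul_of_nonneg_left h11 hq0
      have h13 : S.q * S.Tf ≤ S.Tf := by nlinarith [show (0 : ℝ) ≤ S.Tf by positivity]
      have h14 : (fails (w y) S.T1 (S.T1 + x) : ℝ) ≤
          fails (w (a S.r)) (S.e S.r) (S.T1 + x) + S.Tf + S.n i / 16 := by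
        push_cast at h6
        have : (0 : ℝ) ≤ fails (w (a S.r)) (S.e S.r) (min S.Tf (S.T1 + x)) := by positivity
        have hqT : 0 ≤ S.q * (S.T1 : ℝ) := mul_nonneg hq0 (by positivity)
        push_cast at h12
        linarith
      have h15 : 16 * fails (w y) S.T1 (S.T1 + x) ≤
          16 * fails (w (a S.r)) (S.e S.r) (S.T1 + x) + 16 * S.Tf + S.n i := by
        have : (16 : ℝ) * fails (w y) S.T1 (S.T1 + x) ≤
          16 * fails (w (a S.r)) (S.e S.r) (S.T1 + x) + 16 * S.Tf + S.n i := by linarith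
        exact_mod_cast this
      omega
  · -- Tend_lt
    have h1 := C.a_le 0 (Nat.zero_le _)
    have h2 := C.lt_a S.r le_rfl
    have h3 := N.n_mul_le 0 S.r hr le_rfl
    unfold Tend
    omega

/-- The last anchor survives until time `Tend`. -/
theorem lev_lt (C : S.Config a w) (N : S.Valid) : lev w S.Tend (a S.r) < a S.r :=
  (C.anchorSystem N).lev_last_lt

end Config

end Scales

end TamariLevels

namespace TamariLevels

open Finset MeasureTheory

/-! ### Events concerning several positions -/

/-- The event `A` is determined by the coins before time `t` of the positions in `F`. -/
def DepOnRows (A : Set (ℕ → ℕ → Bool)) (F : Finset ℕ) (t : ℕ) : Prop :=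
  ∀ w w' : ℕ → ℕ → Bool, (∀ y ∈ F, ∀ s < t, w y s = w' y s) → (w ∈ A ↔ w' ∈ A)

namespace DepOnRows

variable {A B : Set (ℕ → ℕ → Bool)} {F F' : Finset ℕ} {t t' : ℕ}

theorem dependsOn (h : DepOnRows A F t) :
    DependsOn (fun w => w ∈ (MeasurableEquiv.curry ℕ ℕ Bool) ⁻¹' A)
      ((F ×ˢ range t : Finset (ℕ × ℕ)) : Set (ℕ × ℕ)) :=
  fun w w' h' => propext (h _ _ fun y hy s hs => h' (y, s) (by simp [hy, hs]))

theorem measurableSet (h : DepOnRows A F t) : MeasurableSet A :=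
  (MeasurableEquiv.measurableSet_preimage _).1 (measurableSet_of_dependsOn h.dependsOn)

theorem mono (h : DepOnRows A F t) (h1 : F ⊆ F') (h2 : t ≤ t') : DepOnRows A F' t' :=
  fun w w' h' => h w w' fun y hy s hs => h' y (h1 hy) s (by omega)

theorem compl (h : DepOnRows A F t) : DepOnRows Aᶜ F t := fun w w' h' => not_congr (h w w' h')

theorem inter (hA : DepOnRows A F t) (hB : DepOnRows B F t) : DepOnRows (A ∩ B) F t :=
  fun w w' h => and_congr (hA w w' h) (hB w w' h)

theorem union (hA : DepOnRows A F t) (hB : DepOnRows B F t) : DepOnRows (A ∪ B) F t :=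
  fun w w' h => or_congr (hA w w' h) (hB w w' h)

theorem biUnion {ι : Type*} {I : Finset ι} {A : ι → Set (ℕ → ℕ → Bool)}
    (h : ∀ i ∈ I, DepOnRows (A i) F t) : DepOnRows (⋃ i ∈ I, A i) F t := by
  intro w w' h'
  simp only [Set.mem_iUnion, exists_prop]
  exact exists_congr fun i => and_congr_right fun hi => h i hi w w' h'

end DepOnRows

theorem depOnRows_box {F : Finset ℕ} {t : ℕ} {M : ℕ → Set (ℕ → Bool)}
    (h : ∀ y ∈ F, DepOn (M y) 0 t) : DepOnRows {w | ∀ y ∈ F, w y ∈ M y} F t := by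
  intro w w' h'
  exact forall_congr' fun y => forall_congr' fun hy => h y hy _ _ fun i _ hi => h' y hy i hi

variable (p : unitInterval)

/-- The probability of an event concerning the coins of all positions. -/
noncomputable def coinP (A : Set (ℕ → ℕ → Bool)) : ℝ := (coinLaw p).real A

theorem coinP_mono {A B : Set (ℕ → ℕ → Bool)} (h : A ⊆ B) : coinP p A ≤ coinP p B :=
  measureReal_mono h

theorem coinP_union_le (A B : Set (ℕ → ℕ → Bool)) : coinP p (A ∪ B) ≤ coinP p A + coinP p B :=
  measureReal_union_le A B

theorem coinP_biUnion_le {ι : Type*} (S : Finset ι) (A : ι → Set (ℕ → ℕ → Bool)) :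
    coinP p (⋃ i ∈ S, A i) ≤ ∑ i ∈ S, coinP p (A i) :=
  measureReal_biUnion_finset_le S A

theorem coinP_inter {A B : Set (ℕ → ℕ → Bool)} {F F' : Finset ℕ} {t t' : ℕ}
    (hA : DepOnRows A F t) (hB : DepOnRows B F' t') (h : Disjoint F F') :
    coinP p (A ∩ B) = coinP p A * coinP p B := by
  unfold coinP
  rw [measureReal_def, measureReal_def, measureReal_def, ← ENNReal.toReal_mul, coinLaw_eq_map,
    MeasurableEquiv.map_apply, MeasurableEquiv.map_apply, MeasurableEquiv.map_apply,
    Set.preimage_inter]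
  congr 1
  refine infinitePi_inter_eq_mul (fun _ => coin p) ?_ hA.dependsOn hB.dependsOn
  rw [Finset.disjoint_left]
  rintro ⟨y, s⟩ h1 h2
  exact Finset.disjoint_left.1 h (mem_product.1 h1).1 (mem_product.1 h2).1

/-- Different positions are independent. -/
theorem coinP_box {F : Finset ℕ} {t : ℕ} {M : ℕ → Set (ℕ → Bool)}
    (h : ∀ y ∈ F, DepOn (M y) 0 t) :
    coinP p {w | ∀ y ∈ F, w y ∈ M y} = ∏ y ∈ F, rowP p (M y) := by
  unfold coinP rowP
  simp_rw [measureReal_def]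
  rw [← ENNReal.toReal_prod, ← Measure.infinitePi_pi (fun _ : ℕ => rowLaw p)
    fun y hy => (h y hy).measurableSet]
  rfl

theorem coinP_row {y t : ℕ} {M : Set (ℕ → Bool)} (h : DepOn M 0 t) :
    coinP p {w | w y ∈ M} = rowP p M := by
  have := coinP_box p (F := {y}) (M := fun _ => M) fun _ _ => h
  simpa using this

/-- The event that the first success occurs at time `g`. -/
def First (g : ℕ) : Set (ℕ → Bool) := {w | (∀ i < g, w i = false) ∧ w g = true}

/-- The event that there is a success before time `g`. -/
def Before (g : ℕ) : Set (ℕ → Bool) := {w | ∃ i < g, w i = true}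

theorem depOn_before (g : ℕ) : DepOn (Before g) 0 g := fun w w' h =>
  exists_congr fun i => and_congr_right fun hi => by rw [h i (Nat.zero_le i) hi]

theorem depOn_first (g : ℕ) : DepOn (First g) 0 (g + 1) := fun w w' h =>
  and_congr (forall_congr' fun i => forall_congr' fun hi => by rw [h i (Nat.zero_le i) (by omega)])
    (by rw [h g (Nat.zero_le g) (Nat.lt_succ_self g)])

theorem rowP_not_before (g : ℕ) : rowP p (Before g)ᶜ = (1 - p) ^ g := by
  induction g with
  | zero =>
    rw [pow_zero, ← rowP_univ p]
    congr 1
    ext w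
    simp [Before]
  | succ g ih =>
    rw [pow_succ, ← ih, show (1 - (p : ℝ)) = wt (1 - p) false by simp [wt], ← rowP_coin p g false,
      ← rowP_inter p (depOn_before g).compl (depOn_coin false) le_rfl]
    congr 1
    ext w
    simp only [Before, Set.mem_compl_iff, Set.mem_ofPred_eq, Set.mem_inter_iff, not_exists, not_and,
      Bool.not_eq_true]
    constructor
    · exact fun h => ⟨fun i hi => h i (by omega), h g (by omega)⟩
    · rintro ⟨h1, h2⟩ i hi
      rcases (Nat.lt_succ_iff.1 hi).lt_or_eq with h3 | rfl
      · exact h1 i h3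
      · exact h2

theorem rowP_before (g : ℕ) : rowP p (Before g) = 1 - (1 - p) ^ g := by
  have := rowP_compl p (depOn_before g)
  rw [rowP_not_before] at this
  linarith

theorem rowP_first (g : ℕ) : rowP p (First g) = p * (1 - p) ^ g := by
  rw [mul_comm, ← rowP_not_before, show (p : ℝ) = wt (1 - p) true by simp [wt],
    ← rowP_coin p g true, ← rowP_inter p (depOn_before g).compl (depOn_coin true) le_rfl]
  congr 1
  ext w
  simp [First, Before]

/-- For `x = 1 - (1 - p) ^ g`, the summand bounds the probability that all but `r` of the positions in
`[y / 2, y)` succeed before time `g`. -/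
theorem sum_pow_half_le {x : ℝ} (h0 : 0 ≤ x) (h1 : x < 1) (r N : ℕ) :
    ∑ y ∈ range N, x ^ (y / 2 - r) ≤ 2 * (r + 1 / (1 - x)) := by
  have h2 : ∀ N, ∑ y ∈ range (2 * N), x ^ (y / 2 - r) = 2 * ∑ k ∈ range N, x ^ (k - r) := by
    intro N
    induction N with
    | zero => simp
    | succ N ih =>
      rw [mul_add, mul_one, sum_range_succ, sum_range_succ, ih, sum_range_succ,
        show 2 * N / 2 = N by omega, show (2 * N + 1) / 2 = N by omega]
      ring
  have h3 : ∀ N, ∑ k ∈ range N, x ^ (k - r) ≤ r + ∑ k ∈ range (N - r), x ^ k := by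
    intro N
    rcases le_total N r with h | h
    · calc _ ≤ ∑ k ∈ range N, (1 : ℝ) :=
            sum_le_sum fun k _ => pow_le_one₀ h0 h1.le
        _ = N := by simp
        _ ≤ r := by exact_mod_cast h
        _ ≤ _ := le_add_of_nonneg_right (sum_nonneg fun _ _ => pow_nonneg h0 _)
    · obtain ⟨d, rfl⟩ := Nat.exists_eq_add_of_le h
      rw [sum_range_add, Nat.add_sub_cancel_left]
      refine add_le_add ?_ (sum_le_sum fun k _ => ?_)
      · calc _ ≤ ∑ k ∈ range r, (1 : ℝ) := sum_le_sum fun k _ => pow_le_one₀ h0 h1.le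
          _ = r := by simp
      · rw [Nat.add_sub_cancel_left]
  have h4 : ∀ N, ∑ k ∈ range N, x ^ k ≤ 1 / (1 - x) := by
    intro N
    rw [geom_sum_eq h1.ne, ← neg_sub 1 x, ← neg_sub 1 (x ^ N), neg_div_neg_eq]
    have : 0 < 1 - x := by linarith
    gcongr
    linarith [pow_nonneg h0 N]
  calc _ ≤ ∑ y ∈ range (2 * N), x ^ (y / 2 - r) :=
        sum_le_sum_of_subset_of_nonneg (range_mono (by omega)) fun _ _ _ => pow_nonneg h0 _
    _ ≤ _ := by
      rw [h2]
      have := (h3 N).trans (add_le_add_right (h4 (N - r)) _)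
      linarith

end TamariLevels

namespace TamariLevels

open Finset MeasureTheory

/-! ### Summing over the positions of the anchors -/

/-- A family of row events from which configurations of anchors are built: `A j` for the anchor
`a j`, `R j` for the positions that must not delay it, and `D y` for all positions. -/
structure RowEvents where
  /-- The number of anchors, minus one. -/
  r : ℕ
  /-- A time after which no coins matter. -/
  t : ℕ
  /-- The bound below which blocked positions are not exempted from `R`. -/
  Y₀ : ℕ
  /-- The scale of `a j`. -/
  n : ℕ → ℕ
  /-- The time of the first success of `a j`. -/
  h : ℕ → ℕ
  A : ℕ → Set (ℕ → Bool)
  R : ℕ → Set (ℕ → Bool)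
  D : ℕ → Set (ℕ → Bool)

namespace RowEvents

variable (S : RowEvents)

/-- The event that the anchors are at the positions `b`. -/
structure Anchored (b : Fin (S.r + 1) → ℕ) (w : ℕ → ℕ → Bool) : Prop where
  mem : ∀ j : Fin (S.r + 1), b j ∈ Ioc (S.n j / 2) (S.n j)
  anchor : ∀ j : Fin (S.r + 1), w (b j) ∈ S.A j
  before : ∀ y, 1 ≤ y → (∀ i, y ≠ b i) → ∀ j ≤ S.r, y ≤ S.n j → w y ∈ Before (S.h j)
  rel : ∀ y, 1 ≤ y → y ≤ S.n S.r → (∀ i, y ≠ b i) → ∀ j ≤ S.r, y ≤ S.n j →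
    (y ≤ S.Y₀ ∨ ¬ Blocked w y) → w y ∈ S.R j
  typical : ∀ y, 1 ≤ y → y ≤ S.n S.r → (∀ i, y ≠ b i) → w y ∈ S.D y

/-- The bounds for the probabilities of the row events: `n j` is about `(1 - p) ^ (-h j)`, `β` bounds
the probability of `A j` given the first success, and `δ`, `δ'` those of the complements of `R j`
and `D y`. -/
structure Bounds (p : unitInterval) (β δ δ' : ℝ) : Prop where
  p_pos : (0 : ℝ) < p
  p_lt : (p : ℝ) < 1
  β_nonneg : 0 ≤ β
  δ_nonneg : 0 ≤ δ
  h_lt : ∀ i j, i < j → j ≤ S.r → S.h i < S.h j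
  h_le : ∀ j ≤ S.r, S.h j ≤ S.t
  n_le : ∀ i j, i < j → j ≤ S.r → 2 * S.n i ≤ S.n j
  n_pow_le : ∀ j ≤ S.r, (S.n j : ℝ) * (1 - p) ^ S.h j ≤ 1
  le_n_pow : ∀ j ≤ S.r, 1 ≤ 2 * ((S.n j : ℝ) * (1 - p) ^ S.h j)
  pow_le : ∀ j ≤ S.r, 2 * (1 - (p : ℝ)) ^ S.h j ≤ 1
  A_dep : ∀ j ≤ S.r, DepOn (S.A j) 0 S.t
  A_sub : ∀ j ≤ S.r, S.A j ⊆ First (S.h j)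
  le_A : ∀ j ≤ S.r, p * (1 - p) ^ S.h j * β ≤ rowP p (S.A j)
  R_dep : ∀ j ≤ S.r, DepOn (S.R j) (S.h j) S.t
  R_le : ∀ j ≤ S.r, rowP p (S.R j)ᶜ ≤ δ
  D_dep : ∀ y, DepOn (S.D y) 0 S.t
  D_le : ∀ y, 1 ≤ y → y ≤ S.n S.r → rowP p (S.D y)ᶜ ≤ δ'
  small : 2 * ((S.r + 1) * δ * (S.Y₀ + S.h S.r * (2 * S.r + 4)) + S.n S.r * δ') ≤
    (1 / 4) ^ (S.r + 1)

variable {S} {p : unitInterval} {β δ δ' : ℝ}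

theorem quarter_le {x : ℝ} {m : ℕ} (h0 : 0 ≤ x) (h1 : 2 * x ≤ 1) (h : m * x ≤ 1) :
    1 / 4 ≤ (1 - x) ^ m := by
  rcases h0.eq_or_lt with rfl | hx
  · norm_num
  have h2 : (1 / 4 : ℝ) ≤ (1 - x) ^ (1 / x : ℝ) := by
    have h3 : (1 / 4 : ℝ) ^ x ≤ 1 - x := by
      have hc := convexOn_rpow_left (show (0 : ℝ) < 1 / 4 by norm_num)
      have h4 := hc.2 (Set.mem_univ 0) (Set.mem_univ (1 / 2)) (show 0 ≤ 1 - 2 * x by linarith)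
        (show 0 ≤ 2 * x by linarith) (by ring)
      simp only [smul_eq_mul, mul_zero, zero_add, Real.rpow_zero, mul_one] at h4
      have h5 : ((1 / 4 : ℝ)) ^ (1 / 2 : ℝ) = 1 / 2 := by
        rw [← Real.sqrt_eq_rpow, show (1 / 4 : ℝ) = (1 / 2) ^ 2 by norm_num]
        exact Real.sqrt_sq (by norm_num)
      rw [h5, show 2 * x * (1 / 2) = x by ring] at h4
      linarith
    calc (1 / 4 : ℝ) = ((1 / 4 : ℝ) ^ x) ^ (1 / x) := by
          rw [← Real.rpow_mul (by norm_num), mul_one_div_cancel hx.ne', Real.rpow_one]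
      _ ≤ _ := Real.rpow_le_rpow (by positivity) h3 (by positivity)
  refine h2.trans ?_
  rw [← Real.rpow_natCast]
  refine Real.rpow_le_rpow_of_exponent_ge (by linarith) (by linarith) ?_
  rw [le_div_iff₀ hx]
  exact h

/-- The positions that are not anchors. -/
def others (S : RowEvents) (b : Fin (S.r + 1) → ℕ) : Finset ℕ := Icc 1 (S.n S.r) \ univ.image b

theorem mem_others {b : Fin (S.r + 1) → ℕ} {y : ℕ} :
    y ∈ S.others b ↔ (1 ≤ y ∧ y ≤ S.n S.r) ∧ ∀ i, y ≠ b i := by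
  simp [others, eq_comm]

/-- The event that the coins of the anchors are as desired. -/
def anchors (S : RowEvents) (b : Fin (S.r + 1) → ℕ) : Set (ℕ → ℕ → Bool) :=
  {w | ∀ j : Fin (S.r + 1), w (b j) ∈ S.A j}

/-- The event that the other positions succeed early enough. -/
def early (S : RowEvents) (b : Fin (S.r + 1) → ℕ) : Set (ℕ → ℕ → Bool) :=
  {w | ∀ y ∈ S.others b, w y ∈ {v | ∀ j ≤ S.r, y ≤ S.n j → v ∈ Before (S.h j)}}

/-- The event that a small position might delay an anchor. -/
def bad₁ (S : RowEvents) (b : Fin (S.r + 1) → ℕ) : Set (ℕ → ℕ → Bool) :=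
  ⋃ y ∈ (S.others b).filter (fun y => y ≤ S.Y₀), ⋃ j ∈ range (S.r + 1), {w | w y ∈ (S.R j)ᶜ}

/-- The event that the position `y` succeeds for the first time at time `g`, after the preceding
positions, and might delay the anchor `a j`. -/
def badAt (S : RowEvents) (b : Fin (S.r + 1) → ℕ) (y j g : ℕ) : Set (ℕ → ℕ → Bool) :=
  {w | w y ∈ First g ∩ (S.R j)ᶜ} ∩
    {w | ∀ c ∈ {c ∈ S.others b | y / 2 ≤ c ∧ c < y}, w c ∈ Before g}

/-- The event that a position that is not blocked might delay an anchor. -/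
def bad₂ (S : RowEvents) (b : Fin (S.r + 1) → ℕ) : Set (ℕ → ℕ → Bool) :=
  ⋃ y ∈ S.others b, ⋃ j ∈ range (S.r + 1), ⋃ g ∈ range (S.h j), S.badAt b y j g

/-- The event that some position is not typical. -/
def bad₃ (S : RowEvents) (b : Fin (S.r + 1) → ℕ) : Set (ℕ → ℕ → Bool) :=
  ⋃ y ∈ S.others b, {w | w y ∈ (S.D y)ᶜ}

/-- The event with anchors `b`, and no bad events. -/
def good (S : RowEvents) (b : Fin (S.r + 1) → ℕ) : Set (ℕ → ℕ → Bool) :=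
  S.anchors b ∩ (S.early b ∩ (S.bad₁ b ∪ S.bad₂ b ∪ S.bad₃ b)ᶜ)

/-- The possible positions of the anchors. -/
def tuples (S : RowEvents) : Finset (Fin (S.r + 1) → ℕ) :=
  Fintype.piFinset fun j : Fin (S.r + 1) => Ioc (S.n j / 2) (S.n j)

theorem depOnRows_row {b : Fin (S.r + 1) → ℕ} {y : ℕ} (hy : y ∈ S.others b)
    {M : Set (ℕ → Bool)} (hM : DepOn M 0 S.t) : DepOnRows {w | w y ∈ M} (S.others b) S.t :=
  fun _ _ h => hM _ _ fun i _ hi => h y hy i hi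

theorem others_disjoint (b : Fin (S.r + 1) → ℕ) : Disjoint (univ.image b) (S.others b) :=
  disjoint_sdiff

namespace Bounds

variable (H : S.Bounds p β δ δ')
include H

theorem n_mono {i j : ℕ} (hij : i ≤ j) (hj : j ≤ S.r) : S.n i ≤ S.n j := by
  rcases hij.lt_or_eq with h | rfl
  · have := H.n_le i j h hj
    omega
  · exact le_rfl

theorem h_mono {i j : ℕ} (hij : i ≤ j) (hj : j ≤ S.r) : S.h i ≤ S.h j := by
  rcases hij.lt_or_eq with h | rfl
  · exact (H.h_lt i j h hj).le
  · exact le_rfl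

theorem injective {b : Fin (S.r + 1) → ℕ} (hb : b ∈ S.tuples) : Function.Injective b := by
  have hlt : ∀ i j : Fin (S.r + 1), i < j → b i < b j := by
    intro i j hij
    have h1 := mem_Ioc.1 (Fintype.mem_piFinset.1 hb i)
    have h2 := mem_Ioc.1 (Fintype.mem_piFinset.1 hb j)
    have h3 := H.n_le i j hij (by have := j.2; omega)
    omega
  intro i j h
  rcases lt_trichotomy i j with h1 | h1 | h1
  · have := hlt _ _ h1
    omega
  · exact h1
  · have := hlt _ _ h1
    omega

theorem anchored {b : Fin (S.r + 1) → ℕ} (hb : b ∈ S.tuples) {w : ℕ → ℕ → Bool}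
    (hw : w ∈ S.good b) : S.Anchored b w := by
  obtain ⟨h1, h2, h3⟩ := hw
  simp only [Set.mem_compl_iff, Set.mem_union, not_or] at h3
  obtain ⟨⟨h3, h4⟩, h5⟩ := h3
  have hbefore : ∀ y, 1 ≤ y → (∀ i, y ≠ b i) → ∀ j ≤ S.r, y ≤ S.n j → w y ∈ Before (S.h j) :=
    fun y hy hya j hj hyj =>
      h2 y (mem_others.2 ⟨⟨hy, hyj.trans (H.n_mono hj le_rfl)⟩, hya⟩) j hj hyj
  refine ⟨fun j => Fintype.mem_piFinset.1 hb j, h1, hbefore, ?_, ?_⟩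
  · intro y hy hyr hya j hj hyj hrel
    by_contra hc
    rcases hrel with hrel | hrel
    · refine h3 ?_
      simp only [bad₁, Set.mem_iUnion, exists_prop]
      exact ⟨y, mem_filter.2 ⟨mem_others.2 ⟨⟨hy, hyr⟩, hya⟩, hrel⟩, j,
        mem_range.2 (by omega), hc⟩
    · refine h4 ?_
      classical
      have hex : ∃ g, w y g = true := by
        obtain ⟨g, -, hg⟩ := hbefore y hy hya j hj hyj
        exact ⟨g, hg⟩
      have hfirst : w y ∈ First (Nat.find hex) := by
        refine ⟨fun i hi => ?_, Nat.find_spec hex⟩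
        have := Nat.find_min hex hi
        simpa using this
      have hlt : Nat.find hex < S.h j := by
        obtain ⟨g, hg, hgt⟩ := hbefore y hy hya j hj hyj
        exact (Nat.find_le hgt).trans_lt hg
      simp only [bad₂, Set.mem_iUnion, exists_prop]
      refine ⟨y, mem_others.2 ⟨⟨hy, hyr⟩, hya⟩, j, mem_range.2 (by omega), Nat.find hex,
        mem_range.2 hlt, ⟨hfirst, hc⟩, fun c hcm => ?_⟩
      obtain ⟨-, hc1, hc2⟩ := mem_filter.1 hcm
      by_contra hcb
      refine hrel ⟨c, Nat.find hex, hc2, hc1, hfirst.1, hfirst.2, fun i hi => ?_⟩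
      by_contra hne
      exact hcb ⟨i, hi, by simpa using hne⟩
  · intro y hy hyr hya
    by_contra hc
    refine h5 ?_
    simp only [bad₃, Set.mem_iUnion, exists_prop]
    exact ⟨y, mem_others.2 ⟨⟨hy, hyr⟩, hya⟩, hc⟩

/-- The positions of the anchors are determined by the coins. -/
theorem anchored_unique {b b' : Fin (S.r + 1) → ℕ} {w : ℕ → ℕ → Bool} (hb : S.Anchored b w)
    (hb' : S.Anchored b' w) : b = b' := by
  funext j
  have hj : (j : ℕ) ≤ S.r := by have := j.2; omega
  have h1 := H.A_sub j hj (hb'.anchor j)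
  have h2 := mem_Ioc.1 (hb'.mem j)
  by_cases hc : ∀ i, b' j ≠ b i
  · obtain ⟨g, hg, hgt⟩ := hb.before (b' j) (by omega) hc j hj h2.2
    have := h1.1 g hg
    simp [hgt] at this
  · push Not at hc
    obtain ⟨i, hi⟩ := hc
    have hir : (i : ℕ) ≤ S.r := by have := i.2; omega
    have h3 := H.A_sub i hir (hb.anchor i)
    rw [← hi] at h3
    have h4 : S.h i = S.h j := by
      rcases lt_trichotomy (S.h i) (S.h j) with h | h | h
      · have := h1.1 _ h
        simp [h3.2] at this
      · exact h
      · have := h3.1 _ h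
        simp [h1.2] at this
    have h5 : (i : ℕ) = j := by
      rcases lt_trichotomy (i : ℕ) j with h | h | h
      · have := H.h_lt i j h hj
        omega
      · exact h
      · have := H.h_lt j i h hir
        omega
    rw [hi, Fin.ext h5]

theorem anchors_dep (b : Fin (S.r + 1) → ℕ) : DepOnRows (S.anchors b) (univ.image b) S.t := by
  intro w w' h
  refine forall_congr' fun j => H.A_dep j (by have := j.2; omega) _ _ fun i _ hi => ?_
  exact h (b j) (mem_image_of_mem b (mem_univ j)) i hi

theorem coinP_anchors {b : Fin (S.r + 1) → ℕ} (hb : b ∈ S.tuples) :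
    coinP p (S.anchors b) = ∏ j : Fin (S.r + 1), rowP p (S.A j) := by
  set M : ℕ → Set (ℕ → Bool) := fun y => {v | ∀ j : Fin (S.r + 1), b j = y → v ∈ S.A j} with hM
  have hinj := H.injective hb
  have h1 : S.anchors b = {w | ∀ y ∈ univ.image b, w y ∈ M y} := by
    ext w
    simp only [anchors, Set.mem_ofPred_eq, mem_image, mem_univ, true_and, forall_exists_index,
      forall_apply_eq_imp_iff, hM]
    constructor
    · intro h j i hij
      rw [← hij]
      exact h i
    · exact fun h j => h j j rfl
  have hMb : ∀ j, M (b j) = S.A j := by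
    intro j
    ext v
    simp only [hM, Set.mem_ofPred_eq]
    exact ⟨fun h => h j rfl, fun h i hi => by rw [hinj hi]; exact h⟩
  rw [h1, coinP_box p (t := S.t), prod_image hinj.injOn]
  · exact prod_congr rfl fun j _ => by rw [hMb]
  · intro y hy
    obtain ⟨j, -, rfl⟩ := mem_image.1 hy
    rw [hMb]
    exact H.A_dep j (by have := j.2; omega)

theorem early_row_dep (y : ℕ) :
    DepOn {v | ∀ j ≤ S.r, y ≤ S.n j → v ∈ Before (S.h j)} 0 S.t :=
  depOn_forall fun j => depOn_imp fun hj => depOn_imp fun _ =>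
    (depOn_before (S.h j)).mono le_rfl (H.h_le j hj)

theorem early_dep (b : Fin (S.r + 1) → ℕ) : DepOnRows (S.early b) (S.others b) S.t :=
  depOnRows_box fun y _ => H.early_row_dep y

/-- The requirements for different anchors are positively correlated, so that the probabilities can
be multiplied. -/
theorem le_coinP_early (b : Fin (S.r + 1) → ℕ) : (1 / 4) ^ (S.r + 1) ≤ coinP p (S.early b) := by
  unfold early
  rw [coinP_box p fun y _ => H.early_row_dep y]
  have hp0 := H.p_pos
  have hp1 := H.p_lt
  have hx0 : ∀ j, 0 ≤ (1 - (p : ℝ)) ^ S.h j := fun j => pow_nonneg (by linarith) _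
  have hx1 : ∀ j ≤ S.r, (1 - (p : ℝ)) ^ S.h j ≤ 1 := fun j hj => by
    linarith [H.pow_le j hj, hx0 j]
  have f0 : ∀ y, ∀ j ∈ range (S.r + 1),
      0 ≤ (if y ≤ S.n j then 1 - (1 - (p : ℝ)) ^ S.h j else 1) := by
    intro y j hj
    have := hx1 j (by have := mem_range.1 hj; omega)
    split_ifs <;> linarith
  have f1 : ∀ y, ∀ j ∈ range (S.r + 1),
      (if y ≤ S.n j then 1 - (1 - (p : ℝ)) ^ S.h j else 1) ≤ 1 := by
    intro y j _
    have := hx0 j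
    split_ifs <;> linarith
  have row : ∀ y, ∏ j ∈ range (S.r + 1), (if y ≤ S.n j then 1 - (1 - (p : ℝ)) ^ S.h j else 1) ≤
      rowP p {v | ∀ j ≤ S.r, y ≤ S.n j → v ∈ Before (S.h j)} := by
    intro y
    classical
    by_cases hex : ∃ j, j ≤ S.r ∧ y ≤ S.n j
    · set i := Nat.find hex
      obtain ⟨hi1, hi2⟩ := Nat.find_spec hex
      have e1 : Before (S.h i) ⊆ {v | ∀ j ≤ S.r, y ≤ S.n j → v ∈ Before (S.h j)} := by
        rintro v ⟨g, hg, hgt⟩ j hj hyj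
        exact ⟨g, hg.trans_le (H.h_mono (Nat.find_le ⟨hj, hyj⟩) hj), hgt⟩
      refine le_trans ?_ (rowP_mono p e1)
      rw [rowP_before, ← mul_prod_erase _ _ (mem_range.2 (Nat.lt_succ_of_le hi1)), if_pos hi2]
      refine mul_le_of_le_one_right (by linarith [hx1 i hi1]) ?_
      exact prod_le_one (fun j hj => f0 y j (erase_subset _ _ hj))
        fun j hj => f1 y j (erase_subset _ _ hj)
    · have : {v : ℕ → Bool | ∀ j ≤ S.r, y ≤ S.n j → v ∈ Before (S.h j)} = Set.univ :=
        Set.eq_univ_of_forall fun v j hj hyj => absurd ⟨j, hj, hyj⟩ hex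
      rw [this, rowP_univ]
      exact prod_le_one (f0 y) (f1 y)
  calc ((1 : ℝ) / 4) ^ (S.r + 1) = ∏ _j ∈ range (S.r + 1), (1 / 4 : ℝ) := by simp
    _ ≤ ∏ j ∈ range (S.r + 1), (1 - (1 - (p : ℝ)) ^ S.h j) ^ S.n j := by
      refine prod_le_prod (fun _ _ => by norm_num) fun j hj => ?_
      have hj : j ≤ S.r := by have := mem_range.1 hj; omega
      exact quarter_le (hx0 j) (H.pow_le j hj) (H.n_pow_le j hj)
    _ ≤ ∏ j ∈ range (S.r + 1), ∏ y ∈ S.others b,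
        (if y ≤ S.n j then 1 - (1 - (p : ℝ)) ^ S.h j else 1) := by
      refine prod_le_prod (fun j hj => ?_) fun j hj => ?_
      · have := hx1 j (by have := mem_range.1 hj; omega)
        exact pow_nonneg (by linarith) _
      · rw [prod_ite, prod_const, prod_const_one, mul_one]
        have := hx1 j (by have := mem_range.1 hj; omega)
        refine pow_le_pow_of_le_one (by linarith) (by linarith [hx0 j]) ?_
        calc _ ≤ #(Icc 1 (S.n j)) := card_le_card fun y hy => by
              obtain ⟨h1, h2⟩ := mem_filter.1 hy
              exact mem_Icc.2 ⟨(mem_others.1 h1).1.1, h2⟩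
          _ = S.n j := by simp
    _ = ∏ y ∈ S.others b, ∏ j ∈ range (S.r + 1),
        (if y ≤ S.n j then 1 - (1 - (p : ℝ)) ^ S.h j else 1) := prod_comm
    _ ≤ _ := prod_le_prod (fun y _ => prod_nonneg (f0 y)) fun y _ => row y

theorem R_row_dep {j : ℕ} (hj : j ≤ S.r) : DepOn (S.R j)ᶜ 0 S.t :=
  (H.R_dep j hj).compl.mono (Nat.zero_le _) le_rfl

theorem badAt_row_dep {j g : ℕ} (hj : j ≤ S.r) (hg : g < S.h j) :
    DepOn (First g ∩ (S.R j)ᶜ) 0 S.t :=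
  ((depOn_first g).mono le_rfl (by have := H.h_le j hj; omega)).inter (H.R_row_dep hj)

theorem before_row_dep {j g : ℕ} (hj : j ≤ S.r) (hg : g < S.h j) : DepOn (Before g) 0 S.t :=
  (depOn_before g).mono le_rfl (by have := H.h_le j hj; omega)

theorem bad_dep (b : Fin (S.r + 1) → ℕ) :
    DepOnRows (S.bad₁ b ∪ S.bad₂ b ∪ S.bad₃ b) (S.others b) S.t := by
  refine (DepOnRows.union ?_ ?_).union ?_
  · exact DepOnRows.biUnion fun y hy => DepOnRows.biUnion fun j hj =>
      depOnRows_row (mem_of_mem_filter y hy) (H.R_row_dep (by have := mem_range.1 hj; omega))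
  · refine DepOnRows.biUnion fun y hy => DepOnRows.biUnion fun j hj => DepOnRows.biUnion
      fun g hg => ?_
    have hj : j ≤ S.r := by have := mem_range.1 hj; omega
    refine (depOnRows_row hy (H.badAt_row_dep hj (mem_range.1 hg))).inter ?_
    exact (depOnRows_box fun c _ => H.before_row_dep hj (mem_range.1 hg)).mono
      (filter_subset _ _) le_rfl
  · exact DepOnRows.biUnion fun y hy => depOnRows_row hy (H.D_dep y).compl

/-- The position `y` is not blocked only if about `y / 2` positions succeed before `y` does. -/
theorem coinP_badAt_le {b : Fin (S.r + 1) → ℕ} {y j g : ℕ} (hy : y ∈ S.others b) (hj : j ≤ S.r)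
    (hg : g < S.h j) : coinP p (S.badAt b y j g) ≤
      p * (1 - p) ^ g * δ * (1 - (1 - p) ^ g) ^ (y / 2 - (S.r + 1)) := by
  have hp0 := H.p_pos
  have hp1 := H.p_lt
  obtain ⟨⟨hy1, hy2⟩, hya⟩ := mem_others.1 hy
  have hq0 : 0 ≤ (1 - (p : ℝ)) ^ g := pow_nonneg (by linarith) _
  have hq1 : (1 - (p : ℝ)) ^ g ≤ 1 := pow_le_one₀ (by linarith) (by linarith)
  unfold badAt
  set F : Finset ℕ := {c ∈ S.others b | y / 2 ≤ c ∧ c < y} with hF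
  have h1 : coinP p ({w | w y ∈ First g ∩ (S.R j)ᶜ} ∩ {w | ∀ c ∈ F, w c ∈ Before g}) =
      rowP p (First g ∩ (S.R j)ᶜ) * ∏ _c ∈ F, rowP p (Before g) := by
    rw [← coinP_row p (y := y) (H.badAt_row_dep hj hg),
      ← coinP_box p fun c _ => H.before_row_dep hj hg]
    refine coinP_inter p (F := {y}) (F' := F) (t := S.t) (t' := S.t) ?_
      (depOnRows_box fun c _ => H.before_row_dep hj hg) ?_
    · exact fun w w' h => H.badAt_row_dep hj hg _ _ fun i _ hi => h y (mem_singleton_self y) i hi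
    · rw [Finset.disjoint_singleton_left]
      intro h
      have := (mem_filter.1 h).2.2
      omega
  rw [h1, rowP_inter p (depOn_first g) (H.R_dep j hj).compl hg, rowP_first, prod_const, rowP_before]
  have h2 : y / 2 - (S.r + 1) ≤ #F := by
    rcases Nat.lt_or_ge y 2 with h | h
    · omega
    · have h3 : Ico (y / 2) y \ univ.image b ⊆ F := by
        intro c hc
        rw [mem_sdiff, mem_Ico] at hc
        refine mem_filter.2 ⟨?_, hc.1⟩
        unfold others
        rw [mem_sdiff, mem_Icc]
        exact ⟨by omega, hc.2⟩
      have h4 := card_le_card h3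
      have h5 := le_card_sdiff (univ.image b) (Ico (y / 2) y)
      have h6 : #(univ.image b) ≤ S.r + 1 := card_image_le.trans (by simp)
      rw [Nat.card_Ico] at h5
      omega
  have h3 : (1 - (1 - (p : ℝ)) ^ g) ^ #F ≤ (1 - (1 - (p : ℝ)) ^ g) ^ (y / 2 - (S.r + 1)) :=
    pow_le_pow_of_le_one (by linarith) (by linarith) h2
  have h4 := H.R_le j hj
  have h5 := H.δ_nonneg
  have h6 : 0 ≤ (1 - (1 - (p : ℝ)) ^ g) ^ #F := pow_nonneg (by linarith) _
  gcongr

/-- On average only few positions are not blocked, so that a union bound over them is affordable. -/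
theorem coinP_bad_le (b : Fin (S.r + 1) → ℕ) : coinP p (S.bad₁ b ∪ S.bad₂ b ∪ S.bad₃ b) ≤
    (S.r + 1) * δ * (S.Y₀ + S.h S.r * (2 * S.r + 4)) + S.n S.r * δ' := by
  have hp0 := H.p_pos
  have hp1 := H.p_lt
  have hδ := H.δ_nonneg
  have e1 : coinP p (S.bad₁ b) ≤ (S.r + 1) * δ * S.Y₀ := by
    calc coinP p (S.bad₁ b)
        ≤ ∑ y ∈ S.others b with y ≤ S.Y₀, ∑ j ∈ range (S.r + 1), coinP p {w | w y ∈ (S.R j)ᶜ} :=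
          (coinP_biUnion_le p _ _).trans (sum_le_sum fun y _ => coinP_biUnion_le p _ _)
      _ ≤ ∑ _y ∈ Icc 1 S.Y₀, ∑ _j ∈ range (S.r + 1), δ := by
          refine (sum_le_sum fun y _ => sum_le_sum fun j hj => ?_).trans
            (sum_le_sum_of_subset_of_nonneg ?_ fun _ _ _ => sum_nonneg fun _ _ => hδ)
          · have hj : j ≤ S.r := by have := mem_range.1 hj; omega
            rw [coinP_row p (H.R_row_dep hj)]
            exact H.R_le j hj
          · intro y hy
            obtain ⟨h1, h2⟩ := mem_filter.1 hy
            exact mem_Icc.2 ⟨(mem_others.1 h1).1.1, h2⟩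
      _ = _ := by
          simp only [sum_const, card_range, Nat.card_Icc, nsmul_eq_mul]
          push_cast
          ring
  have e2 : coinP p (S.bad₂ b) ≤ (S.r + 1) * δ * (S.h S.r * (2 * S.r + 4)) := by
    calc coinP p (S.bad₂ b)
        ≤ ∑ y ∈ S.others b, ∑ j ∈ range (S.r + 1), ∑ g ∈ range (S.h j),
            coinP p (S.badAt b y j g) :=
          (coinP_biUnion_le p _ _).trans (sum_le_sum fun y _ => (coinP_biUnion_le p _ _).trans
            (sum_le_sum fun j _ => coinP_biUnion_le p _ _))
      _ ≤ ∑ y ∈ S.others b, ∑ j ∈ range (S.r + 1), ∑ g ∈ range (S.h j),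
            p * (1 - p) ^ g * δ * (1 - (1 - (p : ℝ)) ^ g) ^ (y / 2 - (S.r + 1)) :=
          sum_le_sum fun y hy => sum_le_sum fun j hj => sum_le_sum fun g hg =>
            H.coinP_badAt_le hy (by have := mem_range.1 hj; omega) (mem_range.1 hg)
      _ = ∑ j ∈ range (S.r + 1), ∑ g ∈ range (S.h j), ∑ y ∈ S.others b,
            p * (1 - p) ^ g * δ * (1 - (1 - (p : ℝ)) ^ g) ^ (y / 2 - (S.r + 1)) := by
          rw [sum_comm]
          exact sum_congr rfl fun j _ => sum_comm
      _ ≤ ∑ j ∈ range (S.r + 1), ∑ _g ∈ range (S.h j), δ * (2 * S.r + 4) := by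
          refine sum_le_sum fun j _ => sum_le_sum fun g _ => ?_
          have hq0 : 0 < (1 - (p : ℝ)) ^ g := pow_pos (by linarith) _
          have hq1 : (1 - (p : ℝ)) ^ g ≤ 1 := pow_le_one₀ (by linarith) (by linarith)
          rw [← mul_sum]
          have h1 : ∑ y ∈ S.others b, (1 - (1 - (p : ℝ)) ^ g) ^ (y / 2 - (S.r + 1)) ≤
              2 * ((S.r + 1 : ℕ) + 1 / (1 - (1 - (1 - (p : ℝ)) ^ g))) := by
            refine le_trans (sum_le_sum_of_subset_of_nonneg (t := range (S.n S.r + 1)) ?_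
              fun _ _ _ => pow_nonneg (by linarith) _)
              (sum_pow_half_le (by linarith) (by linarith) _ _)
            intro y hy
            have := (mem_others.1 hy).1.2
            exact mem_range.2 (by omega)
          rw [sub_sub_cancel] at h1
          calc _ ≤ p * (1 - p) ^ g * δ * (2 * ((S.r + 1 : ℕ) + 1 / (1 - (p : ℝ)) ^ g)) := by gcongr
            _ = p * δ * (2 * (S.r + 1) * (1 - p) ^ g + 2) := by
              push_cast
              field_simp
            _ ≤ 1 * δ * (2 * (S.r + 1) * 1 + 2) := by gcongr
            _ = _ := by ring
      _ ≤ ∑ _j ∈ range (S.r + 1), (S.h S.r : ℝ) * (δ * (2 * S.r + 4)) := by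
          refine sum_le_sum fun j hj => ?_
          rw [sum_const, card_range, nsmul_eq_mul]
          have : (S.h j : ℝ) ≤ S.h S.r := by
            exact_mod_cast H.h_mono (show j ≤ S.r by have := mem_range.1 hj; omega) le_rfl
          gcongr
      _ = _ := by
          simp only [sum_const, card_range, nsmul_eq_mul]
          push_cast
          ring
  have e3 : coinP p (S.bad₃ b) ≤ S.n S.r * δ' := by
    rcases (S.others b).eq_empty_or_nonempty with h0 | ⟨y0, hy0⟩
    · unfold bad₃
      rw [h0]
      rcases Nat.eq_zero_or_pos (S.n S.r) with h1 | h1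
      · simp [h1, coinP]
      · have h2 := (rowP_nonneg p _).trans (H.D_le 1 le_rfl h1)
        simp only [notMem_empty, Set.iUnion_of_empty, Set.iUnion_empty]
        unfold coinP
        rw [measureReal_empty]
        positivity
    have hδ' : 0 ≤ δ' := (rowP_nonneg p _).trans
      (H.D_le y0 (mem_others.1 hy0).1.1 (mem_others.1 hy0).1.2)
    calc coinP p (S.bad₃ b) ≤ ∑ y ∈ S.others b, coinP p {w | w y ∈ (S.D y)ᶜ} :=
          coinP_biUnion_le p _ _
      _ ≤ ∑ _y ∈ Icc 1 (S.n S.r), δ' := by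
          refine (sum_le_sum fun y hy => ?_).trans
            (sum_le_sum_of_subset_of_nonneg sdiff_subset fun _ _ _ => hδ')
          rw [coinP_row p (H.D_dep y).compl]
          exact H.D_le y (mem_others.1 hy).1.1 (mem_others.1 hy).1.2
      _ = _ := by simp
  have e4 := coinP_union_le p (S.bad₁ b ∪ S.bad₂ b) (S.bad₃ b)
  have e5 := coinP_union_le p (S.bad₁ b) (S.bad₂ b)
  linarith

theorem good_dep (b : Fin (S.r + 1) → ℕ) :
    DepOnRows (S.good b) (univ.image b ∪ S.others b) S.t :=
  ((H.anchors_dep b).mono subset_union_left le_rfl).inter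
    (((H.early_dep b).inter (H.bad_dep b).compl).mono subset_union_right le_rfl)

theorem le_coinP_good {b : Fin (S.r + 1) → ℕ} (hb : b ∈ S.tuples) :
    (∏ j : Fin (S.r + 1), rowP p (S.A j)) * ((1 / 4) ^ (S.r + 1) / 2) ≤ coinP p (S.good b) := by
  unfold good
  rw [coinP_inter p (H.anchors_dep b) ((H.early_dep b).inter (H.bad_dep b).compl)
    (others_disjoint b), H.coinP_anchors hb]
  refine mul_le_mul_of_nonneg_left ?_ (prod_nonneg fun _ _ => rowP_nonneg p _)
  have h1 := H.le_coinP_early b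
  have h2 := H.coinP_bad_le b
  have h3 := H.small
  have h4 : coinP p (S.early b) ≤ coinP p (S.early b ∩ (S.bad₁ b ∪ S.bad₂ b ∪ S.bad₃ b)ᶜ) +
      coinP p (S.bad₁ b ∪ S.bad₂ b ∪ S.bad₃ b) := by
    refine (coinP_mono p ?_).trans (coinP_union_le p _ _)
    intro w hw
    by_cases hc : w ∈ S.bad₁ b ∪ S.bad₂ b ∪ S.bad₃ b
    · exact Or.inr hc
    · exact Or.inl ⟨hw, hc⟩
  linarith

/-- Anchors are found with a probability that does not depend on their scales: there are about
`n j / 2` candidates for `a j`, each of which succeeds for the first time at time `h j` with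
probability about `p / n j`, and different choices of the anchors exclude each other. -/
theorem le_coinP_exists_anchored :
    (p * β / 16) ^ (S.r + 1) / 2 ≤ coinP p {w | ∃ b, S.Anchored b w} := by
  have hp0 := H.p_pos
  have hp1 := H.p_lt
  have hβ := H.β_nonneg
  have h1 : coinP p (⋃ b ∈ S.tuples, S.good b) = ∑ b ∈ S.tuples, coinP p (S.good b) := by
    refine measureReal_biUnion_finset ?_ fun b _ => (H.good_dep b).measurableSet
    intro b hb b' hb' hne
    refine Set.disjoint_left.2 fun w h1 h2 => hne ?_
    exact H.anchored_unique (H.anchored hb h1) (H.anchored hb' h2)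
  have h2 : coinP p (⋃ b ∈ S.tuples, S.good b) ≤ coinP p {w | ∃ b, S.Anchored b w} := by
    refine coinP_mono p fun w hw => ?_
    simp only [Set.mem_iUnion, exists_prop] at hw
    obtain ⟨b, hb, hw⟩ := hw
    exact ⟨b, H.anchored hb hw⟩
  refine le_trans ?_ (h1.symm.trans_le h2)
  refine le_trans ?_ (sum_le_sum fun b hb => H.le_coinP_good hb)
  rw [← sum_mul, sum_const, nsmul_eq_mul]
  have h3 : ((#S.tuples : ℕ) : ℝ) = ∏ j : Fin (S.r + 1), (#(Ioc (S.n j / 2) (S.n j)) : ℝ) := by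
    unfold tuples
    rw [Fintype.card_piFinset]
    push_cast
    rfl
  rw [h3, ← prod_mul_distrib]
  calc (p * β / 16) ^ (S.r + 1) / 2
      = (∏ _j : Fin (S.r + 1), (p * β / 4)) * ((1 / 4) ^ (S.r + 1) / 2) := by
        rw [prod_const, card_univ, Fintype.card_fin, ← mul_div_assoc, ← mul_pow]
        congr 2
        ring
    _ ≤ _ := by
        refine mul_le_mul_of_nonneg_right (prod_le_prod (fun _ _ => by positivity) fun j _ => ?_)
          (by positivity)
        have hj : (j : ℕ) ≤ S.r := by have := j.2; omega
        have h4 := H.le_A j hj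
        have h5 := H.le_n_pow j hj
        have h6 : (S.n j : ℝ) / 2 ≤ #(Ioc (S.n j / 2) (S.n j)) := by
          rw [Nat.card_Ioc]
          have : S.n j ≤ 2 * (S.n j - S.n j / 2) := by omega
          have : (S.n j : ℝ) ≤ 2 * ((S.n j - S.n j / 2 : ℕ) : ℝ) := by exact_mod_cast this
          linarith
        calc p * β / 4 ≤ p * β / 4 * (2 * ((S.n j : ℝ) * (1 - p) ^ S.h j)) :=
              le_mul_of_one_le_right (by positivity) h5
          _ = S.n j / 2 * (p * (1 - p) ^ S.h j * β) := by ring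
          _ ≤ _ := by
              have : 0 ≤ p * (1 - (p : ℝ)) ^ S.h j * β :=
                mul_nonneg (mul_nonneg hp0.le (pow_nonneg (by linarith) _)) hβ
              gcongr

end Bounds

end RowEvents

end TamariLevels

namespace TamariLevels

open Finset MeasureTheory

/-! ### The probability of a configuration -/

/-- The event that the failures stay in the tubes of the windows from `σ₀` to `σ - 1`. -/
def TubeInit (q c : ℝ) (U σ₀ o σ : ℕ) : Set (ℕ → Bool) :=
  {w | ∀ s, σ₀ ≤ s → s < σ →
    w ∈ Near (q + c / (3 * U * 2 ^ s)) (6 * 2 ^ s) (o + win U σ₀ s) (3 * 4 ^ s * U)}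

/-- The event that the failures follow the drift up to the window `σ`, in which it stops. -/
def Tube (q c : ℝ) (U σ₀ o σ : ℕ) : Set (ℕ → Bool) :=
  TubeInit q c U σ₀ o σ ∩ Near q (6 * 2 ^ σ) (o + win U σ₀ σ) (3 * 4 ^ σ * U)

theorem depOn_tubeInit (q c : ℝ) (U σ₀ o σ : ℕ) :
    DepOn (TubeInit q c U σ₀ o σ) o (o + win U σ₀ σ) := by
  refine depOn_forall fun s => depOn_imp fun h1 => depOn_imp fun h2 =>
    (depOn_near _ _ _ _).mono (Nat.le_add_right _ _) ?_
  have h3 := win_succ (U := U) h1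
  have h4 : win U σ₀ (s + 1) ≤ win U σ₀ σ := win_mono h2
  rw [add_assoc]
  omega

theorem depOn_tube {q c : ℝ} {U σ₀ o σ : ℕ} (h : σ₀ ≤ σ) :
    DepOn (Tube q c U σ₀ o σ) o (o + win U σ₀ (σ + 1)) := by
  have h3 := win_succ (U := U) h
  have h4 : win U σ₀ σ ≤ win U σ₀ (σ + 1) := win_mono (Nat.le_succ σ)
  refine ((depOn_tubeInit q c U σ₀ o σ).mono le_rfl (by omega)).inter
    ((depOn_near _ _ _ _).mono (Nat.le_add_right _ _) ?_)
  rw [add_assoc]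
  omega

section

variable {p : unitInterval} {q c : ℝ} {U σ₀ : ℕ}

/-- The probability of following the drift through one window is bounded below. -/
theorem le_rowP_window (hp0 : (0 : ℝ) < p) (hq : q = 1 - p) (hqU : 1 ≤ q * U) (hqU' : q * U ≤ 2)
    (hs : 2 * c ≤ 3 * 2 ^ σ₀ * p) {c' : ℝ} (h0 : 0 ≤ c') (h1 : c' ≤ c) {s : ℕ}
    (hs' : σ₀ ≤ s) (τ : ℕ) : 1 / 4 * Real.exp (-(c ^ 2 / (3 * p))) ≤
      rowP p (Near (q + c' / (3 * U * 2 ^ s)) (6 * 2 ^ s) τ (3 * 4 ^ s * U)) := by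
  have hp1 := p.2.2
  have hq0 : 0 < q := by
    rcases lt_or_ge 0 q with h | h
    · exact h
    · have : q * U ≤ 0 := mul_nonpos_of_nonpos_of_nonneg h (by positivity)
      linarith
  have hU0 : 0 < U := by
    rcases Nat.eq_zero_or_pos U with h | h
    · rw [h] at hqU
      norm_num at hqU
    · exact h
  have hU : (1 : ℝ) ≤ U := by exact_mod_cast hU0
  have h2s : (2 : ℝ) ^ σ₀ ≤ 2 ^ s := pow_le_pow_right₀ (by norm_num) hs'
  have h2s0 : (0 : ℝ) < 2 ^ s := by positivity
  have e1 : 2 * c' ≤ 3 * 2 ^ s * p := by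
    have := mul_le_mul_of_nonneg_right h2s hp0.le
    linarith
  have e2 : (2 : ℝ) ^ s * 1 ≤ 2 ^ s * U := mul_le_mul_of_nonneg_left hU h2s0.le
  set z := c' / (3 * U * 2 ^ s) with hz
  have hz0 : 0 ≤ z := by positivity
  have hz1 : U * z * (3 * 2 ^ s) = c' := by
    rw [hz]
    field_simp
  have hUz : 2 * (U * z) ≤ p := by
    have : 2 * (U * z) * (3 * 2 ^ s) ≤ p * (3 * 2 ^ s) := by linarith
    exact le_of_mul_le_mul_right this (by positivity)
  have hzp : 2 * z ≤ p := by nlinarith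
  have hplt : (p : ℝ) < 1 := by linarith
  refine le_trans ?_ (le_rowP_near p hp0 hplt (x := q + z) (by linarith) (by linarith)
    (by positivity) τ (3 * 4 ^ s * U) ?_)
  · gcongr 1 / 4 * Real.exp (-?_)
    rw [← hq, add_sub_cancel_left]
    push_cast
    have e3 : 3 * (4 : ℝ) ^ s * U * (z ^ 2 / (q * p)) = c' ^ 2 / (3 * (q * U) * p) := by
      have h4 : (4 : ℝ) ^ s = (2 ^ s) ^ 2 := by rw [← pow_mul, mul_comm s 2, pow_mul]; norm_num
      rw [← hz1, h4]
      field_simp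
    rw [e3]
    have : c' ^ 2 ≤ c ^ 2 := pow_le_pow_left₀ h0 h1 2
    refine div_le_div₀ (by positivity) this (by positivity) ?_
    nlinarith
  · push_cast
    have h4 : (4 : ℝ) ^ s = (2 ^ s) ^ 2 := by rw [← pow_mul, mul_comm s 2, pow_mul]; norm_num
    rw [h4]
    have e4 : (q + z) * (1 - (q + z)) ≤ q + z := by nlinarith
    have e5 : U * ((q + z) * (1 - (q + z))) ≤ 6 := by
      have := mul_le_mul_of_nonneg_left e4 (show (0 : ℝ) ≤ U by positivity)
      nlinarith
    nlinarith [sq_nonneg ((2 : ℝ) ^ s)]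

theorem le_rowP_tubeInit (hp0 : (0 : ℝ) < p) (hq : q = 1 - p) (hqU : 1 ≤ q * U) (hqU' : q * U ≤ 2)
    (hs : 2 * c ≤ 3 * 2 ^ σ₀ * p) {c' : ℝ} (h0 : 0 ≤ c') (h1 : c' ≤ c) {σ : ℕ}
    (hs' : σ₀ ≤ σ) (o : ℕ) : (1 / 4 * Real.exp (-(c ^ 2 / (3 * p)))) ^ (σ - σ₀) ≤
      rowP p (TubeInit q c' U σ₀ o σ) := by
  induction σ, hs' using Nat.le_induction with
  | base =>
    have : TubeInit q c' U σ₀ o σ₀ = Set.univ :=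
      Set.eq_univ_of_forall fun w s h1 h2 => absurd h1 (by omega)
    rw [this, rowP_univ, Nat.sub_self, pow_zero]
  | succ σ hσ ih =>
    have e1 : TubeInit q c' U σ₀ o (σ + 1) = TubeInit q c' U σ₀ o σ ∩
        Near (q + c' / (3 * U * 2 ^ σ)) (6 * 2 ^ σ) (o + win U σ₀ σ) (3 * 4 ^ σ * U) := by
      ext w
      constructor
      · exact fun h => ⟨fun s h2 h3 => h s h2 (by omega), h σ hσ (by omega)⟩
      · rintro ⟨h, h'⟩ s h2 h3
        rcases Nat.lt_succ_iff_lt_or_eq.1 h3 with h4 | rfl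
        · exact h s h2 h4
        · exact h'
    rw [e1, rowP_inter p (depOn_tubeInit q c' U σ₀ o σ) (depOn_near _ _ _ _) le_rfl,
      Nat.succ_sub hσ, pow_succ]
    exact mul_le_mul ih (le_rowP_window hp0 hq hqU hqU' hs h0 h1 hσ _) (by positivity)
      (rowP_nonneg p _)

theorem le_rowP_tube (hp0 : (0 : ℝ) < p) (hq : q = 1 - p) (hqU : 1 ≤ q * U) (hqU' : q * U ≤ 2)
    (hc : 0 ≤ c) (hs : 2 * c ≤ 3 * 2 ^ σ₀ * p) {c' : ℝ} (h0 : 0 ≤ c') (h1 : c' ≤ c) {σ : ℕ}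
    (hs' : σ₀ ≤ σ) (o : ℕ) : (1 / 4 * Real.exp (-(c ^ 2 / (3 * p)))) ^ (σ + 1) ≤
      rowP p (Tube q c' U σ₀ o σ) := by
  unfold Tube
  rw [rowP_inter p (depOn_tubeInit q c' U σ₀ o σ) (depOn_near _ _ _ _) le_rfl]
  have e1 := le_rowP_window hp0 hq hqU hqU' hs le_rfl hc hs' (o + win U σ₀ σ)
  rw [zero_div, add_zero] at e1
  refine le_trans ?_ (mul_le_mul (le_rowP_tubeInit hp0 hq hqU hqU' hs h0 h1 hs' o) e1
    (by positivity) (rowP_nonneg p _))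
  rw [← pow_succ]
  refine pow_le_pow_of_le_one (by positivity) ?_ (by omega)
  have : Real.exp (-(c ^ 2 / (3 * p))) ≤ 1 := Real.exp_le_one_iff.2 (by
    have : 0 ≤ c ^ 2 / (3 * p) := by positivity
    linarith)
  linarith

end

namespace Scales

variable (S : Scales)

/-- The bounds for the probabilities of the events in a configuration. The event `X j` describes
the coins of the anchor `a j` between the times `h j` and `o j`. -/
structure Likely (p : unitInterval) (X : ℕ → Set (ℕ → Bool)) (ξ δ δ' : ℝ) : Prop where
  valid : S.Valid
  p_pos : (0 : ℝ) < p
  q_eq : S.q = 1 - p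
  U_ge : 1 ≤ S.q * S.U
  ξ_nonneg : 0 ≤ ξ
  δ_nonneg : 0 ≤ δ
  δ'_nonneg : 0 ≤ δ'
  X_dep : ∀ j ≤ S.r, DepOn (X j) (S.h j + 1) (S.o j)
  X_fails : ∀ j ≤ S.r, ∀ w ∈ X j, fails w (S.h j + 1) (S.o j) = S.k j
  X_early : (∀ j ≤ S.r, ∀ w ∈ X j, ∀ s, S.h j < s → s < S.o j → w s = false) ∨
    (∀ j ≤ S.r, S.m j = 0) ∧ ∀ i j, i < j → j ≤ S.r → ∀ w ∈ X i, ∀ w' ∈ X j,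
      ∀ s, S.h j < s → s < S.o j → fails w (S.h i + 1) s ≤ fails w' (S.h j + 1) s
  le_X : ∀ j ≤ S.r, ξ ≤ rowP p (X j)
  sleep_le : ∀ j ≤ S.r, rowP p {w | fails w (S.h j) (S.o j) ≤ S.m j}ᶜ ≤ δ
  rel_le : (4 ^ (S.sr + 2) + 1) * Real.exp (-(S.Λ / 2)) ≤ δ
  post_le : ∀ i < S.r, 2 * (S.V i + 1) *
    Real.exp (-min (S.ε i / 2) (S.ε i ^ 2 / (4 * (S.q * S.V i + 1)))) ≤ δ'
  ε_nonneg : ∀ i < S.r, 0 ≤ S.ε i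
  far_le : Real.exp (-(S.Y₀ / 256)) ≤ δ'
  Y₀_ge : 8 * (S.q * S.Tf) ≤ 3 * S.Y₀
  n_pow_le : ∀ j ≤ S.r, (S.n j : ℝ) * (1 - p) ^ S.h j ≤ 1
  le_n_pow : ∀ j ≤ S.r, 1 ≤ 2 * ((S.n j : ℝ) * (1 - p) ^ S.h j)
  pow_le : ∀ j ≤ S.r, 2 * (1 - (p : ℝ)) ^ S.h j ≤ 1
  small : 2 * ((S.r + 1) * (2 * δ) * (S.Y₀ + S.h S.r * (2 * S.r + 4)) +
    S.n S.r * ((S.r + 1) * δ')) ≤ (1 / 4) ^ (S.r + 1)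

/-- A time after which no coins matter. -/
def horizon : ℕ := S.o S.r + S.W (S.sr + 3) + ∑ i ∈ range S.r, S.V i

/-- The time at which the control of the failures of the anchor `a j` begins. -/
def postTime (j : ℕ) : ℕ := if j = S.r then S.Tf else S.T1

/-- The events for the coins of anchors and of other positions. -/
def rowEvents (X : ℕ → Set (ℕ → Bool)) : RowEvents where
  r := S.r
  t := S.horizon
  Y₀ := S.Y₀
  n := S.n
  h := S.h
  A j := First (S.h j) ∩ (X j ∩ (Tube S.q (S.c j) S.U S.σ₀ (S.o j) (S.sig j) ∩
    {w | j ≠ 0 → w ∈ {v | S.PostRow (S.postTime j) v}}))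
  R j := {w | S.RelRow j w}
  D y := {w | S.PostRow S.T1 w} ∩ {w | S.Y₀ < y → w ∈ {v | fails v 0 S.Tf ≤ y / 2}}

variable {S} {p : unitInterval} {X : ℕ → Set (ℕ → Bool)} {ξ δ δ' : ℝ}

theorem depOn_postRow {τ t : ℕ} (h : ∀ i < S.r, τ + S.V i ≤ t) :
    DepOn {w | S.PostRow τ w} τ t :=
  depOn_forall fun i => depOn_imp fun hi => depOn_forall fun s => depOn_imp fun hs =>
    (depOn_fails (s := τ) (t := τ + s)
      fun k => |(k : ℝ) - S.q * s| ≤ S.ε i).mono le_rfl (by have := h i hi; omega)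

theorem V_le_horizon {i τ : ℕ} (hi : i < S.r) (hτ : τ ≤ S.o S.r + S.W (S.sr + 3)) :
    τ + S.V i ≤ S.horizon := by
  have : S.V i ≤ ∑ i ∈ range S.r, S.V i :=
    single_le_sum (fun _ _ => Nat.zero_le _) (mem_range.2 hi)
  unfold horizon
  omega

theorem Tf_le_add_W : S.Tf ≤ S.o S.r + S.W (S.sr + 3) :=
  Nat.add_le_add_left (S.W_mono (by omega)) _

namespace Likely

variable (H : S.Likely p X ξ δ δ')
include H

theorem T1_le : S.T1 ≤ S.o S.r + S.W (S.sr + 3) :=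
  Nat.add_le_add_left (S.W_mono (by have := H.valid.s₁_lt; omega)) _

theorem postTime_le (j : ℕ) : S.postTime j ≤ S.o S.r + S.W (S.sr + 3) := by
  unfold postTime
  split_ifs
  · exact Tf_le_add_W
  · exact H.T1_le

theorem rowP_postRow_le (τ : ℕ) : rowP p {w | S.PostRow τ w}ᶜ ≤ S.r * δ' := by
  have h1 : {w | S.PostRow τ w}ᶜ ⊆ ⋃ i ∈ range S.r, ⋃ t ∈ range (S.V i + 1),
      ({w | (1 - (p : ℝ)) * t + S.ε i ≤ fails w τ (τ + t)} ∪
        {w | (fails w τ (τ + t) : ℝ) ≤ (1 - p) * t - S.ε i}) := by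
    intro w hw
    simp only [Set.mem_compl_iff, Set.mem_ofPred_eq, PostRow] at hw
    push Not at hw
    obtain ⟨i, hi, t, ht, hc⟩ := hw
    simp only [Set.mem_iUnion, exists_prop, mem_range]
    refine ⟨i, hi, t, by omega, ?_⟩
    rw [H.q_eq] at hc
    rcases lt_abs.1 hc with h | h
    · left
      simp only [Set.mem_ofPred_eq]
      linarith
    · right
      simp only [Set.mem_ofPred_eq]
      linarith
  have hq0 := H.valid.q_nonneg
  calc rowP p {w | S.PostRow τ w}ᶜ ≤ _ := rowP_mono p h1
    _ ≤ ∑ i ∈ range S.r, ∑ _t ∈ range (S.V i + 1),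
        2 * Real.exp (-min (S.ε i / 2) (S.ε i ^ 2 / (4 * (S.q * S.V i + 1)))) := by
      refine (rowP_biUnion_le p _ _).trans (sum_le_sum fun i hi =>
        (rowP_biUnion_le p _ _).trans (sum_le_sum fun t ht => ?_))
      have hi := mem_range.1 hi
      have ht : (t : ℝ) ≤ S.V i := by
        have := mem_range.1 ht
        exact_mod_cast (show t ≤ S.V i by omega)
      have hv : (1 - (p : ℝ)) * t ≤ S.q * S.V i + 1 := by
        rw [← H.q_eq]
        have := mul_le_mul_of_nonneg_left ht hq0
        linarith
      have hv0 : 0 < S.q * S.V i + 1 := by positivity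
      have h2 := rowP_upper p (H.ε_nonneg i hi) hv0 τ t hv
      have h3 := rowP_lower p (H.ε_nonneg i hi) hv0 τ t hv
      have h4 := rowP_union_le p {w | (1 - (p : ℝ)) * t + S.ε i ≤ fails w τ (τ + t)}
        {w | (fails w τ (τ + t) : ℝ) ≤ (1 - p) * t - S.ε i}
      linarith
    _ ≤ ∑ _i ∈ range S.r, δ' := by
      refine sum_le_sum fun i hi => le_trans (le_of_eq ?_) (H.post_le i (mem_range.1 hi))
      rw [sum_const, card_range, nsmul_eq_mul]
      push_cast
      ring
    _ = _ := by simp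

theorem rowP_far_le {y : ℕ} (hy : S.Y₀ < y) : rowP p {v | fails v 0 S.Tf ≤ y / 2}ᶜ ≤ δ' := by
  have hy' : (S.Y₀ : ℝ) ≤ y := by exact_mod_cast hy.le
  have hy0 : (0 : ℝ) < y := by exact_mod_cast (Nat.zero_le _).trans_lt hy
  have h0 := H.Y₀_ge
  have h1 : {v | fails v 0 S.Tf ≤ y / 2}ᶜ ⊆
      {v | (1 - (p : ℝ)) * S.Tf + y / 8 ≤ fails v 0 (0 + S.Tf)} := by
    intro v hv
    simp only [Set.mem_compl_iff, Set.mem_ofPred_eq, not_le, zero_add] at hv ⊢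
    rw [← H.q_eq]
    have : (y : ℝ) ≤ 2 * fails v 0 S.Tf := by exact_mod_cast (show y ≤ 2 * fails v 0 S.Tf by omega)
    linarith
  refine (rowP_mono p h1).trans ((rowP_upper p (x := y / 8) (V := y) (by positivity) hy0 0 S.Tf
    ?_).trans ((Real.exp_le_exp.2 ?_).trans H.far_le))
  · rw [← H.q_eq]
    linarith
  · rw [neg_le_neg_iff]
    refine le_min (by linarith) ?_
    rw [le_div_iff₀ (by positivity)]
    nlinarith

theorem rowP_rel_le {j : ℕ} (hj : j ≤ S.r) : rowP p {w | S.RelRow j w}ᶜ ≤ 2 * δ := by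
  have hU := H.valid.U_pos
  have hΛ : 40 ≤ S.Λ := by
    have := H.valid.Λ_big
    linarith [show (0 : ℝ) ≤ 24 * S.r by positivity]
  have h1 : {w | S.RelRow j w}ᶜ ⊆ {w | fails w (S.h j) (S.o j) ≤ S.m j}ᶜ ∪
      ⋃ k ∈ range (4 ^ (S.sr + 2) + 1),
        {w | (1 - (p : ℝ)) * (k * S.U : ℕ) + S.Λ * (S.φ (k * S.U) + 2 ^ S.σ₀) ≤
          fails w (S.o j) (S.o j + k * S.U)} := by
    intro w hw
    by_cases hc : fails w (S.h j) (S.o j) ≤ S.m j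
    · right
      have : ¬ ∀ k ≤ 4 ^ (S.sr + 2), (fails w (S.o j) (S.o j + k * S.U) : ℝ) ≤
          S.q * (k * S.U) + S.Λ * (S.φ (k * S.U) + 2 ^ S.σ₀) := fun h => hw ⟨hc, h⟩
      push Not at this
      obtain ⟨k, hk, h⟩ := this
      simp only [Set.mem_iUnion, exists_prop, mem_range]
      refine ⟨k, by omega, ?_⟩
      simp only [Set.mem_ofPred_eq]
      rw [← H.q_eq]
      push_cast
      exact h.le
    · exact Or.inl hc
  refine (rowP_mono p h1).trans ((rowP_union_le p _ _).trans ?_)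
  have h2 : rowP p (⋃ k ∈ range (4 ^ (S.sr + 2) + 1),
        {w | (1 - (p : ℝ)) * (k * S.U : ℕ) + S.Λ * (S.φ (k * S.U) + 2 ^ S.σ₀) ≤
          fails w (S.o j) (S.o j + k * S.U)}) ≤ δ := by
    refine (rowP_biUnion_le p _ _).trans (le_trans (sum_le_sum fun k _ =>
      (?_ : _ ≤ Real.exp (-(S.Λ / 2)))) (le_trans (le_of_eq ?_) H.rel_le))
    · set f := S.φ (k * S.U) + 2 ^ S.σ₀ with hf
      have hf1 : 1 ≤ f := by
        have := S.φ_nonneg (k * S.U)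
        have : (1 : ℝ) ≤ 2 ^ S.σ₀ := one_le_pow₀ (by norm_num)
        linarith
      have hfU : ((k * S.U : ℕ) : ℝ) ≤ 4 * S.U * f ^ 2 := le_drift_sq hU _
      have hq := H.valid.qU
      have hq0 := H.valid.q_nonneg
      refine (rowP_upper p (x := S.Λ * f) (V := 8 * f ^ 2) (by positivity) (by positivity) _ _
        ?_).trans (Real.exp_le_exp.2 ?_)
      · rw [← H.q_eq]
        have := mul_le_mul_of_nonneg_left hfU hq0
        nlinarith [sq_nonneg f]
      · rw [neg_le_neg_iff]
        refine le_min (by nlinarith) ?_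
        rw [le_div_iff₀ (by positivity)]
        nlinarith [sq_nonneg f, sq_nonneg (S.Λ * f)]
    · rw [sum_const, card_range, nsmul_eq_mul]
      push_cast
      ring
  linarith [H.sleep_le j hj]

theorem tube_end_le {j : ℕ} (hj : j ≤ S.r) (hj0 : j ≠ 0) :
    S.o j + win S.U S.σ₀ (S.sig j + 1) ≤ S.postTime j := by
  have h1 := H.valid.o_le j S.r hj le_rfl
  have h2 := H.valid.s₁_lt
  unfold postTime
  split_ifs with h
  · subst h
    unfold Tf W sig
    rw [if_neg hj0, if_pos rfl]
  · have h3 : win S.U S.σ₀ (S.sig j + 1) ≤ S.W (S.s₁ + 2 * S.r) := by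
      refine win_mono ?_
      unfold sig
      rw [if_neg hj0, if_neg h]
      omega
    unfold T1
    omega

theorem tube_end_le' {j : ℕ} (hj : j ≤ S.r) :
    S.o j + win S.U S.σ₀ (S.sig j + 1) ≤ S.horizon := by
  have h1 := H.valid.o_le j S.r hj le_rfl
  have h2 := H.valid.s₁_lt
  have h3 : win S.U S.σ₀ (S.sig j + 1) ≤ S.W (S.sr + 3) := by
    refine win_mono ?_
    unfold sig
    split_ifs <;> omega
  unfold horizon
  omega

theorem o_le_horizon {j : ℕ} (hj : j ≤ S.r) : S.o j ≤ S.horizon := by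
  have := H.tube_end_le' hj
  omega

theorem depOn_post (j : ℕ) : DepOn {w | j ≠ 0 → w ∈ {v | S.PostRow (S.postTime j) v}}
    (S.postTime j) S.horizon :=
  depOn_imp fun _ => depOn_postRow fun _ hi => V_le_horizon hi (H.postTime_le j)

theorem two_mul_δ'_le : 2 * (S.r * δ') ≤ 1 := by
  have h1 := H.small
  have h2 := H.δ_nonneg
  have h3 := H.δ'_nonneg
  have h4 := H.le_n_pow S.r le_rfl
  have h5 : (1 : ℝ) ≤ S.n S.r := by
    rcases Nat.eq_zero_or_pos (S.n S.r) with h | h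
    · rw [h] at h4
      norm_num at h4
    · exact_mod_cast h
  have h6 : ((1 : ℝ) / 4) ^ (S.r + 1) ≤ 1 := pow_le_one₀ (by norm_num) (by norm_num)
  have h7 : 0 ≤ (S.r + 1) * (2 * δ) * (S.Y₀ + S.h S.r * (2 * S.r + 4)) := by positivity
  have h8 : 1 * ((S.r + 1) * δ') ≤ S.n S.r * ((S.r + 1) * δ') := by gcongr
  linarith

/-- The probability of the coins of an anchor, relative to the probability of its first success. -/
theorem le_rowP_anchor {j : ℕ} (hj : j ≤ S.r) : p * (1 - p) ^ S.h j *
    (ξ * ((1 / 4 * Real.exp (-(S.c S.r ^ 2 / (3 * p)))) ^ (S.sr + 3) * (1 / 2))) ≤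
      rowP p ((S.rowEvents X).A j) := by
  have N := H.valid
  have hp0 := H.p_pos
  have hp1 : (p : ℝ) ≤ 1 := p.2.2
  have hc0 := N.c_nonneg S.r
  have hcs : 2 * S.c S.r ≤ 3 * 2 ^ S.σ₀ * p := by
    have := N.c_small
    rw [H.q_eq, sub_sub_cancel] at this
    linarith
  have hcj : S.c j ≤ S.c S.r := by
    unfold c
    have : (j : ℝ) ≤ S.r := by exact_mod_cast hj
    linarith
  have hσ := N.σ₀_le_sig hj
  have hsig : S.sig j + 1 ≤ S.sr + 3 := by
    have := N.s₁_lt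
    unfold sig
    split_ifs <;> omega
  have h1 := le_rowP_tube hp0 H.q_eq H.U_ge N.qU hc0 hcs (N.c_nonneg j) hcj hσ (S.o j)
  have h2 : (1 : ℝ) / 2 ≤ rowP p {w | j ≠ 0 → w ∈ {v | S.PostRow (S.postTime j) v}} := by
    have h3 := rowP_compl p (H.depOn_post j)
    have h4 : rowP p {w | j ≠ 0 → w ∈ {v | S.PostRow (S.postTime j) v}}ᶜ ≤ S.r * δ' := by
      refine (rowP_mono p ?_).trans (H.rowP_postRow_le (S.postTime j))
      rw [Set.compl_subset_compl]
      exact fun w hw _ => hw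
    linarith [H.two_mul_δ'_le]
  have h3 : (1 / 4 * Real.exp (-(S.c S.r ^ 2 / (3 * p)))) ^ (S.sr + 3) ≤
      (1 / 4 * Real.exp (-(S.c S.r ^ 2 / (3 * p)))) ^ (S.sig j + 1) := by
    refine pow_le_pow_of_le_one (by positivity) ?_ hsig
    have : Real.exp (-(S.c S.r ^ 2 / (3 * p))) ≤ 1 := Real.exp_le_one_iff.2 (by
      have : 0 ≤ S.c S.r ^ 2 / (3 * p) := by positivity
      linarith)
    linarith
  have hT : rowP p (Tube S.q (S.c j) S.U S.σ₀ (S.o j) (S.sig j)) * (1 / 2) ≤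
      rowP p (Tube S.q (S.c j) S.U S.σ₀ (S.o j) (S.sig j) ∩
        {w | j ≠ 0 → w ∈ {v | S.PostRow (S.postTime j) v}}) := by
    by_cases hj0 : j = 0
    · have : {w : ℕ → Bool | j ≠ 0 → w ∈ {v | S.PostRow (S.postTime j) v}} = Set.univ :=
        Set.eq_univ_of_forall fun w h => absurd hj0 h
      rw [this, Set.inter_univ]
      linarith [rowP_nonneg p (Tube S.q (S.c j) S.U S.σ₀ (S.o j) (S.sig j))]
    · rw [rowP_inter p (depOn_tube hσ) (H.depOn_post j) (H.tube_end_le hj hj0)]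
      exact mul_le_mul_of_nonneg_left h2 (rowP_nonneg p _)
  have hdep : DepOn (Tube S.q (S.c j) S.U S.σ₀ (S.o j) (S.sig j) ∩
      {w | j ≠ 0 → w ∈ {v | S.PostRow (S.postTime j) v}}) (S.o j) S.horizon := by
    by_cases hj0 : j = 0
    · have : {w : ℕ → Bool | j ≠ 0 → w ∈ {v | S.PostRow (S.postTime j) v}} = Set.univ :=
        Set.eq_univ_of_forall fun w h => absurd hj0 h
      rw [this, Set.inter_univ]
      exact (depOn_tube hσ).mono le_rfl (H.tube_end_le' hj)
    · exact ((depOn_tube hσ).mono le_rfl (H.tube_end_le' hj)).inter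
        ((H.depOn_post j).mono (by have := H.tube_end_le hj hj0; omega) le_rfl)
  change _ ≤ rowP p (First (S.h j) ∩ (X j ∩ _))
  have ho := N.h_lt_o j hj
  rw [rowP_inter p (depOn_first _) (((H.X_dep j hj).mono le_rfl (H.o_le_horizon hj)).inter
    (hdep.mono ho le_rfl)) le_rfl, rowP_first,
    rowP_inter p (H.X_dep j hj) hdep le_rfl]
  refine mul_le_mul_of_nonneg_left ?_ (mul_nonneg hp0.le (pow_nonneg (by linarith) _))
  refine mul_le_mul (H.le_X j hj) (le_trans ?_ hT) (by positivity) (rowP_nonneg p _)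
  exact mul_le_mul_of_nonneg_right (h3.trans h1) (by norm_num)

theorem bounds : (S.rowEvents X).Bounds p
    (ξ * ((1 / 4 * Real.exp (-(S.c S.r ^ 2 / (3 * p)))) ^ (S.sr + 3) * (1 / 2)))
    (2 * δ) ((S.r + 1) * δ') where
  p_pos := H.p_pos
  p_lt := by
    have h1 := H.U_ge
    have h2 := H.q_eq
    by_contra hc
    have : S.q * S.U ≤ 0 :=
      mul_nonpos_of_nonpos_of_nonneg (by linarith [not_lt.1 hc]) (by positivity)
    linarith
  β_nonneg := by
    have := H.ξ_nonneg
    positivity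
  δ_nonneg := by linarith [H.δ_nonneg]
  h_lt := H.valid.h_lt
  h_le j hj := by
    have h1 := H.o_le_horizon hj
    have h2 := H.valid.h_lt_o j hj
    exact h2.le.trans h1
  n_le i j hij hj := by
    have := H.valid.n_mul_le i j hij hj
    change 2 * S.n i ≤ S.n j
    omega
  n_pow_le := H.n_pow_le
  le_n_pow := H.le_n_pow
  pow_le := H.pow_le
  A_dep j hj := by
    have h1 := H.o_le_horizon hj
    have h2 := H.valid.h_lt_o j hj
    refine ((depOn_first _).mono le_rfl (by change _ ≤ S.horizon; omega)).inter
      (((H.X_dep j hj).mono (Nat.zero_le _) h1).inter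
      (((depOn_tube (H.valid.σ₀_le_sig hj)).mono (Nat.zero_le _) (H.tube_end_le' hj)).inter
        ((H.depOn_post j).mono (Nat.zero_le _) le_rfl)))
  A_sub j _ := Set.inter_subset_left
  le_A _ hj := H.le_rowP_anchor hj
  R_dep j hj := by
    have h1 := H.valid.h_lt_o j hj
    have h2 := H.valid.o_le j S.r hj le_rfl
    refine DepOn.inter ((depOn_fails (s := S.h j) (t := S.o j) fun k => k ≤ S.m j).mono le_rfl
      (H.o_le_horizon hj)) ?_
    refine depOn_forall fun k => depOn_imp fun hk => (depOn_fails (s := S.o j)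
      (t := S.o j + k * S.U) fun x => (x : ℝ) ≤ S.q * (k * S.U) +
      S.Λ * (S.φ (k * S.U) + 2 ^ S.σ₀)).mono h1.le ?_
    have h3 : k * S.U ≤ S.W (S.sr + 3) := by
      unfold W win
      rw [mul_comm]
      refine Nat.mul_le_mul_left _ (hk.trans ?_)
      have h4 : 4 ^ S.σ₀ ≤ 4 ^ (S.sr + 2) := by
        have := H.valid.σ₀_lt
        have := H.valid.s₁_lt
        exact Nat.pow_le_pow_right (by norm_num) (by omega)
      have h5 : 4 ^ (S.sr + 3) = 4 * 4 ^ (S.sr + 2) := by ring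
      omega
    change _ ≤ S.horizon
    unfold horizon
    omega
  R_le _ hj := H.rowP_rel_le hj
  D_dep y := by
    refine DepOn.inter ((depOn_postRow fun i hi => V_le_horizon hi H.T1_le).mono
      (Nat.zero_le _) le_rfl) (depOn_imp fun _ => (depOn_fails (s := 0) (t := S.Tf)
        fun k => k ≤ y / 2).mono le_rfl ?_)
    exact Tf_le_add_W.trans (Nat.le_add_right _ _)
  D_le y _ _ := by
    have h1 := H.rowP_postRow_le S.T1
    have hδ' := H.δ'_nonneg
    change rowP p ({w | S.PostRow S.T1 w} ∩ {w | S.Y₀ < y → w ∈ {v | fails v 0 S.Tf ≤ y / 2}})ᶜ ≤ _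
    rw [Set.compl_inter]
    refine (rowP_union_le p _ _).trans ?_
    have h2 : rowP p {w | S.Y₀ < y → w ∈ {v | fails v 0 S.Tf ≤ y / 2}}ᶜ ≤ δ' := by
      by_cases hy : S.Y₀ < y
      · refine (rowP_mono p ?_).trans (H.rowP_far_le hy)
        rw [Set.compl_subset_compl]
        exact fun w hw _ => hw
      · have : {w : ℕ → Bool | S.Y₀ < y → w ∈ {v | fails v 0 S.Tf ≤ y / 2}}ᶜ = ∅ := by
          rw [Set.compl_empty_iff]
          exact Set.eq_univ_of_forall fun w h => absurd h hy
        rw [this]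
        simpa [rowP] using hδ'
    linarith
  small := H.small

theorem config {b : Fin (S.r + 1) → ℕ} {w : ℕ → ℕ → Bool}
    (hw : (S.rowEvents X).Anchored b w) :
    S.Config (fun j => if h : j < S.r + 1 then b ⟨j, h⟩ else 0) w := by
  have N := H.valid
  have ha : ∀ j (h : j ≤ S.r),
      (fun j => if h : j < S.r + 1 then b ⟨j, h⟩ else 0) j = b ⟨j, Nat.lt_succ_of_le h⟩ :=
    fun j h => dif_pos (Nat.lt_succ_of_le h)
  have hne : ∀ {y : ℕ}, (∀ i ≤ S.r, y ≠ (fun j => if h : j < S.r + 1 then b ⟨j, h⟩ else 0) i) →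
      ∀ i, y ≠ b i := by
    intro y hy i
    have := hy i (Nat.lt_succ_iff.1 i.2)
    rwa [ha _ (Nat.lt_succ_iff.1 i.2)] at this
  have hanchor : ∀ j (h : j ≤ S.r),
      w ((fun j => if h : j < S.r + 1 then b ⟨j, h⟩ else 0) j) ∈ (S.rowEvents X).A j := by
    intro j h
    rw [ha j h]
    exact hw.anchor ⟨j, Nat.lt_succ_of_le h⟩
  have hmem : ∀ j (h : j ≤ S.r), (fun j => if h : j < S.r + 1 then b ⟨j, h⟩ else 0) j ∈
      Ioc (S.n j / 2) (S.n j) := by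
    intro j h
    rw [ha j h]
    exact hw.mem ⟨j, Nat.lt_succ_of_le h⟩
  generalize (fun j => if h : j < S.r + 1 then b ⟨j, h⟩ else 0) = a at *
  refine ⟨fun j hj => ?_, fun j hj => (mem_Ioc.1 (hmem j hj)).2, fun j hj => ?_, ?_, ?_, ?_, ?_, ?_⟩
  · have := (mem_Ioc.1 (hmem j hj)).1
    omega
  · obtain ⟨h1, h2, h3, h4⟩ := hanchor j hj
    exact ⟨h1.1, h1.2, H.X_fails j hj _ h2, TubeRow.of_near N.U_pos (N.σ₀_le_sig hj) h3.1 h3.2, h4⟩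
  · rcases H.X_early with h | ⟨h, h'⟩
    · exact Or.inl fun j hj => h j hj _ (hanchor j hj).2.1
    · exact Or.inr ⟨h, fun i j hij hj => h' i j hij hj _ (hanchor i (hij.le.trans hj)).2.1 _
        (hanchor j hj).2.1⟩
  · exact fun y hy hya j hj hyj => hw.before y hy (hne hya) j hj hyj
  · intro y hy hya j hj hyj
    have hn : S.n j ≤ S.n S.r := by
      rcases hj.lt_or_eq with h | rfl
      · have := N.n_mul_le j S.r h le_rfl
        omega
      · exact le_rfl
    exact hw.rel y hy (hyj.trans hn) (hne hya) j hj hyj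
  · exact fun y hy hya hyr => (hw.typical y (by omega) hyr (hne hya)).2 hy
  · exact fun y hy hya hyr => (hw.typical y hy hyr (hne hya)).1

/-- A configuration of anchors exists with a probability that does not depend on the scales of the
anchors, and it keeps the last anchor from settling for a long time. -/
theorem le_coinP : (p * (ξ * ((1 / 4 * Real.exp (-(S.c S.r ^ 2 / (3 * p)))) ^ (S.sr + 3) *
    (1 / 2))) / 16) ^ (S.r + 1) / 2 ≤
      coinP p {w | ∃ y ≤ S.n S.r, lev w S.Tend y < y} := by
  refine H.bounds.le_coinP_exists_anchored.trans (coinP_mono p ?_)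
  rintro w ⟨b, hb⟩
  have C := H.config hb
  exact ⟨_, C.a_le S.r le_rfl, C.lev_lt H.valid⟩

end Likely

end Scales

end TamariLevels

namespace TamariLevels

open Finset MeasureTheory

/-! ### Prescribed numbers of failures -/

section

variable (p : unitInterval)

theorem rowP_fails_eq_zero (s n : ℕ) :
    rowP p {w | fails w s (s + n) = 0} = (p : ℝ) ^ n := by
  induction n generalizing s with
  | zero =>
    rw [pow_zero, ← rowP_univ p]
    congr 1
    exact Set.eq_univ_of_forall fun w => by simp [fails]
  | succ n ih =>
    rw [rowP_split p (A0 := ∅) (A1 := {w | fails w (s + 1) (s + 1 + n) = 0}) (τ := s)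
      (t := s + 1 + n) (fun _ _ _ => Iff.rfl) (depOn_fails fun k => k = 0), ih]
    · rw [show rowP p ∅ = 0 by simp [rowP], pow_succ]
      ring
    · intro w hw
      simp only [Set.mem_ofPred_eq, Set.mem_empty_iff_false, iff_false]
      rw [fails_succ_left (by omega), if_pos hw]
      omega
    · intro w hw
      simp only [Set.mem_ofPred_eq]
      rw [fails_succ_left (show s < s + (n + 1) by omega), if_neg (by simp [hw]),
        show s + (n + 1) = s + 1 + n by omega]
      omega

theorem rowP_fails_eq_length (s n : ℕ) :
    rowP p {w | fails w s (s + n) = n} = (1 - (p : ℝ)) ^ n := by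
  induction n generalizing s with
  | zero =>
    rw [pow_zero, ← rowP_univ p]
    congr 1
    exact Set.eq_univ_of_forall fun w => by simp [fails]
  | succ n ih =>
    rw [rowP_split p (A0 := {w | fails w (s + 1) (s + 1 + n) = n}) (A1 := ∅) (τ := s)
      (t := s + 1 + n) (depOn_fails fun k => k = n) (fun _ _ _ => Iff.rfl), ih]
    · rw [show rowP p ∅ = 0 by simp [rowP], pow_succ]
      ring
    · intro w hw
      simp only [Set.mem_ofPred_eq]
      rw [fails_succ_left (show s < s + (n + 1) by omega), if_pos hw,
        show s + (n + 1) = s + 1 + n by omega]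
      omega
    · intro w hw
      simp only [Set.mem_ofPred_eq, Set.mem_empty_iff_false, iff_false]
      rw [fails_succ_left (show s < s + (n + 1) by omega), if_neg (by simp [hw]),
        show s + (n + 1) = s + 1 + n by omega]
      have := succs_add_fails w (s + 1) (s + 1 + n)
      omega

theorem le_rowP_fails_eq_one (s n : ℕ) :
    (n : ℝ) * (1 - (p : ℝ)) * (p : ℝ) ^ n ≤ rowP p {w | fails w s (s + n) = 1} := by
  have hp0 := p.2.1
  have hp1 := p.2.2
  induction n generalizing s with
  | zero => simpa using rowP_nonneg p _
  | succ n ih =>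
    rw [rowP_split p (A0 := {w | fails w (s + 1) (s + 1 + n) = 0})
      (A1 := {w | fails w (s + 1) (s + 1 + n) = 1}) (τ := s)
      (t := s + 1 + n) (depOn_fails fun k => k = 0) (depOn_fails fun k => k = 1),
      rowP_fails_eq_zero]
    · have h1 := mul_le_mul_of_nonneg_left (ih (s + 1)) hp0
      have h2 : (1 - (p : ℝ)) * p ^ (n + 1) ≤ (1 - p) * p ^ n :=
        mul_le_mul_of_nonneg_left (pow_le_pow_of_le_one hp0 hp1 (Nat.le_succ n)) (by linarith)
      calc ((n + 1 : ℕ) : ℝ) * (1 - p) * (p : ℝ) ^ (n + 1)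
          = p * (n * (1 - p) * p ^ n) + (1 - p) * p ^ (n + 1) := by push_cast; ring
        _ ≤ _ := by linarith
    · intro w hw
      simp only [Set.mem_ofPred_eq]
      rw [fails_succ_left (show s < s + (n + 1) by omega), if_pos hw,
        show s + (n + 1) = s + 1 + n by omega]
      omega
    · intro w hw
      simp only [Set.mem_ofPred_eq]
      rw [fails_succ_left (show s < s + (n + 1) by omega), if_neg (by simp [hw]),
        show s + (n + 1) = s + 1 + n by omega]
      omega

theorem one_sub_mul_le (n : ℕ) : 1 - (1 - (p : ℝ)) * n ≤ (p : ℝ) ^ n := by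
  have h := one_add_mul_le_pow (show (-2 : ℝ) ≤ -(1 - p) by linarith [p.2.1]) n
  rw [show 1 + -(1 - (p : ℝ)) = p by ring] at h
  linarith

/-- The event that there is exactly one failure in each of `k` consecutive blocks of `b` coins. -/
def Blocks (b k s : ℕ) : Set (ℕ → Bool) :=
  {w | ∀ i < k, fails w (s + i * b) (s + i * b + b) = 1}

theorem depOn_blocks (b k s : ℕ) : DepOn (Blocks b k s) s (s + k * b) := by
  refine depOn_forall fun i => depOn_imp fun hi =>
    (depOn_fails fun x => x = 1).mono (Nat.le_add_right _ _) ?_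
  have : (i + 1) * b ≤ k * b := Nat.mul_le_mul_right b hi
  linarith

theorem fails_of_blocks {b k s : ℕ} {w : ℕ → Bool} (h : w ∈ Blocks b k s) :
    fails w s (s + k * b) = k := by
  induction k with
  | zero => simp [fails]
  | succ k ih =>
    rw [fails_split w (show s ≤ s + k * b by omega)
      (show s + k * b ≤ s + (k + 1) * b by rw [add_mul]; omega),
      ih fun i hi => h i (by omega), add_mul, one_mul, ← add_assoc, h k (by omega)]

theorem le_rowP_blocks (b k s : ℕ) :
    ((b : ℝ) * (1 - (p : ℝ)) * (p : ℝ) ^ b) ^ k ≤ rowP p (Blocks b k s) := by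
  induction k with
  | zero =>
    rw [pow_zero, ← rowP_univ p]
    exact rowP_mono p fun w _ i hi => absurd hi (by omega)
  | succ k ih =>
    have h0 := mul_nonneg (mul_nonneg (Nat.cast_nonneg b) (sub_nonneg.2 p.2.2)) (pow_nonneg p.2.1 b)
    have e : Blocks b (k + 1) s =
        Blocks b k s ∩ {w | fails w (s + k * b) (s + k * b + b) = 1} := by
      ext w
      constructor
      · exact fun h => ⟨fun i hi => h i (by omega), h k (by omega)⟩
      · rintro ⟨h, h'⟩ i hi
        rcases Nat.lt_succ_iff_lt_or_eq.1 hi with h4 | rfl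
        · exact h i h4
        · exact h'
    rw [e, rowP_inter p (depOn_blocks b k s) (depOn_fails fun x => x = 1) le_rfl, pow_succ]
    exact mul_le_mul ih (le_rowP_fails_eq_one p _ _) h0 (rowP_nonneg p _)

/-- The event that there are no failures in `[s, t)` but `k`, which occur in the blocks after `E`. -/
def Spread (b k s E t : ℕ) : Set (ℕ → Bool) :=
  {w | fails w s E = 0} ∩ (Blocks b k E ∩ {w | fails w (E + k * b) t = 0})

variable {b k s E t : ℕ}

theorem depOn_spread (h1 : s ≤ E) (h2 : E + k * b ≤ t) : DepOn (Spread b k s E t) s t :=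
  ((depOn_fails fun x => x = 0).mono le_rfl (by omega)).inter
    (((depOn_blocks b k E).mono h1 h2).inter ((depOn_fails fun x => x = 0).mono (by omega) le_rfl))

theorem fails_eq_of_spread {w : ℕ → Bool} (h : w ∈ Spread b k s E t) (h1 : s ≤ E) {x : ℕ}
    (h2 : E + k * b ≤ x) (h3 : x ≤ t) : fails w s x = k := by
  obtain ⟨h4, h5, h6⟩ := h
  rw [fails_split w h1 (by omega), fails_split w (show E ≤ E + k * b by omega) h2, h4,
    fails_of_blocks h5]
  have := fails_mono w (E + k * b) h3
  have h7 : fails w (E + k * b) t = 0 := h6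
  omega

theorem fails_le_of_spread {w : ℕ → Bool} (h : w ∈ Spread b k s E t) (h1 : s ≤ E)
    (h2 : E + k * b ≤ t) {x : ℕ} (hx : x ≤ t) : fails w s x ≤ k := by
  rw [← fails_eq_of_spread h h1 h2 le_rfl]
  exact fails_mono w s hx

theorem fails_eq_zero_of_spread {w : ℕ → Bool} (h : w ∈ Spread b k s E t) {x : ℕ} (h2 : x ≤ E) :
    fails w s x = 0 := by
  have := fails_mono w s h2
  have h7 : fails w s E = 0 := h.1
  omega

theorem le_rowP_spread (h1 : s ≤ E) (h2 : E + k * b ≤ t) (hb : b ≤ t)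
    (ht : (1 - (p : ℝ)) * t ≤ 1 / 2) :
    1 / 4 * ((b : ℝ) * (1 - (p : ℝ)) / 2) ^ k ≤ rowP p (Spread b k s E t) := by
  have hq := sub_nonneg.2 p.2.2
  have half : ∀ n ≤ t, 1 / 2 ≤ (p : ℝ) ^ n := by
    intro n hn
    have h3 := one_sub_mul_le p n
    have h4 : (1 - (p : ℝ)) * n ≤ (1 - p) * t :=
      mul_le_mul_of_nonneg_left (by exact_mod_cast hn) hq
    linarith
  obtain ⟨n₁, rfl⟩ := Nat.exists_eq_add_of_le h1
  obtain ⟨n₂, rfl⟩ := Nat.exists_eq_add_of_le h2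
  unfold Spread
  rw [rowP_inter p (depOn_fails fun x => x = 0) (((depOn_blocks b k (s + n₁)).mono le_rfl
    (Nat.le_add_right _ n₂)).inter ((depOn_fails fun x => x = 0).mono (Nat.le_add_right _ _)
    le_rfl)) le_rfl, rowP_inter p (depOn_blocks b k (s + n₁)) (depOn_fails fun x => x = 0) le_rfl,
    rowP_fails_eq_zero, rowP_fails_eq_zero]
  have e1 := half n₁ (by omega)
  have e2 := half n₂ (by omega)
  have e3 : (b * (1 - (p : ℝ)) / 2) ^ k ≤ rowP p (Blocks b k (s + n₁)) := by
    refine le_trans (pow_le_pow_left₀ (by positivity) ?_ k) (le_rowP_blocks p b k _)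
    have := mul_le_mul_of_nonneg_left (half b hb) (show 0 ≤ b * (1 - (p : ℝ)) by positivity)
    linarith
  calc 1 / 4 * (b * (1 - (p : ℝ)) / 2) ^ k
      = 1 / 2 * ((b * (1 - (p : ℝ)) / 2) ^ k * (1 / 2)) := by ring
    _ ≤ _ := by
      refine mul_le_mul e1 (mul_le_mul e3 e2 (by norm_num) (rowP_nonneg p _)) (by positivity) ?_
      exact pow_nonneg p.2.1 _

end

end TamariLevels

namespace TamariLevels

open Finset MeasureTheory

/-! ### The choice of the parameters -/

theorem mul_pow_four_le_two_pow {l : ℕ} (hl : 100 ≤ l) : 10 ^ 12 * l ^ 4 ≤ 2 ^ l := by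
  induction l, hl using Nat.le_induction with
  | base => norm_num
  | succ l hl ih =>
    have h1 : (l + 1) ^ 4 ≤ 2 * l ^ 4 := by
      have h2 : 4 * l ^ 3 + 6 * l ^ 2 + 4 * l + 1 ≤ l ^ 4 := by
        have h3 : 100 * l ^ 3 ≤ l ^ 4 := by
          rw [pow_succ l 3, mul_comm]
          exact Nat.mul_le_mul_left _ hl
        nlinarith [Nat.zero_le (l ^ 2), Nat.zero_le (l ^ 3)]
      nlinarith
    rw [pow_succ 2 l]
    omega

/-- The parameters of the construction: `l` is of the order of `log log n`, and `P` of the order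
of `1 / p`. The heights `u 0 < ⋯ < u r` grow by a factor of at most `3 / 2`, so that the scales
`Q ^ u j` satisfy `Q ^ u (j + 1) ≤ (Q ^ u j) ^ (3 / 2)`, and the fluctuations of the failures on one
scale are negligible compared with the preceding scale. The largest scale is `Q ^ u r`, and powers
of `G`, which is at least `log n`, serve as bounds for polylogarithmic quantities. -/
structure Setup (p : unitInterval) (l P r σ₀ sr : ℕ) (u : ℕ → ℕ) (Q G : ℝ) : Prop where
  p_pos : (0 : ℝ) < p
  p_lt : (p : ℝ) < 1
  Q_eq : Q = (1 - (p : ℝ))⁻¹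
  G_eq : G = 2 ^ l
  l_ge : 100 ≤ l
  P_ge : 1 ≤ (p : ℝ) * P
  P_le : P ≤ l
  A_ge : 1500 * l * P ≤ 2 ^ σ₀
  A_le : 2 ^ σ₀ ≤ 3000 * l * P
  r_pos : 0 < r
  r_le : r ≤ 4 * l
  u_lt : ∀ j < r, u j < u (j + 1)
  u_cube : ∀ j < r, 2 * u (j + 1) ≤ 3 * u j
  u_step : ∀ j < r, u (j + 1) + 5 * u j ≤ 5 * u (j + 1) + 1
  le_pow : ∀ j < r, Q * G ^ 80 ≤ Q ^ u (j + 1)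
  u_le : u r ≤ 2 ^ (2 * l)
  pow_le_exp : Q ^ u r ≤ Real.exp G
  base : u 0 = 2 ∨ Q ^ u 0 ≤ Q * G ^ 80
  base_ge : Q * G ^ 40 ≤ Q ^ u 0
  sr_ge : min (Q ^ u 0) (Q * G ^ 80) ≤ 8000 * (Q * 4 ^ sr)
  sr_le : 2000 * (Q * 4 ^ sr) ≤ min (Q ^ u 0) (Q * G ^ 80)

/-- The scales for the parameters, depending on the onset `o` and on the number `m`. -/
noncomputable def scales (p : unitInterval) (l P r σ₀ sr : ℕ) (u m o : ℕ → ℕ) : Scales where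
  r := r
  U := ⌈(1 - (p : ℝ))⁻¹⌉₊
  σ₀ := σ₀
  s₁ := 4 * l
  sr := sr
  Y₀ := 1024 * 4 ^ sr
  h := u
  n j := ⌊(1 - (p : ℝ))⁻¹ ^ u j⌋₊
  k j := 16000000 * l ^ 2 * P ^ 2 + j * (150000 * l * P ^ 2)
  m := m
  o := o
  V i := 2 * P * ⌊(1 - (p : ℝ))⁻¹ ^ u (i + 1)⌋₊
  q := 1 - p
  Λ := 1000 * l
  ε i := if i = 0 then p * ((win ⌈(1 - (p : ℝ))⁻¹⌉₊ σ₀ sr : ℝ) -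
    win ⌈(1 - (p : ℝ))⁻¹⌉₊ σ₀ (4 * l + 2 * r)) / 4 else ⌊(1 - (p : ℝ))⁻¹ ^ u i⌋₊ / 32

theorem scales_ε_zero {p : unitInterval} {l P r σ₀ sr : ℕ} {u m o : ℕ → ℕ} :
    (scales p l P r σ₀ sr u m o).ε 0 = p * ((win ⌈(1 - (p : ℝ))⁻¹⌉₊ σ₀ sr : ℝ) -
      win ⌈(1 - (p : ℝ))⁻¹⌉₊ σ₀ (4 * l + 2 * r)) / 4 := by
  simp only [scales, if_true]

theorem scales_ε_of_ne {p : unitInterval} {l P r σ₀ sr : ℕ} {u m o : ℕ → ℕ} {i : ℕ} (hi : i ≠ 0) :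
    (scales p l P r σ₀ sr u m o).ε i = ⌊(1 - (p : ℝ))⁻¹ ^ u i⌋₊ / 32 := by
  simp only [scales, if_neg hi]

/-- The requirements for the coins of the anchors up to the time `o j`. -/
structure Onset (p : unitInterval) (S : Scales) (l P : ℕ) (Q G ξ : ℝ) (X : ℕ → Set (ℕ → Bool)) :
    Prop where
  o_le : ∀ i j, i ≤ j → j ≤ S.r → S.o i ≤ S.o j
  h_lt_o : ∀ j ≤ S.r, S.h j < S.o j
  lead : ∀ i j, i ≤ j → j ≤ S.r → S.o j + S.h i + S.k i ≤ S.o i + S.h j + S.k j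
  m_le : ∀ j ≤ S.r, S.m j + 4000000 * l ^ 2 * P ≤ S.k j
  o_r_le : (S.o S.r : ℝ) ≤ Q * G ^ 10
  ξ_nonneg : 0 ≤ ξ
  X_dep : ∀ j ≤ S.r, DepOn (X j) (S.h j + 1) (S.o j)
  X_fails : ∀ j ≤ S.r, ∀ w ∈ X j, fails w (S.h j + 1) (S.o j) = S.k j
  X_early : (∀ j ≤ S.r, ∀ w ∈ X j, ∀ s, S.h j < s → s < S.o j → w s = false) ∨
    (∀ j ≤ S.r, S.m j = 0) ∧ ∀ i j, i < j → j ≤ S.r → ∀ w ∈ X i, ∀ w' ∈ X j,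
      ∀ s, S.h j < s → s < S.o j → fails w (S.h i + 1) s ≤ fails w' (S.h j + 1) s
  le_X : ∀ j ≤ S.r, ξ ≤ rowP p (X j)
  sleep_le : ∀ j ≤ S.r, rowP p {w | fails w (S.h j) (S.o j) ≤ S.m j}ᶜ ≤ (G ^ 95)⁻¹

namespace Setup

variable {p : unitInterval} {l P r σ₀ sr : ℕ} {u m o : ℕ → ℕ} {Q G ξ : ℝ}
  {X : ℕ → Set (ℕ → Bool)} (H : Setup p l P r σ₀ sr u Q G)
include H

theorem Q_gt : 1 < Q := by
  rw [H.Q_eq]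
  exact (one_lt_inv₀ (by linarith [H.p_lt])).2 (by linarith [H.p_pos])

theorem q_mul_Q : (1 - (p : ℝ)) * Q = 1 := by
  rw [H.Q_eq]
  exact mul_inv_cancel₀ (by linarith [H.p_lt])

theorem poly_le : 10 ^ 12 * (l : ℝ) ^ 4 ≤ G := by
  rw [H.G_eq]
  exact_mod_cast mul_pow_four_le_two_pow H.l_ge

theorem l_ge' : (100 : ℝ) ≤ l := by exact_mod_cast H.l_ge

theorem l_le_sq : (l : ℝ) ^ 2 ≤ (l : ℝ) ^ 4 :=
  pow_le_pow_right₀ (by linarith [H.l_ge']) (by norm_num)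

theorem l_le_l_sq : 100 * (l : ℝ) ≤ (l : ℝ) ^ 2 := by
  have := H.l_ge'
  nlinarith

theorem G_ge : (10 : ℝ) ^ 12 ≤ G := by
  have h1 := H.poly_le
  have h2 := H.l_ge'
  have h3 := H.l_le_sq
  have h4 := H.l_le_l_sq
  linarith

theorem P_pos : 0 < P := by
  rcases Nat.eq_zero_or_pos P with h | h
  · have := H.P_ge
    rw [h] at this
    norm_num at this
  · exact h

theorem P_le' : (P : ℝ) ≤ l := by exact_mod_cast H.P_le

theorem U_ge : Q ≤ (⌈(1 - (p : ℝ))⁻¹⌉₊ : ℝ) := by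
  rw [H.Q_eq]
  exact Nat.le_ceil _

theorem U_le : (⌈(1 - (p : ℝ))⁻¹⌉₊ : ℝ) ≤ 2 * Q := by
  have h1 := Nat.ceil_lt_add_one (show 0 ≤ (1 - (p : ℝ))⁻¹ by
    rw [← H.Q_eq]
    linarith [H.Q_gt])
  rw [← H.Q_eq] at h1 ⊢
  linarith [H.Q_gt]

theorem U_pos : 0 < ⌈(1 - (p : ℝ))⁻¹⌉₊ := by
  have h1 := H.U_ge
  have h2 := H.Q_gt
  exact_mod_cast (show (0 : ℝ) < (⌈(1 - (p : ℝ))⁻¹⌉₊ : ℝ) by linarith)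

theorem four_pow_eq (a : ℕ) : (4 : ℝ) ^ (a * l) = G ^ (2 * a) := by
  rw [H.G_eq, ← pow_mul, show (4 : ℝ) = 2 ^ 2 by norm_num, ← pow_mul]
  congr 1
  ring

theorem G_pow_le {a b : ℕ} (h : a ≤ b) : G ^ a ≤ G ^ b :=
  pow_le_pow_right₀ (by linarith [H.G_ge]) h

theorem G_pow_mul_le {a b : ℕ} (h : a < b) : (10 : ℝ) ^ 12 * G ^ a ≤ G ^ b := by
  refine le_trans ?_ (H.G_pow_le (Nat.succ_le_of_lt h))
  rw [pow_succ' G]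
  exact mul_le_mul_of_nonneg_right H.G_ge (pow_nonneg (by linarith [H.G_ge]) _)

theorem le_four_pow : G ^ 39 ≤ (4 : ℝ) ^ sr := by
  have h1 := H.Q_gt
  have h2 := H.G_ge
  have h3 : Q * G ^ 40 ≤ min (Q ^ u 0) (Q * G ^ 80) :=
    le_min H.base_ge (mul_le_mul_of_nonneg_left (H.G_pow_le (by norm_num)) (by linarith))
  have h4 : Q * (10 ^ 12 * G ^ 39) ≤ Q * (8000 * 4 ^ sr) := by
    have := mul_le_mul_of_nonneg_left (H.G_pow_mul_le (show 39 < 40 by norm_num)) (show 0 ≤ Q by linarith)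
    linarith [H.sr_ge]
  have h5 := le_of_mul_le_mul_left h4 (by linarith)
  have h6 : 0 ≤ G ^ 39 := pow_nonneg (by linarith) _
  linarith

theorem four_pow_le : 2000 * (4 : ℝ) ^ sr ≤ G ^ 80 := by
  have h1 := H.Q_gt
  have h4 : Q * (2000 * 4 ^ sr) ≤ Q * G ^ 80 := by
    linarith [H.sr_le, min_le_right (Q ^ u 0) (Q * G ^ 80)]
  exact le_of_mul_le_mul_left h4 (by linarith)

theorem mul_four_pow_le : 2000 * (Q * 4 ^ sr) ≤ Q ^ u 0 := H.sr_le.trans (min_le_left _ _)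

theorem s₁_lt : 4 * l + 2 * r < sr := by
  have h1 : (4 : ℝ) ^ (12 * l) < 4 ^ sr := by
    rw [H.four_pow_eq 12]
    refine lt_of_lt_of_le ?_ H.le_four_pow
    exact pow_lt_pow_right₀ (by linarith [H.G_ge]) (by norm_num)
  have h2 := (pow_lt_pow_iff_right₀ (show (1 : ℝ) < 4 by norm_num)).1 h1
  have := H.r_le
  omega

theorem u_mono {i j : ℕ} (hij : i ≤ j) (hj : j ≤ r) : u i ≤ u j := by
  induction j, hij using Nat.le_induction with
  | base => exact le_rfl
  | succ j hij ih => exact (ih (by omega)).trans (H.u_lt j (by omega)).le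

theorem u_strict {i j : ℕ} (hij : i < j) (hj : j ≤ r) : u i < u j :=
  (H.u_lt i (by omega)).trans_le (H.u_mono hij hj)

theorem pow_mono {i j : ℕ} (hij : i ≤ j) (hj : j ≤ r) : Q ^ u i ≤ Q ^ u j :=
  pow_le_pow_right₀ H.Q_gt.le (H.u_mono hij hj)

theorem G_pow_le_Q_pow {j : ℕ} (hj : j ≤ r) : G ^ 40 ≤ Q ^ u j := by
  refine le_trans ?_ (H.base_ge.trans (H.pow_mono (Nat.zero_le j) hj))
  exact le_mul_of_one_le_left (pow_nonneg (by linarith [H.G_ge]) _) H.Q_gt.le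

theorem mul_Q_pow_le {j : ℕ} (hj : j < r) : G ^ 16 * Q ^ u j ≤ Q ^ u (j + 1) := by
  have h1 := H.Q_gt
  have hx : 0 < Q ^ u j := pow_pos (by linarith) _
  have hy : 0 < Q ^ u (j + 1) := pow_pos (by linarith) _
  have h2 : Q ^ u (j + 1) * (Q ^ u j) ^ 5 ≤ (Q ^ u (j + 1)) ^ 5 * Q := by
    rw [← pow_mul, ← pow_add, ← pow_mul, ← pow_succ]
    refine pow_le_pow_right₀ h1.le ?_
    have := H.u_step j hj
    omega
  have h3 : Q * (G ^ 80 * (Q ^ u j) ^ 5) ≤ Q * (Q ^ u (j + 1)) ^ 5 := by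
    have := mul_le_mul_of_nonneg_right (H.le_pow j hj) (pow_nonneg hx.le 5)
    linarith
  have h4 := le_of_mul_le_mul_left h3 (by linarith)
  have h5 : (G ^ 16 * Q ^ u j) ^ 5 ≤ (Q ^ u (j + 1)) ^ 5 := by
    rw [mul_pow, ← pow_mul]
    exact h4
  exact le_of_pow_le_pow_left₀ (by norm_num) hy.le h5

theorem mul_Q_pow_le' {i j : ℕ} (hij : i < j) (hj : j ≤ r) : G ^ 16 * Q ^ u i ≤ Q ^ u j :=
  (H.mul_Q_pow_le (by omega)).trans (H.pow_mono hij hj)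

theorem floor_le (j : ℕ) : (⌊(1 - (p : ℝ))⁻¹ ^ u j⌋₊ : ℝ) ≤ Q ^ u j := by
  rw [← H.Q_eq]
  exact Nat.floor_le (pow_nonneg (by linarith [H.Q_gt]) _)

theorem le_floor {j : ℕ} (hj : j ≤ r) : Q ^ u j ≤ 2 * (⌊(1 - (p : ℝ))⁻¹ ^ u j⌋₊ : ℝ) := by
  have h1 := Nat.lt_floor_add_one (Q ^ u j)
  have h2 := H.G_pow_le_Q_pow hj
  have h3 : G ^ 1 ≤ G ^ 40 := H.G_pow_le (by norm_num)
  have h4 := H.G_ge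
  rw [← H.Q_eq]
  rw [pow_one] at h3
  linarith

theorem k_le {j : ℕ} (hj : j ≤ r) :
    16000000 * l ^ 2 * P ^ 2 + j * (150000 * l * P ^ 2) ≤ 17000000 * l ^ 2 * P ^ 2 := by
  have h1 : j ≤ 4 * l := hj.trans H.r_le
  calc _ ≤ 16000000 * l ^ 2 * P ^ 2 + (4 * l) * (150000 * l * P ^ 2) := by gcongr
    _ ≤ _ := by nlinarith [Nat.zero_le (l ^ 2 * P ^ 2)]

theorem k_le_G {j : ℕ} (hj : j ≤ r) :
    ((16000000 * l ^ 2 * P ^ 2 + j * (150000 * l * P ^ 2) : ℕ) : ℝ) ≤ G := by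
  have h1 : ((16000000 * l ^ 2 * P ^ 2 + j * (150000 * l * P ^ 2) : ℕ) : ℝ) ≤
      ((17000000 * l ^ 2 * P ^ 2 : ℕ) : ℝ) := by exact_mod_cast H.k_le hj
  refine h1.trans ?_
  push_cast
  have h2 : (P : ℝ) ^ 2 ≤ (l : ℝ) ^ 2 := pow_le_pow_left₀ (by positivity) H.P_le' 2
  have h3 : (l : ℝ) ^ 2 * (P : ℝ) ^ 2 ≤ (l : ℝ) ^ 4 := by
    calc (l : ℝ) ^ 2 * (P : ℝ) ^ 2 ≤ (l : ℝ) ^ 2 * (l : ℝ) ^ 2 := by gcongr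
      _ = _ := by ring
  linarith [H.poly_le, show (0 : ℝ) ≤ (l : ℝ) ^ 4 by positivity]

theorem u_le' : (u r : ℝ) ≤ G ^ 2 := by
  rw [H.G_eq, ← pow_mul, mul_comm l 2]
  exact_mod_cast H.u_le

theorem lP_le : (l : ℝ) * P ≤ (l : ℝ) ^ 4 := by
  calc (l : ℝ) * P ≤ l * l := mul_le_mul_of_nonneg_left H.P_le' (by positivity)
    _ = (l : ℝ) ^ 2 := by ring
    _ ≤ _ := H.l_le_sq

theorem A_le' : (2 : ℝ) ^ σ₀ ≤ 3000 * (l * P) := by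
  have : ((2 ^ σ₀ : ℕ) : ℝ) ≤ ((3000 * l * P : ℕ) : ℝ) := by exact_mod_cast H.A_le
  push_cast at this
  linarith

theorem A_ge' : 1500 * ((l : ℝ) * P) ≤ (2 : ℝ) ^ σ₀ := by
  have : ((1500 * l * P : ℕ) : ℝ) ≤ ((2 ^ σ₀ : ℕ) : ℝ) := by exact_mod_cast H.A_ge
  push_cast at this
  linarith

theorem σ₀_lt : σ₀ < 4 * l := by
  have h1 : (2 : ℝ) ^ σ₀ < 2 ^ l := by
    rw [← H.G_eq]
    have := H.A_le'
    have := H.lP_le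
    have := H.poly_le
    have : (0 : ℝ) < (l : ℝ) ^ 4 := by
      have := H.l_ge'
      positivity
    linarith
  have := (pow_lt_pow_iff_right₀ (show (1 : ℝ) < 2 by norm_num)).1 h1
  omega

/-- The difference of two window lengths. -/
theorem win_sub_win : (⌈(1 - (p : ℝ))⁻¹⌉₊ : ℝ) * 4 ^ sr / 2 ≤
    (win ⌈(1 - (p : ℝ))⁻¹⌉₊ σ₀ sr : ℝ) - win ⌈(1 - (p : ℝ))⁻¹⌉₊ σ₀ (4 * l + 2 * r) := by
  have h1 := H.σ₀_lt
  have h2 := H.s₁_lt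
  have e1 : 4 ^ σ₀ ≤ 4 ^ sr := Nat.pow_le_pow_right (by norm_num) (by omega)
  have e2 : 4 ^ σ₀ ≤ 4 ^ (4 * l + 2 * r) := Nat.pow_le_pow_right (by norm_num) (by omega)
  unfold win
  rw [Nat.cast_mul, Nat.cast_mul, Nat.cast_sub e1, Nat.cast_sub e2]
  push_cast
  have e3 : (4 : ℝ) ^ (4 * l + 2 * r) * 4 ≤ 4 ^ sr := by
    rw [← pow_succ]
    exact pow_le_pow_right₀ (by norm_num) h2
  have e4 : (0 : ℝ) ≤ ⌈(1 - (p : ℝ))⁻¹⌉₊ := by positivity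
  have e5 : (0 : ℝ) < 4 ^ (4 * l + 2 * r) := by positivity
  nlinarith

variable (hX : Onset p (scales p l P r σ₀ sr u m o) l P Q G ξ X)
include hX

theorem valid : (scales p l P r σ₀ sr u m o).Valid where
  r_pos := H.r_pos
  U_pos := H.U_pos
  q_nonneg := by
    change 0 ≤ 1 - (p : ℝ)
    linarith [H.p_lt]
  q_lt := by
    change 1 - (p : ℝ) < 1
    linarith [H.p_pos]
  qU := by
    change (1 - (p : ℝ)) * (⌈(1 - (p : ℝ))⁻¹⌉₊ : ℝ) ≤ 2
    have := mul_le_mul_of_nonneg_left H.U_le (show 0 ≤ 1 - (p : ℝ) by linarith [H.p_lt])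
    linarith [H.q_mul_Q]
  σ₀_lt := H.σ₀_lt
  s₁_lt := H.s₁_lt
  h_lt _ _ hij hj := H.u_strict hij hj
  o_le := hX.o_le
  h_lt_o := hX.h_lt_o
  lead := hX.lead
  gap i j hij hj := by
    change 48 * (2 : ℝ) ^ σ₀ < (1 - (1 - (p : ℝ))) * (((u j : ℝ) +
      (16000000 * l ^ 2 * P ^ 2 + j * (150000 * l * P ^ 2) : ℕ)) - (u i +
      (16000000 * l ^ 2 * P ^ 2 + i * (150000 * l * P ^ 2) : ℕ)))
    have h1 : (u i : ℝ) ≤ u j := by exact_mod_cast H.u_mono hij.le hj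
    have h2 : (i : ℝ) + 1 ≤ j := by exact_mod_cast hij
    have h3 := H.A_le'
    have h4 := H.P_ge
    have h5 := H.l_ge'
    have hP : (0 : ℝ) < P := by exact_mod_cast H.P_pos
    have hp := H.p_pos
    push_cast
    have h6 : (150000 : ℝ) * l * P ^ 2 ≤ (j - i) * (150000 * l * P ^ 2) :=
      le_mul_of_one_le_left (by positivity) (by linarith)
    have h7 : (150000 : ℝ) * l * P ≤ p * (150000 * l * P ^ 2) := by
      have := mul_le_mul_of_nonneg_left h4 (show (0 : ℝ) ≤ 150000 * l * P by positivity)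
      linarith
    have h8 : (p : ℝ) * (150000 * l * P ^ 2) ≤ p * ((u j - u i : ℝ) + (j - i) * (150000 * l * P ^ 2)) :=
      mul_le_mul_of_nonneg_left (by linarith) hp.le
    have h9 : (0 : ℝ) < l * P := by positivity
    linarith
  c_small := by
    change 2 * (2 * (1000 * (l : ℝ)) + 24 * (r : ℝ) + 12) ≤ 3 * (2 : ℝ) ^ σ₀ * (1 - (1 - (p : ℝ)))
    have h1 : (r : ℝ) ≤ 4 * l := by exact_mod_cast H.r_le
    have h2 := mul_le_mul_of_nonneg_right H.A_ge' H.p_pos.le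
    have h3 := mul_le_mul_of_nonneg_left H.P_ge (show (0 : ℝ) ≤ 1500 * l by positivity)
    have h4 := H.l_ge'
    linarith
  Λ_big := by
    change 24 * (r : ℝ) + 40 ≤ 1000 * l
    have h1 : (r : ℝ) ≤ 4 * l := by exact_mod_cast H.r_le
    have h4 := H.l_ge'
    linarith
  sleep j hj := by
    have h1 : ((m j + 4000000 * l ^ 2 * P : ℕ) : ℝ) ≤ (scales p l P r σ₀ sr u m o).k j := by
      exact_mod_cast hX.m_le j hj
    push_cast at h1
    change (m j : ℝ) + 1 + 1000 * l * (1 + 2 ^ σ₀) + 12 * 2 ^ σ₀ < _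
    have h2 := H.A_le'
    have h3 := H.l_ge'
    have hP : (1 : ℝ) ≤ P := by exact_mod_cast H.P_pos
    have h4 := mul_le_mul_of_nonneg_left h2 (show (0 : ℝ) ≤ 1000 * l by positivity)
    have h5 : (l : ℝ) * P * 100 ≤ (l : ℝ) ^ 2 * P := by
      have := mul_le_mul_of_nonneg_left h3 (show (0 : ℝ) ≤ l * P by positivity)
      linarith
    have h6 : (l : ℝ) * 1 ≤ l * P := by gcongr
    linarith
  s₁_big := by
    change u r + (16000000 * l ^ 2 * P ^ 2 + r * (150000 * l * P ^ 2)) < 2 ^ (4 * l)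
    have h1 := H.u_le'
    have h2 := H.k_le_G le_rfl
    have h3 : G * G ≤ G ^ 2 := by rw [sq]
    have h4 := H.G_ge
    have h5 : G ^ 2 * (10 ^ 12) ≤ G ^ 3 := by
      have := H.G_pow_mul_le (show 2 < 3 by norm_num)
      linarith
    have h6 : G ^ 3 ≤ G ^ 4 := H.G_pow_le (by norm_num)
    have h7 : G ^ 4 = 2 ^ (4 * l) := by rw [H.G_eq, ← pow_mul, mul_comm]
    have h8 : ((u r + (16000000 * l ^ 2 * P ^ 2 + r * (150000 * l * P ^ 2)) : ℕ) : ℝ) <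
        ((2 ^ (4 * l) : ℕ) : ℝ) := by
      rw [Nat.cast_add, Nat.cast_pow, Nat.cast_ofNat, ← h7]
      nlinarith
    exact_mod_cast h8
  n_mul_le i j hij hj := by
    change 100 * ⌊(1 - (p : ℝ))⁻¹ ^ u i⌋₊ ≤ ⌊(1 - (p : ℝ))⁻¹ ^ u j⌋₊
    have h1 := H.floor_le i
    have h2 := H.le_floor hj
    have h3 := H.mul_Q_pow_le' hij hj
    have h4 : G ^ 1 ≤ G ^ 16 := H.G_pow_le (by norm_num)
    rw [pow_one] at h4
    have h5 : 0 < Q ^ u i := pow_pos (by linarith [H.Q_gt]) _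
    have h6 : 200 * Q ^ u i ≤ G ^ 16 * Q ^ u i :=
      mul_le_mul_of_nonneg_right (by linarith [H.G_ge]) h5.le
    have h7 : 100 * (⌊(1 - (p : ℝ))⁻¹ ^ u i⌋₊ : ℝ) ≤ (⌊(1 - (p : ℝ))⁻¹ ^ u j⌋₊ : ℝ) := by linarith
    exact_mod_cast h7
  Tf_le := by
    change 4 * (o r + win ⌈(1 - (p : ℝ))⁻¹⌉₊ σ₀ (sr + 1)) + 8 ≤ ⌊(1 - (p : ℝ))⁻¹ ^ u 0⌋₊
    have h1 : (win ⌈(1 - (p : ℝ))⁻¹⌉₊ σ₀ (sr + 1) : ℝ) ≤ 2 * Q * (4 * 4 ^ sr) := by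
      have : win ⌈(1 - (p : ℝ))⁻¹⌉₊ σ₀ (sr + 1) ≤ ⌈(1 - (p : ℝ))⁻¹⌉₊ * 4 ^ (sr + 1) :=
        Nat.mul_le_mul_left _ (Nat.sub_le _ _)
      have h2 : (win ⌈(1 - (p : ℝ))⁻¹⌉₊ σ₀ (sr + 1) : ℝ) ≤
          (⌈(1 - (p : ℝ))⁻¹⌉₊ * 4 ^ (sr + 1) : ℕ) := by exact_mod_cast this
      refine h2.trans ?_
      push_cast
      rw [pow_succ, mul_comm ((4 : ℝ) ^ sr) 4]
      exact mul_le_mul_of_nonneg_right H.U_le (by positivity)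
    have h2 := H.mul_four_pow_le
    have h3 := H.le_floor (Nat.zero_le r)
    have h4 : (o r : ℝ) ≤ Q * G ^ 10 := hX.o_r_le
    have h5 : 10 ^ 12 * (Q * G ^ 10) ≤ Q ^ u 0 := by
      refine le_trans ?_ H.base_ge
      have := mul_le_mul_of_nonneg_left
        (H.G_pow_mul_le (show 10 < 40 by norm_num))
        (show 0 ≤ Q by linarith [H.Q_gt])
      linarith
    have h6 : G ≤ Q ^ u 0 := by
      refine le_trans ?_ (H.G_pow_le_Q_pow (Nat.zero_le r))
      have := H.G_pow_le (show 1 ≤ 40 by norm_num)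
      rwa [pow_one] at this
    have h7 := H.G_ge
    have h8 : 4 * ((o r : ℝ) + win ⌈(1 - (p : ℝ))⁻¹⌉₊ σ₀ (sr + 1)) + 8 ≤
        ⌊(1 - (p : ℝ))⁻¹ ^ u 0⌋₊ := by
      nlinarith
    exact_mod_cast h8
  ε_le i hi _ := by
    change (if i = 0 then _ else (⌊(1 - (p : ℝ))⁻¹ ^ u i⌋₊ : ℝ) / 32) ≤ _
    rw [if_neg (by omega)]
    exact le_rfl
  ε_zero_le := by
    have h : (scales p l P r σ₀ sr u m o).ε 0 = p * ((win ⌈(1 - (p : ℝ))⁻¹⌉₊ σ₀ sr : ℝ) -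
      win ⌈(1 - (p : ℝ))⁻¹⌉₊ σ₀ (4 * l + 2 * r)) / 4 := scales_ε_zero
    rw [h]
    change _ ≤ (1 - (1 - (p : ℝ))) * _ / 4
    rw [sub_sub_cancel]
    exact le_rfl
  V_ge i hi := by
    change 2 * (⌊(1 - (p : ℝ))⁻¹ ^ u (i + 1)⌋₊ : ℝ) ≤
      (1 - (1 - (p : ℝ))) * ((2 * P * ⌊(1 - (p : ℝ))⁻¹ ^ u (i + 1)⌋₊ : ℕ) : ℝ)
    push_cast
    have := mul_le_mul_of_nonneg_right H.P_ge
      (show (0 : ℝ) ≤ 2 * (⌊(1 - (p : ℝ))⁻¹ ^ u (i + 1)⌋₊ : ℝ) by positivity)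
    linarith
  last := by
    change 24 * (2 : ℝ) ^ sr < (1 - (1 - (p : ℝ))) * ((win ⌈(1 - (p : ℝ))⁻¹⌉₊ σ₀ sr : ℝ) -
      win ⌈(1 - (p : ℝ))⁻¹⌉₊ σ₀ (4 * l + 2 * r)) / 2
    have h1 := H.win_sub_win
    have h2 : (1 : ℝ) ≤ ⌈(1 - (p : ℝ))⁻¹⌉₊ := by exact_mod_cast H.U_pos
    have hP : (0 : ℝ) < P := by exact_mod_cast H.P_pos
    have hp := H.p_pos
    have h3 : (4 : ℝ) ^ sr = 2 ^ sr * 2 ^ sr := by rw [← mul_pow]; norm_num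
    have h4 : G ≤ 2 ^ sr := by
      rw [H.G_eq]
      exact pow_le_pow_right₀ (by norm_num) (by have := H.s₁_lt; omega)
    have h5 : 100 * (P : ℝ) < G := by
      have h6 := H.P_le'
      have h7 := H.poly_le
      have h8 := H.l_le_sq
      have h9 := H.l_le_l_sq
      have h10 := H.l_ge'
      linarith
    have h6 : (1 : ℝ) * 4 ^ sr ≤ ⌈(1 - (p : ℝ))⁻¹⌉₊ * 4 ^ sr := by gcongr
    have h7 : 100 * (P : ℝ) * 2 ^ sr < 4 ^ sr := by
      rw [h3]
      exact mul_lt_mul_of_pos_right (h5.trans_le h4) (by positivity)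
    have h8 : p * (4 ^ sr / 2) ≤ p * ((win ⌈(1 - (p : ℝ))⁻¹⌉₊ σ₀ sr : ℝ) -
      win ⌈(1 - (p : ℝ))⁻¹⌉₊ σ₀ (4 * l + 2 * r)) := mul_le_mul_of_nonneg_left (by linarith) hp.le
    have h9 := mul_lt_mul_of_pos_left h7 hp
    have h10 := mul_le_mul_of_nonneg_right H.P_ge (show (0 : ℝ) ≤ 2 ^ sr by positivity)
    linarith

end Setup

end TamariLevels

namespace TamariLevels

open Finset MeasureTheory

/-- The precision of the control of the failures is sufficient for the law of large numbers. -/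
theorem four_mul_le_min {G ε V : ℝ} (hε : 8 * G ≤ ε) (hV : 0 ≤ V) (h : 16 * G * (V + 1) ≤ ε ^ 2) :
    4 * G ≤ min (ε / 2) (ε ^ 2 / (4 * (V + 1))) := by
  refine le_min (by linarith) ?_
  rw [le_div_iff₀ (by positivity)]
  linarith

namespace Setup

variable {p : unitInterval} {l P r σ₀ sr : ℕ} {u m o : ℕ → ℕ} {Q G ξ : ℝ}
  {X : ℕ → Set (ℕ → Bool)} (H : Setup p l P r σ₀ sr u Q G)
include H

theorem G_le_exp : G ≤ Real.exp l := by
  rw [H.G_eq, ← Real.exp_one_pow]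
  refine pow_le_pow_left₀ (by norm_num) ?_ l
  linarith [Real.add_one_le_exp (1 : ℝ)]

theorem ε_succ {x y : ℝ} (hx : G ^ 40 ≤ x) (hxy : y ^ 2 ≤ x ^ 3) :
    16 * G * (2 * G * y + 1) ≤ (x / 64) ^ 2 := by
  have hG := H.G_ge
  have h1 : G ^ 1 ≤ G ^ 40 := H.G_pow_le (by norm_num)
  rw [pow_one] at h1
  have h2 : 10 ^ 12 * G ^ 4 ≤ x := (H.G_pow_mul_le (by norm_num)).trans hx
  have hG4 : 0 ≤ G ^ 4 := by positivity
  have hx0 : 0 < x := by linarith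
  -- both sides are compared through their squares, as `y ^ 2 ≤ x ^ 3`
  have h3 : (10 ^ 6 * G ^ 2 * y) ^ 2 ≤ (x ^ 2) ^ 2 := by
    calc (10 ^ 6 * G ^ 2 * y) ^ 2 = 10 ^ 12 * G ^ 4 * y ^ 2 := by ring
      _ ≤ x * x ^ 3 := mul_le_mul h2 hxy (sq_nonneg y) hx0.le
      _ = _ := by ring
  have h4 := abs_le_of_sq_le_sq' h3 (sq_nonneg x)
  have h5 : G ≤ x := h1.trans hx
  have h6 : G * (10 ^ 12) ≤ x * x := mul_le_mul h5 (by linarith) (by norm_num) hx0.le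
  nlinarith [h4.2]

theorem pow_cube {j : ℕ} (hj : j < r) : (Q ^ u (j + 1)) ^ 2 ≤ (Q ^ u j) ^ 3 := by
  rw [← pow_mul, ← pow_mul]
  refine pow_le_pow_right₀ H.Q_gt.le ?_
  have := H.u_cube j hj
  omega

/-- The length of the first windows, compared with the second scale. -/
theorem ε_base : G ^ 5 * ((1 - (p : ℝ)) * Q ^ u 1) ≤ (Q * 4 ^ sr) ^ 2 := by
  have hQ := H.Q_gt
  have hG := H.G_ge
  have hr := H.r_pos
  have hq := H.q_mul_Q
  have h8 : 0 ≤ 1 - (p : ℝ) := by linarith [H.p_lt]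
  have hG0 : 0 ≤ G ^ 5 := by positivity
  have h1 : 64000000 * G ^ 5 ≤ G ^ 6 := by
    have := H.G_pow_mul_le (show 5 < 6 by norm_num)
    linarith
  have h2 : G ^ 6 * ((1 - (p : ℝ)) * Q ^ u 1) ≤ (min (Q ^ u 0) (Q * G ^ 80)) ^ 2 := by
    rcases H.base with h | h
    · have e1 : Q ^ u 1 ≤ Q ^ 3 :=
        pow_le_pow_right₀ hQ.le (by
          have h3 := H.u_cube 0 hr
          rw [zero_add] at h3
          omega)
      have e2 : G ^ 40 * Q ≤ min (Q ^ u 0) (Q * G ^ 80) := by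
        refine le_min (by linarith [H.base_ge]) ?_
        have := mul_le_mul_of_nonneg_left (H.G_pow_le (show 40 ≤ 80 by norm_num))
          (show 0 ≤ Q by linarith)
        linarith
      calc G ^ 6 * ((1 - (p : ℝ)) * Q ^ u 1) ≤ G ^ 80 * ((1 - p) * Q ^ 3) := by
            have := H.G_pow_le (show 6 ≤ 80 by norm_num)
            gcongr
        _ = (G ^ 40 * Q) ^ 2 * ((1 - p) * Q) := by ring
        _ = (G ^ 40 * Q) ^ 2 := by rw [hq, mul_one]
        _ ≤ _ := pow_le_pow_left₀ (by positivity) e2 2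
    · rw [min_eq_left h]
      set x := Q ^ u 0 with hx
      have hx0 : 0 < x := by positivity
      have e1 := H.pow_cube hr
      rw [zero_add] at e1
      have e2 := H.base_ge
      have e3 : G ^ 12 * ((1 - (p : ℝ)) * Q ^ u 1) ^ 2 ≤ x ^ 4 := by
        calc G ^ 12 * ((1 - (p : ℝ)) * Q ^ u 1) ^ 2
            = G ^ 12 * ((1 - p) ^ 2 * (Q ^ u 1) ^ 2) := by ring
          _ ≤ G ^ 40 * (1 * x ^ 3) := by
              have := H.G_pow_le (show 12 ≤ 40 by norm_num)
              have : (1 - (p : ℝ)) ^ 2 ≤ 1 := pow_le_one₀ h8 (by linarith [H.p_pos])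
              gcongr
          _ ≤ x * x ^ 3 := by
              rw [one_mul]
              refine mul_le_mul_of_nonneg_right (le_trans ?_ e2) (by positivity)
              exact le_mul_of_one_le_left (by positivity) hQ.le
          _ = _ := by ring
      have e4 : (G ^ 6 * ((1 - (p : ℝ)) * Q ^ u 1)) ^ 2 ≤ (x ^ 2) ^ 2 := by
        calc _ = G ^ 12 * ((1 - (p : ℝ)) * Q ^ u 1) ^ 2 := by ring
          _ ≤ _ := e3
          _ = _ := by ring
      exact (abs_le_of_sq_le_sq' e4 (sq_nonneg x)).2
  have h3 : (min (Q ^ u 0) (Q * G ^ 80)) ^ 2 ≤ (8000 * (Q * 4 ^ sr)) ^ 2 :=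
    pow_le_pow_left₀ (le_min (by positivity) (by positivity)) H.sr_ge 2
  have h4 : 64000000 * G ^ 5 * ((1 - (p : ℝ)) * Q ^ u 1) ≤ G ^ 6 * ((1 - p) * Q ^ u 1) :=
    mul_le_mul_of_nonneg_right h1 (by positivity)
  linarith

theorem PG_le : 10 ^ 6 * (P : ℝ) ≤ G := by
  have h6 := H.P_le'
  have h7 := H.poly_le
  have h8 := H.l_le_sq
  have h9 := H.l_le_l_sq
  have h10 := H.l_ge'
  linarith

theorem V_le {i : ℕ} :
    ((2 * P * ⌊(1 - (p : ℝ))⁻¹ ^ u (i + 1)⌋₊ : ℕ) : ℝ) ≤ 2 * P * Q ^ u (i + 1) := by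
  push_cast
  exact mul_le_mul_of_nonneg_left (H.floor_le (i + 1)) (by positivity)

variable (hX : Onset p (scales p l P r σ₀ sr u m o) l P Q G ξ X)
include hX

/-- The parameters meet the conditions for the existence of configurations. -/
theorem likely : (scales p l P r σ₀ sr u m o).Likely p X ξ (G ^ 95)⁻¹ (Real.exp (-(2 * G))) where
  valid := H.valid hX
  p_pos := H.p_pos
  q_eq := rfl
  U_ge := by
    change 1 ≤ (1 - (p : ℝ)) * (⌈(1 - (p : ℝ))⁻¹⌉₊ : ℝ)
    have := mul_le_mul_of_nonneg_left H.U_ge (show 0 ≤ 1 - (p : ℝ) by linarith [H.p_lt])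
    linarith [H.q_mul_Q]
  ξ_nonneg := hX.ξ_nonneg
  δ_nonneg := by
    have := H.G_ge
    positivity
  δ'_nonneg := (Real.exp_pos _).le
  X_dep := hX.X_dep
  X_fails := hX.X_fails
  X_early := hX.X_early
  le_X := hX.le_X
  sleep_le := hX.sleep_le
  rel_le := by
    change (4 ^ (sr + 2) + 1) * Real.exp (-(1000 * (l : ℝ) / 2)) ≤ (G ^ 95)⁻¹
    have hG := H.G_ge
    have h1 := H.four_pow_le
    have h2 : (4 : ℝ) ^ (sr + 2) + 1 ≤ G ^ 80 := by
      have : (1 : ℝ) ≤ 4 ^ sr := one_le_pow₀ (by norm_num)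
      rw [pow_add]
      linarith
    have h3 := H.G_le_exp
    have h4 : Real.exp (-(1000 * (l : ℝ) / 2)) ≤ (G ^ 175)⁻¹ := by
      rw [Real.exp_neg]
      refine inv_anti₀ (by positivity) ?_
      calc G ^ 175 ≤ Real.exp l ^ 175 := pow_le_pow_left₀ (by linarith) h3 _
        _ = Real.exp (175 * l) := by rw [← Real.exp_nat_mul]; norm_num
        _ ≤ _ := Real.exp_le_exp.2 (by linarith [H.l_ge'])
    calc _ ≤ G ^ 80 * (G ^ 175)⁻¹ := by gcongr
      _ = (G ^ 95)⁻¹ := by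
        rw [show G ^ 175 = G ^ 80 * G ^ 95 by rw [← pow_add], mul_inv, ← mul_assoc,
          mul_inv_cancel₀ (by positivity), one_mul]
  post_le i hi := by
    have hi : i < r := hi
    change 2 * (((2 * P * ⌊(1 - (p : ℝ))⁻¹ ^ u (i + 1)⌋₊ : ℕ) : ℝ) + 1) * Real.exp (-min _
      (_ / (4 * ((1 - (p : ℝ)) * ((2 * P * ⌊(1 - (p : ℝ))⁻¹ ^ u (i + 1)⌋₊ : ℕ) : ℝ) + 1)))) ≤ _
    have hG := H.G_ge
    have hV := H.V_le (i := i)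
    have hPG := H.PG_le
    have hP : (0 : ℝ) < P := by exact_mod_cast H.P_pos
    have hq0 : 0 ≤ 1 - (p : ℝ) := by linarith [H.p_lt]
    have hQ0 : 0 < Q := by linarith [H.Q_gt]
    set V := ((2 * P * ⌊(1 - (p : ℝ))⁻¹ ^ u (i + 1)⌋₊ : ℕ) : ℝ) with hVdef
    have hV0 : 0 ≤ V := by positivity
    have h1 : 4 * G ≤ min ((scales p l P r σ₀ sr u m o).ε i / 2)
        ((scales p l P r σ₀ sr u m o).ε i ^ 2 / (4 * ((1 - p) * V + 1))) := by
      rcases Nat.eq_zero_or_pos i with rfl | hi0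
      · have e0 : (scales p l P r σ₀ sr u m o).ε 0 = p * ((win ⌈(1 - (p : ℝ))⁻¹⌉₊ σ₀ sr : ℝ) -
          win ⌈(1 - (p : ℝ))⁻¹⌉₊ σ₀ (4 * l + 2 * r)) / 4 := scales_ε_zero
        have e1 := H.win_sub_win
        have e2 := H.U_ge
        have e3 : Q * 4 ^ sr / 2 ≤ (win ⌈(1 - (p : ℝ))⁻¹⌉₊ σ₀ sr : ℝ) -
            win ⌈(1 - (p : ℝ))⁻¹⌉₊ σ₀ (4 * l + 2 * r) := by
          have := mul_le_mul_of_nonneg_right e2 (show (0 : ℝ) ≤ 4 ^ sr by positivity)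
          linarith
        set F := Q * 4 ^ sr with hF
        have e4 : F ≤ 8 * P * (scales p l P r σ₀ sr u m o).ε 0 := by
          rw [e0]
          have h2 := mul_le_mul_of_nonneg_left e3 (show 0 ≤ (p : ℝ) * P by
            have := H.p_pos
            positivity)
          have h3 := mul_le_mul_of_nonneg_right H.P_ge (show 0 ≤ F / 2 by positivity)
          linarith
        have e5 : G ^ 39 ≤ F := by
          refine H.le_four_pow.trans ?_
          exact le_mul_of_one_le_left (by positivity) H.Q_gt.le
        have e6 : 0 < F := lt_of_lt_of_le (by positivity) e5
        set ε := (scales p l P r σ₀ sr u m o).ε 0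
        have e7 : 8 * P * G * 8 ≤ F := by
          refine le_trans ?_ e5
          calc 8 * P * G * 8 ≤ 10 ^ 12 * G ^ 2 := by nlinarith
            _ ≤ _ := H.G_pow_mul_le (by norm_num)
        have e8 : 0 < ε := by
          by_contra hc
          have : 8 * P * ε ≤ 0 := mul_nonpos_of_nonneg_of_nonpos (by positivity) (not_lt.1 hc)
          linarith
        refine four_mul_le_min ?_ (by positivity) ?_
        · have : 8 * (P : ℝ) * (8 * G) ≤ 8 * P * ε := by linarith
          exact le_of_mul_le_mul_left this (by positivity)
        · have e9 := H.ε_base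
          rw [← hF] at e9
          have e10 : F ^ 2 ≤ (G * ε) ^ 2 := by
            refine pow_le_pow_left₀ e6.le (e4.trans ?_) 2
            exact mul_le_mul_of_nonneg_right (by linarith) e8.le
          have e11 : (1 - p) * V ≤ G * ((1 - p) * Q ^ u 1) := by
            calc (1 - p) * V ≤ (1 - p) * (2 * P * Q ^ u (0 + 1)) := by gcongr
              _ = 2 * P * ((1 - p) * Q ^ u 1) := by rw [zero_add]; ring
              _ ≤ _ := by
                have : 0 ≤ (1 - p) * Q ^ u 1 := by positivity
                exact mul_le_mul_of_nonneg_right (by linarith) this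
          set T := (1 - (p : ℝ)) * Q ^ u 1
          have hT : 0 ≤ T := by positivity
          have e12 : G ^ 78 ≤ F ^ 2 := by
            have := pow_le_pow_left₀ (by positivity) e5 2
            rwa [← pow_mul] at this
          have e13 : 10 ^ 12 * G ^ 3 ≤ F ^ 2 := (H.G_pow_mul_le (by norm_num)).trans e12
          have e14 : 10 ^ 12 * G ^ 4 * T ≤ F ^ 2 := by
            refine le_trans ?_ e9
            exact mul_le_mul_of_nonneg_right (H.G_pow_mul_le (by norm_num)) hT
          have e15 : G ^ 2 * (16 * G * ((1 - p) * V + 1)) ≤ G ^ 2 * ε ^ 2 := by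
            calc G ^ 2 * (16 * G * ((1 - p) * V + 1)) ≤ G ^ 2 * (16 * G * (G * T + 1)) := by gcongr
              _ = 16 * (G ^ 4 * T) + 16 * G ^ 3 := by ring
              _ ≤ F ^ 2 := by
                have : 0 ≤ G ^ 4 * T := by positivity
                have : 0 ≤ G ^ 3 := by positivity
                linarith
              _ ≤ G ^ 2 * ε ^ 2 := by rw [← mul_pow]; exact e10
          exact le_of_mul_le_mul_left e15 (by positivity)
      · have e0 : (scales p l P r σ₀ sr u m o).ε i = ⌊(1 - (p : ℝ))⁻¹ ^ u i⌋₊ / 32 :=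
          scales_ε_of_ne hi0.ne'
        have e1 := H.le_floor hi.le
        have e2 := H.G_pow_le_Q_pow hi.le
        have e3 := H.ε_succ e2 (H.pow_cube hi)
        have e4 : Q ^ u i / 64 ≤ (scales p l P r σ₀ sr u m o).ε i := by
          rw [e0]
          linarith
        refine four_mul_le_min ?_ (by positivity) ?_
        · have := H.G_pow_mul_le (show 1 < 40 by norm_num)
          rw [pow_one] at this
          linarith
        · calc 16 * G * ((1 - p) * V + 1) ≤ 16 * G * (2 * G * Q ^ u (i + 1) + 1) := by
                have : (1 - p) * V ≤ 1 * (2 * P * Q ^ u (i + 1)) :=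
                  mul_le_mul (by linarith [H.p_pos]) hV hV0 (by norm_num)
                have h3 : 2 * (P : ℝ) * Q ^ u (i + 1) ≤ 2 * G * Q ^ u (i + 1) := by
                  have : (P : ℝ) ≤ G := by linarith
                  gcongr
                exact mul_le_mul_of_nonneg_left (by linarith) (by positivity)
            _ ≤ (Q ^ u i / 64) ^ 2 := e3
            _ ≤ _ := pow_le_pow_left₀ (by positivity) e4 2
    have h2 : 2 * (V + 1) ≤ Real.exp (2 * G) := by
      have e1 : Q ^ u (i + 1) ≤ Real.exp G := (H.pow_mono hi le_rfl).trans H.pow_le_exp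
      have e2 : G ≤ Real.exp G := by linarith [Real.add_one_le_exp G]
      have e3 : Real.exp (2 * G) = Real.exp G * Real.exp G := by
        rw [← Real.exp_add]
        ring_nf
      rw [e3]
      have e4 : 2 * (P : ℝ) * Q ^ u (i + 1) ≤ 2 * P * Real.exp G := by gcongr
      have e5 : (4 * P + 2) * Real.exp G ≤ G * Real.exp G := by
        have : (1 : ℝ) ≤ P := by exact_mod_cast H.P_pos
        have : 4 * (P : ℝ) + 2 ≤ G := by linarith
        gcongr
      have e6 : G * Real.exp G ≤ Real.exp G * Real.exp G := by gcongr
      linarith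
    calc _ ≤ Real.exp (2 * G) * Real.exp (-(4 * G)) := by
          refine mul_le_mul h2 (Real.exp_le_exp.2 (neg_le_neg h1)) (Real.exp_pos _).le
            (Real.exp_pos _).le
      _ = Real.exp (-(2 * G)) := by
        rw [← Real.exp_add]
        ring_nf
  ε_nonneg i hi := by
    rcases Nat.eq_zero_or_pos i with rfl | hi0
    · have e0 : (scales p l P r σ₀ sr u m o).ε 0 = p * ((win ⌈(1 - (p : ℝ))⁻¹⌉₊ σ₀ sr : ℝ) -
        win ⌈(1 - (p : ℝ))⁻¹⌉₊ σ₀ (4 * l + 2 * r)) / 4 := scales_ε_zero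
      have e1 := H.win_sub_win
      have e2 : 0 ≤ (win ⌈(1 - (p : ℝ))⁻¹⌉₊ σ₀ sr : ℝ) -
          win ⌈(1 - (p : ℝ))⁻¹⌉₊ σ₀ (4 * l + 2 * r) := le_trans (by positivity) e1
      have := H.p_pos
      rw [e0]
      positivity
    · have e0 : (scales p l P r σ₀ sr u m o).ε i = ⌊(1 - (p : ℝ))⁻¹ ^ u i⌋₊ / 32 := scales_ε_of_ne hi0.ne'
      rw [e0]
      positivity
  far_le := by
    change Real.exp (-(((1024 * 4 ^ sr : ℕ) : ℝ) / 256)) ≤ _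
    refine Real.exp_le_exp.2 (neg_le_neg ?_)
    push_cast
    have h1 := H.le_four_pow
    have h2 : G ^ 1 ≤ G ^ 39 := H.G_pow_le (by norm_num)
    rw [pow_one] at h2
    linarith [H.G_ge]
  Y₀_ge := by
    change 8 * ((1 - (p : ℝ)) * ((o r + win ⌈(1 - (p : ℝ))⁻¹⌉₊ σ₀ (sr + 1) : ℕ) : ℝ)) ≤
      3 * ((1024 * 4 ^ sr : ℕ) : ℝ)
    have hq0 : 0 ≤ 1 - (p : ℝ) := by linarith [H.p_lt]
    have h1 : (win ⌈(1 - (p : ℝ))⁻¹⌉₊ σ₀ (sr + 1) : ℝ) ≤ 2 * Q * (4 * 4 ^ sr) := by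
      have : win ⌈(1 - (p : ℝ))⁻¹⌉₊ σ₀ (sr + 1) ≤ ⌈(1 - (p : ℝ))⁻¹⌉₊ * 4 ^ (sr + 1) :=
        Nat.mul_le_mul_left _ (Nat.sub_le _ _)
      have h2 : (win ⌈(1 - (p : ℝ))⁻¹⌉₊ σ₀ (sr + 1) : ℝ) ≤
          (⌈(1 - (p : ℝ))⁻¹⌉₊ * 4 ^ (sr + 1) : ℕ) := by exact_mod_cast this
      refine h2.trans ?_
      push_cast
      rw [pow_succ, mul_comm ((4 : ℝ) ^ sr) 4]
      exact mul_le_mul_of_nonneg_right H.U_le (by positivity)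
    have h4 : (o r : ℝ) ≤ Q * G ^ 10 := hX.o_r_le
    have h5 : G ^ 10 ≤ (4 : ℝ) ^ sr := (H.G_pow_le (by norm_num)).trans H.le_four_pow
    have h6 : (1 - (p : ℝ)) * ((o r : ℝ) + win ⌈(1 - (p : ℝ))⁻¹⌉₊ σ₀ (sr + 1)) ≤
        (1 - p) * (Q * (9 * 4 ^ sr)) := by
      refine mul_le_mul_of_nonneg_left ?_ hq0
      have := mul_le_mul_of_nonneg_left h5 (show 0 ≤ Q by linarith [H.Q_gt])
      linarith
    rw [← mul_assoc, H.q_mul_Q] at h6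
    push_cast
    linarith [show (0 : ℝ) ≤ 4 ^ sr by positivity]
  n_pow_le j _ := by
    change (⌊(1 - (p : ℝ))⁻¹ ^ u j⌋₊ : ℝ) * (1 - (p : ℝ)) ^ u j ≤ 1
    have hq0 : 0 ≤ 1 - (p : ℝ) := by linarith [H.p_lt]
    have h1 := mul_le_mul_of_nonneg_right (H.floor_le j) (pow_nonneg hq0 (u j))
    rwa [← mul_pow, mul_comm Q, H.q_mul_Q, one_pow] at h1
  le_n_pow j hj := by
    change 1 ≤ 2 * ((⌊(1 - (p : ℝ))⁻¹ ^ u j⌋₊ : ℝ) * (1 - (p : ℝ)) ^ u j)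
    have hq0 : 0 ≤ 1 - (p : ℝ) := by linarith [H.p_lt]
    have h1 := mul_le_mul_of_nonneg_right (H.le_floor hj) (pow_nonneg hq0 (u j))
    rw [← mul_pow, mul_comm Q, H.q_mul_Q, one_pow] at h1
    linarith
  pow_le j hj := by
    change 2 * (1 - (p : ℝ)) ^ u j ≤ 1
    have hq0 : 0 ≤ 1 - (p : ℝ) := by linarith [H.p_lt]
    have h2 : 2 ≤ Q ^ u j := by
      refine le_trans ?_ (H.G_pow_le_Q_pow hj)
      have : G ^ 1 ≤ G ^ 40 := H.G_pow_le (by norm_num)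
      rw [pow_one] at this
      linarith [H.G_ge]
    have h1 := mul_le_mul_of_nonneg_right h2 (pow_nonneg hq0 (u j))
    rwa [← mul_pow, mul_comm Q, H.q_mul_Q, one_pow] at h1
  small := by
    change 2 * (((r : ℝ) + 1) * (2 * (G ^ 95)⁻¹) * (((1024 * 4 ^ sr : ℕ) : ℝ) +
      (u r : ℝ) * (2 * r + 4)) + (⌊(1 - (p : ℝ))⁻¹ ^ u r⌋₊ : ℝ) *
        ((r + 1) * Real.exp (-(2 * G)))) ≤ (1 / 4) ^ (r + 1)
    have hG := H.G_ge
    have h1 := H.four_pow_le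
    have h2 := H.u_le'
    have hr : (r : ℝ) ≤ 4 * l := by exact_mod_cast H.r_le
    have hl := H.l_ge'
    have hlG : 10 ^ 6 * (l : ℝ) ≤ G := by
      have h7 := H.poly_le
      have h8 := H.l_le_sq
      have h9 := H.l_le_l_sq
      linarith
    have h3 : ((1024 * 4 ^ sr : ℕ) : ℝ) + (u r : ℝ) * (2 * r + 4) ≤ 2 * G ^ 80 := by
      push_cast
      have e1 : (u r : ℝ) * (2 * r + 4) ≤ G ^ 2 * G :=
        mul_le_mul h2 (by linarith) (by positivity) (by positivity)
      have e2 : G ^ 2 * G ≤ G ^ 80 := by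
        rw [← pow_succ]
        exact H.G_pow_le (by norm_num)
      have e3 : (0 : ℝ) ≤ 4 ^ sr := by positivity
      linarith
    have h4 : ((r : ℝ) + 1) * (2 * (G ^ 95)⁻¹) * (((1024 * 4 ^ sr : ℕ) : ℝ) +
        (u r : ℝ) * (2 * r + 4)) ≤ (G ^ 13)⁻¹ := by
      calc _ ≤ G / 4 * (2 * (G ^ 95)⁻¹) * (2 * G ^ 80) := by
            have : (r : ℝ) + 1 ≤ G / 4 := by linarith
            gcongr
        _ = G ^ 81 * (G ^ 95)⁻¹ := by ring
        _ = (G ^ 14)⁻¹ := by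
            rw [show G ^ 95 = G ^ 81 * G ^ 14 by rw [← pow_add], mul_inv, ← mul_assoc,
              mul_inv_cancel₀ (by positivity), one_mul]
        _ ≤ _ := inv_anti₀ (by positivity) (H.G_pow_le (by norm_num))
    have h5 : (⌊(1 - (p : ℝ))⁻¹ ^ u r⌋₊ : ℝ) * ((r + 1) * Real.exp (-(2 * G))) ≤
        (G ^ 13)⁻¹ := by
      have e1 := (H.floor_le r).trans H.pow_le_exp
      have e2 : Real.exp (-(2 * G)) = (Real.exp G)⁻¹ * (Real.exp G)⁻¹ := by
        rw [← Real.exp_neg, ← Real.exp_add]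
        ring_nf
      have e3 : G ^ 14 ≤ Real.exp G := by
        have e4 : G ≤ 2 ^ 100 * Real.exp (G / 2 ^ 100) := by
          have := Real.add_one_le_exp (G / 2 ^ 100)
          linarith
        have e5 : G / 14 ≤ Real.exp (G / 14 - 1) := by
          have := Real.add_one_le_exp (G / 14 - 1)
          linarith
        have e6 : 14 ≤ Real.exp 3 := by
          have := Real.exp_one_gt_d9
          have h3 : Real.exp 3 = Real.exp 1 ^ 3 := by rw [← Real.exp_nat_mul]; norm_num
          rw [h3]
          calc (14 : ℝ) ≤ 2.7 ^ 3 := by norm_num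
            _ ≤ _ := pow_le_pow_left₀ (by norm_num) (by linarith) 3
        -- the exponential function beats the power, as `G` is large
        have e7 : G ≤ Real.exp (G / 28) := by
          have e8 : G / 56 ≤ Real.exp (G / 56) := by
            have := Real.add_one_le_exp (G / 56)
            linarith
          have e9 : Real.exp (G / 28) = Real.exp (G / 56) * Real.exp (G / 56) := by
            rw [← Real.exp_add]
            ring_nf
          rw [e9]
          nlinarith
        calc G ^ 14 ≤ Real.exp (G / 28) ^ 14 := pow_le_pow_left₀ (by linarith) e7 _
          _ = Real.exp (14 * (G / 28)) := by rw [← Real.exp_nat_mul]; norm_num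
          _ ≤ _ := Real.exp_le_exp.2 (by linarith)
      calc _ ≤ Real.exp G * (G * ((Real.exp G)⁻¹ * (Real.exp G)⁻¹)) := by
            rw [e2]
            have : (r : ℝ) + 1 ≤ G := by linarith
            gcongr
        _ = G * (Real.exp G)⁻¹ := by
            have := Real.exp_pos G
            field_simp
        _ ≤ G * (G ^ 14)⁻¹ := by gcongr
        _ = (G ^ 13)⁻¹ := by
            rw [show G ^ 14 = G * G ^ 13 by rw [← pow_succ'], mul_inv, ← mul_assoc,
              mul_inv_cancel₀ (by positivity), one_mul]
    have h6 : (4 : ℝ) ^ (r + 1) * 4 ≤ G ^ 13 := by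
      calc (4 : ℝ) ^ (r + 1) * 4 = 4 ^ (r + 2) := by ring
        _ ≤ 4 ^ (5 * l) := pow_le_pow_right₀ (by norm_num) (by
            have := H.r_le
            have := H.l_ge
            omega)
        _ = G ^ 10 := H.four_pow_eq 5
        _ ≤ _ := H.G_pow_le (by norm_num)
    have h7 : (G ^ 13)⁻¹ ≤ (4 ^ (r + 1) * 4)⁻¹ := inv_anti₀ (by positivity) h6
    have h8 : ((1 : ℝ) / 4) ^ (r + 1) = (4 ^ (r + 1) * 4)⁻¹ * 4 := by
      rw [mul_inv, one_div, inv_pow]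
      ring
    rw [h8]
    linarith

end Setup

end TamariLevels

namespace TamariLevels

open Finset MeasureTheory

/-! ### The onset of the anchors -/

/-- The number of failures of the anchor `a j` between its first success and its onset. -/
def sleepCount (l P j : ℕ) : ℕ := 16000000 * l ^ 2 * P ^ 2 + j * (150000 * l * P ^ 2)

theorem sleepCount_mono {l P i j : ℕ} (h : i ≤ j) : sleepCount l P i ≤ sleepCount l P j :=
  Nat.add_le_add_left (Nat.mul_le_mul_right _ h) _

theorem eq_false_of_fails_eq_length {w : ℕ → Bool} {s n : ℕ} (h : fails w s (s + n) = n) {i : ℕ}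
    (h1 : s ≤ i) (h2 : i < s + n) : w i = false := by
  have h3 := succs_add_fails w s (s + n)
  have h4 : succs w s (s + n) = 0 := by omega
  unfold succs at h4
  rw [card_eq_zero] at h4
  by_contra hc
  have : i ∈ (∅ : Finset ℕ) := by
    rw [← h4]
    exact mem_filter.2 ⟨mem_Ico.2 ⟨h1, h2⟩, by simpa using hc⟩
  simp at this

namespace Setup

variable {p : unitInterval} {l P r σ₀ sr : ℕ} {u : ℕ → ℕ} {Q G : ℝ}
  (H : Setup p l P r σ₀ sr u Q G)
include H

theorem sleepCount_le {j : ℕ} (hj : j ≤ r) : sleepCount l P j ≤ 17000000 * l ^ 2 * P ^ 2 :=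
  H.k_le hj

theorem sleepCount_le_G {j : ℕ} (hj : j ≤ r) : (sleepCount l P j : ℝ) ≤ G := H.k_le_G hj

theorem le_sleepCount (j : ℕ) : 4000000 * l ^ 2 * P ≤ sleepCount l P j := by
  have h1 := H.P_pos
  have h2 : l ^ 2 * P * 1 ≤ l ^ 2 * P * P := Nat.mul_le_mul_left _ h1
  unfold sleepCount
  nlinarith [Nat.zero_le (j * (150000 * l * P ^ 2))]

/-- If `p` is not close to `1`, then the anchors simply fail for a while after their first
success. -/
theorem onset_of_le (hq : 1 ≤ (1 - (p : ℝ)) * G ^ 120) :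
    Onset p (scales p l P r σ₀ sr u (fun j => sleepCount l P j - 4000000 * l ^ 2 * P)
      fun j => u j + 1 + sleepCount l P j) l P Q G ((G ^ 120)⁻¹ ^ (17000000 * l ^ 2 * P ^ 2))
      fun j => {w | fails w (u j + 1) (u j + 1 + sleepCount l P j) = sleepCount l P j} where
  o_le i j hij hj := by
    have h1 := H.u_mono hij hj
    have h2 := sleepCount_mono (l := l) (P := P) hij
    change u i + 1 + sleepCount l P i ≤ u j + 1 + sleepCount l P j
    omega
  h_lt_o j _ := by
    change u j < u j + 1 + sleepCount l P j
    omega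
  lead i j _ _ := by
    change u j + 1 + sleepCount l P j + u i + sleepCount l P i ≤
      u i + 1 + sleepCount l P i + u j + sleepCount l P j
    omega
  m_le j _ := by
    have := H.le_sleepCount j
    change sleepCount l P j - 4000000 * l ^ 2 * P + 4000000 * l ^ 2 * P ≤ sleepCount l P j
    omega
  o_r_le := by
    change ((u r + 1 + sleepCount l P r : ℕ) : ℝ) ≤ Q * G ^ 10
    have h1 := H.u_le'
    have h2 := H.sleepCount_le_G le_rfl
    have hG := H.G_ge
    have h3 : 10 ^ 12 * G ^ 2 ≤ G ^ 10 := H.G_pow_mul_le (by norm_num)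
    have h4 : 1 * G ^ 10 ≤ Q * G ^ 10 := by
      have := H.Q_gt.le
      gcongr
    push_cast
    nlinarith
  ξ_nonneg := by
    have := H.G_ge
    positivity
  X_dep j _ := depOn_fails fun x => x = sleepCount l P j
  X_fails _ _ _ hw := hw
  X_early := Or.inl fun j _ w hw s h1 h2 => eq_false_of_fails_eq_length hw h1 h2
  le_X j hj := by
    have hG := H.G_ge
    rw [rowP_fails_eq_length]
    have h1 : (G ^ 120)⁻¹ ≤ 1 - (p : ℝ) := by
      rw [inv_le_iff_one_le_mul₀ (by positivity)]
      exact hq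
    calc (G ^ 120)⁻¹ ^ (17000000 * l ^ 2 * P ^ 2) ≤ (1 - (p : ℝ)) ^ (17000000 * l ^ 2 * P ^ 2) :=
          pow_le_pow_left₀ (by positivity) h1 _
      _ ≤ _ := pow_le_pow_of_le_one (by linarith [H.p_lt]) (by linarith [H.p_pos])
          (H.sleepCount_le hj)
  sleep_le j hj := by
    change rowP p {w | fails w (u j) (u j + 1 + sleepCount l P j) ≤
      sleepCount l P j - 4000000 * l ^ 2 * P}ᶜ ≤ _
    set k := sleepCount l P j with hk
    set M := 4000000 * l ^ 2 * P with hM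
    have hMk := H.le_sleepCount j
    have hp := H.p_pos
    have hp1 := H.p_lt
    have hPp := H.P_ge
    have hl := H.l_ge'
    have hMr : (M : ℝ) = 4000000 * (l : ℝ) ^ 2 * P := by rw [hM]; push_cast; ring
    have h1 : 4 * (M : ℝ) ≤ p * (k + 1 : ℕ) := by
      have e1 : 16000000 * (l : ℝ) ^ 2 * P ^ 2 ≤ (k + 1 : ℕ) := by
        have : 16000000 * l ^ 2 * P ^ 2 ≤ k + 1 := by
          rw [hk]
          unfold sleepCount
          omega
        exact_mod_cast this
      have e2 := mul_le_mul_of_nonneg_left e1 hp.le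
      have e3 := mul_le_mul_of_nonneg_right hPp (show 0 ≤ 16000000 * (l : ℝ) ^ 2 * P by positivity)
      rw [hMr]
      linarith
    have h2 : 0 ≤ p * ((k + 1 : ℕ) : ℝ) - M := by
      have : (0 : ℝ) ≤ M := by positivity
      linarith
    have h3 : {w | fails w (u j) (u j + 1 + k) ≤ k - M}ᶜ ⊆
        {w | (1 - (p : ℝ)) * (k + 1 : ℕ) + (p * ((k + 1 : ℕ) : ℝ) - M) ≤
          fails w (u j) (u j + (k + 1))} := by
      intro w hw
      simp only [Set.mem_compl_iff, Set.mem_ofPred_eq, not_le] at hw ⊢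
      rw [show u j + (k + 1) = u j + 1 + k by ring]
      have : ((k + 1 : ℕ) : ℝ) ≤ (fails w (u j) (u j + 1 + k) + M : ℕ) := by
        exact_mod_cast (show k + 1 ≤ fails w (u j) (u j + 1 + k) + M by omega)
      push_cast at this ⊢
      linarith
    have h4 : (G ^ 95)⁻¹ ≥ Real.exp (-(95 * l)) := by
      rw [Real.exp_neg]
      refine inv_anti₀ (by have := H.G_ge; positivity) ?_
      calc G ^ 95 ≤ Real.exp l ^ 95 := pow_le_pow_left₀ (by linarith [H.G_ge]) H.G_le_exp _
        _ = _ := by rw [← Real.exp_nat_mul]; norm_num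
    refine (rowP_mono p h3).trans ((rowP_upper p h2 (V := (k + 1 : ℕ)) (by positivity) _ _
      (mul_le_of_le_one_left (by positivity) (by linarith))).trans (le_trans
      (Real.exp_le_exp.2 (neg_le_neg ?_)) h4))
    have h5 : 4000000 * (l : ℝ) ^ 2 ≤ M * p := by
      rw [hMr]
      have := mul_le_mul_of_nonneg_left hPp (show 0 ≤ 4000000 * (l : ℝ) ^ 2 by positivity)
      linarith
    have h6 : 4000000 * (l : ℝ) ^ 2 ≤ M := h5.trans (mul_le_of_le_one_right (by positivity) hp1.le)
    have h7 : (l : ℝ) * 100 ≤ l ^ 2 := by nlinarith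
    refine le_min (by linarith) ?_
    rw [le_div_iff₀ (by positivity)]
    set z := ((k + 1 : ℕ) : ℝ)
    have hz : 0 < z := by positivity
    have h8 : 3 / 4 * (p * z) ≤ p * z - M := by linarith
    have h9 : (3 / 4 * (p * z)) ^ 2 ≤ (p * z - M) ^ 2 := pow_le_pow_left₀ (by positivity) h8 2
    have h10 : 4 * (M * (p : ℝ)) ≤ p * (p * z) := by
      have := mul_le_mul_of_nonneg_left h1 hp.le
      linarith
    have h11 : 16000000 * (l : ℝ) ^ 2 * z ≤ p * (p * z) * z := by
      refine mul_le_mul_of_nonneg_right ?_ hz.le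
      linarith
    have h12 : (l : ℝ) * z * 100 ≤ (l : ℝ) ^ 2 * z := by
      have := mul_le_mul_of_nonneg_right h7 hz.le
      linarith
    nlinarith

/-- If `p` is close to `1`, then the anchors fail one after the other, and so rarely that typical
positions do not fail before the onset. -/
theorem onset_of_lt (hq : (1 - (p : ℝ)) * G ^ 120 ≤ 1) :
    Onset p (scales p l P r σ₀ sr u (fun _ => 0)
      fun _ => u r + 1 + (r + 1) * (sleepCount l P r * ⌊Q / G ^ 112⌋₊)) l P Q G
      ((G ^ 120)⁻¹ ^ (17000000 * l ^ 2 * P ^ 2))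
      fun j => Spread ⌊Q / G ^ 112⌋₊ (sleepCount l P j) (u j + 1)
        (u r + 1 + (r - j) * (sleepCount l P r * ⌊Q / G ^ 112⌋₊))
        (u r + 1 + (r + 1) * (sleepCount l P r * ⌊Q / G ^ 112⌋₊)) := by
  have hG := H.G_ge
  have hQ := H.Q_gt
  have hQq := H.q_mul_Q
  have hq0 : 0 ≤ 1 - (p : ℝ) := by linarith [H.p_lt]
  set b := ⌊Q / G ^ 112⌋₊ with hb
  set B := sleepCount l P r * b with hB
  have hble : (b : ℝ) ≤ Q / G ^ 112 := Nat.floor_le (by positivity)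
  have hbG : (b : ℝ) * G ^ 112 ≤ Q := by rwa [le_div_iff₀ (by positivity)] at hble
  have hQG : G ^ 120 ≤ Q := by
    have h1 : (1 - (p : ℝ)) * G ^ 120 ≤ (1 - p) * Q := by linarith
    exact le_of_mul_le_mul_left h1 (by linarith [H.p_lt])
  have hbge : Q ≤ 2 * (b * G ^ 112) := by
    have h1 := Nat.lt_floor_add_one (Q / G ^ 112)
    rw [div_lt_iff₀ (by positivity), ← hb] at h1
    have h2 : 10 ^ 12 * G ^ 112 ≤ G ^ 120 := H.G_pow_mul_le (by norm_num)
    have h3 : 0 ≤ G ^ 112 := by positivity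
    linarith
  have hkr := H.sleepCount_le_G le_rfl
  have hl := H.l_ge'
  have hlG : 10 ^ 6 * (l : ℝ) ≤ G := by
    have h7 := H.poly_le
    have h8 := H.l_le_sq
    have h9 := H.l_le_l_sq
    linarith
  have hr : (r : ℝ) + 1 ≤ G := by
    have : (r : ℝ) ≤ 4 * l := by exact_mod_cast H.r_le
    linarith
  have hur := H.u_le'
  have ho : ((u r + 1 + (r + 1) * B : ℕ) : ℝ) ≤ Q * (2 * (G ^ 110)⁻¹) := by
    have e1 : ((r : ℝ) + 1) * (sleepCount l P r * b) ≤ Q * (G ^ 110)⁻¹ := by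
      calc ((r : ℝ) + 1) * (sleepCount l P r * b) ≤ G * (G * (Q / G ^ 112)) := by gcongr
        _ = _ := by field_simp
    have e2 : (u r : ℝ) + 1 ≤ Q * (G ^ 110)⁻¹ := by
      rw [← div_eq_mul_inv, le_div_iff₀ (by positivity)]
      calc ((u r : ℝ) + 1) * G ^ 110 ≤ (G ^ 2 * G) * G ^ 110 := by
            gcongr
            nlinarith
        _ = G ^ 113 := by ring
        _ ≤ G ^ 120 := H.G_pow_le (by norm_num)
        _ ≤ Q := hQG
    rw [hB]
    push_cast
    linarith
  have hqo : (1 - (p : ℝ)) * ((u r + 1 + (r + 1) * B : ℕ) : ℝ) ≤ (G ^ 95)⁻¹ := by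
    calc _ ≤ (1 - (p : ℝ)) * (Q * (2 * (G ^ 110)⁻¹)) := mul_le_mul_of_nonneg_left ho hq0
      _ = 2 * (G ^ 110)⁻¹ := by rw [← mul_assoc, hQq, one_mul]
      _ ≤ (G ^ 95)⁻¹ := by
        have h1 : 10 ^ 12 * G ^ 95 ≤ G ^ 110 := H.G_pow_mul_le (by norm_num)
        rw [← div_eq_mul_inv, ← one_div, div_le_div_iff₀ (by positivity) (by positivity)]
        have : 0 < G ^ 95 := by positivity
        linarith
  have hG95 : (G ^ 95)⁻¹ ≤ 1 / 2 := by
    rw [← one_div]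
    refine div_le_div_of_nonneg_left (by norm_num) (by norm_num) ?_
    have h1 : G ^ 1 ≤ G ^ 95 := H.G_pow_le (by norm_num)
    linarith
  have hE : ∀ j ≤ r, (r - j) * B + sleepCount l P j * b ≤ (r + 1) * B := by
    intro j hj
    have h1 : sleepCount l P j * b ≤ B := Nat.mul_le_mul_right _ (sleepCount_mono hj)
    have h2 : (r - j + 1) * B ≤ (r + 1) * B := Nat.mul_le_mul_right _ (by omega)
    rw [add_mul, one_mul] at h2
    omega
  refine
    { o_le := fun _ _ _ _ => le_rfl
      h_lt_o := fun j hj => ?_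
      lead := fun i j hij hj => ?_
      m_le := fun j _ => ?_
      o_r_le := ?_
      ξ_nonneg := by positivity
      X_dep := fun j hj => ?_
      X_fails := fun j hj w hw => ?_
      X_early := Or.inr ⟨fun _ _ => rfl, fun i j hij hj w hw w' hw' s _ hs => ?_⟩
      le_X := fun j hj => ?_
      sleep_le := fun j hj => ?_ }
  · have := H.u_mono (show j ≤ r from hj) le_rfl
    change u j < u r + 1 + (r + 1) * B
    omega
  · have h1 := H.u_mono hij hj
    have h2 := sleepCount_mono (l := l) (P := P) hij
    change u r + 1 + (r + 1) * B + u i + sleepCount l P i ≤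
      u r + 1 + (r + 1) * B + u j + sleepCount l P j
    omega
  · have := H.le_sleepCount j
    change 0 + 4000000 * l ^ 2 * P ≤ sleepCount l P j
    omega
  · refine ho.trans (mul_le_mul_of_nonneg_left ?_ (by linarith))
    have h1 : (G ^ 110)⁻¹ ≤ 1 := inv_le_one_of_one_le₀ (one_le_pow₀ (by linarith))
    have h2 : G ^ 1 ≤ G ^ 10 := H.G_pow_le (by norm_num)
    linarith
  · have h1 : j ≤ r := hj
    have := H.u_mono h1 le_rfl
    have := hE j h1
    exact depOn_spread (by omega) (by omega)
  · have h1 : j ≤ r := hj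
    have := H.u_mono h1 le_rfl
    have := hE j h1
    change fails w (u j + 1) (u r + 1 + (r + 1) * B) = sleepCount l P j
    exact fails_eq_of_spread hw (by omega) (by omega) le_rfl
  · have h1 : j ≤ r := hj
    have h2 := H.u_mono h1 le_rfl
    have h3 := H.u_mono (hij.le.trans h1) le_rfl
    have h4 := hE j h1
    have h5 := hE i (hij.le.trans h1)
    have hs : s < u r + 1 + (r + 1) * B := hs
    change fails w (u i + 1) s ≤ fails w' (u j + 1) s
    rcases le_or_gt s (u r + 1 + (r - i) * B) with h6 | h6
    · rw [fails_eq_zero_of_spread hw h6]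
      exact Nat.zero_le _
    · have h7 : (r - j) * B + sleepCount l P j * b ≤ (r - i) * B := by
        have h1 : sleepCount l P j * b ≤ B := Nat.mul_le_mul_right _ (sleepCount_mono h1)
        have h2 : (r - j + 1) * B ≤ (r - i) * B := Nat.mul_le_mul_right _ (by omega)
        rw [add_mul, one_mul] at h2
        omega
      rw [fails_eq_of_spread hw' (by omega) (by omega) hs.le]
      exact (fails_le_of_spread hw (by omega) (by omega) hs.le).trans (sleepCount_mono hij.le)
  · have h1 : j ≤ r := hj
    have h2 := H.u_mono h1 le_rfl
    have h3 := hE j h1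
    have hkj : 1 ≤ sleepCount l P j := by
      refine le_trans ?_ (H.le_sleepCount j)
      have := H.P_pos
      have := H.l_ge
      exact Nat.mul_pos (Nat.mul_pos (by norm_num) (by positivity)) H.P_pos
    have h4 : b ≤ u r + 1 + (r + 1) * B := by
      have : 1 * b ≤ sleepCount l P j * b := Nat.mul_le_mul_right _ hkj
      omega
    refine le_trans ?_ (le_rowP_spread p (by omega) (by omega) h4 (hqo.trans hG95))
    have h5 : (G ^ 113)⁻¹ ≤ (b : ℝ) * (1 - p) / 2 := by
      rw [← one_div, div_le_div_iff₀ (by positivity) (by norm_num)]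
      have h6 := mul_le_mul_of_nonneg_left hbge hq0
      have h7 : 10 ^ 12 * G ^ 112 ≤ G ^ 113 := H.G_pow_mul_le (by norm_num)
      have h8 : 0 ≤ (b : ℝ) * (1 - p) := by positivity
      have h9 := mul_le_mul_of_nonneg_left h7 h8
      linarith
    calc (G ^ 120)⁻¹ ^ (17000000 * l ^ 2 * P ^ 2) ≤ (G ^ 120)⁻¹ ^ sleepCount l P j :=
          pow_le_pow_of_le_one (by positivity) (inv_le_one_of_one_le₀ (one_le_pow₀ (by linarith)))
            (H.sleepCount_le h1)
      _ = ((G ^ 7)⁻¹ * (G ^ 113)⁻¹) ^ sleepCount l P j := by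
          rw [← mul_inv, ← pow_add]
      _ = (G ^ 7)⁻¹ ^ sleepCount l P j * (G ^ 113)⁻¹ ^ sleepCount l P j := by rw [mul_pow]
      _ ≤ 1 / 4 * ((b : ℝ) * (1 - p) / 2) ^ sleepCount l P j := by
          refine mul_le_mul ?_ (pow_le_pow_left₀ (by positivity) h5 _) (by positivity)
            (by norm_num)
          have h6 : (G ^ 7)⁻¹ ≤ 1 / 4 := by
            rw [← one_div]
            refine div_le_div_of_nonneg_left (by norm_num) (by norm_num) ?_
            have h1 : G ^ 1 ≤ G ^ 7 := H.G_pow_le (by norm_num)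
            linarith
          calc (G ^ 7)⁻¹ ^ sleepCount l P j ≤ (G ^ 7)⁻¹ ^ 1 :=
                pow_le_pow_of_le_one (by positivity) (by linarith) hkj
            _ ≤ 1 / 4 := by rwa [pow_one]
  · have h1 : j ≤ r := hj
    have h2 := H.u_mono h1 le_rfl
    change rowP p {w | fails w (u j) (u r + 1 + (r + 1) * B) ≤ 0}ᶜ ≤ _
    obtain ⟨d, hd⟩ := Nat.exists_eq_add_of_le
      (show u j ≤ u r + 1 + (r + 1) * B by omega)
    rw [rowP_compl p (depOn_fails fun x => x ≤ 0)]
    simp only [nonpos_iff_eq_zero]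
    rw [hd, rowP_fails_eq_zero]
    have h3 := one_sub_mul_le p d
    have h4 : (1 - (p : ℝ)) * d ≤ (1 - p) * ((u r + 1 + (r + 1) * B : ℕ) : ℝ) := by
      refine mul_le_mul_of_nonneg_left ?_ hq0
      exact_mod_cast (show d ≤ u r + 1 + (r + 1) * B by omega)
    linarith

theorem sr_le' : sr ≤ 40 * l := by
  have h1 : (4 : ℝ) ^ sr ≤ 4 ^ (40 * l) := by
    have h0 : (4 : ℝ) ^ (40 * l) = G ^ 80 := H.four_pow_eq 40
    rw [h0]
    have := H.four_pow_le
    have : (0 : ℝ) ≤ 4 ^ sr := by positivity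
    linarith
  exact (pow_le_pow_iff_right₀ (show (1 : ℝ) < 4 by norm_num)).1 h1

/-- A position of the largest scale stays unsettled for a long time with the required probability:
each of the at most `4 * l + 1` anchors contributes a factor `exp (-O(l ^ 3))` for fixed `p`, coming
from windows whose number is of order `l`, and drifts of order `l`. -/
theorem exp_le_coinP : Real.exp (-(2 * 10 ^ 10 * ((l : ℝ) ^ 4 * P ^ 2))) ≤
    coinP p {w | ∃ y ≤ ⌊(1 - (p : ℝ))⁻¹ ^ u r⌋₊, lev w (⌊(1 - (p : ℝ))⁻¹ ^ u r⌋₊ / 4) y < y} := by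
  have hp := H.p_pos
  have hG := H.G_ge
  have hl := H.l_ge'
  have hP : (1 : ℝ) ≤ P := by exact_mod_cast H.P_pos
  have hr : (r : ℝ) ≤ 4 * l := by exact_mod_cast H.r_le
  have main : (p * ((G ^ 120)⁻¹ ^ (17000000 * l ^ 2 * P ^ 2) * ((1 / 4 * Real.exp
      (-((2 * (1000 * l) + 24 * r) ^ 2 / (3 * p)))) ^ (sr + 3) * (1 / 2))) / 16) ^ (r + 1) / 2 ≤
      coinP p {w | ∃ y ≤ ⌊(1 - (p : ℝ))⁻¹ ^ u r⌋₊,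
        lev w (⌊(1 - (p : ℝ))⁻¹ ^ u r⌋₊ / 4) y < y} := by
    rcases le_total 1 ((1 - (p : ℝ)) * G ^ 120) with hq | hq
    · exact (H.likely (H.onset_of_le hq)).le_coinP
    · exact (H.likely (H.onset_of_lt hq)).le_coinP
  refine le_trans ?_ main
  have e1 : Real.exp (-l) ≤ p / 32 := by
    have h1 : p * (P : ℝ) ≤ p * l := mul_le_mul_of_nonneg_left H.P_le' hp.le
    have h2 : 32 * (l : ℝ) ≤ Real.exp l := by
      refine le_trans ?_ H.G_le_exp
      have h7 := H.poly_le
      have h8 := H.l_le_sq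
      have h9 := H.l_le_l_sq
      linarith
    rw [Real.exp_neg, inv_le_comm₀ (Real.exp_pos _) (by positivity), inv_div]
    refine le_trans ?_ h2
    rw [div_le_iff₀ hp]
    linarith [H.P_ge]
  have e2 : Real.exp (-(120 * (17000000 * ((l : ℝ) ^ 3 * P ^ 2)))) ≤
      (G ^ 120)⁻¹ ^ (17000000 * l ^ 2 * P ^ 2) := by
    have h1 : Real.exp (-(120 * l)) ≤ (G ^ 120)⁻¹ := by
      rw [Real.exp_neg]
      refine inv_anti₀ (by positivity) ?_
      calc G ^ 120 ≤ Real.exp l ^ 120 := pow_le_pow_left₀ (by linarith) H.G_le_exp _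
        _ = _ := by rw [← Real.exp_nat_mul]; norm_num
    refine le_trans (le_of_eq ?_) (pow_le_pow_left₀ (Real.exp_pos _).le h1 _)
    rw [← Real.exp_nat_mul]
    congr 1
    push_cast
    ring
  have e3 : Real.exp (-(1600000 * ((l : ℝ) ^ 2 * P))) ≤
      1 / 4 * Real.exp (-((2 * (1000 * l) + 24 * r) ^ 2 / (3 * p))) := by
    have h1 : Real.exp (-2) ≤ 1 / 4 := by
      rw [Real.exp_neg, ← one_div]
      refine div_le_div_of_nonneg_left (by norm_num) (by norm_num) ?_
      have h2 : Real.exp 2 = Real.exp 1 ^ 2 := by rw [← Real.exp_nat_mul]; norm_num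
      rw [h2]
      have := Real.add_one_le_exp (1 : ℝ)
      nlinarith
    have h2 : (2 * (1000 * (l : ℝ)) + 24 * r) ^ 2 / (3 * p) ≤ 1500000 * ((l : ℝ) ^ 2 * P) := by
      rw [div_le_iff₀ (by positivity)]
      have h3 : (2 * (1000 * (l : ℝ)) + 24 * r) ^ 2 ≤ (2096 * l) ^ 2 :=
        pow_le_pow_left₀ (by positivity) (by linarith) 2
      have h4 := mul_le_mul_of_nonneg_left H.P_ge (show 0 ≤ 4500000 * (l : ℝ) ^ 2 by positivity)
      have h5 : 0 ≤ (l : ℝ) ^ 2 := by positivity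
      linarith
    calc Real.exp (-(1600000 * ((l : ℝ) ^ 2 * P)))
        ≤ Real.exp (-2 + -((2 * (1000 * l) + 24 * r) ^ 2 / (3 * p))) := by
          refine Real.exp_le_exp.2 ?_
          have : (1 : ℝ) ≤ (l : ℝ) ^ 2 * P := one_le_mul_of_one_le_of_one_le (by nlinarith) hP
          linarith
      _ ≤ _ := by
          rw [Real.exp_add]
          exact mul_le_mul_of_nonneg_right h1 (Real.exp_pos _).le
  have hl3 : (l : ℝ) ^ 2 * P * l ≤ (l : ℝ) ^ 3 * P ^ 2 := by
    have : (l : ℝ) ^ 3 * P * 1 ≤ (l : ℝ) ^ 3 * P * P := by gcongr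
    linarith
  have e4 : Real.exp (-(1600000 * 41 * ((l : ℝ) ^ 3 * P ^ 2))) ≤
      (1 / 4 * Real.exp (-((2 * (1000 * l) + 24 * r) ^ 2 / (3 * p)))) ^ (sr + 3) := by
    refine le_trans ?_ (pow_le_pow_left₀ (Real.exp_pos _).le e3 _)
    rw [← Real.exp_nat_mul]
    refine Real.exp_le_exp.2 ?_
    have h1 : (sr : ℝ) ≤ 40 * l := by exact_mod_cast H.sr_le'
    have h2 : ((sr + 3 : ℕ) : ℝ) * (1600000 * ((l : ℝ) ^ 2 * P)) ≤
        41 * l * (1600000 * ((l : ℝ) ^ 2 * P)) := by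
      push_cast
      have : (sr : ℝ) + 3 ≤ 41 * l := by linarith
      gcongr
    linarith
  have hl4 : (l : ℝ) ≤ (l : ℝ) ^ 3 * P ^ 2 := by
    have h1 : (1 : ℝ) ≤ (l : ℝ) ^ 2 * P ^ 2 :=
      one_le_mul_of_one_le_of_one_le (by nlinarith) (by nlinarith)
    have : (l : ℝ) * 1 ≤ l * ((l : ℝ) ^ 2 * P ^ 2) := by gcongr
    linarith
  set z := (l : ℝ) ^ 3 * P ^ 2 with hz
  have e5 : Real.exp (-(3 * 10 ^ 9 * z)) ≤ p * ((G ^ 120)⁻¹ ^ (17000000 * l ^ 2 * P ^ 2) *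
      ((1 / 4 * Real.exp (-((2 * (1000 * l) + 24 * r) ^ 2 / (3 * p)))) ^ (sr + 3) *
        (1 / 2))) / 16 := by
    calc Real.exp (-(3 * 10 ^ 9 * z)) ≤
        Real.exp (-l + (-(120 * (17000000 * z)) + -(1600000 * 41 * z))) :=
          Real.exp_le_exp.2 (by linarith)
      _ ≤ p / 32 * ((G ^ 120)⁻¹ ^ (17000000 * l ^ 2 * P ^ 2) * (1 / 4 * Real.exp
          (-((2 * (1000 * l) + 24 * r) ^ 2 / (3 * p)))) ^ (sr + 3)) := by
          rw [Real.exp_add, Real.exp_add]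
          gcongr
      _ = _ := by ring
  calc Real.exp (-(2 * 10 ^ 10 * ((l : ℝ) ^ 4 * P ^ 2)))
      ≤ Real.exp ((r + 1 : ℕ) * (-(3 * 10 ^ 9 * z)) + -1) := by
        refine Real.exp_le_exp.2 ?_
        have h1 : ((r + 1 : ℕ) : ℝ) * (3 * 10 ^ 9 * z) ≤ 5 * l * (3 * 10 ^ 9 * z) := by
          push_cast
          have : (r : ℝ) + 1 ≤ 5 * l := by linarith
          gcongr
        have h2 : (l : ℝ) ^ 4 * P ^ 2 = l * z := by rw [hz]; ring
        have h3 : 1 ≤ l * z := one_le_mul_of_one_le_of_one_le (by linarith) (by linarith)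
        rw [h2]
        linarith
    _ = Real.exp (-(3 * 10 ^ 9 * z)) ^ (r + 1) * Real.exp (-1) := by
        rw [Real.exp_add, Real.exp_nat_mul]
    _ ≤ _ := by
        rw [div_eq_mul_one_div]
        refine mul_le_mul (pow_le_pow_left₀ (Real.exp_pos _).le e5 _) ?_ (Real.exp_pos _).le
          (by positivity)
        rw [Real.exp_neg, ← one_div]
        refine div_le_div_of_nonneg_left (by norm_num) (by norm_num) ?_
        linarith [Real.add_one_le_exp (1 : ℝ)]

end Setup

end TamariLevels

namespace TamariLevels

open Finset MeasureTheory

/-! ### The heights of the anchors -/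

/-- The heights of the anchors in decreasing order. -/
def heightSeq (t : ℕ) : ℕ → ℕ
  | 0 => t
  | i + 1 => (2 * heightSeq t i + 2) / 3

theorem two_le_heightSeq {t : ℕ} (ht : 2 ≤ t) (i : ℕ) : 2 ≤ heightSeq t i := by
  induction i with
  | zero => exact ht
  | succ i ih =>
    unfold heightSeq
    omega

theorem heightSeq_le {t : ℕ} (ht : 2 ≤ t) (i : ℕ) :
    3 ^ i * (heightSeq t i - 2) ≤ 2 ^ i * (t - 2) := by
  induction i with
  | zero => exact le_rfl
  | succ i ih =>
    have h1 := two_le_heightSeq ht i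
    have h2 : 3 * (heightSeq t (i + 1) - 2) ≤ 2 * (heightSeq t i - 2) := by
      rw [show heightSeq t (i + 1) = (2 * heightSeq t i + 2) / 3 from rfl]
      omega
    calc 3 ^ (i + 1) * (heightSeq t (i + 1) - 2)
        = 3 ^ i * (3 * (heightSeq t (i + 1) - 2)) := by ring
      _ ≤ 3 ^ i * (2 * (heightSeq t i - 2)) := Nat.mul_le_mul_left _ h2
      _ = 2 * (3 ^ i * (heightSeq t i - 2)) := by ring
      _ ≤ 2 * (2 ^ i * (t - 2)) := Nat.mul_le_mul_left _ ih
      _ = _ := by ring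

/-- Parameters for the construction with a given largest height `t`. -/
theorem exists_setup {p : unitInterval} {l P t : ℕ} (hp0 : (0 : ℝ) < p) (hp1 : (p : ℝ) < 1)
    (hl : 100 ≤ l) (hP : 1 ≤ (p : ℝ) * P) (hPl : P ≤ l) (ht : 3 ≤ t)
    (ht1 : (1 - (p : ℝ))⁻¹ * (2 ^ l) ^ 80 < (1 - (p : ℝ))⁻¹ ^ t)
    (ht2 : (1 - (p : ℝ))⁻¹ ^ t ≤ Real.exp (2 ^ l)) :
    ∃ r σ₀ sr u, Setup p l P r σ₀ sr u (1 - (p : ℝ))⁻¹ (2 ^ l) ∧ u r = t := by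
  set Q := (1 - (p : ℝ))⁻¹ with hQ
  have hQ1 : 1 < Q := (one_lt_inv₀ (by linarith)).2 (by linarith)
  set G : ℝ := 2 ^ l with hG
  have hG1 : 1 ≤ G := one_le_pow₀ (by norm_num)
  have hPpos : 0 < P := by
    rcases Nat.eq_zero_or_pos P with h | h
    · rw [h] at hP
      norm_num at hP
    · exact h
  -- `t * p` is at most `log (Q ^ t)`
  have htG : t ≤ 2 ^ (2 * l) := by
    have h1 : Real.exp p ≤ Q := by
      rw [hQ, le_inv_comm₀ (Real.exp_pos _) (by linarith), ← Real.exp_neg]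
      linarith [Real.add_one_le_exp (-(p : ℝ))]
    have h2 : Real.exp (t * p) ≤ Real.exp G := by
      rw [Real.exp_nat_mul]
      exact (pow_le_pow_left₀ (Real.exp_pos _).le h1 t).trans ht2
    have h3 := Real.exp_le_exp.1 h2
    have h4 : (t : ℝ) ≤ G * G := by
      have h5 := mul_le_mul_of_nonneg_left hP (show (0 : ℝ) ≤ t by positivity)
      have h6 := mul_le_mul_of_nonneg_right h3 (show (0 : ℝ) ≤ P by positivity)
      have h7 : (P : ℝ) ≤ G := by
        have : P ≤ 2 ^ l := hPl.trans Nat.lt_two_pow_self.le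
        rw [hG]
        exact_mod_cast this
      have h8 : G * P ≤ G * G := mul_le_mul_of_nonneg_left h7 (by linarith)
      linarith
    have h5 : (t : ℝ) ≤ ((2 ^ (2 * l) : ℕ) : ℝ) := by
      push_cast
      rw [two_mul, pow_add]
      exact h4
    exact_mod_cast h5
  have h2f := two_le_heightSeq (show 2 ≤ t by omega)
  -- `t - 2` is multiplied by at most `2 / 3` in each step, so `4 * l` steps suffice
  have hlast : heightSeq t (4 * l) = 2 ∨ Q ^ heightSeq t (4 * l) ≤ Q * G ^ 80 := by
    left
    by_contra hc
    have h1 := heightSeq_le (show 2 ≤ t by omega) (4 * l)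
    have h2 := h2f (4 * l)
    have h3 : 3 ^ (4 * l) * 1 ≤ 3 ^ (4 * l) * (heightSeq t (4 * l) - 2) :=
      Nat.mul_le_mul_left _ (by omega)
    have h4 : 2 ^ (4 * l) * (t - 2) ≤ 2 ^ (4 * l) * 2 ^ (2 * l) := Nat.mul_le_mul_left _ (by omega)
    have h5 : 3 ^ (4 * l) ≤ 2 ^ (6 * l) := by
      rw [show 6 * l = 4 * l + 2 * l by ring, pow_add]
      omega
    rw [pow_mul, pow_mul] at h5
    have h6 : (2 ^ 6) ^ l < (3 ^ 4) ^ l := Nat.pow_lt_pow_left (by norm_num) (by omega)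
    omega
  classical
  have hex : ∃ i, heightSeq t i = 2 ∨ Q ^ heightSeq t i ≤ Q * G ^ 80 := ⟨_, hlast⟩
  set r := Nat.find hex with hr
  have hrl : r ≤ 4 * l := Nat.find_le hlast
  have hr0 : 0 < r := by
    rw [hr, Nat.find_pos]
    change ¬ (t = 2 ∨ Q ^ t ≤ Q * G ^ 80)
    rintro (h | h)
    · omega
    · exact absurd h ht1.not_ge
  have hnot : ∀ i < r, 3 ≤ heightSeq t i ∧ Q * G ^ 80 ≤ Q ^ heightSeq t i := by
    intro i hi
    have h1 := Nat.find_min hex hi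
    rw [not_or, not_le] at h1
    have := h2f i
    exact ⟨by omega, h1.2.le⟩
  have hu : ∀ j < r, ∃ f, 3 ≤ f ∧ Q * G ^ 80 ≤ Q ^ f ∧ heightSeq t (r - (j + 1)) = f ∧
      heightSeq t (r - j) = (2 * f + 2) / 3 := by
    intro j hj
    obtain ⟨h1, h2⟩ := hnot (r - (j + 1)) (by omega)
    refine ⟨_, h1, h2, rfl, ?_⟩
    rw [show r - j = r - (j + 1) + 1 by omega]
    rfl
  -- twice the smallest height exceeds the next height `f`, and `Q * G ^ 80 ≤ Q ^ f`
  have hbase : Q * G ^ 40 ≤ Q ^ heightSeq t (r - 0) := by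
    obtain ⟨f, h1, h2, -, h4⟩ := hu 0 hr0
    have h5 : (Q * G ^ 40) ^ 2 ≤ (Q ^ heightSeq t (r - 0)) ^ 2 := by
      calc (Q * G ^ 40) ^ 2 = Q * (Q * G ^ 80) := by ring
        _ ≤ Q * Q ^ f := mul_le_mul_of_nonneg_left h2 (by linarith)
        _ = Q ^ (f + 1) := by ring
        _ ≤ Q ^ (heightSeq t (r - 0) * 2) := pow_le_pow_right₀ hQ1.le (by omega)
        _ = _ := pow_mul _ _ _
    exact le_of_pow_le_pow_left₀ (by norm_num) (by positivity) h5
  set M := min (Q ^ heightSeq t (r - 0)) (Q * G ^ 80) with hM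
  have hMQ : Q * G ^ 40 ≤ M :=
    le_min hbase (mul_le_mul_of_nonneg_left (pow_le_pow_right₀ hG1 (by norm_num)) (by linarith))
  obtain ⟨sr, hsr1, hsr2⟩ := exists_nat_pow_near (x := M / (2000 * Q)) (y := 4) (by
    rw [one_le_div (by positivity)]
    have h1 : 2000 ≤ G ^ 40 := by
      calc (2000 : ℝ) ≤ 2 ^ 100 := by norm_num
        _ ≤ G := pow_le_pow_right₀ (by norm_num) hl
        _ = G ^ 1 := (pow_one G).symm
        _ ≤ _ := pow_le_pow_right₀ hG1 (by norm_num)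
    have := mul_le_mul_of_nonneg_left h1 (show 0 ≤ Q by linarith)
    linarith) (by norm_num)
  rw [le_div_iff₀ (by positivity)] at hsr1
  rw [div_lt_iff₀ (by positivity), pow_succ] at hsr2
  obtain ⟨σ₀, hσ1, hσ2⟩ := exists_nat_pow_near (x := ((3000 * l * P : ℕ) : ℝ)) (y := 2) (by
    have : 0 < l * P := Nat.mul_pos (by omega) hPpos
    exact_mod_cast (show 1 ≤ 3000 * l * P by rw [mul_assoc]; omega)) (by norm_num)
  have hσ1' : 2 ^ σ₀ ≤ 3000 * l * P := by exact_mod_cast hσ1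
  have hσ2' : 3000 * l * P < 2 ^ (σ₀ + 1) := by exact_mod_cast hσ2
  refine ⟨r, σ₀, sr, fun j => heightSeq t (r - j), ?_, congrArg (heightSeq t) (Nat.sub_self r)⟩
  refine
    { p_pos := hp0
      p_lt := hp1
      Q_eq := rfl
      G_eq := rfl
      l_ge := hl
      P_ge := hP
      P_le := hPl
      A_ge := by
        rw [pow_succ] at hσ2'
        rw [mul_assoc] at hσ2' ⊢
        omega
      A_le := hσ1'
      r_pos := hr0
      r_le := hrl
      u_lt := fun j hj => ?_
      u_cube := fun j hj => ?_
      u_step := fun j hj => ?_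
      le_pow := fun j hj => ?_
      u_le := by
        rw [Nat.sub_self]
        exact htG
      pow_le_exp := by
        rw [Nat.sub_self]
        exact ht2
      base := Nat.find_spec hex
      base_ge := hbase
      sr_ge := by linarith
      sr_le := by linarith }
  all_goals obtain ⟨f, h1, h2, h3, h4⟩ := hu j hj
  · rw [h3, h4]
    omega
  · rw [h3, h4]
    omega
  · rw [h3, h4]
    omega
  · rw [h3]
    exact h2

/-- The probability that a position of size about `(1 - p) ^ (-t)` stays unsettled. -/
theorem exp_le_coinP {p : unitInterval} {l P t : ℕ} (hp0 : (0 : ℝ) < p) (hp1 : (p : ℝ) < 1)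
    (hl : 100 ≤ l) (hP : 1 ≤ (p : ℝ) * P) (hPl : P ≤ l) (ht : 3 ≤ t)
    (ht1 : (1 - (p : ℝ))⁻¹ * (2 ^ l) ^ 80 < (1 - (p : ℝ))⁻¹ ^ t)
    (ht2 : (1 - (p : ℝ))⁻¹ ^ t ≤ Real.exp (2 ^ l)) :
    Real.exp (-(2 * 10 ^ 10 * ((l : ℝ) ^ 4 * P ^ 2))) ≤ coinP p {w |
      ∃ y ≤ ⌊(1 - (p : ℝ))⁻¹ ^ t⌋₊, lev w (⌊(1 - (p : ℝ))⁻¹ ^ t⌋₊ / 4) y < y} := by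
  obtain ⟨r, σ₀, sr, u, H, rfl⟩ := exists_setup hp0 hp1 hl hP hPl ht ht1 ht2
  exact H.exp_le_coinP

end TamariLevels

namespace TamariLevels

open Finset MeasureTheory

/-! ### Few failures -/

theorem succs_le_sub_of_fail {w : ℕ → Bool} {g : ℕ} (h : ∀ i < g, w i = false) (u : ℕ) :
    succs w 0 u ≤ u - g := by
  have h1 : succs w 0 u = succs w 0 (min g u) + succs w (min g u) u :=
    succs_split w (Nat.zero_le _) (min_le_right _ _)
  have h2 : succs w 0 (min g u) = 0 := by
    unfold succs
    rw [card_eq_zero, filter_eq_empty_iff]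
    intro i hi
    have := (mem_Ico.1 hi).2
    simp [h i (by omega)]
  have := succs_le w (min g u) u
  omega

theorem le_lev_of_success {w : ℕ → ℕ → Bool} {y t : ℕ} (hw : w y 0 = true) (ht : 0 < t) :
    y ≤ lev w t y := by
  rcases Nat.eq_zero_or_pos y with rfl | hy
  · exact Nat.zero_le _
  have h1 := lt_lev_of_blocked w (x := y) (y := y - 1) (g := 0) (by omega) (by simp) hw (by simp)
  rw [zero_add] at h1
  have h2 : lev w 1 y ≤ lev w t y := lev_mono w y ht
  omega

/-- If all positions below `b` settle in the first step, but `b` does not move, then `b` needs at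
least `b` further steps. -/
theorem lev_lt_of_single {w : ℕ → ℕ → Bool} {b T : ℕ} (hb : w b 0 = false)
    (h : ∀ y, 0 < y → y < b → w y 0 = true) (hT : 0 < T) (hTb : T ≤ b) : lev w T b < b := by
  have h1 := lev_eq_of_clear w (a := b) (s := 0) (t := T) (m := 0) (Nat.zero_le _) rfl (by omega) ?_
  · have h2 := succs_le_sub_of_fail (w := w b) (g := 1) (fun i hi => by
      rw [Nat.lt_one_iff.1 hi]
      exact hb) T
    omega
  · intro u _ _ hu y hy h2
    have hu0 : 0 < u := by
      rcases Nat.eq_zero_or_pos u with rfl | h3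
      · rw [hb] at hu
        exact absurd hu (by simp)
      · exact h3
    have := le_lev_of_success (h y (by omega) hy) hu0
    omega

/-- Suppose that `a` fails twice, that `f` fails just once, and that every other position below `a`
does not fail twice, and not at all if it is less than `f`. After two steps, the positions between
`f` and `a` are on levels above `f`, and `a` does not catch up with them if they do not fail too
often. -/
theorem lev_lt_of_pair {w : ℕ → ℕ → Bool} {f a m T : ℕ} (ha : w a ∈ (Before 2)ᶜ)
    (hf : w f ∈ First 1 ∩ {v | fails v 2 (2 + m) = 0}) (hm : m / 2 < f) (hfm : f ≤ m)
    (hsmall : ∀ y, 0 < y → y ≤ m → y ≠ f → w y ∈ First 0)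
    (hlarge : ∀ y, m < y → y < a → w y ∈ Before 2 ∩ {v | fails v 2 (2 + T) ≤ m / 2})
    (hTa : T + 2 ≤ a) : lev w (T + 2) a < a := by
  have hafail : ∀ i < 2, w a i = false := by
    intro i hi
    by_contra hc
    exact ha ⟨i, hi, by simpa using hc⟩
  have h1 := lev_eq_of_clear w (a := a) (s := 0) (t := T + 2) (m := 0) (Nat.zero_le _) rfl
    (by omega) ?_
  · have h2 := succs_le_sub_of_fail hafail (T + 2)
    omega
  intro u _ hu hau y hy h2
  have hu2 : 2 ≤ u := by
    by_contra hc
    rw [hafail u (by omega)] at hau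
    exact absurd hau (by simp)
  have h3 := succs_le_sub_of_fail hafail u
  by_cases hyf : y = f
  · subst hyf
    have h4 := min_le_lev w y (Nat.zero_le u) (Nat.zero_le _)
    have h5 := succs_add_fails (w y) 2 (min u (2 + m))
    have h6 := fails_mono (w y) 2 (min_le_right u (2 + m))
    have h7 : fails (w y) 2 (2 + m) = 0 := hf.2
    have h8 := succs_split (w y) (Nat.zero_le 2) (show 2 ≤ min u (2 + m) by omega)
    have h9 := succs_mono (w y) 0 (min_le_left u (2 + m))
    have h10 : 1 ≤ succs (w y) 0 2 := by
      unfold succs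
      rw [Nat.one_le_iff_ne_zero, card_ne_zero]
      exact ⟨1, mem_filter.2 ⟨by simp, hf.1.2⟩⟩
    omega
  · by_cases hy0 : w y 0 = true
    · have := le_lev_of_success hy0 (show 0 < u by omega)
      omega
    · have hmy : m < y := by
        by_contra hc
        exact hy0 (hsmall y (by omega) (by omega) hyf).2
      obtain ⟨⟨i, hi, hit⟩, h5⟩ := hlarge y hmy hy
      have h5 : fails (w y) 2 (2 + T) ≤ m / 2 := h5
      have hi1 : w y 1 = true := by
        have : i = 0 ∨ i = 1 := by omega
        rcases this with rfl | rfl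
        · exact absurd hit hy0
        · exact hit
      have h6 := lt_lev_of_blocked w (x := y) (y := f) (g := 1) (by omega)
        (fun i hi => by rw [Nat.lt_one_iff.1 hi]; simpa using hy0) hi1 hf.1.1
      have h7 := min_le_lev w y (s := 2) (t := u) hu2 (Nat.succ_le_of_lt h6)
      have h8 := succs_add_fails (w y) 2 u
      have h9 := fails_mono (w y) 2 (show u ≤ 2 + T by omega)
      omega

theorem one_sub_sum_le_prod {ι : Type*} (s : Finset ι) (x : ι → ℝ) (h0 : ∀ i ∈ s, 0 ≤ x i)
    (h1 : ∀ i ∈ s, x i ≤ 1) : 1 - ∑ i ∈ s, (1 - x i) ≤ ∏ i ∈ s, x i := by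
  classical
  induction s using Finset.induction_on with
  | empty => simp
  | insert i s hi ih =>
    rw [sum_insert hi, prod_insert hi]
    have h2 := ih (fun j hj => h0 j (mem_insert_of_mem hj)) fun j hj => h1 j (mem_insert_of_mem hj)
    have h3 := h0 i (mem_insert_self i s)
    have h4 := h1 i (mem_insert_self i s)
    have h5 : ∏ i ∈ s, x i ≤ 1 := prod_le_one (fun j hj => h0 j (mem_insert_of_mem hj))
      fun j hj => h1 j (mem_insert_of_mem hj)
    nlinarith

section

variable {p : unitInterval}

theorem card_Ioc_half_ge (m : ℕ) : (m : ℝ) / 2 ≤ #(Ioc (m / 2) m) := by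
  rw [Nat.card_Ioc]
  have h1 : m ≤ 2 * (m - m / 2) := by omega
  have h2 : (m : ℝ) ≤ 2 * ((m - m / 2 : ℕ) : ℝ) := by exact_mod_cast h1
  linarith

/-- The coins of the position `y` when `b` is the only position that fails in the first step. -/
def singleRow (b y : ℕ) : Set (ℕ → Bool) :=
  if y = b then (Before 1)ᶜ else First 0

theorem depOn_singleRow (b y : ℕ) : DepOn (singleRow b y) 0 1 := by
  unfold singleRow
  split_ifs
  · exact (depOn_before 1).compl
  · exact depOn_first 0

/-- The probability that there is exactly one failure in the first step, among `m` positions. -/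
theorem le_coinP_single {m : ℕ} (hm : 2 ≤ m) (hq : (1 - (p : ℝ)) * m ≤ 1 / 2) :
    (1 - (p : ℝ)) * m / 4 ≤ coinP p {w | ∃ y ≤ m, lev w (m / 2) y < y} := by
  have hp0 := p.2.1
  have hp1 := p.2.2
  set E : ℕ → Set (ℕ → ℕ → Bool) := fun b =>
    {w | ∀ y ∈ Icc 1 m, w y ∈ singleRow b y} with hE
  have hsub : ⋃ b ∈ Ioc (m / 2) m, E b ⊆ {w | ∃ y ≤ m, lev w (m / 2) y < y} := by
    intro w hw
    simp only [Set.mem_iUnion, exists_prop] at hw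
    obtain ⟨b, hb, hw⟩ := hw
    have hb := mem_Ioc.1 hb
    refine ⟨b, hb.2, lev_lt_of_single ?_ ?_ (by omega) (by omega)⟩
    · have h1 := hw b (mem_Icc.2 (by omega))
      rw [singleRow, if_pos rfl] at h1
      by_contra hc
      exact h1 ⟨0, by omega, by simpa using hc⟩
    · intro y hy hyb
      have h1 := hw y (mem_Icc.2 (by omega))
      rw [singleRow, if_neg hyb.ne] at h1
      exact h1.2
  have hdisj : coinP p (⋃ b ∈ Ioc (m / 2) m, E b) = ∑ b ∈ Ioc (m / 2) m, coinP p (E b) := by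
    refine measureReal_biUnion_finset ?_ fun b _ =>
      (depOnRows_box fun y _ => depOn_singleRow b y).measurableSet
    intro b hb b' hb' hne
    refine Set.disjoint_left.2 fun w h1 h2 => ?_
    have hb := mem_Ioc.1 hb
    have e1 := h1 b (mem_Icc.2 (by omega))
    have e2 := h2 b (mem_Icc.2 (by omega))
    rw [singleRow, if_pos rfl] at e1
    rw [singleRow, if_neg hne] at e2
    exact e1 ⟨0, by omega, e2.2⟩
  refine le_trans ?_ (coinP_mono p hsub)
  rw [hdisj]
  calc (1 - (p : ℝ)) * m / 4 ≤ #(Ioc (m / 2) m) * ((1 - (p : ℝ)) * (1 / 2)) := by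
        have h1 := mul_le_mul_of_nonneg_right (card_Ioc_half_ge m)
          (show 0 ≤ (1 - (p : ℝ)) * (1 / 2) by linarith)
        linarith
    _ = ∑ _b ∈ Ioc (m / 2) m, (1 - (p : ℝ)) * (1 / 2) := by rw [sum_const, nsmul_eq_mul]
    _ ≤ _ := by
        refine sum_le_sum fun b hb => ?_
        have hb := mem_Ioc.1 hb
        rw [hE, coinP_box p fun y _ => depOn_singleRow b y,
          ← mul_prod_erase _ _ (mem_Icc.2 (show 1 ≤ b ∧ b ≤ m by omega)), singleRow,
          if_pos rfl, rowP_not_before, pow_one]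
        refine mul_le_mul_of_nonneg_left ?_ (by linarith)
        calc (1 : ℝ) / 2 ≤ p ^ m := by linarith [one_sub_mul_le p m]
          _ ≤ p ^ #((Icc 1 m).erase b) := pow_le_pow_of_le_one hp0 hp1 (by
              refine (card_le_card (erase_subset _ _)).trans ?_
              simp)
          _ = ∏ _y ∈ (Icc 1 m).erase b, (p : ℝ) := by rw [prod_const]
          _ ≤ _ := by
              refine prod_le_prod (fun _ _ => hp0) fun y hy => ?_
              rw [singleRow, if_neg (mem_erase.1 hy).1, rowP_first, pow_zero, mul_one]

/-- The coins of the position `y` in the configuration with a position `f` that fails once and a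
position `a` that fails twice. -/
def pairRow (m T f a y : ℕ) : Set (ℕ → Bool) :=
  if y = a then (Before 2)ᶜ else if y = f then First 1 ∩ {v | fails v 2 (2 + m) = 0} else
    if y ≤ m then First 0 else Before 2 ∩ {v | fails v 2 (2 + T) ≤ m / 2}

theorem depOn_pairRow (m T f a y : ℕ) : DepOn (pairRow m T f a y) 0 (2 + m + T) := by
  unfold pairRow
  split_ifs
  · exact (depOn_before 2).compl.mono le_rfl (by omega)
  · exact ((depOn_first 1).mono le_rfl (by omega)).inter
      ((depOn_fails fun x => x = 0).mono (Nat.zero_le _) (by omega))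
  · exact (depOn_first 0).mono le_rfl (by omega)
  · exact ((depOn_before 2).mono le_rfl (by omega)).inter
      ((depOn_fails fun x => x ≤ m / 2).mono (Nat.zero_le _) (by omega))

/-- The probability that a position stays unsettled because of a pair of slow positions. -/
theorem le_coinP_pair {m n T : ℕ} {δ : ℝ} (hm : 2 ≤ m) (hmn : 2 * m ≤ n) (hTn : 2 * T + 4 ≤ n)
    (hp : 1 / 2 ≤ (p : ℝ)) (hqm : (1 - (p : ℝ)) * m ≤ 1 / 8) (hqn : (1 - (p : ℝ)) ^ 2 * n ≤ 1 / 8)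
    (hδ : rowP p {v | fails v 2 (2 + T) ≤ m / 2}ᶜ ≤ δ) (hδn : n * δ ≤ 1 / 8) :
    (1 - (p : ℝ)) * m * ((1 - (p : ℝ)) ^ 2 * n) / 32 ≤
      coinP p {w | ∃ y ≤ n, lev w (T + 2) y < y} := by
  have hp1 := p.2.2
  have hq0 : 0 ≤ 1 - (p : ℝ) := by linarith
  have hδ0 : 0 ≤ δ := (rowP_nonneg p _).trans hδ
  set I := Ioc (m / 2) m ×ˢ Ioc (n / 2) n with hI
  set E : ℕ × ℕ → Set (ℕ → ℕ → Bool) := fun b =>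
    {w | ∀ y ∈ Icc 1 n, w y ∈ pairRow m T b.1 b.2 y} with hE
  have hmem : ∀ b ∈ I, (m / 2 < b.1 ∧ b.1 ≤ m) ∧ n / 2 < b.2 ∧ b.2 ≤ n := by
    intro b hb
    rw [hI, mem_product, mem_Ioc, mem_Ioc] at hb
    exact hb
  have hsub : ⋃ b ∈ I, E b ⊆ {w | ∃ y ≤ n, lev w (T + 2) y < y} := by
    intro w hw
    simp only [Set.mem_iUnion, exists_prop] at hw
    obtain ⟨⟨f, a⟩, hb, hw⟩ := hw
    obtain ⟨⟨h1, h2⟩, h3, h4⟩ := hmem _ hb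
    simp only at h1 h2 h3 h4
    have hrow : ∀ y, 0 < y → y ≤ n → w y ∈ pairRow m T f a y := fun y h5 h6 =>
      hw y (mem_Icc.2 ⟨h5, h6⟩)
    refine ⟨a, h4, lev_lt_of_pair (f := f) (m := m) ?_ ?_ h1 h2 ?_ ?_ (by omega)⟩
    · have := hrow a (by omega) h4
      rwa [pairRow, if_pos rfl] at this
    · have := hrow f (by omega) (by omega)
      rwa [pairRow, if_neg (by omega), if_pos rfl] at this
    · intro y h5 h6 h7
      have := hrow y h5 (by omega)
      rwa [pairRow, if_neg (by omega), if_neg h7, if_pos h6] at this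
    · intro y h5 h6
      have := hrow y (by omega) (by omega)
      rwa [pairRow, if_neg (by omega), if_neg (by omega), if_neg (by omega)] at this
  have hdisj : coinP p (⋃ b ∈ I, E b) = ∑ b ∈ I, coinP p (E b) := by
    refine measureReal_biUnion_finset ?_ fun b _ =>
      (depOnRows_box fun y _ => depOn_pairRow m T b.1 b.2 y).measurableSet
    rintro ⟨f, a⟩ hb ⟨f', a'⟩ hb' hne
    refine Set.disjoint_left.2 fun w h1 h2 => ?_
    obtain ⟨⟨e1, e2⟩, e3, e4⟩ := hmem _ hb
    obtain ⟨⟨e1', e2'⟩, e3', e4'⟩ := hmem _ hb'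
    simp only at e1 e2 e3 e4 e1' e2' e3' e4'
    by_cases haa : a = a'
    · have hff : f ≠ f' := fun h => hne (by rw [h, haa])
      have h3 : w f ∈ pairRow m T f a f := h1 f (mem_Icc.2 (by omega))
      have h4 : w f ∈ pairRow m T f' a' f := h2 f (mem_Icc.2 (by omega))
      rw [pairRow, if_neg (by omega), if_pos rfl] at h3
      rw [pairRow, if_neg (by omega), if_neg hff, if_pos e2] at h4
      have h5 := h3.1.1 0 (by omega)
      rw [h4.2] at h5
      exact absurd h5 (by simp)
    · have h3 : w a ∈ pairRow m T f a a := h1 a (mem_Icc.2 (by omega))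
      have h4 : w a ∈ pairRow m T f' a' a := h2 a (mem_Icc.2 (by omega))
      rw [pairRow, if_pos rfl] at h3
      rw [pairRow, if_neg haa, if_neg (by omega), if_neg (by omega)] at h4
      exact h3 h4.1
  refine le_trans ?_ (coinP_mono p hsub)
  rw [hdisj]
  have hbox : ∀ b ∈ I, (1 - (p : ℝ)) ^ 2 * ((1 - p) / 4 * (1 / 2)) ≤ coinP p (E b) := by
    rintro ⟨f, a⟩ hb
    obtain ⟨⟨e1, e2⟩, e3, e4⟩ := hmem _ hb
    simp only at e1 e2 e3 e4
    rw [hE, coinP_box p fun y _ => depOn_pairRow m T f a y,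
      ← mul_prod_erase _ _ (mem_Icc.2 (show 1 ≤ a ∧ a ≤ n by omega)),
      ← mul_prod_erase _ _ (mem_erase.2 ⟨show f ≠ a by omega,
        mem_Icc.2 (show 1 ≤ f ∧ f ≤ n by omega)⟩)]
    have r1 : rowP p (pairRow m T f a a) = (1 - (p : ℝ)) ^ 2 := by
      rw [pairRow, if_pos rfl, rowP_not_before]
    have r2 : (1 - (p : ℝ)) / 4 ≤ rowP p (pairRow m T f a f) := by
      rw [pairRow, if_neg (by omega), if_pos rfl, rowP_inter p (depOn_first 1)
        (depOn_fails fun x => x = 0) le_rfl, rowP_first, rowP_fails_eq_zero, pow_one]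
      have h1 := one_sub_mul_le p m
      calc (1 - (p : ℝ)) / 4 = 1 / 2 * (1 - p) * (1 / 2) := by ring
        _ ≤ p * (1 - p) * p ^ m := by
          refine mul_le_mul (mul_le_mul_of_nonneg_right hp hq0) (by linarith) (by norm_num) ?_
          exact mul_nonneg (by linarith) hq0
    have r3 : (1 : ℝ) / 2 ≤ ∏ y ∈ ((Icc 1 n).erase a).erase f, rowP p (pairRow m T f a y) := by
      refine le_trans ?_ (one_sub_sum_le_prod _ _ (fun _ _ => rowP_nonneg p _)
        fun _ _ => rowP_le_one p _)
      have h1 : ∑ y ∈ ((Icc 1 n).erase a).erase f, (1 - rowP p (pairRow m T f a y)) ≤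
          ∑ y ∈ Icc 1 n, ((if y ≤ m then 1 - (p : ℝ) else 0) + ((1 - p) ^ 2 + δ)) := by
        refine (sum_le_sum fun y hy => ?_).trans (sum_le_sum_of_subset_of_nonneg
          ((erase_subset _ _).trans (erase_subset _ _)) fun y _ _ => ?_)
        · obtain ⟨h2, h3⟩ := mem_erase.1 hy
          have h4 := (mem_erase.1 h3).1
          rw [pairRow, if_neg h4, if_neg h2]
          split_ifs with h5
          · rw [rowP_first, pow_zero, mul_one]
            have := sq_nonneg (1 - (p : ℝ))
            linarith
          · have h6 := rowP_compl p (((depOn_before 2).mono le_rfl (show 2 ≤ 2 + T by omega)).inter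
              ((depOn_fails (s := 2) (t := 2 + T) fun x => x ≤ m / 2).mono (Nat.zero_le _) le_rfl))
            have h7 := rowP_union_le p (Before 2)ᶜ {v | fails v 2 (2 + T) ≤ m / 2}ᶜ
            rw [← Set.compl_inter, rowP_not_before] at h7
            linarith
        · have := sq_nonneg (1 - (p : ℝ))
          split_ifs <;> linarith
      have h2 : ∑ y ∈ Icc 1 n, ((if y ≤ m then 1 - (p : ℝ) else 0) + ((1 - p) ^ 2 + δ)) ≤ 3 / 8 := by
        rw [sum_add_distrib, ← sum_filter, sum_const, sum_const, nsmul_eq_mul, nsmul_eq_mul,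
          Nat.card_Icc, Nat.add_sub_cancel]
        have h3 : #{y ∈ Icc 1 n | y ≤ m} ≤ m := by
          calc _ ≤ #(Icc 1 m) := card_le_card fun y hy => by
                obtain ⟨h4, h5⟩ := mem_filter.1 hy
                exact mem_Icc.2 ⟨(mem_Icc.1 h4).1, h5⟩
            _ = m := by simp
        have h4 : (#{y ∈ Icc 1 n | y ≤ m} : ℝ) * (1 - p) ≤ m * (1 - p) :=
          mul_le_mul_of_nonneg_right (by exact_mod_cast h3) hq0
        linarith
      linarith
    rw [r1]
    refine mul_le_mul_of_nonneg_left ?_ (sq_nonneg _)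
    exact mul_le_mul r2 r3 (by norm_num) (rowP_nonneg p _)
  have hcard : (m : ℝ) / 2 * (n / 2) ≤ #I := by
    rw [hI, card_product, Nat.cast_mul]
    exact mul_le_mul (card_Ioc_half_ge m) (card_Ioc_half_ge n) (by positivity) (by positivity)
  calc (1 - (p : ℝ)) * m * ((1 - (p : ℝ)) ^ 2 * n) / 32
      = (m / 2 * (n / 2)) * ((1 - (p : ℝ)) ^ 2 * ((1 - p) / 4 * (1 / 2))) := by ring
    _ ≤ #I * ((1 - (p : ℝ)) ^ 2 * ((1 - p) / 4 * (1 / 2))) :=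
        mul_le_mul_of_nonneg_right hcard (by positivity)
    _ = ∑ _b ∈ I, (1 - (p : ℝ)) ^ 2 * ((1 - p) / 4 * (1 / 2)) := by rw [sum_const, nsmul_eq_mul]
    _ ≤ _ := sum_le_sum hbox

end

end TamariLevels

namespace TamariLevels

open MeasureTheory Filter

/-! ### Uniquely attained maxima -/

section

variable {p : unitInterval}

instance isProbabilityMeasure_geometricLaw : IsProbabilityMeasure (geometricLaw p) :=
  Measure.isProbabilityMeasure_map (Measurable.of_discrete).aemeasurable

theorem geometricLaw_real_le (hp : 0 < p) (k : ℕ) :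
    (geometricLaw p).real {g | g ≤ k} = 1 - (1 - (p : ℝ)) ^ k := by
  rw [geometricLaw, map_measureReal_apply Measurable.of_discrete (.of_discrete)]
  have h1 : (fun j : ℕ => j + 1) ⁻¹' {g | g ≤ k} = (Finset.range k : Set ℕ) := by
    ext j
    simp only [Set.mem_preimage, Set.mem_ofPred_eq, Finset.coe_range, Set.mem_Iio,
      Nat.add_one_le_iff]
  rw [h1, ← sum_measureReal_singleton]
  simp_rw [ProbabilityTheory.geometricMeasure_real_singleton hp.ne']
  rw [← Finset.sum_mul, mul_comm]
  have h2 := mul_neg_geom_sum (1 - (p : ℝ)) k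
  rwa [sub_sub_cancel] at h2

theorem pi_geometricLaw_real_le (hp : 0 < p) {n : ℕ} (A : Finset (Fin n)) (k : ℕ) :
    (Measure.pi fun _ : Fin n => geometricLaw p).real {g | ∀ i ∈ A, g i ≤ k} =
      (1 - (1 - (p : ℝ)) ^ k) ^ A.card := by
  classical
  have h1 : {g : Fin n → ℕ | ∀ i ∈ A, g i ≤ k} =
      Set.univ.pi fun i => if i ∈ A then {g | g ≤ k} else Set.univ := by
    ext g
    simp only [Set.mem_ofPred_eq, Set.mem_pi, Set.mem_univ, true_implies]
    refine forall_congr' fun i => ?_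
    split_ifs with h <;> simp [h]
  rw [h1, measureReal_def, Measure.pi_pi, ENNReal.toReal_prod]
  calc _ = ∏ i, if i ∈ A then 1 - (1 - (p : ℝ)) ^ k else 1 := by
        refine Finset.prod_congr rfl fun i _ => ?_
        split_ifs
        · rw [← geometricLaw_real_le hp, measureReal_def]
        · simp
    _ = _ := by rw [Finset.prod_ite_mem, Finset.univ_inter, Finset.prod_const]

/-- If the maximum is attained just once, then it exceeds `k + 1`, or one half of the variables are
at most `k`. -/
theorem uniqueMaxProb_le (hp : 0 < p) (m k : ℕ) :
    uniqueMaxProb p (m + m) ≤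
      (m + m) * (1 - (p : ℝ)) ^ (k + 1) + 2 * (1 - (1 - (p : ℝ)) ^ k) ^ m := by
  have hp0 := p.2.1
  have hp1 := p.2.2
  set μ := Measure.pi fun _ : Fin (m + m) => geometricLaw p with hμ
  set A : Finset (Fin (m + m)) := Finset.univ.map (Fin.castAddEmb m) with hA
  set B : Finset (Fin (m + m)) := Finset.univ.map (Fin.natAddEmb m) with hB
  have hsub : {g : Fin (m + m) → ℕ | ∃! i, ∀ j, g j ≤ g i} ⊆
      {g | ∀ i ∈ (Finset.univ : Finset (Fin (m + m))), g i ≤ k + 1}ᶜ ∪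
        ({g | ∀ i ∈ A, g i ≤ k} ∪ {g | ∀ i ∈ B, g i ≤ k}) := by
    rintro g ⟨i₀, -, hi₀⟩
    by_contra hc
    simp only [Set.mem_union, Set.mem_compl_iff, Set.mem_ofPred_eq, not_or, not_not] at hc
    obtain ⟨h1, h2, h3⟩ := hc
    push Not at h2 h3
    obtain ⟨i, hi, hik⟩ := h2
    obtain ⟨j, hj, hjk⟩ := h3
    have h2 : i = i₀ := hi₀ i fun x => (h1 x (Finset.mem_univ x)).trans (by omega)
    have h3 : j = i₀ := hi₀ j fun x => (h1 x (Finset.mem_univ x)).trans (by omega)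
    obtain ⟨a, -, ha⟩ := Finset.mem_map.1 hi
    obtain ⟨b, -, hb⟩ := Finset.mem_map.1 hj
    have h4 : (Fin.castAdd m a : ℕ) = (Fin.natAdd m b : ℕ) :=
      congrArg Fin.val (ha.trans (h2.trans (h3.symm.trans hb.symm)))
    have h5 := a.2
    simp only [Fin.val_castAdd, Fin.val_natAdd] at h4
    omega
  have h1 : μ.real {g | ∀ i ∈ (Finset.univ : Finset (Fin (m + m))), g i ≤ k + 1}ᶜ ≤
      (m + m) * (1 - (p : ℝ)) ^ (k + 1) := by
    rw [probReal_compl_eq_one_sub (MeasurableSet.of_discrete),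
      pi_geometricLaw_real_le hp, Finset.card_univ, Fintype.card_fin]
    have h2 := one_add_mul_le_pow (a := -(1 - (p : ℝ)) ^ (k + 1)) (by
      have := pow_le_one₀ (n := k + 1) (show 0 ≤ 1 - (p : ℝ) by linarith) (by linarith)
      linarith) (m + m)
    rw [← sub_eq_add_neg] at h2
    push_cast at h2
    linarith
  calc uniqueMaxProb p (m + m) ≤ _ := measureReal_mono (μ := μ) hsub
    _ ≤ _ := (measureReal_union_le _ _).trans
        (add_le_add_right (measureReal_union_le _ _) _)
    _ ≤ _ := by
      rw [pi_geometricLaw_real_le hp, pi_geometricLaw_real_le hp, hA, hB, Finset.card_map,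
        Finset.card_map, Finset.card_univ, Fintype.card_fin]
      linarith

/-- It suffices to bound the probability along a sequence of `n`. -/
theorem zetaMinus_le (hp0 : 0 < p) (hp1 : p < 1) :
    zetaMinus p ≤ (1 - (p : ℝ)) * (4 + 2 * Real.log (1 - (p : ℝ))⁻¹) := by
  have hp0' : (0 : ℝ) < p := hp0
  have hp1' : (p : ℝ) < 1 := hp1
  set q := 1 - (p : ℝ) with hq
  have hq0 : 0 < q := by linarith
  have hq1 : q < 1 := by linarith
  have hQ : 1 < q⁻¹ := (one_lt_inv₀ hq0).2 hq1
  have hlog : 0 < Real.log q⁻¹ := Real.log_pos hQ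
  refine liminf_le_of_frequently_le ?_ (isBoundedUnder_of ⟨0, fun n => measureReal_nonneg⟩)
  refine frequently_atTop.2 fun N => ?_
  obtain ⟨k, hk⟩ := pow_unbounded_of_one_lt (N / Real.log q⁻¹) hQ
  -- with `m` about `q ^ (-k) * log (1 / q)`, the two error terms are balanced
  set m := ⌈q⁻¹ ^ k * Real.log q⁻¹⌉₊ with hm
  have hm1 : q⁻¹ ^ k * Real.log q⁻¹ ≤ m := Nat.le_ceil _
  have hm2 : (m : ℝ) < q⁻¹ ^ k * Real.log q⁻¹ + 1 := Nat.ceil_lt_add_one (by positivity)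
  refine ⟨m + m, ?_, (uniqueMaxProb_le hp0 m k).trans ?_⟩
  · rw [div_lt_iff₀ hlog] at hk
    have : (N : ℝ) ≤ m := hk.le.trans hm1
    have : N ≤ m := by exact_mod_cast this
    omega
  rw [← hq]
  have hr : q ^ k * q⁻¹ ^ k = 1 := by rw [← mul_pow, mul_inv_cancel₀ hq0.ne', one_pow]
  have hr0 : 0 < q ^ k := pow_pos hq0 k
  have hr1 : q ^ k ≤ 1 := pow_le_one₀ hq0.le hq1.le
  have h1 : (1 - q ^ k) ^ m ≤ q := by
    calc (1 - q ^ k) ^ m ≤ Real.exp (-q ^ k) ^ m :=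
          pow_le_pow_left₀ (by linarith) (Real.one_sub_le_exp_neg _) m
      _ = Real.exp (-(q ^ k * m)) := by rw [← Real.exp_nat_mul]; ring_nf
      _ ≤ Real.exp (-(Real.log q⁻¹)) := by
          refine Real.exp_le_exp.2 (neg_le_neg ?_)
          calc Real.log q⁻¹ = q ^ k * (q⁻¹ ^ k * Real.log q⁻¹) := by rw [← mul_assoc, hr, one_mul]
            _ ≤ q ^ k * m := mul_le_mul_of_nonneg_left hm1 hr0.le
      _ = q := by rw [Real.log_inv, neg_neg, Real.exp_log hq0]
  have h2 : (m : ℝ) * q ^ k ≤ Real.log q⁻¹ + 1 := by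
    calc (m : ℝ) * q ^ k ≤ (q⁻¹ ^ k * Real.log q⁻¹ + 1) * q ^ k :=
          mul_le_mul_of_nonneg_right hm2.le hr0.le
      _ = (q ^ k * q⁻¹ ^ k) * Real.log q⁻¹ + q ^ k := by ring
      _ ≤ _ := by rw [hr]; linarith
  have h3 := mul_le_mul_of_nonneg_right h2 hq0.le
  calc (m + m) * q ^ (k + 1) + 2 * (1 - q ^ k) ^ m
      = 2 * (m * q ^ k * q) + 2 * (1 - q ^ k) ^ m := by ring
    _ ≤ _ := by linarith

end

/-! ### Expected times -/

theorem one_le_expectedTime (p : unitInterval) {n : ℕ} (hn : 2 ≤ n) :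
    1 ≤ Ungarian.expectedTime p (Tam n) := by
  have hne : (⊤ : Tam n) ≠ ⊥ := by
    intro h
    have h1 : (Fin.revPerm : Equiv.Perm (Fin n)) = 1 := congrArg Subtype.val h
    have h2 := congrArg Fin.val (Equiv.congr_fun h1 ⟨0, by omega⟩)
    simp only [Fin.revPerm_apply, Fin.val_rev, Equiv.Perm.coe_one, id_eq] at h2
    omega
  have hm : MeasurableSet {ω : ℕ → Tam n | ω 0 = ⊤} :=
    measurableSet_eq_fun (measurable_pi_apply _) measurable_const
  calc 1 = ∫⁻ _ in {ω : ℕ → Tam n | ω 0 = ⊤}, 1 ∂(Ungarian.chainLaw (Tam n) p) := by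
        rw [setLIntegral_one, chainLaw_zero]
    _ ≤ ∫⁻ ω in {ω : ℕ → Tam n | ω 0 = ⊤}, Ungarian.absorptionTime ω
          ∂(Ungarian.chainLaw (Tam n) p) := by
        refine setLIntegral_mono' hm fun ω hω => le_iInf₂ fun t ht => ?_
        have ht0 : t ≠ 0 := by
          rintro rfl
          exact hne (hω.symm.trans ht)
        exact_mod_cast Nat.one_le_iff_ne_zero.2 ht0
    _ ≤ _ := setLIntegral_le_lintegral _ _

theorem ofReal_le_expectedTime {p : unitInterval} {n m T : ℕ} {c : ℝ} (hmn : m < n)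
    (hc : c ≤ T * coinP p {w | ∃ y ≤ m, lev w T y < y}) :
    ENNReal.ofReal c ≤ Ungarian.expectedTime p (Tam n) := by
  refine (ENNReal.ofReal_le_ofReal hc).trans ?_
  rw [ENNReal.ofReal_mul (Nat.cast_nonneg T), ENNReal.ofReal_natCast, coinP,
    ofReal_measureReal]
  exact mul_coinLaw_le_expectedTime p fun w ⟨y, hy, h⟩ => ⟨y, by omega, h⟩

end TamariLevels

namespace TamariLevels

open MeasureTheory Filter

/-! ### Lower bounds for the expected time -/

section

variable {p : unitInterval} {n : ℕ}

/-- The case `Q < n ≤ Q ^ 2`, where `Q = 1 / (1 - p)`: a single position fails in the first step. -/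
theorem ofReal_le_expectedTime_of_lt_sq (hq : 0 < 1 - (p : ℝ)) (hQ : 10 ≤ (1 - (p : ℝ))⁻¹)
    (h1 : (1 - (p : ℝ))⁻¹ ≤ n - 1) (h2 : (n : ℝ) - 1 < (1 - (p : ℝ))⁻¹ ^ 2) :
    ENNReal.ofReal ((1 - (p : ℝ)) * n / 10 ^ 7) ≤ Ungarian.expectedTime p (Tam n) := by
  set q := 1 - (p : ℝ) with hqdef
  set Q := q⁻¹ with hQdef
  have hqQ : q * Q = 1 := mul_inv_cancel₀ hq.ne'
  have hq1 : q ≤ 1 / 10 := by nlinarith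
  set m := ⌊Q / 2⌋₊ with hm
  have hm1 : (m : ℝ) ≤ Q / 2 := Nat.floor_le (by linarith)
  have hm2 : Q / 2 < m + 1 := Nat.lt_floor_add_one _
  have hm4 : 2 ≤ m := Nat.le_floor (by norm_num; linarith)
  have hqm1 : q * m ≤ 1 / 2 := by nlinarith
  have hqm2 : 1 / 4 ≤ q * m := by nlinarith
  have hmn : m < n := by
    have : (m : ℝ) < n := by linarith
    exact_mod_cast this
  refine ofReal_le_expectedTime (T := m / 2) hmn ?_
  have hT : Q / 8 ≤ ((m / 2 : ℕ) : ℝ) := by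
    have h3 : m ≤ 2 * (m / 2) + 1 := by omega
    have h4 : (m : ℝ) ≤ 2 * ((m / 2 : ℕ) : ℝ) + 1 := by exact_mod_cast h3
    linarith
  calc q * n / 10 ^ 7 ≤ Q / 8 * (1 / 4 / 4) := by nlinarith
    _ ≤ ((m / 2 : ℕ) : ℝ) * (q * m / 4) :=
        mul_le_mul hT (by linarith) (by norm_num) (by positivity)
    _ ≤ _ := mul_le_mul_of_nonneg_left (le_coinP_single hm4 hqm1) (Nat.cast_nonneg _)

theorem sq_mul_exp_neg_le {Q : ℝ} (hQ : 10 ^ 9 ≤ Q) : Q ^ 2 * Real.exp (-(Q / 256)) ≤ 1 := by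
  have h1 : Q / 768 ≤ Real.exp (Q / 768) := by linarith [Real.add_one_le_exp (Q / 768)]
  have h2 : (Q / 768) ^ 3 ≤ Real.exp (Q / 256) := by
    calc (Q / 768) ^ 3 ≤ Real.exp (Q / 768) ^ 3 := pow_le_pow_left₀ (by linarith) h1 3
      _ = _ := by rw [← Real.exp_nat_mul]; push_cast; ring_nf
  have h3 : Q ^ 2 ≤ (Q / 768) ^ 3 := by
    have : Q ^ 2 * 768 ^ 3 ≤ Q ^ 2 * Q := mul_le_mul_of_nonneg_left (by linarith) (sq_nonneg Q)
    rw [div_pow, le_div_iff₀ (by norm_num)]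
    linarith [pow_succ Q 2]
  rw [Real.exp_neg, ← div_eq_mul_inv, div_le_one (Real.exp_pos _)]
  exact h3.trans h2

/-- The case `Q ^ 2 < n ≤ Q ^ 3`: there is a pair of slow positions, one of size about `Q` and
another one of size about `Q ^ 2`. -/
theorem ofReal_le_expectedTime_of_lt_cube (hq : 0 < 1 - (p : ℝ)) (hQ : 10 ^ 9 ≤ (1 - (p : ℝ))⁻¹)
    (h1 : (1 - (p : ℝ))⁻¹ ^ 2 ≤ n - 1) (h2 : (n : ℝ) - 1 < (1 - (p : ℝ))⁻¹ ^ 3) :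
    ENNReal.ofReal ((1 - (p : ℝ)) * n / 10 ^ 7) ≤ Ungarian.expectedTime p (Tam n) := by
  set q := 1 - (p : ℝ) with hqdef
  set Q := q⁻¹ with hQdef
  have hqQ : q * Q = 1 := mul_inv_cancel₀ hq.ne'
  have hqQ2 : q ^ 2 * Q ^ 2 = 1 := by rw [← mul_pow, hqQ, one_pow]
  have hq1 : q ≤ 1 / 10 ^ 9 := by nlinarith
  have hQ2 : 10 ^ 9 * Q ≤ Q ^ 2 := by nlinarith
  have hq2 : q ^ 2 ≤ 1 / 10 ^ 9 := by nlinarith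
  set m := ⌊Q / 8⌋₊ with hm
  have hm1 : (m : ℝ) ≤ Q / 8 := Nat.floor_le (by linarith)
  have hm2 : Q / 8 < m + 1 := Nat.lt_floor_add_one _
  have hm4 : 2 ≤ m := Nat.le_floor (by norm_num; linarith)
  set b := ⌊Q ^ 2 / 8⌋₊ with hb
  have hb1 : (b : ℝ) ≤ Q ^ 2 / 8 := Nat.floor_le (by positivity)
  have hb2 : Q ^ 2 / 8 < b + 1 := Nat.lt_floor_add_one _
  set T := ⌊Q ^ 2 / 64⌋₊ with hT
  have hT1 : (T : ℝ) ≤ Q ^ 2 / 64 := Nat.floor_le (by positivity)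
  have hT2 : Q ^ 2 / 64 < T + 1 := Nat.lt_floor_add_one _
  have hbn : b < n := by
    have : (b : ℝ) < n := by linarith
    exact_mod_cast this
  have hmb : 2 * m ≤ b := by
    have : (2 * m : ℝ) ≤ b := by linarith
    exact_mod_cast this
  have hTb : 2 * T + 4 ≤ b := by
    have : (2 * T + 4 : ℝ) ≤ b := by linarith
    exact_mod_cast this
  have hqm1 : q * m ≤ 1 / 8 := by nlinarith
  have hqm2 : 1 / 16 ≤ q * m := by nlinarith
  have hqb1 : q ^ 2 * b ≤ 1 / 8 := by
    have := mul_le_mul_of_nonneg_left hb1 (sq_nonneg q)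
    linarith
  have hqb2 : 1 / 16 ≤ q ^ 2 * b := by
    have := mul_le_mul_of_nonneg_left hb2.le (sq_nonneg q)
    linarith
  have hqT : q * T ≤ Q / 64 := by
    calc q * T ≤ q * (Q ^ 2 / 64) := mul_le_mul_of_nonneg_left hT1 hq.le
      _ = q * Q * Q / 64 := by ring
      _ = Q / 64 := by rw [hqQ, one_mul]
  have hδ : rowP p {v | fails v 2 (2 + T) ≤ m / 2}ᶜ ≤ Real.exp (-(Q / 256)) := by
    refine (rowP_mono p ?_).trans ((rowP_upper p (x := Q / 64) (V := Q / 64) (by linarith)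
      (by linarith) 2 T hqT).trans (Real.exp_le_exp.2 (neg_le_neg (le_min ?_ ?_))))
    · intro v hv
      have h3 : m ≤ 2 * fails v 2 (2 + T) := by
        have : ¬ fails v 2 (2 + T) ≤ m / 2 := hv
        omega
      have h4 : (m : ℝ) ≤ 2 * fails v 2 (2 + T) := by exact_mod_cast h3
      have h5 : (1 - (p : ℝ)) * T + Q / 64 ≤ fails v 2 (2 + T) := by linarith
      exact h5
    · linarith
    · rw [le_div_iff₀ (by linarith)]
      nlinarith
  have hδb : b * Real.exp (-(Q / 256)) ≤ 1 / 8 := by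
    have h3 := mul_le_mul_of_nonneg_right hb1 (Real.exp_pos (-(Q / 256))).le
    linarith [sq_mul_exp_neg_le hQ]
  refine ofReal_le_expectedTime (T := T + 2) hbn ?_
  have hqn : q * n ≤ 2 * Q ^ 2 := by
    calc q * n ≤ q * (Q ^ 3 + 1) := mul_le_mul_of_nonneg_left (by linarith) hq.le
      _ = q * Q * Q ^ 2 + q := by ring
      _ ≤ _ := by rw [hqQ]; nlinarith
  calc q * n / 10 ^ 7 ≤ Q ^ 2 / 64 * (1 / 16 * (1 / 16) / 32) := by linarith [sq_nonneg Q]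
    _ ≤ ((T + 2 : ℕ) : ℝ) * (q * m * (q ^ 2 * b) / 32) := by
        refine mul_le_mul (by push_cast; linarith) ?_ (by norm_num) (by positivity)
        have := mul_le_mul hqm2 hqb2 (by norm_num) (by linarith)
        linarith
    _ ≤ _ := mul_le_mul_of_nonneg_left
        (le_coinP_pair hm4 hmb hTb (by linarith) hqm1 hqb1 hδ hδb) (Nat.cast_nonneg _)

/-- The case `Q ^ t < n ≤ Q ^ (t + 1)` with `t ≥ 3`. -/
theorem ofReal_le_expectedTime_of_pow_le {l P t : ℕ} (hp0 : (0 : ℝ) < p) (hp1 : (p : ℝ) < 1)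
    (hl : 100 ≤ l) (hP : 1 ≤ (p : ℝ) * P) (hPl : P ≤ l) (ht : 3 ≤ t)
    (h1 : (1 - (p : ℝ))⁻¹ ^ t ≤ n - 1) (h2 : (n : ℝ) - 1 < (1 - (p : ℝ))⁻¹ ^ (t + 1))
    (h3 : ((2 : ℝ) ^ l) ^ 160 ≤ n - 1) (h4 : (n : ℝ) ≤ Real.exp (2 ^ l)) :
    ENNReal.ofReal ((1 - (p : ℝ)) * n / 10 ^ 7 *
      Real.exp (-(2 * 10 ^ 10 * ((l : ℝ) ^ 4 * P ^ 2)))) ≤ Ungarian.expectedTime p (Tam n) := by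
  have hq : 0 < 1 - (p : ℝ) := by linarith
  have hQ1 : 1 ≤ (1 - (p : ℝ))⁻¹ := (one_le_inv₀ hq).2 (by linarith)
  have hmain := exp_le_coinP (t := t) hp0 hp1 hl hP hPl ht
  set q := 1 - (p : ℝ) with hqdef
  set Q := q⁻¹ with hQdef
  have hqQ : q * Q = 1 := mul_inv_cancel₀ hq.ne'
  obtain ⟨s, rfl⟩ : ∃ s, t = s + 1 := ⟨t - 1, by omega⟩
  have hl1 : (1 : ℝ) ≤ 2 ^ l := one_le_pow₀ (by norm_num)
  have hbig : ((2 : ℝ) ^ l) ^ 80 < Q ^ s := by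
    refine lt_of_pow_lt_pow_left₀ 2 (by positivity) ?_
    calc (((2 : ℝ) ^ l) ^ 80) ^ 2 = (2 ^ l) ^ 160 := by rw [← pow_mul]
      _ < Q ^ (s + 1 + 1) := h3.trans_lt h2
      _ ≤ Q ^ (s * 2) := pow_le_pow_right₀ hQ1 (by omega)
      _ = (Q ^ s) ^ 2 := pow_mul _ _ _
  have h5 := hmain (by
    rw [pow_succ' Q s]
    exact mul_lt_mul_of_pos_left hbig (by linarith)) (by linarith)
  set m := ⌊Q ^ (s + 1)⌋₊ with hm
  have hm1 : (m : ℝ) ≤ Q ^ (s + 1) := Nat.floor_le (by positivity)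
  have hm2 : Q ^ (s + 1) < m + 1 := Nat.lt_floor_add_one _
  have hmn : m < n := by
    have : (m : ℝ) < n := by linarith
    exact_mod_cast this
  have hQ80 : (2 : ℝ) ^ 8 ≤ Q ^ (s + 1) := by
    calc (2 : ℝ) ^ 8 ≤ (2 ^ l) ^ 80 := by
          rw [← pow_mul]
          exact pow_le_pow_right₀ (by norm_num) (by omega)
      _ ≤ Q ^ s := hbig.le
      _ ≤ _ := pow_le_pow_right₀ hQ1 (by omega)
  have hm3 : Q ^ (s + 1) / 8 ≤ ((m / 4 : ℕ) : ℝ) := by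
    have h6 : m ≤ 4 * (m / 4) + 3 := by omega
    have h7 : (m : ℝ) ≤ 4 * ((m / 4 : ℕ) : ℝ) + 3 := by exact_mod_cast h6
    norm_num at hQ80
    linarith
  have hqn : q * n ≤ 2 * Q ^ (s + 1) := by
    calc q * n ≤ q * (Q ^ (s + 1 + 1) + 1) := mul_le_mul_of_nonneg_left (by linarith) hq.le
      _ = q * Q * Q ^ (s + 1) + q := by ring
      _ ≤ _ := by rw [hqQ]; norm_num at hQ80; linarith
  refine ofReal_le_expectedTime (T := m / 4) hmn ?_
  exact mul_le_mul (by linarith [pow_pos (show 0 < Q by linarith) (s + 1)]) h5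
    (Real.exp_pos _).le (Nat.cast_nonneg _)

end

end TamariLevels

namespace TamariLevels

open MeasureTheory Filter

/-! ### Combining the bounds -/

theorem one_le_log_log {n : ℕ} (hn : 16 ≤ n) : 1 ≤ Real.log (Real.log n) := by
  have h1 : Real.exp 1 ≤ Real.log n := by
    calc Real.exp 1 ≤ 4 * Real.log 2 := by linarith [Real.exp_one_lt_d9, Real.log_two_gt_d9]
      _ = Real.log (2 ^ 4) := by rw [Real.log_pow]; norm_num
      _ ≤ Real.log n := Real.log_le_log (by norm_num) (by
          have : (16 : ℝ) ≤ n := by exact_mod_cast hn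
          linarith)
  exact (Real.le_log_iff_exp_le ((Real.exp_pos 1).trans_le h1)).2 h1

theorem le_exp_two_pow {n l : ℕ} (hn : 16 ≤ n) (hl : 2 * Real.log (Real.log n) ≤ l) :
    (n : ℝ) ≤ Real.exp (2 ^ l) := by
  have hL := one_le_log_log hn
  have hn0 : (16 : ℝ) ≤ n := by exact_mod_cast hn
  have hlog : 0 < Real.log n := Real.log_pos (by linarith)
  rw [← Real.log_le_iff_le_exp (by linarith)]
  calc Real.log n = Real.exp (Real.log (Real.log n)) := (Real.exp_log hlog).symm
    _ ≤ Real.exp (l * Real.log 2) := by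
        refine Real.exp_le_exp.2 ?_
        have := mul_le_mul_of_nonneg_right hl (Real.log_pos one_lt_two).le
        nlinarith [Real.log_two_gt_d9]
    _ = 2 ^ l := by rw [Real.exp_nat_mul, Real.exp_log two_pos]

/-- The lower bound for the expected time, with `1 - p` in place of `zetaMinus p`. With `Q` denoting
`1 / (1 - p)`, the cases are distinguished by the largest `t` with `Q ^ t < n`. -/
theorem ofReal_mul_exp_le_expectedTime {p : unitInterval} {n : ℕ} (hp0 : (0 : ℝ) < p)
    (hp1 : (p : ℝ) < 1) (hn : 16 ≤ n) :
    ENNReal.ofReal ((1 - (p : ℝ)) * n *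
      Real.exp (-(10 ^ 20 * ((p : ℝ)⁻¹ ^ 6 * Real.log (Real.log n) ^ 4)))) ≤
        Ungarian.expectedTime p (Tam n) := by
  have hL := one_le_log_log hn
  have hexp := fun l => le_exp_two_pow (l := l) hn
  set L := Real.log (Real.log n) with hLdef
  have hn0 : (16 : ℝ) ≤ n := by exact_mod_cast hn
  set r := (p : ℝ)⁻¹ with hr
  have hpr : (p : ℝ) * r = 1 := mul_inv_cancel₀ hp0.ne'
  have hr1 : 1 ≤ r := (one_le_inv₀ hp0).2 hp1.le
  set P := ⌈r⌉₊ with hPdef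
  have hP1 : r ≤ P := Nat.le_ceil _
  have hP2 : (P : ℝ) < r + 1 := Nat.ceil_lt_add_one (by linarith)
  set l := 100 + P + ⌈2 * L⌉₊ with hl
  have hl1 : 2 * L ≤ (⌈2 * L⌉₊ : ℝ) := Nat.le_ceil _
  have hl2 : (⌈2 * L⌉₊ : ℝ) < 2 * L + 1 := Nat.ceil_lt_add_one (by linarith)
  have hl3 : (l : ℝ) = 100 + P + ⌈2 * L⌉₊ := by rw [hl]; push_cast; ring
  have hlL : (l : ℝ) ≤ 105 * (L * r) := by nlinarith
  have hn1 := hexp l (by linarith)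
  have hLr : 1 ≤ L * r := one_le_mul_of_one_le_of_one_le hL hr1
  set X := r ^ 6 * L ^ 4 with hX
  have hX1 : L * r ≤ X := by
    calc L * r ≤ (L * r) ^ 4 := le_self_pow₀ hLr (by norm_num)
      _ = 1 * (r ^ 4 * L ^ 4) := by ring
      _ ≤ r ^ 2 * (r ^ 4 * L ^ 4) :=
          mul_le_mul_of_nonneg_right (one_le_pow₀ hr1) (by positivity)
      _ = X := by rw [hX]; ring
  have hX2 : (l : ℝ) ^ 4 * P ^ 2 ≤ (4 * 105 ^ 4) * X := by
    calc (l : ℝ) ^ 4 * P ^ 2 ≤ (105 * (L * r)) ^ 4 * (2 * r) ^ 2 :=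
          mul_le_mul (pow_le_pow_left₀ (Nat.cast_nonneg l) hlL 4)
            (pow_le_pow_left₀ (Nat.cast_nonneg P) (by linarith) 2) (by positivity) (by positivity)
      _ = _ := by rw [hX]; ring
  have hq : 0 < 1 - (p : ℝ) := by linarith
  have hE1 := one_le_expectedTime p (show 2 ≤ n by omega)
  -- the crude bound suffices if `(1 - p) * n` is not large
  have htriv : (1 - (p : ℝ)) * n ≤ Real.exp (10 ^ 20 * X) → ENNReal.ofReal ((1 - (p : ℝ)) * n *
      Real.exp (-(10 ^ 20 * X))) ≤ Ungarian.expectedTime p (Tam n) := by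
    intro h
    refine le_trans ?_ hE1
    rw [← ENNReal.ofReal_one]
    refine ENNReal.ofReal_le_ofReal ?_
    rwa [Real.exp_neg, ← div_eq_mul_inv, div_le_one (Real.exp_pos _)]
  have he2 : (2 : ℝ) ≤ Real.exp 1 := by linarith [Real.add_one_le_exp 1]
  -- if `n` is bounded by a power of `2 ^ l`, then the exponential factor outweighs it
  by_cases hbig : ((2 : ℝ) ^ l) ^ 160 ≤ n - 1
  swap
  · refine htriv ?_
    calc (1 - (p : ℝ)) * n ≤ 1 * n := mul_le_mul_of_nonneg_right (by linarith) (by linarith)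
      _ ≤ 2 * ((2 : ℝ) ^ l) ^ 160 := by linarith
      _ = 2 ^ (l * 160 + 1) := by rw [← pow_mul, pow_succ']
      _ ≤ Real.exp 1 ^ (l * 160 + 1) := pow_le_pow_left₀ (by norm_num) he2 _
      _ = Real.exp (l * 160 + 1) := by rw [← Real.exp_nat_mul]; push_cast; ring_nf
      _ ≤ _ := Real.exp_le_exp.2 (by linarith)
  set q := 1 - (p : ℝ) with hqdef
  set Q := q⁻¹ with hQ
  have hqQ : q * Q = 1 := mul_inv_cancel₀ hq.ne'
  have hQ1 : 1 < Q := (one_lt_inv₀ hq).2 (by linarith)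
  by_cases hQn : Q ≤ n - 1
  swap
  · refine htriv ?_
    have h1 : q * n ≤ 2 := by nlinarith
    linarith [Real.add_one_le_exp (10 ^ 20 * X)]
  have hbig' : ((10 : ℝ) ^ 9) ^ 3 < n - 1 := by
    calc ((10 : ℝ) ^ 9) ^ 3 < 2 ^ 160 := by norm_num
      _ ≤ (2 ^ l) ^ 160 := pow_le_pow_left₀ (by norm_num) (by
          calc (2 : ℝ) = 2 ^ 1 := (pow_one 2).symm
            _ ≤ 2 ^ l := pow_le_pow_right₀ (by norm_num) (by omega)) _
      _ ≤ _ := hbig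
  have hconst : 1 / 10 ^ 7 * Real.exp (-(2 * 10 ^ 10 * ((l : ℝ) ^ 4 * P ^ 2))) ≥
      Real.exp (-(10 ^ 20 * X)) := by
    have h1 : Real.exp (-30) ≤ 1 / 10 ^ 7 := by
      rw [Real.exp_neg, ← one_div]
      refine one_div_le_one_div_of_le (by norm_num) ?_
      calc (10 : ℝ) ^ 7 ≤ 2 ^ 30 := by norm_num
        _ ≤ Real.exp 1 ^ 30 := pow_le_pow_left₀ (by norm_num) he2 _
        _ = Real.exp 30 := by rw [← Real.exp_nat_mul]; norm_num
    calc Real.exp (-(10 ^ 20 * X))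
        ≤ Real.exp (-30 + -(2 * 10 ^ 10 * ((l : ℝ) ^ 4 * P ^ 2))) :=
          Real.exp_le_exp.2 (by linarith)
      _ = Real.exp (-30) * Real.exp (-(2 * 10 ^ 10 * ((l : ℝ) ^ 4 * P ^ 2))) := Real.exp_add _ _
      _ ≤ _ := mul_le_mul_of_nonneg_right h1 (Real.exp_pos _).le
  have hconst' : Real.exp (-(10 ^ 20 * X)) ≤ 1 / 10 ^ 7 :=
    hconst.le.trans (mul_le_of_le_one_right (by norm_num)
      (Real.exp_le_one_iff.2 (neg_nonpos.2 (by positivity))))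
  have hqn : 0 ≤ q * n := by positivity
  have hsmall : ENNReal.ofReal (q * n / 10 ^ 7) ≤ Ungarian.expectedTime p (Tam n) →
      ENNReal.ofReal (q * n * Real.exp (-(10 ^ 20 * X))) ≤ Ungarian.expectedTime p (Tam n) := by
    refine (ENNReal.ofReal_le_ofReal ?_).trans
    have := mul_le_mul_of_nonneg_left hconst' hqn
    linarith
  obtain ⟨t, ht1, ht2⟩ := exists_nat_pow_near (x := (n : ℝ) - 1) (by linarith) hQ1
  have ht0 : t ≠ 0 := by
    rintro rfl
    rw [zero_add, pow_one] at ht2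
    linarith
  have hQbig : ∀ s ≤ 3, (n : ℝ) - 1 < Q ^ s → 10 ^ 9 ≤ Q := by
    intro s hs h
    by_contra! hc
    have h1 : Q ^ s ≤ Q ^ 3 := pow_le_pow_right₀ hQ1.le hs
    have h2 : Q ^ 3 ≤ (10 ^ 9) ^ 3 := pow_le_pow_left₀ (by linarith) hc.le 3
    linarith
  obtain rfl | rfl | ht3 : t = 1 ∨ t = 2 ∨ 3 ≤ t := by omega
  · have := hQbig 2 (by norm_num) ht2
    exact hsmall (ofReal_le_expectedTime_of_lt_sq hq (by linarith) hQn ht2)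
  · exact hsmall (ofReal_le_expectedTime_of_lt_cube hq (hQbig 3 le_rfl ht2) ht1 ht2)
  · refine le_trans (ENNReal.ofReal_le_ofReal ?_) (ofReal_le_expectedTime_of_pow_le (l := l)
      (P := P) hp0 hp1 (by omega) ?_ (by omega) ht3 ht1 ht2 hbig hn1)
    · have := mul_le_mul_of_nonneg_left hconst hqn
      rw [← hqdef]
      linarith
    · calc 1 = (p : ℝ) * r := hpr.symm
        _ ≤ p * P := mul_le_mul_of_nonneg_left hP1 hp0.le

/-- The case of `p` so close to `1` that `1 / (1 - p)` exceeds the size of the lattice. -/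
theorem zetaMinus_mul_le {p : unitInterval} (hp0 : 0 < p) (hp1 : p < 1) {x : ℝ}
    (hx : 1 ≤ x) (hQ : x ≤ (1 - (p : ℝ))⁻¹) : zetaMinus p * x ≤ 6 + 2 * Real.log x := by
  have hp1' : (p : ℝ) < 1 := hp1
  have h1 := zetaMinus_le hp0 hp1
  set q := 1 - (p : ℝ) with hq
  have hq0 : 0 < q := by linarith
  have hqQ : q * q⁻¹ = 1 := mul_inv_cancel₀ hq0.ne'
  set Q := q⁻¹ with hQdef
  have hQ0 : 0 < Q := by linarith
  have h2 : Real.log Q ≤ Real.log x + (Q / x - 1) := by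
    have h3 := Real.log_le_sub_one_of_pos (show 0 < Q / x by positivity)
    rw [Real.log_div hQ0.ne' (by linarith)] at h3
    linarith
  have hx0 : 0 ≤ Real.log x := Real.log_nonneg hx
  have hqx : q * x ≤ 1 := by nlinarith
  calc zetaMinus p * x ≤ q * (4 + 2 * Real.log Q) * x :=
        mul_le_mul_of_nonneg_right h1 (by linarith)
    _ ≤ q * (4 + 2 * (Real.log x + (Q / x - 1))) * x := by gcongr
    _ = q * x * (2 + 2 * Real.log x) + 2 * (q * Q) * (x / x) := by
        field_simp
        ring
    _ ≤ 1 * (2 + 2 * Real.log x) + 2 * (q * Q) * (x / x) := by gcongr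
    _ ≤ _ := by
        rw [hqQ, div_self (by linarith)]
        linarith

/-- The exponential `exp (C / p ^ 2)` absorbs the powers of `1 / p`, and `C` the constant. -/
theorem le_pow_mul_exp {p K C : ℝ} (hp0 : 0 < p) (hp1 : p < 1) (hK : 1 ≤ K)
    (hC : 7 + Real.log K ≤ C) : K * p⁻¹ ^ 6 ≤ p ^ 8 * Real.exp (C / p ^ 2) := by
  set r := p⁻¹ with hr
  have hpr : p * r = 1 := mul_inv_cancel₀ hp0.ne'
  have hr1 : 1 ≤ r := (one_le_inv₀ hp0).2 hp1.le
  have hlog : 0 ≤ Real.log K := Real.log_nonneg hK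
  have h1 : K * (r ^ 2) ^ 7 ≤ Real.exp (C / p ^ 2) := by
    calc K * (r ^ 2) ^ 7 ≤ Real.exp (Real.log K) * Real.exp (r ^ 2) ^ 7 := by
          rw [Real.exp_log (by linarith)]
          gcongr
          linarith [Real.add_one_le_exp (r ^ 2)]
      _ = Real.exp (Real.log K + 7 * r ^ 2) := by
          rw [Real.exp_add, ← Real.exp_nat_mul]
          norm_num
      _ ≤ Real.exp (C / p ^ 2) := by
          refine Real.exp_le_exp.2 ?_
          rw [div_eq_mul_inv, ← inv_pow, ← hr]
          have h2 : 1 ≤ r ^ 2 := one_le_pow₀ hr1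
          nlinarith
  calc K * r ^ 6 = (p * r) ^ 8 * (K * r ^ 6) := by rw [hpr, one_pow, one_mul]
    _ = p ^ 8 * (K * (r ^ 2) ^ 7) := by ring
    _ ≤ _ := mul_le_mul_of_nonneg_left h1 (by positivity)

theorem zetaMinus_mul_exp_le {p : unitInterval} {n : ℕ} {A : ℝ} (hp0 : 0 < p) (hp1 : p < 1)
    (hn : 16 ≤ n) (hA : (10 ^ 20 + 10) * (p : ℝ)⁻¹ ^ 6 ≤ A) :
    ENNReal.ofReal (zetaMinus p * n * Real.exp (-(A * Real.log (Real.log n) ^ 4))) ≤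
      Ungarian.expectedTime p (Tam n) := by
  have hp0' : (0 : ℝ) < p := hp0
  have hp1' : (p : ℝ) < 1 := hp1
  have hL := one_le_log_log hn
  have hn0 : (16 : ℝ) ≤ n := by exact_mod_cast hn
  have hlog : 0 < Real.log n := Real.log_pos (by linarith)
  have hlogL : Real.log n = Real.exp (Real.log (Real.log n)) := (Real.exp_log hlog).symm
  have hr1 : 1 ≤ (p : ℝ)⁻¹ ^ 6 := one_le_pow₀ ((one_le_inv₀ hp0').2 hp1'.le)
  have hcore := ofReal_mul_exp_le_expectedTime hp0' hp1' hn
  set L := Real.log (Real.log n) with hLdef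
  have hL4 : L ≤ L ^ 4 := le_self_pow₀ hL (by norm_num)
  have hA1 : 10 ^ 20 * ((p : ℝ)⁻¹ ^ 6 * L ^ 4) + 10 * L ≤ A * L ^ 4 := by
    have h1 := mul_le_mul_of_nonneg_right hA (show 0 ≤ L ^ 4 by positivity)
    have h2 := mul_le_mul hr1 hL4 (by linarith) (by linarith)
    linarith
  -- `8 * log n` is negligible
  have h8 : 8 * Real.log n ≤ Real.exp (10 * L) := by
    have h1 : (8 : ℝ) ≤ Real.exp (9 * L) := by linarith [Real.add_one_le_exp (9 * L)]
    calc 8 * Real.log n ≤ Real.exp (9 * L) * Real.exp L := by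
          rw [hlogL]
          gcongr
      _ = Real.exp (10 * L) := by rw [← Real.exp_add]; ring_nf
  have hlog1 : 1 ≤ Real.log n := by linarith [Real.add_one_le_exp L]
  rcases le_total (n : ℝ) (1 - (p : ℝ))⁻¹ with hnQ | hnQ
  · refine le_trans ?_ (one_le_expectedTime p (show 2 ≤ n by omega))
    rw [← ENNReal.ofReal_one]
    refine ENNReal.ofReal_le_ofReal ?_
    have h1 := zetaMinus_mul_le hp0 hp1 (by linarith) hnQ
    calc zetaMinus p * n * Real.exp (-(A * L ^ 4))
        ≤ Real.exp (10 * L) * Real.exp (-(A * L ^ 4)) := by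
          gcongr
          linarith
      _ = Real.exp (10 * L + -(A * L ^ 4)) := (Real.exp_add _ _).symm
      _ ≤ 1 := by
          refine Real.exp_le_one_iff.2 ?_
          have : 0 ≤ 10 ^ 20 * ((p : ℝ)⁻¹ ^ 6 * L ^ 4) := by positivity
          linarith
  · refine le_trans (ENNReal.ofReal_le_ofReal ?_) hcore
    have h1 := zetaMinus_le hp0 hp1
    have hq : 0 < 1 - (p : ℝ) := by linarith
    have h2 : Real.log (1 - (p : ℝ))⁻¹ ≤ Real.log n := Real.log_le_log (inv_pos.2 hq) hnQ
    have h3 : zetaMinus p ≤ (1 - (p : ℝ)) * Real.exp (10 * L) :=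
      h1.trans (mul_le_mul_of_nonneg_left (by linarith) hq.le)
    calc zetaMinus p * n * Real.exp (-(A * L ^ 4))
        ≤ (1 - (p : ℝ)) * Real.exp (10 * L) * n * Real.exp (-(A * L ^ 4)) := by gcongr
      _ = (1 - (p : ℝ)) * n * Real.exp (10 * L + -(A * L ^ 4)) := by
          rw [Real.exp_add]
          ring
      _ ≤ _ := by
          gcongr
          linarith

theorem tendsto_log_log_pow_div_log :
    Tendsto (fun n : ℕ => Real.log (Real.log n) ^ 4 / Real.log n) atTop (nhds 0) :=
  (Real.isLittleO_pow_log_id_atTop (n := 4)).tendsto_div_nhds_zero.comp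
    (Real.tendsto_log_atTop.comp tendsto_natCast_atTop_atTop)

end TamariLevels

theorem mainTheorem2 :
    (∃ C : ℝ, 0 < C ∧ ∀ p : unitInterval, 0 < p → p < 1 → ∀ n : ℕ, 16 ≤ n →
      ENNReal.ofReal (zetaMinus p * n *
          Real.exp (-((p : ℝ) ^ 8 * Real.exp (C / (p : ℝ) ^ 2) *
            Real.log (Real.log n) ^ 4))) ≤
        Ungarian.expectedTime p (Tam n)) ∧
    (∀ p : unitInterval, 0 < p → p < 1 →
      ∃ ε : ℕ → ℝ, Filter.Tendsto ε Filter.atTop (nhds 0) ∧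
        ∀ n : ℕ, 16 ≤ n →
          ENNReal.ofReal ((n : ℝ) ^ (1 - ε n)) ≤ Ungarian.expectedTime p (Tam n)) := by
  constructor
  · have hK : (0 : ℝ) ≤ Real.log (10 ^ 20 + 10) := Real.log_nonneg (by norm_num)
    refine ⟨7 + Real.log (10 ^ 20 + 10), by linarith, fun p hp0 hp1 n hn => ?_⟩
    exact TamariLevels.zetaMinus_mul_exp_le hp0 hp1 hn
      (TamariLevels.le_pow_mul_exp hp0 hp1 (by norm_num) le_rfl)
  · intro p hp0 hp1
    have hp1' : (p : ℝ) < 1 := hp1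
    have hq : 0 < 1 - (p : ℝ) := by linarith
    refine ⟨fun n => 10 ^ 20 * (p : ℝ)⁻¹ ^ 6 * (Real.log (Real.log n) ^ 4 / Real.log n) +
      -Real.log (1 - (p : ℝ)) * (Real.log n)⁻¹, ?_, fun n hn => ?_⟩
    · have h1 : Filter.Tendsto (fun n : ℕ => (Real.log n)⁻¹) Filter.atTop (nhds 0) :=
        tendsto_inv_atTop_zero.comp
          (Real.tendsto_log_atTop.comp tendsto_natCast_atTop_atTop)
      have h2 := (TamariLevels.tendsto_log_log_pow_div_log.const_mul
        (10 ^ 20 * (p : ℝ)⁻¹ ^ 6)).add (h1.const_mul (-Real.log (1 - (p : ℝ))))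
      rwa [mul_zero, mul_zero, add_zero] at h2
    · have hn0 : (16 : ℝ) ≤ n := by exact_mod_cast hn
      have hlog : 0 < Real.log n := Real.log_pos (by linarith)
      refine le_trans (le_of_eq ?_) (TamariLevels.ofReal_mul_exp_le_expectedTime hp0 hp1' hn)
      congr 1
      rw [Real.rpow_def_of_pos (by linarith)]
      calc _ = Real.exp (Real.log (1 - (p : ℝ)) + Real.log n +
            -(10 ^ 20 * ((p : ℝ)⁻¹ ^ 6 * Real.log (Real.log n) ^ 4))) := by
            congr 1
            field_simp
            ring
        _ = _ := by rw [Real.exp_add, Real.exp_add, Real.exp_log hq, Real.exp_log (by linarith)]
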